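/- **Data.** Let $m,n\ge 0$ be integers with $n$ even and $N=m+n>2$; put $s=\lfloor N/2\rfloor$ and $i'=N+1-i$. Let $V=\mathbb C^{m|n}$ have a homogeneous basis $v_1,\dots,v_N$ with parities $\bar i=|v_i|\in\mathbb Z/2$ satisfying $\overline{i'}=\bar i$, and choose signs $\vartheta_i=\pm1$ with $\vartheta_i=1$ if $\bar i=\bar 0$ and $\vartheta_i=-\vartheta_{i'}$ if $\bar i=\bar1$. Let $\mathbb K=\mathbb C(q^{1/2})$; below $V$ is taken over $\mathbb K$. Let $P=\bigoplus_{k=1}^s\mathbb Z\varepsilon_k$ with $(\varepsilon_k,\varepsilon_l)=\delta_{kl}(-1)^{\bar k}$, and set $\varepsilon_{i'}=-\varepsilon_i$ (so $\varepsilon_{s+1}=0$ for odd $N$). The roots $\varepsilon_a-\varepsilon_b$ ($a<b<a'$, parity $\bar a+\bar b$) and $2\varepsilon_a$ ($a\le s$, $\bar a=\bar 1$, even) are the positive ones, and $\rho$ is half the sum of the even positive roots minus half the sum of the odd positive roots. The simple roots are $\alpha_i=\varepsilon_i-\varepsilon_{i+1}$ for $i<s$, and $\alpha_s=\varepsilon_s-\varepsilon_{s+1}$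 if $m$ is odd, $\alpha_s=\varepsilon_{s-1}-\varepsilon_{s+1}$ if $m$ is even and $\bar s=\bar 0$, $\alpha_s=2\varepsilon_s$ if $m$ is even and $\bar s=\bar1$. Let $\theta=\varepsilon_1+\varepsilon_2$ if $\bar 1=\bar 0$ (i.e. $|v_1|=\bar0$) and $\theta=2\varepsilon_1$ if $|v_1|=\bar1$; write $\theta=\sum_{i=1}^s\mathsf k_i\alpha_i$, $\alpha_0=\delta-\theta$ with $\delta$ orthogonal to everything, and $a_{ij}=(\alpha_i,\alpha_j)$ for $0\le i,j\le s$. **The quantum affine superalgebra.** $U_q(\widehat{\mathfrak{osp}}(V))$ is the $\mathbb K$-superalgebra generated by $e_i,f_i,q^{\pm h_i/2}$ ($0\le i\le s$), $\gamma^{\pm1}$, $D^{\pm1}$, where $e_i,f_i$ have the parity of $\alpha_i$ (of $\theta$ if $i=0$) and the others are even, with the relations: the $q^{h_i/2}$ commute; $q^{\pm h_i/2}q^{\mp h_i/2}=\gamma^{\pm1}\gamma^{\mp1}=D^{\pm1}D^{\mp1}=1$; $\gamma=q^{h_0/2}\prod_{i=1}^s(q^{h_i/2})^{\mathsf k_i}$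 is central; $[D,q^{h_i/2}]=0$, $De_iD^{-1}=q^{\delta_{0i}}e_i$, $Df_iD^{-1}=q^{-\delta_{0i}}f_i$; $q^{h_i/2}e_jq^{-h_i/2}=q^{a_{ij}/2}e_j$, $q^{h_i/2}f_jq^{-h_i/2}=q^{-a_{ij}/2}f_j$; $[e_i,f_j]=\delta_{ij}\frac{q^{h_i}-q^{-h_i}}{q-q^{-1}}$ (supercommutator); and all standard and higher order $q$-Serre relations, i.e. those making up the radicals of the Hopf pairing between the free superalgebras on the $f_i$ and on the $e_i$ for which $(f_i,e_j)=\delta_{ij}/(q^{-1}-q)$. $U'_q(\widehat{\mathfrak{osp}}(V))$ is the same algebra without $D^{\pm1}$. The coproduct, with values in the graded tensor square, is $\Delta(x)=q^{h_i/2}\otimes x+x\otimes q^{-h_i/2}$ for $x=e_i,f_i$, and $\Delta(x)=x\otimes x$ for $x=q^{\pm h_i/2},\gamma^{\pm1},D^{\pm1}$. **Evaluation modules.** Let $E_{ij}$ be the matrix units, $X_{ij}=E_{ij}-(-1)^{\bar i(\bar i+\bar j)}\vartheta_i\vartheta_jE_{j'i'}$, and write $q^{\mathrm{diag}(d_1,\dots,d_N)}=\sum_r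 q^{d_r}E_{rr}$. For $1\le i\le s$ let $\varrho^{a,b}_u$ be given, if $i<s$ or $m$ is odd, by $$e_i\mapsto X_{i,i+1},\quad f_i\mapsto(-1)^{\bar i}X_{i+1,i},\quad q^{\pm h_i/2}\mapsto q^{\pm((-1)^{\bar i}X_{ii}-(-1)^{\overline{i+1}}X_{i+1,i+1})/2};$$ if $m$ is even, $\bar s=\bar 0$ and $i=s$, by $e_s\mapsto X_{s-1,s+1}$, $f_s\mapsto(-1)^{\overline{s-1}}X_{s+1,s-1}$, $q^{\pm h_s/2}\mapsto q^{\pm((-1)^{\overline{s-1}}X_{s-1,s-1}-(-1)^{\overline{s+1}}X_{s+1,s+1})/2}$; and if $m$ is even, $\bar s=\bar1$ and $i=s$, by $e_s\mapsto E_{s,s+1}$, $f_s\mapsto-(q+q^{-1})E_{s+1,s}$, $q^{\pm h_s/2}\mapsto q^{\mp X_{ss}}$. Moreover $\gamma^{\pm1}\mapsto\mathrm I$, and: if $|v_1|=\bar1$, then $e_0\mapsto au\,E_{1'1}$, $f_0\mapsto bu^{-1}E_{11'}$, $q^{\pm h_0/2}\mapsto q^{\pm X_{11}}$, where $a,b\in\mathbb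 K$ and $ab=-(q+q^{-1})$; if $|v_1|=\bar0$, then $e_0\mapsto au\,X_{2'1}$, $f_0\mapsto bu^{-1}X_{12'}$, $q^{\pm h_0/2}\mapsto q^{\mp((-1)^{\bar1}X_{11}+(-1)^{\bar2}X_{22})/2}$, where $ab=(-1)^{\bar2}$. For $u\in\mathbb K^\times$ this defines a $U'_q(\widehat{\mathfrak{osp}}(V))$-module on $V$; for an indeterminate $u$, together with $D^{\pm1}(v\otimes u^k)=q^{\pm k}v\otimes u^k$, it defines a $U_q(\widehat{\mathfrak{osp}}(V))$-module on $V(u)=V\otimes\mathbb K[u,u^{-1}]$. Tensor products of modules are formed through $\Delta$, with the usual sign rule $(F\otimes G)(x\otimes y)=(-1)^{|G||x|}Fx\otimes Gy$. **Theorem.** Let $\tau(x\otimes y)=(-1)^{|x||y|}y\otimes x$ and $$\begin{aligned}R(z)=(z-q^{-m+n+2})\Big\{\mathrm I&+(q^{1/2}-q^{-1/2})\sum_{i=1}^N(-1)^{\bar i}E_{ii}\otimes\big(q^{(\varepsilon_i,\varepsilon_i)/2}E_{ii}-q^{-(\varepsilon_i,\varepsilon_i)/2}E_{i'i'}\big)\\&+(q-q^{-1})\sum_{i>j}(-1)^{\bar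 j}E_{ij}\otimes\big(E_{ji}-(-1)^{\bar j(\bar i+\bar j)}\vartheta_i\vartheta_jq^{(\rho,\varepsilon_i-\varepsilon_j)}E_{i'j'}\big)\Big\}\\&+(q-q^{-1})\frac{z-q^{-m+n+2}}{z-1}\,\tau-(q-q^{-1})q^{-m+n+2}\sum_{i,j=1}^N(-1)^{\bar i\bar j}\vartheta_i\vartheta_jq^{(\rho,\varepsilon_i-\varepsilon_j)}E_{ij}\otimes E_{i'j'},\end{aligned}$$ where the $\tau$ in this formula acts on $V\otimes V$ only. Put $\hat R(z)=\tau\circ R(z)$ and $z=u/v$. Then the following hold. 1. The formulas above define modules $\varrho^{a,b}_u,\varrho^{a,b}_v$ and their tensor products, and $$\hat R(u/v)\circ(\varrho^{a,b}_u\otimes\varrho^{a,b}_v)(x)=(\varrho^{a,b}_v\otimes\varrho^{a,b}_u)(x)\circ\hat R(u/v)$$ for indeterminates $u,v$ and all $x\in U_q(\widehat{\mathfrak{osp}}(V))$ (an identity of operators $V(u)\otimes V(v)\to V(v)\otimes V(u)$ after multiplication by $z-1$), and likewise for all $u\ne v$ in $\mathbb K^\times$ and all $x\in U'_q(\widehat{\mathfrak{osp}}(V))$.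 2. $R$ satisfies the Yang–Baxter equation with a spectral parameter: for pairwise distinct $u,v,w\in\mathbb K^\times$, $$R_{12}(v/w)R_{13}(u/w)R_{23}(u/v)=R_{23}(u/v)R_{13}(u/w)R_{12}(v/w),$$ $$\hat R_{12}(v/w)\hat R_{23}(u/w)\hat R_{12}(u/v)=\hat R_{23}(u/v)\hat R_{12}(u/w)\hat R_{23}(v/w)$$ on $V^{\otimes3}$, where $R_{12}=R\otimes\mathrm{Id}$, $R_{23}=\mathrm{Id}\otimes R$ and $R_{13}=(\mathrm{Id}\otimes\tau)R_{12}(\mathrm{Id}\otimes\tau)$. -/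

import Mathlib

open scoped TensorProduct LaurentPolynomial

noncomputable section

namespace OspAffine

/-! ### Ground field and sign conventions -/

/-- The ground field `ℂ(q^{1/2})`; the variable of `RatFunc ℂ` is `q^{1/2}`. -/
abbrev K : Type := RatFunc ℂ

/-- `qHalf k` is `q^{k/2}`. -/
def qHalf (k : ℤ) : K := (RatFunc.X : K) ^ k

/-- The quantum parameter `q`. -/
def q : K := qHalf 2

/-- The sign `(-1)^x` of a parity `x`. -/
def sgn (x : ZMod 2) : ℤ := if x = 0 then 1 else -1

/-! ### Orthosymplectic data -/

/-- The combinatorial data fixed throughout: `N = m + n > 2`, the parities of the basis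
`v_1, …, v_N` of `V = ℂ^{m|n}` (symmetric under `i ↦ i' = N + 1 - i`, which is `Fin.rev`, with an
even number `n` of odd vectors), and signs `ϑ_i = ±1` with `ϑ_i = 1` for even `i` and
`ϑ_i = -ϑ_{i'}` for odd `i`. -/
structure OspDatum where
  N : ℕ
  two_lt : 2 < N
  par : Fin N → ZMod 2
  par_rev : ∀ i, par i.rev = par i
  even_card_odd : Even (Finset.univ.filter fun i => par i = 1).card
  theta : Fin N → ℤ
  theta_unit : ∀ i, theta i = 1 ∨ theta i = -1
  theta_even : ∀ i, par i = 0 → theta i = 1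
  theta_odd : ∀ i, par i = 1 → theta i = -theta i.rev

namespace OspDatum

variable (o : OspDatum)

/-- `m`, the dimension of the even part of `V`. -/
def m : ℕ := (Finset.univ.filter fun i => o.par i = 0).card

/-- `n`, the dimension of the odd part of `V`. -/
def n : ℕ := (Finset.univ.filter fun i => o.par i = 1).card

/-- The rank `s = ⌊N / 2⌋`. -/
def s : ℕ := o.N / 2

/-- The index `k ∈ {1, …, N}` in the usual one-based numbering (only used for such `k`). -/
def ix (k : ℕ) : Fin o.N :=
  ⟨(k - 1) % o.N, Nat.mod_lt _ (lt_trans Nat.zero_lt_two o.two_lt)⟩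

/-- `ε_i ∈ P = ⨁_{k = 1}^s ℤ ε_k` for every `1 ≤ i ≤ N`, where `ε_{i'} = -ε_i`, and
`ε_{s+1} = 0` for odd `N`. -/
def eps (i : Fin o.N) : Fin o.s → ℤ := fun k =>
  if (i : ℕ) = k then 1 else if (i.rev : ℕ) = k then -1 else 0

/-- The bilinear form on `P` with `(ε_i, ε_j) = δ_{ij} (-1)^{|i|}` for `i, j ≤ s`. -/
def form (x y : Fin o.s → ℤ) : ℤ :=
  ∑ k : Fin o.s, sgn (o.par ⟨k, lt_of_lt_of_le k.2 (Nat.div_le_self _ _)⟩) * (x k * y k)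

/-- The highest root. -/
def highestRoot : Fin o.s → ℤ :=
  if o.par (o.ix 1) = 0 then o.eps (o.ix 1) + o.eps (o.ix 2) else 2 • o.eps (o.ix 1)

/-- The simple root `α_i` for `1 ≤ i ≤ s`, and the classical part `-θ` of `α_0 = δ - θ`
for `i = 0`. As `δ` is orthogonal to everything, the classical parts determine all `(α_i, α_j)`. -/
def simpleRoot (i : ℕ) : Fin o.s → ℤ :=
  if i = 0 then -o.highestRoot
  else if i < o.s ∨ Odd o.m then o.eps (o.ix i) - o.eps (o.ix (i + 1))
  else if o.par (o.ix o.s) = 0 then o.eps (o.ix (o.s - 1)) - o.eps (o.ix (o.s + 1))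
  else 2 • o.eps (o.ix o.s)

/-- The symmetrized extended Cartan matrix `a_{ij} = (α_i, α_j)`, `0 ≤ i, j ≤ s`. -/
def cartan (i j : ℕ) : ℤ := o.form (o.simpleRoot i) (o.simpleRoot j)

/-- The parity of the root `α_i`, which is the parity of `e_i` and `f_i`, for `0 ≤ i ≤ s`. -/
def genPar (i : ℕ) : ZMod 2 :=
  if i = 0 then (if o.par (o.ix 1) = 0 then o.par (o.ix 1) + o.par (o.ix 2) else 0)
  else if i < o.s ∨ Odd o.m then o.par (o.ix i) + o.par (o.ix (i + 1))
  else if o.par (o.ix o.s) = 0 then o.par (o.ix (o.s - 1)) + o.par (o.ix (o.s + 1))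
  else 0

/-- Twice the Weyl vector: the sum of the positive even roots minus the sum of the positive odd
roots. The positive roots are `ε_a - ε_b` for `a < b < a'`, of parity `|a| + |b|`, and the even
roots `2 ε_a` for `a ≤ s` with `|a| = 1`. -/
def twoRho : Fin o.s → ℤ :=
  (∑ a : Fin o.N, ∑ b : Fin o.N,
    if a < b ∧ b < a.rev then sgn (o.par a + o.par b) • (o.eps a - o.eps b) else 0) +
  ∑ a : Fin o.N, if (a : ℕ) < o.s ∧ o.par a = 1 then 2 • o.eps a else 0

/-! ### The quantum affine superalgebras -/

/-- The scalar `(-1)^{|α_i| |α_j|} q^{(α_i, α_j)}`. -/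
def braid (i j : ℕ) : K := sgn (o.genPar i * o.genPar j) * qHalf (2 * o.cartan i j)

/-- The Hopf pairing `(f_{i_1} ⋯ f_{i_r}, e_{j_1} ⋯ e_{j_t})` between the free superalgebras on
`f_0, …, f_s` and on `e_0, …, e_s`, up to a nonzero factor that depends only on the degrees:
`(f_i y, w) = (y, ∂_i w)` for the skew derivation `∂_i` with `∂_i (e_j) = δ_{ij}` and
`∂_i (x y) = ∂_i (x) y + (-1)^{|α_i| |x|} q^{(α_i, deg x)} x ∂_i (y)`. -/
def wordPairing : List (Fin (o.s + 1)) → List (Fin (o.s + 1)) → K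
  | [], w => if w = [] then 1 else 0
  | i :: y, w => ∑ k : Fin w.length,
      if w.get k = i then
        ((w.take k).map fun j => o.braid i j).prod * wordPairing y (w.eraseIdx k)
      else 0

/-- The ideal of all (standard and higher order) `q`-Serre relations, i.e. the radical of the Hopf
pairing in the free superalgebra; an element of the latter is a finite combination of words. -/
def IsSerre (x : List (Fin (o.s + 1)) →₀ K) : Prop :=
  ∀ y : List (Fin (o.s + 1)), (x.sum fun w c => c * o.wordPairing y w) = 0

/-- The generators `e_i`, `f_i`, `q^{± h_i / 2}` (`0 ≤ i ≤ s`) and `γ^{± 1}`. -/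
inductive Gen (o : OspDatum) : Type
  | e (i : Fin (o.s + 1))
  | f (i : Fin (o.s + 1))
  | k (i : Fin (o.s + 1))
  | kInv (i : Fin (o.s + 1))
  | gam
  | gamInv

/-- The degree generators `D^{± 1}`. -/
inductive DGen : Type
  | D
  | DInv

/-- The defining relations among the elements `g x`, for the generators `x` other than `D^{± 1}`.
In `gam_eq` the `κ i` are the (uniquely determined) coefficients of `θ` in the simple roots. -/
inductive AffineRel {B : Type} [Ring B] [Algebra K B] (g : Gen o → B) : B → B → Prop
  | gam_gamInv : AffineRel g (g .gam * g .gamInv) 1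
  | gamInv_gam : AffineRel g (g .gamInv * g .gam) 1
  | gam_eq (κ : Fin o.s → ℕ)
      (hκ : ∑ i : Fin o.s, κ i • o.simpleRoot ((i : ℕ) + 1) = o.highestRoot) :
      AffineRel g (g .gam) (g (.k 0) * (List.ofFn fun i : Fin o.s => g (.k i.succ) ^ κ i).prod)
  | gam_central (x : Gen o) : AffineRel g (g .gam * g x) (g x * g .gam)
  | k_comm (i j : Fin (o.s + 1)) : AffineRel g (g (.k i) * g (.k j)) (g (.k j) * g (.k i))
  | k_kInv (i : Fin (o.s + 1)) : AffineRel g (g (.k i) * g (.kInv i)) 1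
  | kInv_k (i : Fin (o.s + 1)) : AffineRel g (g (.kInv i) * g (.k i)) 1
  | k_e (i j : Fin (o.s + 1)) :
      AffineRel g (g (.k i) * g (.e j) * g (.kInv i)) (qHalf (o.cartan i j) • g (.e j))
  | k_f (i j : Fin (o.s + 1)) :
      AffineRel g (g (.k i) * g (.f j) * g (.kInv i)) (qHalf (-o.cartan i j) • g (.f j))
  | e_f (i j : Fin (o.s + 1)) :
      AffineRel g
        (g (.e i) * g (.f j) - sgn (o.genPar i * o.genPar j) • (g (.f j) * g (.e i)))
        (if i = j then (q - q⁻¹)⁻¹ • (g (.k i) ^ 2 - g (.kInv i) ^ 2) else 0)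
  | serre_e (x : List (Fin (o.s + 1)) →₀ K) (hx : o.IsSerre x) :
      AffineRel g (x.sum fun w c => c • (w.map fun i => g (.e i)).prod) 0
  | serre_f (x : List (Fin (o.s + 1)) →₀ K) (hx : o.IsSerre x) :
      AffineRel g (x.sum fun w c => c • (w.map fun i => g (.f i)).prod) 0

/-- The algebra `U'_q` without the degree generators. -/
abbrev UReduced : Type := RingQuot (o.AffineRel (FreeAlgebra.ι K))

/-- The generators of `U'_q`. -/
def UReduced.gen (x : Gen o) : o.UReduced := RingQuot.mkAlgHom K _ (FreeAlgebra.ι K x)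

/-- The defining relations in the presence of `D^{± 1}`. -/
inductive FullRel : FreeAlgebra K (Gen o ⊕ DGen) → FreeAlgebra K (Gen o ⊕ DGen) → Prop
  | affine (x y : FreeAlgebra K (Gen o ⊕ DGen))
      (h : o.AffineRel (fun g => FreeAlgebra.ι K (Sum.inl g)) x y) : FullRel x y
  | D_DInv : FullRel (FreeAlgebra.ι K (.inr .D) * FreeAlgebra.ι K (.inr .DInv)) 1
  | DInv_D : FullRel (FreeAlgebra.ι K (.inr .DInv) * FreeAlgebra.ι K (.inr .D)) 1
  | D_k (i : Fin (o.s + 1)) :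
      FullRel (FreeAlgebra.ι K (.inr .D) * FreeAlgebra.ι K (.inl (.k i)))
        (FreeAlgebra.ι K (.inl (.k i)) * FreeAlgebra.ι K (.inr .D))
  | D_e (i : Fin (o.s + 1)) :
      FullRel (FreeAlgebra.ι K (.inr .D) * FreeAlgebra.ι K (.inl (.e i)) *
          FreeAlgebra.ι K (.inr .DInv))
        ((if i = 0 then q else 1) • FreeAlgebra.ι K (.inl (.e i)))
  | D_f (i : Fin (o.s + 1)) :
      FullRel (FreeAlgebra.ι K (.inr .D) * FreeAlgebra.ι K (.inl (.f i)) *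
          FreeAlgebra.ι K (.inr .DInv))
        ((if i = 0 then q⁻¹ else 1) • FreeAlgebra.ι K (.inl (.f i)))

/-- The orthosymplectic quantum affine superalgebra `U_q`. -/
abbrev U : Type := RingQuot o.FullRel

/-- The generators of `U_q`. -/
def U.gen (x : Gen o ⊕ DGen) : o.U := RingQuot.mkAlgHom K _ (FreeAlgebra.ι K x)

/-! ### Evaluation modules

For a commutative `K`-algebra `A` the superspace `V ⊗ A` is `Fin N → A`. It is used for `A = K` and
for `A = K[T;T⁻¹]`. -/

section Modules

variable (A : Type) [CommRing A] [Algebra K A]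

/-- `V ⊗ A`. -/
abbrev VV : Type := Fin o.N → A

/-- The matrix unit `E_{ij}`, which maps `v_j` to `v_i`, as an operator on `V ⊗ A`. -/
def E (i j : Fin o.N) : Module.End K (o.VV A) :=
  LinearMap.single K (fun _ : Fin o.N => A) i ∘ₗ LinearMap.proj j

/-- `X_{ij} = E_{ij} - (-1)^{|i|(|i| + |j|)} ϑ_i ϑ_j E_{j'i'}`. -/
def X (i j : Fin o.N) : Module.End K (o.VV A) :=
  o.E A i j - (sgn (o.par i * (o.par i + o.par j)) * o.theta i * o.theta j) • o.E A j.rev i.rev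

/-- Multiplication by an element of `A` on `V ⊗ A`. -/
def mulBy (x : A) : Module.End K (o.VV A) := Algebra.lsmul K K (o.VV A) x

/-- The `(r, r)` entry of the diagonal matrix `X_{cc} = E_{cc} - E_{c'c'}`. -/
def xDiag (c r : Fin o.N) : ℤ := (if r = c then 1 else 0) - (if r = c.rev then 1 else 0)

/-- The `(r, r)` entry of the diagonal matrix by which `h_i` acts on `V`, `0 ≤ i ≤ s`. -/
def hDiag (i : ℕ) (r : Fin o.N) : ℤ :=
  if i = 0 then
    if o.par (o.ix 1) = 1 then 2 * o.xDiag (o.ix 1) r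
    else -(sgn (o.par (o.ix 1)) * o.xDiag (o.ix 1) r + sgn (o.par (o.ix 2)) * o.xDiag (o.ix 2) r)
  else if i < o.s ∨ Odd o.m then
    sgn (o.par (o.ix i)) * o.xDiag (o.ix i) r -
      sgn (o.par (o.ix (i + 1))) * o.xDiag (o.ix (i + 1)) r
  else if o.par (o.ix o.s) = 0 then
    sgn (o.par (o.ix (o.s - 1))) * o.xDiag (o.ix (o.s - 1)) r -
      sgn (o.par (o.ix (o.s + 1))) * o.xDiag (o.ix (o.s + 1)) r
  else -2 * o.xDiag (o.ix o.s) r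

/-- The action of `e_i`, `1 ≤ i ≤ s`. -/
def eFin (i : ℕ) : Module.End K (o.VV A) :=
  if i < o.s ∨ Odd o.m then o.X A (o.ix i) (o.ix (i + 1))
  else if o.par (o.ix o.s) = 0 then o.X A (o.ix (o.s - 1)) (o.ix (o.s + 1))
  else o.E A (o.ix o.s) (o.ix (o.s + 1))

/-- The action of `f_i`, `1 ≤ i ≤ s`. In the last case it is `κ_s · (-2 E_{s+1,s})` with
`κ_s = (q + q⁻¹) / 2`. -/
def fFin (i : ℕ) : Module.End K (o.VV A) :=
  if i < o.s ∨ Odd o.m then sgn (o.par (o.ix i)) • o.X A (o.ix (i + 1)) (o.ix i)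
  else if o.par (o.ix o.s) = 0 then
    sgn (o.par (o.ix (o.s - 1))) • o.X A (o.ix (o.s + 1)) (o.ix (o.s - 1))
  else ((q + q⁻¹) / 2) • ((-2 : ℤ) • o.E A (o.ix (o.s + 1)) (o.ix o.s))

/-- The value to which `a b` is fixed. -/
def abValue : K :=
  if o.par (o.ix 1) = 1 then -(q + q⁻¹) else (sgn (o.par (o.ix 2)) : K)

variable {A} in
/-- The operators `ϱ^{a,b}_u(x)` on `V ⊗ A` for the generators `x` other than `D^{± 1}`, with
spectral parameter `u ∈ A^×`. -/
def evalGen (a b : K) (u : Aˣ) : Gen o → Module.End K (o.VV A)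
  | .e i =>
      if (i : ℕ) = 0 then
        a • (o.mulBy A (u : A) *
          if o.par (o.ix 1) = 1 then o.E A (o.ix 1).rev (o.ix 1) else o.X A (o.ix 2).rev (o.ix 1))
      else o.eFin A i
  | .f i =>
      if (i : ℕ) = 0 then
        b • (o.mulBy A ((u⁻¹ : Aˣ) : A) *
          if o.par (o.ix 1) = 1 then o.E A (o.ix 1) (o.ix 1).rev else o.X A (o.ix 1) (o.ix 2).rev)
      else o.fFin A i
  | .k i => ∑ r : Fin o.N, qHalf (o.hDiag i r) • o.E A r r
  | .kInv i => ∑ r : Fin o.N, qHalf (-o.hDiag i r) • o.E A r r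
  | .gam => 1
  | .gamInv => 1

/-! ### Tensor products and R-matrices -/

/-- The tensor square of `V ⊗ A` over `K`. -/
abbrev VV2 : Type := o.VV A ⊗[K] o.VV A

/-- The parity operator `v_i ↦ (-1)^{|i|} v_i`. -/
def parityOp : Module.End K (o.VV A) := ∑ i : Fin o.N, sgn (o.par i) • o.E A i i

variable {A} in
/-- The super tensor product `F ⊗ G` of operators, where `G` is homogeneous of parity `d`:
`(F ⊗ G)(x ⊗ y) = (-1)^{d |x|} F x ⊗ G y`. -/
def superTensor (d : ZMod 2) (F G : Module.End K (o.VV A)) : Module.End K (o.VV2 A) :=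
  TensorProduct.map (F * o.parityOp A ^ d.val) G

variable {A} in
/-- The operators `(ϱ_1 ⊗ ϱ_2)(Δ(x))` for the generators `x` other than `D^{± 1}`, in terms of
the operators `F = ϱ_1` and `G = ϱ_2` on the generators. -/
def coprodGen (F G : Gen o → Module.End K (o.VV A)) : Gen o → Module.End K (o.VV2 A)
  | .e i => o.superTensor (o.genPar i) (F (.k i)) (G (.e i)) +
      o.superTensor 0 (F (.e i)) (G (.kInv i))
  | .f i => o.superTensor (o.genPar i) (F (.k i)) (G (.f i)) +
      o.superTensor 0 (F (.f i)) (G (.kInv i))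
  | .k i => o.superTensor 0 (F (.k i)) (G (.k i))
  | .kInv i => o.superTensor 0 (F (.kInv i)) (G (.kInv i))
  | .gam => o.superTensor 0 (F .gam) (G .gam)
  | .gamInv => o.superTensor 0 (F .gamInv) (G .gamInv)

/-- `E_{ij} ⊗ E_{kl}`. -/
def EE (i j k l : Fin o.N) : Module.End K (o.VV2 A) :=
  o.superTensor (o.par k + o.par l) (o.E A i j) (o.E A k l)

/-- The graded permutation `x ⊗ y ↦ (-1)^{|x| |y|} y ⊗ x` of the two factors `V ⊗ A`. -/
def superSwap : Module.End K (o.VV2 A) :=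
  (TensorProduct.comm K (o.VV A) (o.VV A)).toLinearMap *
    ∑ i : Fin o.N, ∑ j : Fin o.N,
      sgn (o.par i * o.par j) • TensorProduct.map (o.E A i i) (o.E A j j)

/-- `τ_{VV} = ∑_{i,j} (-1)^{|j|} E_{ij} ⊗ E_{ji}`, which permutes only the factors `V`. -/
def tauOp : Module.End K (o.VV2 A) :=
  ∑ i : Fin o.N, ∑ j : Fin o.N, sgn (o.par j) • o.EE A i j j i

/-- The finite R-matrix `R_∞`, the expression in braces in the formula for `R(z)`. -/
def RInf : Module.End K (o.VV2 A) :=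
  1 + (qHalf 1 - qHalf (-1)) • ∑ i : Fin o.N, sgn (o.par i) •
      (qHalf (o.form (o.eps i) (o.eps i)) • o.EE A i i i i -
        qHalf (-o.form (o.eps i) (o.eps i)) • o.EE A i i i.rev i.rev) +
    (q - q⁻¹) • ∑ i : Fin o.N, ∑ j : Fin o.N,
      if j < i then sgn (o.par j) •
        (o.EE A i j j i -
          (sgn (o.par j * (o.par i + o.par j)) * o.theta i * o.theta j) •
            qHalf (o.form o.twoRho (o.eps i - o.eps j)) • o.EE A i j i.rev j.rev)
      else 0

/-- `∑_{i,j} (-1)^{|i| |j|} ϑ_i ϑ_j q^{(ρ, ε_i - ε_j)} E_{ij} ⊗ E_{i'j'}`. -/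
def QOp : Module.End K (o.VV2 A) :=
  ∑ i : Fin o.N, ∑ j : Fin o.N,
    (sgn (o.par i * o.par j) * o.theta i * o.theta j) •
      qHalf (o.form o.twoRho (o.eps i - o.eps j)) • o.EE A i j i.rev j.rev

/-- The scalar `q^{-m+n+2}`. -/
def crossing : K := q ^ (-(o.m : ℤ) + (o.n : ℤ) + 2)

/-- The R-matrix `R(z)` on `V ⊗ V`, for a value `z ≠ 1` of the spectral parameter. -/
def spectralR (z : K) : Module.End K (o.VV2 K) :=
  (z - o.crossing) • o.RInf K +
    ((q - q⁻¹) * ((z - o.crossing) / (z - 1))) • o.tauOp K -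
    ((q - q⁻¹) * o.crossing) • o.QOp K

/-- `R̂(z) = τ ∘ R(z)`. -/
def spectralRHat (z : K) : Module.End K (o.VV2 K) := o.superSwap K * o.spectralR z

/-- `(z - 1) R(z)`, which is polynomial in `z`, for `z` an operator commuting with all
`E_{ij} ⊗ E_{kl}`. -/
def clearedR (z : Module.End K (o.VV2 A)) : Module.End K (o.VV2 A) :=
  (z - 1) * (z - o.crossing • 1) * o.RInf A +
    (q - q⁻¹) • ((z - o.crossing • 1) * o.tauOp A) -
    ((q - q⁻¹) * o.crossing) • ((z - 1) * o.QOp A)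

end Modules

/-! ### Formal spectral parameters -/

/-- `V(u) = V ⊗ K[u, u⁻¹]`, where the indeterminate `u` is `T`. -/
abbrev FormalV : Type := o.VV K[T;T⁻¹]

/-- The indeterminate of `K[T;T⁻¹]` as a unit. -/
def unitT : (K[T;T⁻¹])ˣ where
  val := LaurentPolynomial.T 1
  inv := LaurentPolynomial.T (-1)
  val_inv := by rw [← LaurentPolynomial.T_add]; simp
  inv_val := by rw [← LaurentPolynomial.T_add]; simp

/-- Multiplication by `z = u / v` on `V(u) ⊗ V(v)`, where `u` (resp. `v`) is the indeterminate
of the first (resp. second) factor. -/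
def formalZ : Module.End K (o.VV2 K[T;T⁻¹]) :=
  TensorProduct.map (o.mulBy K[T;T⁻¹] (LaurentPolynomial.T 1))
    (o.mulBy K[T;T⁻¹] (LaurentPolynomial.T (-1)))

/-- The operator `(z - 1) R̂(z) : V(u) ⊗ V(v) → V(v) ⊗ V(u)` with `z = u / v`. In the source the
first factor is `V(u)` and in the target it is `V(v)`; both tensor products are realized on the
same space, the indeterminate being called `T` in every factor. -/
def formalRHat : Module.End K (o.VV2 K[T;T⁻¹]) :=
  o.superSwap K[T;T⁻¹] * o.clearedR K[T;T⁻¹] o.formalZ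

/-! ### The modules over the quantum affine superalgebras

Each predicate prescribes the values on the generators, hence has at most one solution. -/

variable {o}

/-- `ρ` is the evaluation module `ϱ^{a,b}_u` of `U'_q` on `V`. -/
def IsEvaluation (a b : K) (u : Kˣ) (ρ : o.UReduced →ₐ[K] Module.End K (o.VV K)) : Prop :=
  ∀ x : Gen o, ρ (UReduced.gen o x) = o.evalGen a b u x

/-- `π` is the tensor product of the `U'_q`-modules `ρ₁` and `ρ₂`, i.e. `(ρ₁ ⊗ ρ₂) ∘ Δ`. -/
def IsTensor (ρ₁ ρ₂ : o.UReduced →ₐ[K] Module.End K (o.VV K))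
    (π : o.UReduced →ₐ[K] Module.End K (o.VV2 K)) : Prop :=
  ∀ x : Gen o, π (UReduced.gen o x) =
    o.coprodGen (fun y => ρ₁ (UReduced.gen o y)) (fun y => ρ₂ (UReduced.gen o y)) x

/-- `ρ` is the evaluation module `ϱ^{a,b}_u` of `U_q` on `V(u) = V ⊗ K[u, u⁻¹]`, where
`D^{± 1}` acts by `v ⊗ u^k ↦ q^{± k} v ⊗ u^k`. -/
def IsFormalEvaluation (a b : K) (ρ : o.U →ₐ[K] Module.End K o.FormalV) : Prop :=
  (∀ x : Gen o, ρ (U.gen o (.inl x)) = o.evalGen a b unitT x) ∧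
  (∀ (i : Fin o.N) (k : ℤ), ρ (U.gen o (.inr .D)) (Pi.single i (LaurentPolynomial.T k)) =
    q ^ k • (Pi.single i (LaurentPolynomial.T k) : o.FormalV)) ∧
  (∀ (i : Fin o.N) (k : ℤ), ρ (U.gen o (.inr .DInv)) (Pi.single i (LaurentPolynomial.T k)) =
    q ^ (-k) • (Pi.single i (LaurentPolynomial.T k) : o.FormalV))

/-- `π` is the tensor product of the `U_q`-modules `ρ₁` and `ρ₂`, i.e. `(ρ₁ ⊗ ρ₂) ∘ Δ`, where
`Δ(D^{± 1}) = D^{± 1} ⊗ D^{± 1}`. -/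
def IsFormalTensor (ρ₁ ρ₂ : o.U →ₐ[K] Module.End K o.FormalV)
    (π : o.U →ₐ[K] Module.End K (o.VV2 K[T;T⁻¹])) : Prop :=
  (∀ x : Gen o, π (U.gen o (.inl x)) =
    o.coprodGen (fun y => ρ₁ (U.gen o (.inl y))) (fun y => ρ₂ (U.gen o (.inl y))) x) ∧
  ∀ x : DGen, π (U.gen o (.inr x)) =
    TensorProduct.map (ρ₁ (U.gen o (.inr x))) (ρ₂ (U.gen o (.inr x)))

/-! ### Operators on the tensor cube -/

variable (o)

/-- `V ⊗ V ⊗ V`. -/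
abbrev VV3 : Type := (o.VV K ⊗[K] o.VV K) ⊗[K] o.VV K

variable {o}

/-- `F_{12} = F ⊗ Id`. -/
def op12 (F : Module.End K (o.VV2 K)) : Module.End K o.VV3 := LinearMap.rTensor (o.VV K) F

/-- `F_{23} = Id ⊗ F`. -/
def op23 (F : Module.End K (o.VV2 K)) : Module.End K o.VV3 :=
  (TensorProduct.assoc K (o.VV K) (o.VV K) (o.VV K)).symm.toLinearMap ∘ₗ
    LinearMap.lTensor (o.VV K) F ∘ₗ
      (TensorProduct.assoc K (o.VV K) (o.VV K) (o.VV K)).toLinearMap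

/-- `F_{13} = (Id ⊗ τ) F_{12} (Id ⊗ τ)`. -/
def op13 (F : Module.End K (o.VV2 K)) : Module.End K o.VV3 :=
  op23 (o.superSwap K) * op12 F * op23 (o.superSwap K)

end OspDatum

end OspAffine

end

open scoped TensorProduct LaurentPolynomial Matrix Kronecker

set_option linter.unusedSectionVars false
set_option linter.unusedSimpArgs false

/-! Write `T` for the finite braiding τR_∞ (`braid2`), ω for the invariant vector of V ⊗ V under the
finite quantum algebra, and Q for the rank one operator ωω* (`capCup`). With ζ = q^{-m+n+2} the
matrix R̂(z) equals (z - ζ)T + (q - q⁻¹)(z - ζ)/(z - 1) - (q - q⁻¹)ζQ. This is the Baxterization of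
a Birman–Wenzl–Murakami representation, and all three claims are read off from properties of T and
Q.

Existence of the modules. All relations except the Serre relations are direct computations with the
root operators X_{ab}. The Serre relations are known only as the radical of the Hopf pairing, so no
list of them is checked. By duality in each content (multiset of letters), a functional on words
kills the radical exactly when its homogeneous parts are combinations of pairings with fixed words
(`cutc_mem_shuf_of_sum_eq_zero`, `sum_eq_zero_of_locally`). Induction on the content shows that a
radical element acts on V by an operator M that supercommutes with every f_i, because the defect
consists of skew derivatives of lower content. If its weight is nonzero, some column of M vanishes
for weight reasons, and the f_i spread this to all columns. If its weight is zero, M is zero or a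
scalar. The scalar is zero because ω is killed by all e_i on V(1) ⊗ V(ζ), so that the coproduct
gives M(1 + q^{k/2})ω = 0 (`eWord_cutc_mem`). Signed transposition transfers the result to the f_i,
and closure of these functionals under the braided coproduct transfers it to tensor products
(`Locally.cop`).

Intertwining. Every simple generator moves the basis by one step in a suitable order, so it commutes
with T (`braidMat_comm_raise`, `braidMat_comm_lower`), and it commutes with Q by invariance of ω.
For e_0 and f_0, T only exchanges one half of the coproduct with the other, T⁻¹ = T - (q - q⁻¹) + (q
- q⁻¹)Q exchanges them the opposite way, and ω is killed at the ratio ζ of spectral parameters.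
These facts give the relation for the whole R̂(z) by pure algebra (`cleared_intertwines`).

Yang–Baxter. An operator that commutes with the raising operators is determined by its values on v_N
⊗ V or v_N ⊗ V ⊗ V, and T flips v_N past any vector up to a scalar. This yields the inverse of T,
the braid relation and the sliding of caps, hence the BMW relations (`isBMW`). Since ζ = νq for the
twist ν (`crossing_eq_twist`), the Yang–Baxter equation in braid form is an identity in the BMW
algebra (`IsBMW.yangBaxter`), and conjugation by graded flips gives the form with R. -/

noncomputable section

/-! ### Words, skew derivations and the Hopf pairing of free algebras. -/

namespace SkewWords

variable {k I : Type} [Field k] [DecidableEq I] (χ : I → I → k)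
variable {M M' : Type} [AddCommGroup M] [Module k M] [AddCommGroup M'] [Module k M']

/-- The transpose of the left skew derivation `∂_i` of the free algebra, acting on functionals. -/
def skewDer (i : I) : (List I → M) → List I → M
  | _, [] => 0
  | φ, j :: w => (if j = i then φ w else 0) + χ i j • skewDer i (fun v => φ (j :: v)) w

/-- The transpose of the right skew derivation. -/
def skewDerR (i : I) : (List I → M) → List I → M
  | _, [] => 0
  | φ, j :: w => (if j = i then (w.map (χ i)).prod • φ w else 0) +
      skewDerR i (fun v => φ (j :: v)) w

/-- The Hopf pairing of words, as an iterated skew derivation. -/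
def wpair : List I → List I → k
  | [], w => if w = [] then 1 else 0
  | i :: y, w => skewDer χ i (wpair y) w

/-- The functional dual to the braided coproduct of words. -/
def cop : (List I → List I → M) → List I → M
  | g, [] => g [] []
  | g, i :: w => cop (fun a b => g (i :: a) b + (a.map (χ i)).prod • g a (i :: b)) w

variable {χ}

theorem skewDer_map (L : M →ₗ[k] M') (i : I) (φ : List I → M) (w : List I) :
    skewDer χ i (fun v => L (φ v)) w = L (skewDer χ i φ w) := by
  induction w generalizing φ with
  | nil => simp [skewDer]
  | cons j w ih =>
    simp only [skewDer, map_add, map_smul]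
    rw [ih (fun v => φ (j :: v))]
    split_ifs <;> simp

theorem skewDerR_map (L : M →ₗ[k] M') (i : I) (φ : List I → M) (w : List I) :
    skewDerR χ i (fun v => L (φ v)) w = L (skewDerR χ i φ w) := by
  induction w generalizing φ with
  | nil => simp [skewDerR]
  | cons j w ih =>
    simp only [skewDerR, map_add]
    rw [ih (fun v => φ (j :: v))]
    split_ifs <;> simp

theorem skewDer_add (i : I) (φ ψ : List I → M) (w : List I) :
    skewDer χ i (fun v => φ v + ψ v) w = skewDer χ i φ w + skewDer χ i ψ w := by
  induction w generalizing φ ψ with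
  | nil => simp [skewDer]
  | cons j w ih =>
    simp only [skewDer]
    rw [ih (fun v => φ (j :: v)) (fun v => ψ (j :: v))]
    split_ifs <;> module

theorem skewDer_zero (i : I) (w : List I) : skewDer χ i (fun _ => (0 : M)) w = 0 := by
  induction w with
  | nil => simp [skewDer]
  | cons j w ih => simp [skewDer, ih]

theorem skewDer_smul (i : I) (c : k) (φ : List I → M) (w : List I) :
    skewDer χ i (fun v => c • φ v) w = c • skewDer χ i φ w :=
  skewDer_map (LinearMap.lsmul k M c) i φ w

theorem skewDerR_add (i : I) (φ ψ : List I → M) (w : List I) :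
    skewDerR χ i (fun v => φ v + ψ v) w = skewDerR χ i φ w + skewDerR χ i ψ w := by
  induction w generalizing φ ψ with
  | nil => simp [skewDerR]
  | cons j w ih =>
    simp only [skewDerR]
    rw [ih (fun v => φ (j :: v)) (fun v => ψ (j :: v))]
    split_ifs <;> module

theorem skewDerR_zero (i : I) (w : List I) : skewDerR χ i (fun _ => (0 : M)) w = 0 := by
  induction w with
  | nil => simp [skewDerR]
  | cons j w ih => simp [skewDerR, ih]

theorem skewDerR_smul (i : I) (c : k) (φ : List I → M) (w : List I) :
    skewDerR χ i (fun v => c • φ v) w = c • skewDerR χ i φ w :=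
  skewDerR_map (LinearMap.lsmul k M c) i φ w

/-- Each term of the derivation deletes one letter `i`, so it evaluates `φ` only at words whose
content is that of `w` with one `i` removed. -/
theorem skewDer_congr (i : I) (φ ψ : List I → M) (w : List I)
    (h : ∀ v : List I, (i ::ₘ (v : Multiset I)) = w → φ v = ψ v) :
    skewDer χ i φ w = skewDer χ i ψ w := by
  induction w generalizing φ ψ with
  | nil => rfl
  | cons j w ih =>
    simp only [skewDer]
    rw [ih (fun v => φ (j :: v)) (fun v => ψ (j :: v))]
    · split_ifs with hj
      · rw [h w (by rw [← hj]; simp)]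
      · rfl
    · intro v hv
      apply h
      rw [← Multiset.cons_coe, ← Multiset.cons_coe, Multiset.cons_swap, hv]

theorem skewDerR_congr (i : I) (φ ψ : List I → M) (w : List I)
    (h : ∀ v : List I, (i ::ₘ (v : Multiset I)) = w → φ v = ψ v) :
    skewDerR χ i φ w = skewDerR χ i ψ w := by
  induction w generalizing φ ψ with
  | nil => rfl
  | cons j w ih =>
    simp only [skewDerR]
    rw [ih (fun v => φ (j :: v)) (fun v => ψ (j :: v))]
    · split_ifs with hj
      · rw [h w (by rw [← hj]; simp)]
      · rfl
    · intro v hv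
      apply h
      rw [← Multiset.cons_coe, ← Multiset.cons_coe, Multiset.cons_swap, hv]

theorem skewDer_eq_zero (i : I) (φ : List I → M) (w : List I)
    (h : ∀ v : List I, (i ::ₘ (v : Multiset I)) = w → φ v = 0) : skewDer χ i φ w = 0 := by
  rw [skewDer_congr i φ (fun _ => 0) w h, skewDer_zero]

/-- Every letter of `y` must delete an equal letter of `w`, so the pairing is graded by content. All
duality arguments can therefore be made in finite-dimensional blocks. -/
theorem wpair_eq_zero (y w : List I) (h : (y : Multiset I) ≠ w) : wpair χ y w = 0 := by
  induction y generalizing w with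
  | nil =>
    have : w ≠ [] := by rintro rfl; exact h rfl
    simp [wpair, this]
  | cons i y ih =>
    refine skewDer_eq_zero i _ w fun v hv => ih v fun e => h ?_
    rw [← hv, ← e, Multiset.cons_coe]

theorem prod_char_congr (c : I → k) {w v : List I} (h : (w : Multiset I) = v) :
    (w.map c).prod = (v.map c).prod :=
  ((Multiset.coe_eq_coe.1 h).map c).prod_eq

/-- All words at which `φ` is evaluated have the same content, so a character of the content is
constant on them and can be pulled out. -/
theorem skewDer_char (i : I) (c : I → k) (φ : List I → M) (w : List I) :
    c i • skewDer χ i (fun v => (v.map c).prod • φ v) w = (w.map c).prod • skewDer χ i φ w := by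
  have h1 : c i • skewDer χ i (fun v => (v.map c).prod • φ v) w =
      skewDer χ i (fun v => ((i :: v).map c).prod • φ v) w := by
    rw [← skewDer_smul]
    simp [mul_smul]
  rw [h1, ← skewDer_smul]
  refine skewDer_congr i _ _ w fun v hv => ?_
  rw [prod_char_congr c (w := i :: v) (v := w) (by rw [← hv, Multiset.cons_coe])]

/-- The left derivation weighs a deletion by the letters before it, the right one by the letters
after it. The two deletions interact only if the deleted `i` stands to the right of the deleted `j`.
One order then gains `χ i j` and the other `χ j i`, which agree by symmetry. -/
theorem skewDer_skewDerR (hχ : ∀ i j, χ i j = χ j i) (i j : I) (φ : List I → M) (w : List I) :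
    skewDer χ i (skewDerR χ j φ) w = skewDerR χ j (skewDer χ i φ) w := by
  induction w generalizing φ with
  | nil => rfl
  | cons l w ih =>
    have e1 : (fun v => skewDerR χ j φ (l :: v)) =
        fun v => (if l = j then (v.map (χ j)).prod • φ v else 0) +
          skewDerR χ j (fun u => φ (l :: u)) v := rfl
    have e2 : (fun v => skewDer χ i φ (l :: v)) =
        fun v => (if l = i then φ v else 0) + χ i l • skewDer χ i (fun u => φ (l :: u)) v := rfl
    rw [skewDer, skewDerR, e1, e2, skewDer_add, skewDerR_add, skewDerR_smul, ← ih]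
    have h1 : χ i l • skewDer χ i (fun v => if l = j then (v.map (χ j)).prod • φ v else 0) w =
        if l = j then (w.map (χ j)).prod • skewDer χ i φ w else 0 := by
      split_ifs with h
      · rw [h, hχ i j, skewDer_char]
      · rw [skewDer_zero, smul_zero]
    have h2 : skewDerR χ j (fun v => if l = i then φ v else 0) w =
        if l = i then skewDerR χ j φ w else 0 := by
      split_ifs with h
      · rfl
      · rw [skewDerR_zero]
    rw [smul_add, h1, h2]
    abel

/-- The pairing peels letters off the left of `y`. Because the two kinds of derivations commute, it
may also be computed by peeling letters off the right. -/
theorem wpair_snoc (hχ : ∀ i j, χ i j = χ j i) (y : List I) (i : I) (w : List I) :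
    wpair χ (y ++ [i]) w = skewDerR χ i (wpair χ y) w := by
  induction y generalizing w with
  | nil =>
    change skewDer χ i (wpair χ []) w = _
    -- On a functional supported at the empty word the two derivations agree: only one-letter words
    -- contribute, and their weights are empty products.
    have key : ∀ (w : List I) (φ : List I → k), (∀ v, v ≠ [] → φ v = 0) →
        skewDer χ i φ w = skewDerR χ i φ w := by
      intro w φ hφ
      cases w with
      | nil => rfl
      | cons j w =>
        have h0 : (fun v => φ (j :: v)) = fun _ => (0 : k) := by
          funext v
          exact hφ _ (by simp)
        rw [skewDer, skewDerR, h0, skewDer_zero, skewDerR_zero]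
        by_cases hw : w = []
        · simp [hw]
        · simp [hφ w hw]
    exact key w _ fun v hv => by simp [wpair, hv]
  | cons j y ih =>
    change skewDer χ j (wpair χ (y ++ [i])) w = skewDerR χ i (skewDer χ j (wpair χ y)) w
    rw [← skewDer_skewDerR hχ]
    congr 1
    funext v
    exact ih v

/-! ### Reversal -/

theorem skewDer_append (i : I) (φ : List I → M) (w v : List I) :
    skewDer χ i φ (w ++ v) = skewDer χ i (fun u => φ (u ++ v)) w +
      (w.map (χ i)).prod • skewDer χ i (fun u => φ (w ++ u)) v := by
  induction w generalizing φ with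
  | nil => simp [skewDer]
  | cons j w ih =>
    simp only [List.cons_append, skewDer, List.map_cons, List.prod_cons]
    rw [ih (fun u => φ (j :: u))]
    module

theorem skewDer_reverse (i : I) (φ : List I → M) (w : List I) :
    skewDer χ i φ w.reverse = skewDerR χ i (fun v => φ v.reverse) w := by
  induction w generalizing φ with
  | nil => rfl
  | cons j w ih =>
    simp only [List.reverse_cons, skewDerR, skewDer_append]
    rw [ih (fun u => φ (u ++ [j]))]
    simp only [skewDer, List.append_nil, smul_zero, add_zero, List.map_reverse,
      List.prod_reverse]
    rw [add_comm]
    congr 1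
    split_ifs <;> simp

/-- Reversal exchanges left and right derivations. This symmetry later carries the Serre relations
from the `e_i` to the transposed operators `f_i`. -/
theorem wpair_reverse (hχ : ∀ i j, χ i j = χ j i) (y w : List I) :
    wpair χ y w.reverse = wpair χ y.reverse w := by
  induction y generalizing w with
  | nil => simp [wpair]
  | cons i y ih =>
    rw [List.reverse_cons, wpair_snoc hχ]
    change skewDer χ i (wpair χ y) w.reverse = _
    rw [skewDer_reverse]
    congr 1
    funext v
    exact ih v

/-! ### The braided coproduct -/

theorem cop_map (L : M →ₗ[k] M') (g : List I → List I → M) (w : List I) :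
    cop χ (fun a b => L (g a b)) w = L (cop χ g w) := by
  induction w generalizing g with
  | nil => rfl
  | cons i w ih =>
    rw [cop, cop, ← ih]
    simp

theorem cop_add (g g' : List I → List I → M) (w : List I) :
    cop χ (fun a b => g a b + g' a b) w = cop χ g w + cop χ g' w := by
  induction w generalizing g g' with
  | nil => rfl
  | cons i w ih =>
    rw [cop, cop, cop, ← ih]
    congr 1
    funext a b
    module

theorem cop_congr (g g' : List I → List I → M) (w : List I)
    (h : ∀ a b : List I, (a : Multiset I) + b = w → g a b = g' a b) :
    cop χ g w = cop χ g' w := by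
  induction w generalizing g g' with
  | nil => exact h [] [] rfl
  | cons i w ih =>
    rw [cop, cop]
    refine ih _ _ fun a b hab => ?_
    rw [h (i :: a) b (by rw [← Multiset.cons_coe, Multiset.cons_add, hab, Multiset.cons_coe]),
      h a (i :: b) (by rw [← Multiset.cons_coe, Multiset.add_cons, hab, Multiset.cons_coe])]

theorem cop_zero (w : List I) : cop χ (fun _ _ => (0 : M)) w = 0 := by
  have := cop_map (χ := χ) (0 : M →ₗ[k] M) (fun _ _ => (0 : M)) w
  simpa using this

theorem cop_left (φ : List I → M) (w : List I) :
    cop χ (fun a b => if b = [] then φ a else 0) w = φ w := by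
  induction w generalizing φ with
  | nil => simp [cop]
  | cons i w ih =>
    rw [cop, ← ih (fun a => φ (i :: a))]
    simp

theorem cop_right (φ : List I → M) (w : List I) :
    cop χ (fun a b => if a = [] then φ b else 0) w = φ w := by
  induction w generalizing φ with
  | nil => simp [cop]
  | cons i w ih =>
    rw [cop, ← ih (fun b => φ (i :: b))]
    refine cop_congr _ _ _ fun a b _ => ?_
    by_cases h : a = [] <;> simp [h]

/-- This is dual to the associativity (iy)z = i(yz). The braiding factor of the coproduct passes
through the derivation by `skewDer_char`. -/
theorem cop_skewDer (hχ : ∀ i j, χ i j = χ j i) (i : I) (g : List I → List I → M) (w : List I) :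
    cop χ (fun a b => skewDer χ i (fun c => g c b) a) w = skewDer χ i (cop χ g) w := by
  induction w generalizing g with
  | nil => rfl
  | cons j w ih =>
    have e : (fun v => cop χ g (j :: v)) =
        cop χ (fun a b => g (j :: a) b + (a.map (χ j)).prod • g a (j :: b)) := rfl
    rw [skewDer, e, ← ih, cop]
    have e2 : (fun a b => skewDer χ i (fun c => g c b) (j :: a) +
          (a.map (χ j)).prod • skewDer χ i (fun c => g c (j :: b)) a) =
        fun a b => (if j = i then g a b else 0) +
          χ i j • skewDer χ i (fun c => g (j :: c) b + (c.map (χ j)).prod • g c (j :: b)) a := by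
      funext a b
      rw [skewDer, skewDer_add, smul_add, hχ i j, skewDer_char, hχ j i, add_assoc]
    rw [e2, cop_add]
    congr 1
    · split_ifs
      · rfl
      · exact cop_zero w
    · exact cop_map (LinearMap.lsmul k M (χ i j))
        (fun a b => skewDer χ i (fun c => g (j :: c) b + (c.map (χ j)).prod • g c (j :: b)) a) w

/-- Hopf property of the pairing: concatenation in the first argument is dual to the braided
coproduct in the second. It follows by peeling the letters of `y` with `cop_skewDer`. -/
theorem cop_wpair (hχ : ∀ i j, χ i j = χ j i) (y z w : List I) :
    cop χ (fun a b => wpair χ y a * wpair χ z b) w = wpair χ (y ++ z) w := by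
  induction y generalizing w with
  | nil =>
    rw [List.nil_append, ← cop_right (χ := χ) (wpair χ z) w]
    congr 1
    funext a b
    by_cases h : a = [] <;> simp [h, wpair]
  | cons i y ih =>
    change _ = skewDer χ i (wpair χ (y ++ z)) w
    rw [← funext ih, ← cop_skewDer hχ]
    congr 1
    funext a b
    change skewDer χ i (wpair χ y) a * _ = _
    have := skewDer_smul (χ := χ) i (wpair χ z b) (wpair χ y) a
    simp only [smul_eq_mul] at this
    rw [mul_comm, ← this]
    simp only [mul_comm]

/-- Products over words of sums `x_i + y_i` with `y_i x_j = χ_{ij} x_j y_i`. -/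
theorem prod_add_eq_cop {B : Type} [Ring B] [Algebra k B] (x y : I → B)
    (hxy : ∀ i j, y i * x j = χ i j • (x j * y i)) (w : List I) :
    (w.map fun i => x i + y i).prod =
      cop χ (fun a b => (a.map x).prod * (b.map y).prod) w := by
  -- One `y_i` is moved through a whole word in the `x_j`; the collected scalars are the braiding
  -- factor in `cop`.
  have hy : ∀ i (a : List I), y i * (a.map x).prod =
      (a.map (χ i)).prod • ((a.map x).prod * y i) := by
    intro i a
    induction a with
    | nil => simp
    | cons j a ih =>
      rw [List.map_cons, List.prod_cons, ← mul_assoc, hxy, smul_mul_assoc, mul_assoc, ih]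
      simp [mul_smul, mul_assoc]
  induction w with
  | nil => simp [cop]
  | cons i w ih =>
    rw [List.map_cons, List.prod_cons, ih, cop]
    have := cop_map (χ := χ) (LinearMap.mulLeft k (x i + y i))
      (fun a b => (a.map x).prod * (b.map y).prod) w
    simp only [LinearMap.mulLeft_apply] at this
    rw [← this]
    congr 1
    funext a b
    rw [add_mul, ← mul_assoc (y i), hy]
    simp [mul_assoc]

/-! ### Functionals in the image of the pairing -/

variable (χ M) in
/-- The functionals on words with values in `M` that come from the Hopf pairing. -/
def shuf : Submodule k (List I → M) :=
  Submodule.span k {φ | ∃ (y : List I) (v : M), φ = fun w => wpair χ y w • v}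

theorem wpair_mem_shuf (y : List I) (v : M) : (fun w => wpair χ y w • v) ∈ shuf χ M :=
  Submodule.subset_span ⟨y, v, rfl⟩

/-- A linear operator on functionals preserves `shuf` if it does so on the generators. -/
theorem shuf_map (F : (List I → M) →ₗ[k] (List I → M'))
    (hF : ∀ y v, F (fun w => wpair χ y w • v) ∈ shuf χ M') {φ : List I → M} (hφ : φ ∈ shuf χ M) :
    F φ ∈ shuf χ M' := by
  have : shuf χ M ≤ (shuf χ M').comap F := by
    refine Submodule.span_le.2 ?_
    rintro _ ⟨y, v, rfl⟩
    exact hF y v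
  exact this hφ

theorem skewDer_mem_shuf (i : I) {φ : List I → M} (hφ : φ ∈ shuf χ M) :
    skewDer χ i φ ∈ shuf χ M := by
  refine shuf_map (F := ⟨⟨fun φ => skewDer χ i φ, fun φ ψ => funext fun w => skewDer_add i φ ψ w⟩,
    fun c φ => funext fun w => skewDer_smul i c φ w⟩) (fun y v => ?_) hφ
  convert wpair_mem_shuf (χ := χ) (i :: y) v using 1
  funext w
  exact skewDer_map (LinearMap.toSpanSingleton k M v) i (wpair χ y) w

theorem skewDerR_mem_shuf (hχ : ∀ i j, χ i j = χ j i) (i : I) {φ : List I → M}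
    (hφ : φ ∈ shuf χ M) : skewDerR χ i φ ∈ shuf χ M := by
  refine shuf_map (F := ⟨⟨fun φ => skewDerR χ i φ,
    fun φ ψ => funext fun w => skewDerR_add i φ ψ w⟩,
    fun c φ => funext fun w => skewDerR_smul i c φ w⟩) (fun y v => ?_) hφ
  convert wpair_mem_shuf (χ := χ) (y ++ [i]) v using 1
  funext w
  rw [wpair_snoc hχ]
  exact skewDerR_map (LinearMap.toSpanSingleton k M v) i (wpair χ y) w

theorem reverse_mem_shuf (hχ : ∀ i j, χ i j = χ j i) {φ : List I → M}
    (hφ : φ ∈ shuf χ M) : (fun w => φ w.reverse) ∈ shuf χ M := by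
  refine shuf_map (F := ⟨⟨fun φ w => φ w.reverse, fun φ ψ => rfl⟩, fun c φ => rfl⟩)
    (fun y v => ?_) hφ
  convert wpair_mem_shuf (χ := χ) y.reverse v using 1
  funext w
  simp [wpair_reverse hχ]

/-- `shuf` is stable under linear maps that depend on the content of a word only. -/
theorem content_mem_shuf (L : Multiset I → M →ₗ[k] M') {φ : List I → M}
    (hφ : φ ∈ shuf χ M) : (fun w : List I => L w (φ w)) ∈ shuf χ M' := by
  refine shuf_map (F := ⟨⟨fun φ w => L w (φ w), fun φ ψ => by funext w; simp⟩,
    fun c φ => by funext w; simp⟩) (fun y v => ?_) hφ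
  convert wpair_mem_shuf (χ := χ) y (L y v) using 1
  funext w
  -- Pairing with `y` is supported on the content of `y`, so the content-dependent map can be frozen
  -- at that content.
  by_cases h : (y : Multiset I) = w
  · simp [h]
  · simp [wpair_eq_zero y w h]

/-- By bilinearity it suffices to take pairings with fixed words `y` and `z`; by `cop_wpair` their
product is the pairing with the concatenation. -/
theorem cop_mul_mem_shuf {B : Type} [Ring B] [Algebra k B] (hχ : ∀ i j, χ i j = χ j i)
    {φ ψ : List I → B} (hφ : φ ∈ shuf χ B) (hψ : ψ ∈ shuf χ B) :
    cop χ (fun a b => φ a * ψ b) ∈ shuf χ B := by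
  have smul1 : ∀ (c : k) (g : List I → List I → B),
      cop χ (fun a b => c • g a b) = c • cop χ g := fun c g =>
    funext fun w => cop_map (χ := χ) (LinearMap.lsmul k B c) g w
  refine shuf_map (F := ⟨⟨fun φ => cop χ (fun a b => φ a * ψ b), fun f g => ?_⟩, fun c f => ?_⟩)
    (fun y v => ?_) hφ
  · funext w
    simp only [Pi.add_apply, add_mul]
    exact cop_add _ _ w
  · simp only [Pi.smul_apply, smul_mul_assoc, RingHom.id_apply]
    exact smul1 _ _
  · refine shuf_map (F := ⟨⟨fun ψ => cop χ (fun a b => (wpair χ y a • v) * ψ b), fun f g => ?_⟩,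
      fun c f => ?_⟩) (fun z u => ?_) hψ
    · funext w
      simp only [Pi.add_apply, mul_add]
      exact cop_add _ _ w
    · simp only [Pi.smul_apply, mul_smul_comm, RingHom.id_apply]
      exact smul1 _ _
    · convert wpair_mem_shuf (χ := χ) (y ++ z) (v * u) using 1
      funext w
      have := cop_map (χ := χ) (LinearMap.toSpanSingleton k B (v * u))
        (fun a b => wpair χ y a * wpair χ z b) w
      rw [cop_wpair hχ] at this
      simp only [LinearMap.toSpanSingleton_apply] at this
      rw [← this]
      simp [mul_smul]

/-! ### The radical -/

variable (χ) in
/-- The radical of the pairing. -/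
def IsRad (x : List I →₀ k) : Prop := ∀ y : List I, (x.sum fun w c => c * wpair χ y w) = 0

theorem sum_eq_zero_of_mem_shuf {φ : List I → M} (hφ : φ ∈ shuf χ M) {x : List I →₀ k}
    (hx : IsRad χ x) : (x.sum fun w c => c • φ w) = 0 := by
  have : shuf χ M ≤ LinearMap.ker
      (∑ w ∈ x.support, x w • LinearMap.proj (R := k) (φ := fun _ : List I => M) w) := by
    refine Submodule.span_le.2 ?_
    rintro _ ⟨y, v, rfl⟩
    have h := hx y
    simp only [SetLike.mem_coe, LinearMap.mem_ker, LinearMap.sum_apply, LinearMap.smul_apply,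
      LinearMap.proj_apply, smul_smul]
    rw [← Finset.sum_smul]
    rw [Finsupp.sum] at h
    rw [h, zero_smul]
  have h := this hφ
  simpa [LinearMap.sum_apply, Finsupp.sum] using h

/-- Restriction of a functional to the words of a given content. -/
def cutc (μ : Multiset I) (φ : List I → M) (w : List I) : M :=
  if (w : Multiset I) = μ then φ w else 0

/-- The functionals all of whose homogeneous parts come from the Hopf pairing. -/
def Locally (χ : I → I → k) (φ : List I → M) : Prop := ∀ μ : Multiset I, cutc μ φ ∈ shuf χ M

/-- Contents are unbounded, so a functional given by a representation need not be a finite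
combination of pairings. A finite combination of words meets only finitely many contents, so
homogeneous parts suffice. -/
theorem sum_eq_zero_of_locally {φ : List I → M} (hφ : Locally χ φ) {x : List I →₀ k}
    (hx : IsRad χ x) : (x.sum fun w c => c • φ w) = 0 := by
  classical
  have h : ∀ w ∈ x.support, x w • φ w =
      ∑ μ ∈ x.support.image (fun w : List I => (w : Multiset I)), x w • cutc μ φ w := by
    intro w hw
    rw [← Finset.smul_sum]
    congr 1
    simp only [cutc]
    rw [Finset.sum_ite_eq, if_pos (Finset.mem_image_of_mem _ hw)]
  rw [Finsupp.sum, Finset.sum_congr rfl h, Finset.sum_comm]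
  exact Finset.sum_eq_zero fun μ _ => sum_eq_zero_of_mem_shuf (hφ μ) hx

/-- This is finite-dimensional duality. There are finitely many words of content `μ`; let `G` be
their Gram matrix. Its kernel consists of radical elements, since different contents are orthogonal.
Hence the linear extension `L` of `φ` vanishes on the kernel and factors through `G`, which writes
`φ` as a combination of rows of the Gram matrix. -/
theorem cutc_mem_shuf_of_sum_eq_zero {φ : List I → M} (μ : Multiset I)
    (h : ∀ x : List I →₀ k, IsRad χ x → (∀ w ∈ x.support, (w : Multiset I) = μ) →
      (x.sum fun w c => c • φ w) = 0) : cutc μ φ ∈ shuf χ M := by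
  classical
  let W := {w : List I // (w : Multiset I) = μ}
  have : Finite W := by
    obtain ⟨l, hl⟩ := Quot.exists_rep μ
    refine Set.Finite.to_subtype (s := {w : List I | (w : Multiset I) = μ}) ?_
    refine (List.finite_toSet l.permutations).subset fun w hw => ?_
    refine List.mem_permutations.2 (Multiset.coe_eq_coe.1 ?_)
    exact (Set.mem_ofPred.1 hw).trans hl.symm
  have := Fintype.ofFinite W
  let G : (W → k) →ₗ[k] (W → k) := LinearMap.pi fun y =>
    ∑ w : W, wpair χ y.1 w.1 • LinearMap.proj w
  let L : (W → k) →ₗ[k] M := ∑ w : W, (LinearMap.proj w : (W → k) →ₗ[k] k).smulRight (φ w.1)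
  have hker : ∀ f, G f = 0 → L f = 0 := by
    intro f hf
    let x : List I →₀ k := ∑ w : W, Finsupp.single w.1 (f w)
    have hsum : ∀ {P : Type} [AddCommGroup P] [Module k P] (ψ : List I → P),
        (x.sum fun w c => c • ψ w) = ∑ w : W, f w • ψ w.1 := by
      intro P _ _ ψ
      rw [← Finsupp.sum_finsetSum_index (fun _ => by simp) (fun _ _ _ => by rw [add_smul])]
      refine Finset.sum_congr rfl fun w _ => ?_
      rw [Finsupp.sum_single_index (h := fun w c => c • ψ w) (zero_smul _ _)]
    have hx : IsRad χ x := by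
      intro y
      have := hsum (wpair χ y)
      simp only [smul_eq_mul] at this
      rw [this]
      by_cases hy : (y : Multiset I) = μ
      · have h1 := congrFun hf ⟨y, hy⟩
        simpa [G, LinearMap.sum_apply, mul_comm] using h1
      · refine Finset.sum_eq_zero fun w _ => ?_
        rw [wpair_eq_zero y w.1 (by rw [w.2]; exact hy), mul_zero]
    have hsupp : ∀ w ∈ x.support, (w : Multiset I) = μ := by
      intro w hw
      obtain ⟨v, -, hv⟩ := Finset.mem_biUnion.1 (Finsupp.support_finsetSum hw)
      have := Finsupp.support_single_subset hv
      rw [Finset.mem_singleton] at this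
      rw [this]
      exact v.2
    have := h x hx hsupp
    rw [hsum] at this
    simpa [L, LinearMap.sum_apply] using this
  -- The factorization `L = m ∘ G` is built on the range of `G` by a linear section and then
  -- extended to the whole space.
  obtain ⟨s, hs⟩ := LinearMap.exists_rightInverse_of_surjective G.rangeRestrict
    (LinearMap.range_eq_top.2 G.surjective_rangeRestrict)
  obtain ⟨m, hm⟩ := LinearMap.exists_extend (L ∘ₗ s)
  have hmG : ∀ f, m (G f) = L f := by
    intro f
    have h1 : m (G f) = L (s (G.rangeRestrict f)) := by
      have := LinearMap.congr_fun hm (G.rangeRestrict f)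
      simpa using this
    have h2 : G (s (G.rangeRestrict f)) = G f := by
      have := LinearMap.congr_fun hs (G.rangeRestrict f)
      exact congrArg Subtype.val this
    rw [h1, ← sub_eq_zero, ← map_sub]
    exact hker _ (by rw [map_sub, h2, sub_self])
  have hfin : cutc μ φ = ∑ y : W, fun w => wpair χ y.1 w • m (Pi.single y 1) := by
    funext w
    rw [Finset.sum_apply, cutc]
    split_ifs with hw
    · have h1 := hmG (Pi.single ⟨w, hw⟩ 1)
      have h2 : L (Pi.single ⟨w, hw⟩ 1) = φ w := by
        simp only [L, LinearMap.sum_apply, LinearMap.smulRight_apply, LinearMap.proj_apply]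
        rw [Finset.sum_eq_single ⟨w, hw⟩ (fun v _ hv => by simp [Pi.single_apply, hv])
          (fun h => absurd (Finset.mem_univ _) h)]
        simp
      have h3 : G (Pi.single ⟨w, hw⟩ 1) = ∑ y : W, wpair χ y.1 w • Pi.single y (1 : k) := by
        funext y
        simp only [G, LinearMap.pi_apply, LinearMap.sum_apply, LinearMap.smul_apply,
          LinearMap.proj_apply, Finset.sum_apply, Pi.smul_apply]
        rw [Finset.sum_eq_single ⟨w, hw⟩ (fun v _ hv => by simp [Pi.single_apply, hv])
          (fun h => absurd (Finset.mem_univ _) h),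
          Finset.sum_eq_single y (fun v _ hv => by simp [Pi.single_apply, hv.symm])
          (fun h => absurd (Finset.mem_univ _) h)]
        simp
      rw [← h2, ← h1, h3, map_sum]
      simp only [map_smul]
    · refine (Finset.sum_eq_zero fun y _ => ?_).symm
      rw [wpair_eq_zero y.1 w (by rw [y.2]; exact fun e => hw e.symm), zero_smul]
  rw [hfin]
  exact Submodule.sum_mem _ fun y _ => wpair_mem_shuf _ _

theorem Locally.content {φ : List I → M} (hφ : Locally χ φ) (L : Multiset I → M →ₗ[k] M') :
    Locally χ (fun w : List I => L w (φ w)) := by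
  intro μ
  convert content_mem_shuf L (hφ μ) using 1
  funext w
  simp only [cutc]
  split_ifs <;> simp

theorem Locally.reverse (hχ : ∀ i j, χ i j = χ j i) {φ : List I → M} (hφ : Locally χ φ) :
    Locally χ (fun w : List I => φ w.reverse) := by
  intro μ
  convert reverse_mem_shuf hχ (hφ μ) using 1
  funext w
  simp [cutc]

/-- Up to a functional in `shuf`, the coproduct is primitive in the lowest degree in which a factor
does not come from the pairing. -/
theorem exists_cop_eq {B : Type} [Ring B] [Algebra k B] (hχ : ∀ i j, χ i j = χ j i)
    {φ ψ : List I → B} {μ : Multiset I} (hμ : μ ≠ 0) (hφ : ∀ ν < μ, cutc ν φ ∈ shuf χ B)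
    (hψ : ∀ ν < μ, cutc ν ψ ∈ shuf χ B) (hφ1 : φ [] = 1) (hψ1 : ψ [] = 1) :
    ∃ θ ∈ shuf χ B, ∀ w : List I, (w : Multiset I) = μ →
      cop χ (fun a b => φ a * ψ b) w = φ w + ψ w + θ w := by
  classical
  -- Only finitely many contents lie strictly below `μ`, so truncation there is a finite sum of
  -- homogeneous parts.
  have trunc : ∀ φ : List I → B, (∀ ν < μ, cutc ν φ ∈ shuf χ B) →
      (fun w : List I => if (w : Multiset I) < μ then φ w else 0) ∈ shuf χ B := by
    intro φ hφ
    have : (fun w : List I => if (w : Multiset I) < μ then φ w else 0) =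
        ∑ ν ∈ μ.powerset.toFinset.filter (· < μ), cutc ν φ := by
      funext w
      rw [Finset.sum_apply]
      simp only [cutc]
      rw [Finset.sum_ite_eq]
      refine if_congr ?_ rfl rfl
      simp only [Finset.mem_filter, Multiset.mem_toFinset, Multiset.mem_powerset]
      exact ⟨fun h => ⟨h.le, h⟩, fun h => h.2⟩
    rw [this]
    exact Submodule.sum_mem _ fun ν hν => hφ ν (Finset.mem_filter.1 hν).2
  refine ⟨_, cop_mul_mem_shuf hχ (trunc φ hφ) (trunc ψ hψ), fun w hw => ?_⟩
  -- In content `μ` the splittings with an empty factor give `φ` and `ψ`. In every other splitting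
  -- both factors have content below `μ` and are seen by the truncations.
  rw [← cop_left (χ := χ) φ w, ← cop_right (χ := χ) ψ w, ← cop_add, ← cop_add]
  refine cop_congr _ _ _ fun a b hab => ?_
  rw [hw] at hab
  have ha : (a : Multiset I) < μ ↔ b ≠ [] := by
    rw [← hab, lt_add_iff_pos_right]
    rw [pos_iff_ne_zero, ne_eq, Multiset.coe_eq_zero]
  have hb : (b : Multiset I) < μ ↔ a ≠ [] := by
    rw [← hab, lt_add_iff_pos_left]
    rw [pos_iff_ne_zero, ne_eq, Multiset.coe_eq_zero]
  have hne : ¬ (a = [] ∧ b = []) := by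
    rintro ⟨rfl, rfl⟩
    exact hμ hab.symm
  simp only [ha, hb]
  by_cases h1 : a = []
  · subst h1
    have h2 : b ≠ [] := fun h => hne ⟨rfl, h⟩
    simp [h2, hφ1]
  · by_cases h2 : b = []
    · subst h2
      simp [h1, hψ1]
    · simp [h1, h2]

/-- The splittings with two nonempty factors come from the pairing by closure under products; the
remaining two summands are `φ` and `ψ`. This is how the Serre relations pass to tensor products of
modules. -/
theorem Locally.cop {B : Type} [Ring B] [Algebra k B] (hχ : ∀ i j, χ i j = χ j i)
    {φ ψ : List I → B} (hφ : Locally χ φ) (hψ : Locally χ ψ) (hφ1 : φ [] = 1) (hψ1 : ψ [] = 1) :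
    Locally χ (SkewWords.cop χ fun a b => φ a * ψ b) := by
  intro μ
  by_cases hμ : μ = 0
  · subst hμ
    convert wpair_mem_shuf (χ := χ) [] (1 : B) using 1
    funext w
    by_cases h : w = []
    · subst h
      simp [cutc, wpair, SkewWords.cop, hφ1, hψ1]
    · simp [cutc, wpair, h]
  · obtain ⟨θ, hθ, h⟩ := exists_cop_eq hχ hμ (fun ν _ => hφ ν) (fun ν _ => hψ ν) hφ1 hψ1
    have hθ' : cutc μ θ ∈ shuf χ B := by
      have := content_mem_shuf (χ := χ)
        (fun ν => if ν = μ then (LinearMap.id : B →ₗ[k] B) else 0) hθ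
      convert this using 1
      funext w
      simp only [cutc]
      split_ifs <;> simp
    have : cutc μ (SkewWords.cop χ fun a b => φ a * ψ b) = cutc μ φ + cutc μ ψ + cutc μ θ := by
      funext w
      simp only [cutc, Pi.add_apply]
      split_ifs with hw
      · exact h w hw
      · simp
    rw [this]
    exact Submodule.add_mem _ (Submodule.add_mem _ (hφ μ) (hψ μ)) hθ'

/-! ### Commuting a word past a lowering operator -/

/-- In an algebra where `e_j f = ε_j f e_j + δ_{ij} (Kp - Km)`, moving `f` through a word in the
`e_j` produces the two skew derivatives of the word. -/
theorem prod_mul_lower {B : Type} [Ring B] [Algebra k B] (e : I → B) (f Kp Km : B) (i : I)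
    (ε : I → k) (hε : ∀ j, ε j * ε j = 1)
    (hf : ∀ j, e j * f = ε j • (f * e j) + if j = i then Kp - Km else 0)
    (hKp : ∀ j, ε j • (Kp * e j) = χ i j • (e j * Kp))
    (hKm : ∀ j, ε j • (e j * Km) = χ i j • (Km * e j)) (w : List I) :
    (w.map e).prod * f = (w.map ε).prod • (f * (w.map e).prod) +
      skewDerR χ i (fun v => (v.map e).prod) w * Kp -
      ((w.map ε).prod * ε i) • (Km * skewDer χ i (fun v => (v.map e).prod) w) := by
  -- `Kp` has to be carried to the right end of the word; the scalars collected are the suffix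
  -- weights of the right derivation.
  have hKpw : ∀ w : List I, (w.map ε).prod • (Kp * (w.map e).prod) =
      (w.map (χ i)).prod • ((w.map e).prod * Kp) := by
    intro w
    induction w with
    | nil => simp
    | cons j w ih =>
      simp only [List.map_cons, List.prod_cons]
      rw [mul_comm (ε j), mul_smul, ← mul_assoc, ← smul_mul_assoc (ε j), hKp, smul_mul_assoc,
        smul_comm, mul_assoc, ← mul_smul_comm, ih, mul_smul_comm, smul_smul, mul_assoc]
  induction w with
  | nil => simp [skewDer, skewDerR]
  | cons j w ih =>
    have h1 := skewDer_map (χ := χ) (LinearMap.mulLeft k (e j)) i (fun v => (v.map e).prod) w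
    have h2 := skewDerR_map (χ := χ) (LinearMap.mulLeft k (e j)) i (fun v => (v.map e).prod) w
    simp only [LinearMap.mulLeft_apply] at h1 h2
    simp only [List.map_cons, List.prod_cons, skewDer, skewDerR]
    rw [h1, h2, mul_assoc, ih]
    set W := (w.map e).prod
    set R := skewDerR χ i (fun v => (v.map e).prod) w
    set S := skewDer χ i (fun v => (v.map e).prod) w
    set c := (w.map ε).prod
    have h3 : e j * (Km * S) = ε j • χ i j • (Km * (e j * S)) := by
      rw [← mul_assoc, ← mul_assoc, ← smul_mul_assoc, ← hKm, smul_mul_assoc, smul_smul, hε,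
        one_smul]
    -- Passing `f` over one letter leaves a defect only for `j = i`. Its part `Kp` will travel to
    -- the right and its part `Km` stays on the left, where `h3` produces the prefix weights of the
    -- left derivation.
    have h4 : e j * (f * W) = ε j • (f * (e j * W)) +
        if j = i then Kp * W - Km * W else 0 := by
      rw [← mul_assoc, hf, add_mul, smul_mul_assoc, mul_assoc]
      split_ifs
      · rw [sub_mul]
      · rw [zero_mul]
    have h5 := hKpw w
    rw [mul_sub, mul_add, mul_smul_comm, mul_smul_comm, h3, h4]
    split_ifs with hj
    · subst hj
      have e1 : ε j * c * ε j = c := by rw [mul_right_comm, hε, one_mul]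
      rw [e1, add_mul, smul_mul_assoc, ← h5, mul_add, mul_smul_comm, smul_smul (c * ε j),
        mul_assoc c, hε, mul_one, ← mul_assoc (e j)]
      module
    · rw [add_zero, zero_add, zero_add, mul_smul_comm, ← mul_assoc (e j)]
      module

end SkewWords

namespace OspAffine

instance natAlgebraK : Algebra ℕ K := Semiring.toNatAlgebra

instance intAlgebraK : Algebra ℤ K := Ring.toIntAlgebra K

/-! ### Powers of `q^{1/2}` and signs -/

theorem qHalf_zero : qHalf 0 = 1 := zpow_zero _

theorem X_ne_zero : (RatFunc.X : K) ≠ 0 := RatFunc.X_ne_zero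

theorem qHalf_add (a b : ℤ) : qHalf (a + b) = qHalf a * qHalf b := zpow_add₀ X_ne_zero a b

theorem qHalf_neg (a : ℤ) : qHalf (-a) = (qHalf a)⁻¹ := zpow_neg _ a

theorem qHalf_sub (a b : ℤ) : qHalf (a - b) = qHalf a * (qHalf b)⁻¹ := by
  rw [sub_eq_add_neg, qHalf_add, qHalf_neg]

theorem qHalf_ne_zero (a : ℤ) : qHalf a ≠ 0 := zpow_ne_zero _ X_ne_zero

theorem qHalf_mul (a b : ℤ) : qHalf (a * b) = qHalf a ^ b := zpow_mul _ a b

theorem intDegree_qHalf_nat (n : ℕ) : RatFunc.intDegree (qHalf n) = n := by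
  induction n with
  | zero => simp [qHalf_zero]
  | succ n ih =>
    push_cast
    rw [qHalf_add, RatFunc.intDegree_mul (qHalf_ne_zero _) (qHalf_ne_zero _), ih]
    simp [qHalf]

/-- The degree of q^{a/2} as a rational function in q^{1/2} is `a`, while constants have degree
zero. -/
theorem qHalf_eq_const {a : ℤ} {c : ℂ} (h : qHalf a = RatFunc.C c) : a = 0 := by
  have key : ∀ (n : ℕ) (c : ℂ), qHalf n = RatFunc.C c → n = 0 := by
    intro n c h
    have := congrArg RatFunc.intDegree h
    rw [intDegree_qHalf_nat, RatFunc.intDegree_C] at this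
    exact_mod_cast this
  obtain ⟨n, rfl | rfl⟩ := a.eq_nat_or_neg
  · exact_mod_cast key n c h
  · rw [qHalf_neg, inv_eq_iff_eq_inv, ← map_inv₀] at h
    simpa using key n _ h

/-- Otherwise the power would be the constant -1, hence have exponent 0, and then 2 = 0. The
argument for the Serre relations in weight zero ends with this factor. -/
theorem one_add_qHalf_ne_zero (a : ℤ) : 1 + qHalf a ≠ 0 := by
  intro h
  have h1 : qHalf a = RatFunc.C (-1) := by
    rw [map_neg, map_one]
    exact eq_neg_of_add_eq_zero_right h
  rw [qHalf_eq_const h1, qHalf_zero] at h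
  norm_num at h

theorem q_ne_zero : q ≠ 0 := qHalf_ne_zero 2

theorem q_sub_inv_ne_zero : q - q⁻¹ ≠ 0 := by
  intro h
  have h1 : q * q = 1 := by
    have := sub_eq_zero.1 h
    nth_rw 2 [this]
    exact mul_inv_cancel₀ q_ne_zero
  rw [q, ← qHalf_add] at h1
  have h2 := qHalf_eq_const (c := 1) (h1.trans (map_one _).symm)
  norm_num at h2

theorem q_zpow (a : ℤ) : q ^ a = qHalf (2 * a) := (qHalf_mul 2 a).symm

theorem zmod_two_cases (x : ZMod 2) : x = 0 ∨ x = 1 := by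
  revert x
  decide

@[simp] theorem sgn_zero : sgn 0 = 1 := rfl

@[simp] theorem sgn_one : sgn 1 = -1 := rfl

theorem sgn_add (x y : ZMod 2) : sgn (x + y) = sgn x * sgn y := by
  revert x y
  decide

theorem sgn_mul_self (x : ZMod 2) : sgn x * sgn x = 1 := by
  revert x
  decide

theorem sgn_cast_mul_self (x : ZMod 2) : (sgn x : K) * sgn x = 1 := by
  exact_mod_cast congrArg (Int.cast : ℤ → K) (sgn_mul_self x)

theorem zmod_two_self_add (x : ZMod 2) : x + x = 0 := by
  revert x
  decide

namespace OspDatum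

variable (o : OspDatum)

/-! ### The numbers `(2ρ, ε_c)` -/

/-- At an odd middle vector the sign ϑ would be its own negative. -/
theorem par_eq_zero_of_rev {i : Fin o.N} (h : i.rev = i) : o.par i = 0 := by
  rcases zmod_two_cases (o.par i) with h0 | h1
  · exact h0
  · have := o.theta_odd i h1
    rw [h] at this
    rcases o.theta_unit i with h2 | h2 <;> rw [h2] at this <;> norm_num at this

theorem theta_mul_self (i : Fin o.N) : o.theta i * o.theta i = 1 := by
  rcases o.theta_unit i with h | h <;> rw [h] <;> norm_num

theorem theta_mul_rev (i : Fin o.N) : o.theta i * o.theta i.rev = sgn (o.par i) := by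
  rcases zmod_two_cases (o.par i) with h | h
  · rw [o.theta_even i h, o.theta_even i.rev (by rw [o.par_rev, h]), h]
    rfl
  · rw [o.theta_odd i h, h, sgn_one, neg_mul, theta_mul_self]

theorem m_add_n : o.m + o.n = o.N := by
  have h := Finset.card_filter_add_card_filter_not (s := (Finset.univ : Finset (Fin o.N)))
    (fun i => o.par i = 0)
  rw [Finset.card_univ, Fintype.card_fin] at h
  rw [← h]
  unfold m n
  congr 2
  ext i
  rcases zmod_two_cases (o.par i) with h | h <;> simp [h]

theorem odd_m_iff : Odd o.m ↔ Odd o.N := by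
  have h : Even o.n := o.even_card_odd
  rw [← o.m_add_n, Nat.odd_add]
  tauto

theorem sum_sgn : ∑ i, sgn (o.par i) = (o.m : ℤ) - o.n := by
  have h : ∀ i, sgn (o.par i) = (if o.par i = 0 then 1 else 0) - if o.par i = 1 then 1 else 0 := by
    intro i
    rcases zmod_two_cases (o.par i) with h | h <;> simp [h]
  rw [Finset.sum_congr rfl fun i _ => h i, Finset.sum_sub_distrib, Finset.sum_boole,
    Finset.sum_boole]
  rfl

/-- The inclusion of the indices of the coordinates of `P` into those of the basis of `V`. -/
def inc (k : Fin o.s) : Fin o.N := ⟨k, lt_of_lt_of_le k.2 (Nat.div_le_self _ _)⟩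

theorem two_s_le : 2 * o.s ≤ o.N := by
  unfold s
  omega

theorem le_two_s_add_one : o.N ≤ 2 * o.s + 1 := by
  unfold s
  omega

theorem inc_lt_rev (k : Fin o.s) : o.inc k < (o.inc k).rev := by
  have := k.2
  have := o.two_s_le
  rw [Fin.lt_def, Fin.val_rev]
  simp only [inc]
  omega

theorem xDiag_rev (c r : Fin o.N) : o.xDiag c.rev r = -o.xDiag c r := by
  simp [xDiag]

theorem xDiag_rev_right (c r : Fin o.N) : o.xDiag c r.rev = -o.xDiag c r := by
  simp [xDiag, Fin.rev_eq_iff]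

theorem eps_apply (c : Fin o.N) (k : Fin o.s) : o.eps c k = o.xDiag c (o.inc k) := by
  have h := o.inc_lt_rev k
  unfold eps xDiag
  have h1 : ((c : ℕ) = k) ↔ o.inc k = c := by
    rw [Fin.ext_iff]
    exact eq_comm
  have h2 : ((c.rev : ℕ) = k) ↔ o.inc k = c.rev := by
    rw [Fin.ext_iff]
    exact eq_comm
  rw [if_congr h1 rfl (if_congr h2 rfl rfl)]
  by_cases h3 : o.inc k = c
  · have : o.inc k ≠ c.rev := by
      rw [← h3]
      exact h.ne
    simp [h3, h3 ▸ this]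
  · by_cases h4 : o.inc k = c.rev
    · rw [if_neg h3, if_pos h4, if_neg h3, if_pos h4]
      rfl
    · rw [if_neg h3, if_neg h4, if_neg h3, if_neg h4]
      rfl

theorem eps_rev (c : Fin o.N) : o.eps c.rev = -o.eps c := by
  funext k
  rw [Pi.neg_apply, eps_apply, eps_apply, xDiag_rev]

theorem form_eq (x y : Fin o.s → ℤ) : o.form x y = ∑ k, sgn (o.par (o.inc k)) * (x k * y k) := rfl

theorem form_add_left (x y z : Fin o.s → ℤ) : o.form (x + y) z = o.form x z + o.form y z := by
  simp only [form_eq, ← Finset.sum_add_distrib, Pi.add_apply]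
  exact Finset.sum_congr rfl fun _ _ => by ring

theorem form_neg_left (x z : Fin o.s → ℤ) : o.form (-x) z = -o.form x z := by
  simp only [form_eq, ← Finset.sum_neg_distrib, Pi.neg_apply]
  exact Finset.sum_congr rfl fun _ _ => by ring

theorem form_sub_left (x y z : Fin o.s → ℤ) : o.form (x - y) z = o.form x z - o.form y z := by
  rw [sub_eq_add_neg, form_add_left, form_neg_left, sub_eq_add_neg]

theorem form_comm (x y : Fin o.s → ℤ) : o.form x y = o.form y x := by
  simp only [form_eq]
  exact Finset.sum_congr rfl fun _ _ => by ring

theorem form_add_right (x y z : Fin o.s → ℤ) : o.form x (y + z) = o.form x y + o.form x z := by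
  rw [form_comm, form_add_left, form_comm, form_comm _ z]

theorem form_neg_right (x z : Fin o.s → ℤ) : o.form x (-z) = -o.form x z := by
  rw [form_comm, form_neg_left, form_comm]

theorem form_sub_right (x y z : Fin o.s → ℤ) : o.form x (y - z) = o.form x y - o.form x z := by
  rw [form_comm, form_sub_left, form_comm, form_comm _ z]

theorem form_zero_left (x : Fin o.s → ℤ) : o.form 0 x = 0 := by
  simp [form_eq]

theorem eps_inc (k : Fin o.s) : o.eps (o.inc k) = Pi.single k 1 := by
  funext l
  have h := o.inc_lt_rev k
  have h2 := o.inc_lt_rev l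
  rw [eps_apply, xDiag, Pi.single_apply]
  have h1 : o.inc l = o.inc k ↔ l = k := by
    rw [Fin.ext_iff, Fin.ext_iff]
    rfl
  have h3 : o.inc l ≠ (o.inc k).rev := by
    intro e
    rw [e, Fin.rev_rev] at h2
    exact absurd h (not_lt.2 h2.le)
  simp [h1, h3]

theorem form_eps_inc (x : Fin o.s → ℤ) (k : Fin o.s) :
    o.form x (o.eps (o.inc k)) = sgn (o.par (o.inc k)) * x k := by
  rw [eps_inc, form_eq, Finset.sum_eq_single k]
  · simp
  · intro l _ hl
    simp [hl]
  · simp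

/-- Every index is one of the first `s`, one of the last `s`, or the middle one. -/
theorem index_cases (c : Fin o.N) :
    (∃ k, c = o.inc k) ∨ (∃ k, c = (o.inc k).rev) ∨ c.rev = c := by
  have h1 := o.two_s_le
  have h2 := o.le_two_s_add_one
  by_cases hc : (c : ℕ) < o.s
  · exact Or.inl ⟨⟨c, hc⟩, rfl⟩
  · by_cases hc' : (c.rev : ℕ) < o.s
    · refine Or.inr (Or.inl ⟨⟨c.rev, hc'⟩, ?_⟩)
      rw [← Fin.rev_eq_iff]
      rfl
    · refine Or.inr (Or.inr (Fin.ext ?_))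
      have := c.2
      rw [Fin.val_rev] at hc' ⊢
      omega

theorem eps_eq_zero {c : Fin o.N} (h : c.rev = c) : o.eps c = 0 := by
  have h1 := o.eps_rev c
  rw [h] at h1
  funext k
  have := congrFun h1 k
  simp only [Pi.neg_apply, Pi.zero_apply] at this ⊢
  omega

theorem form_eps_eps (a c : Fin o.N) :
    o.form (o.eps a) (o.eps c) = sgn (o.par a) * o.xDiag a c := by
  have key : ∀ k, o.form (o.eps a) (o.eps (o.inc k)) = sgn (o.par a) * o.xDiag a (o.inc k) := by
    intro k
    rw [form_eps_inc, eps_apply]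
    by_cases h1 : o.inc k = a
    · rw [h1]
    · by_cases h2 : o.inc k = a.rev
      · rw [h2, par_rev]
      · simp [xDiag, h1, h2]
  rcases o.index_cases c with ⟨k, rfl⟩ | ⟨k, rfl⟩ | h
  · exact key k
  · rw [eps_rev, form_neg_right, key, xDiag_rev_right]
    ring
  · rw [eps_eq_zero o h, form_comm, form_zero_left]
    have := o.xDiag_rev_right a c
    rw [h] at this
    have h0 : o.xDiag a c = 0 := by omega
    rw [h0, mul_zero]

/-- The sum of the signs of the basis vectors strictly between `c` and `c'`. -/
def between (c : Fin o.N) : ℤ := ∑ b, if c < b ∧ b < c.rev then sgn (o.par b) else 0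

/-- The number `(2ρ, ε_c)`. -/
def rhoEps (c : Fin o.N) : ℤ := o.form o.twoRho (o.eps c)

theorem rhoEps_rev (c : Fin o.N) : o.rhoEps c.rev = -o.rhoEps c := by
  rw [rhoEps, eps_rev, form_neg_right, rhoEps]

theorem rhoEps_mid {c : Fin o.N} (h : c.rev = c) : o.rhoEps c = 0 := by
  rw [rhoEps, eps_eq_zero o h, form_comm, form_zero_left]

/-- Coordinate `k` receives contributions from the roots ε_a - ε_b with a, b or b' equal to c = `inc
k`. Those with b = c and with b = c' cancel, so what remains is a = c, a sum over the indices
between c and c', and the root 2ε_c if c is odd. -/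
theorem twoRho_apply (k : Fin o.s) :
    o.twoRho k = sgn (o.par (o.inc k)) * o.between (o.inc k) +
      if o.par (o.inc k) = 1 then 2 else 0 := by
  have hk := o.inc_lt_rev k
  set c := o.inc k with hc
  have h1 : ∀ a b : Fin o.N, (if a < b ∧ b < a.rev then
      sgn (o.par a + o.par b) • (o.eps a - o.eps b) else 0) k =
      (if a = c then if c < b ∧ b < c.rev then sgn (o.par c) * sgn (o.par b) else 0 else 0) -
      ((if b = c then if a < c ∧ c < a.rev then sgn (o.par a + o.par c) else 0 else 0) -
        (if b = c.rev then if a < c ∧ c < a.rev then sgn (o.par a + o.par c) else 0 else 0)) := by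
    intro a b
    have e0 : a = c.rev → ¬ (a < b ∧ b < a.rev) := by
      rintro rfl ⟨h, h'⟩
      rw [Fin.rev_rev] at h'
      exact absurd (h.trans h') (not_lt.2 hk.le)
    -- The range a < b < a' is symmetric under b ↦ b', which is the reason for the cancellation.
    have e1 : (a < c.rev ∧ c.rev < a.rev) ↔ (a < c ∧ c < a.rev) := by
      rw [Fin.rev_lt_rev, Fin.lt_rev_iff]
      exact and_comm
    have e2 : c ≠ c.rev := hk.ne
    have e3 : o.eps a k - o.eps b k = (if a = c then 1 else 0) - (if a = c.rev then 1 else 0) -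
        ((if b = c then 1 else 0) - (if b = c.rev then 1 else 0)) := by
      rw [eps_apply, eps_apply]
      simp only [xDiag, ← hc, eq_comm (a := c), Fin.rev_eq_iff]
    by_cases hab : a < b ∧ b < a.rev
    · rw [if_pos hab, Pi.smul_apply, Pi.sub_apply, e3, if_neg (fun h => e0 h hab), sgn_add,
        smul_eq_mul]
      by_cases ha : a = c
      · subst ha
        have hb1 : b ≠ c := hab.1.ne'
        have hb2 : b ≠ c.rev := hab.2.ne
        simp [hb1, hb2, hab]
      · by_cases hb : b = c
        · subst hb
          simp [ha, hab, e2, sgn_add]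
        · by_cases hb' : b = c.rev
          · subst hb'
            simp [ha, e1.1 hab, e2.symm, sgn_add, o.par_rev]
          · simp [ha, hb, hb']
    · rw [if_neg hab, Pi.zero_apply]
      by_cases ha : a = c
      · subst ha
        simp [hab]
      · by_cases hb : b = c
        · subst hb
          simp [ha, hab, e2]
        · by_cases hb' : b = c.rev
          · subst hb'
            rw [e1] at hab
            simp [ha, hab, e2.symm]
          · simp [ha, hb, hb']
  have h2 : ∀ a : Fin o.N, (if (a : ℕ) < o.s ∧ o.par a = 1 then 2 • o.eps a else 0) k =
      if a = c then if o.par c = 1 then 2 else 0 else 0 := by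
    intro a
    by_cases ha : a = c
    · subst ha
      have : (c : ℕ) < o.s := k.2
      have e : o.eps c k = 1 := by rw [hc, eps_inc, Pi.single_eq_same]
      split_ifs with h3 h4 h4
      · simp [e]
      · exact absurd h3.2 h4
      · exact absurd ⟨this, h4⟩ h3
      · rfl
    · rw [if_neg ha]
      split_ifs with h3
      · have e : o.eps a k = 0 := by
          rw [eps_apply, ← hc, xDiag, if_neg (Ne.symm ha), if_neg]
          · rfl
          · intro e
            have e' : o.inc ⟨a, h3.1⟩ = a := rfl
            have := o.inc_lt_rev ⟨a, h3.1⟩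
            rw [e', ← e] at this
            rw [← Fin.rev_eq_iff] at e
            rw [e] at hk
            exact absurd hk (not_lt.2 this.le)
        simp [e]
      · rfl
  rw [twoRho, Pi.add_apply, Finset.sum_apply, Finset.sum_apply]
  simp only [Finset.sum_apply]
  simp only [h1, h2, Finset.sum_sub_distrib]
  congr 1
  · rw [Finset.sum_comm]
    simp only [Finset.sum_ite_eq', Finset.mem_univ, if_true]
    rw [sub_self, sub_zero, between, Finset.mul_sum]
    exact Finset.sum_congr rfl fun b _ => by split_ifs <;> simp
  · simp

theorem rhoEps_inc (k : Fin o.s) :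
    o.rhoEps (o.inc k) = o.between (o.inc k) + sgn (o.par (o.inc k)) - 1 := by
  rw [rhoEps, form_eps_inc, twoRho_apply, mul_add, ← mul_assoc, sgn_mul_self, one_mul]
  rcases zmod_two_cases (o.par (o.inc k)) with h | h <;> simp [h, sgn]
  ring

theorem rhoEps_of_lt {c : Fin o.N} (h : c < c.rev) :
    o.rhoEps c = o.between c + sgn (o.par c) - 1 := by
  have hc : (c : ℕ) < o.s := by
    rw [Fin.lt_def, Fin.val_rev] at h
    have := o.le_two_s_add_one
    omega
  exact o.rhoEps_inc ⟨c, hc⟩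

theorem between_succ {c d : Fin o.N} (hd : (d : ℕ) = c + 1) (h : d < d.rev) :
    o.between c = o.between d + 2 * sgn (o.par d) := by
  rw [Fin.lt_def, Fin.val_rev] at h
  have hpt : ∀ b : Fin o.N, (if c < b ∧ b < c.rev then sgn (o.par b) else 0) =
      (if d < b ∧ b < d.rev then sgn (o.par b) else 0) +
        ((if b = d then sgn (o.par d) else 0) + if b = d.rev then sgn (o.par d) else 0) := by
    intro b
    have hne : d ≠ d.rev := fun e => by
      have := congrArg Fin.val e
      rw [Fin.val_rev] at this
      omega
    by_cases hb : b = d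
    · subst hb
      have h1 : c < b ∧ b < c.rev := by
        rw [Fin.lt_def, Fin.lt_def, Fin.val_rev]
        omega
      simp [h1, hne]
    · by_cases hb' : b = d.rev
      · subst hb'
        have h1 : c < d.rev ∧ d.rev < c.rev := by
          rw [Fin.lt_def, Fin.lt_def, Fin.val_rev, Fin.val_rev]
          omega
        simp [h1, hne.symm, o.par_rev]
      · rw [if_neg hb, if_neg hb', add_zero, add_zero]
        refine if_congr ?_ rfl rfl
        have h1 : (b : ℕ) ≠ d := fun e => hb (Fin.ext e)
        have h2 : (b : ℕ) ≠ d.rev := fun e => hb' (Fin.ext e)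
        simp only [Fin.lt_def, Fin.val_rev] at h2 ⊢
        have := b.2
        omega
  rw [between, Finset.sum_congr rfl fun b _ => hpt b, Finset.sum_add_distrib,
    Finset.sum_add_distrib, Finset.sum_ite_eq', Finset.sum_ite_eq', if_pos (Finset.mem_univ _),
    if_pos (Finset.mem_univ _), between]
  ring

theorem between_mid {c d : Fin o.N} (hd : (d : ℕ) = c + 1) (h : d.rev = d) :
    o.between c = 1 := by
  have hp := o.par_eq_zero_of_rev h
  have h' := congrArg Fin.val h
  rw [Fin.val_rev] at h'
  rw [between, Finset.sum_eq_single d]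
  · rw [if_pos, hp, sgn_zero]
    simp only [Fin.lt_def, Fin.val_rev]
    omega
  · intro b _ hb
    rw [if_neg]
    have h1 : (b : ℕ) ≠ d := fun e => hb (Fin.ext e)
    simp only [Fin.lt_def, Fin.val_rev]
    omega
  · simp

theorem between_last {c : Fin o.N} (h : (c.rev : ℕ) = c + 1) : o.between c = 0 := by
  refine Finset.sum_eq_zero fun b _ => if_neg ?_
  simp only [Fin.lt_def]
  omega

theorem between_first {c : Fin o.N} (h : (c : ℕ) = 0) :
    o.between c = o.m - o.n - 2 * sgn (o.par c) := by
  have hN := o.two_lt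
  have hpt : ∀ b : Fin o.N, (if c < b ∧ b < c.rev then sgn (o.par b) else 0) = sgn (o.par b) -
        ((if b = c then sgn (o.par c) else 0) + if b = c.rev then sgn (o.par c) else 0) := by
    intro b
    have hne : c ≠ c.rev := fun e => by
      have := congrArg Fin.val e
      rw [Fin.val_rev] at this
      omega
    by_cases hb : b = c
    · subst hb
      simp [hne]
    · by_cases hb' : b = c.rev
      · subst hb'
        simp [hne.symm, o.par_rev]
      · have h1 : (b : ℕ) ≠ c := fun e => hb (Fin.ext e)
        have h2 : (b : ℕ) ≠ c.rev := fun e => hb' (Fin.ext e)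
        have := b.2
        rw [if_pos, if_neg hb, if_neg hb', add_zero, sub_zero]
        simp only [Fin.lt_def, Fin.val_rev] at h2 ⊢
        omega
  rw [between, Finset.sum_congr rfl fun b _ => hpt b, Finset.sum_sub_distrib,
    Finset.sum_add_distrib, Finset.sum_ite_eq', Finset.sum_ite_eq', if_pos (Finset.mem_univ _),
    if_pos (Finset.mem_univ _), sum_sgn]
  ring

end OspDatum

end OspAffine

namespace OspAffine.OspDatum

variable (o : OspDatum)

/-! ### The pair of indices attached to a generator

The operator `e_i` is a multiple of `X_{pr}` and `f_i` one of `X_{rp}`, where `p = tgt i` and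
`r = src i`; accordingly `α_i = ε_p - ε_r`. -/

/-- The index `p` with `α_i = ε_p - ε_r`. -/
def tgt (i : ℕ) : Fin o.N :=
  if i = 0 then (if o.par (o.ix 1) = 0 then (o.ix 2).rev else (o.ix 1).rev)
  else if i < o.s ∨ Odd o.m then o.ix i
  else if o.par (o.ix o.s) = 0 then o.ix (o.s - 1) else o.ix o.s

/-- The index `r` with `α_i = ε_p - ε_r`. -/
def src (i : ℕ) : Fin o.N :=
  if i = 0 then o.ix 1
  else if i < o.s ∨ Odd o.m then o.ix (i + 1)
  else o.ix (o.s + 1)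

theorem val_ix {k : ℕ} (h : k - 1 < o.N) : (o.ix k : ℕ) = k - 1 := Nat.mod_eq_of_lt h

theorem one_le_s : 1 ≤ o.s := by
  have := o.two_lt
  unfold s
  omega

/-- The possible configurations of the pair attached to a generator. -/
theorem pair_cases {i : ℕ} (hi : i ≤ o.s) :
    (i = 0 ∧ o.par (o.src i) = 0 ∧ (o.src i : ℕ) = 0 ∧ (o.tgt i : ℕ) = o.N - 2) ∨
    (i = 0 ∧ o.par (o.tgt i) = 1 ∧ (o.src i : ℕ) = 0 ∧ (o.tgt i : ℕ) = o.N - 1) ∨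
    (0 < i ∧ i < o.s ∧ (o.tgt i : ℕ) = i - 1 ∧ (o.src i : ℕ) = i) ∨
    (i = o.s ∧ o.N = 2 * o.s + 1 ∧ (o.tgt i : ℕ) = o.s - 1 ∧ (o.src i : ℕ) = o.s) ∨
    (i = o.s ∧ o.N = 2 * o.s ∧ 2 ≤ o.s ∧ o.par (o.src i) = 0 ∧ (o.tgt i : ℕ) = o.s - 2 ∧
      (o.src i : ℕ) = o.s) ∨
    (i = o.s ∧ o.N = 2 * o.s ∧ o.par (o.tgt i) = 1 ∧ (o.tgt i : ℕ) = o.s - 1 ∧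
      (o.src i : ℕ) = o.s) := by
  have hN := o.two_lt
  have h1 := o.two_s_le
  have h2 := o.le_two_s_add_one
  have hs := o.one_le_s
  rcases Nat.eq_zero_or_pos i with rfl | h0
  · have hv : (o.src 0 : ℕ) = 0 := by rw [src, if_pos rfl, val_ix] <;> omega
    by_cases hp : o.par (o.ix 1) = 0
    · refine Or.inl ⟨rfl, by rw [src, if_pos rfl, hp], hv, ?_⟩
      rw [tgt, if_pos rfl, if_pos hp, Fin.val_rev, val_ix] <;> omega
    · refine Or.inr (Or.inl ⟨rfl, ?_, hv, ?_⟩)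
      · rw [tgt, if_pos rfl, if_neg hp, par_rev]
        exact (zmod_two_cases _).resolve_left hp
      · rw [tgt, if_pos rfl, if_neg hp, Fin.val_rev, val_ix] <;> omega
  · have hi0 : i ≠ 0 := by omega
    by_cases his : i < o.s
    · refine Or.inr (Or.inr (Or.inl ⟨h0, his, ?_, ?_⟩))
      · rw [tgt, if_neg hi0, if_pos (Or.inl his), val_ix]
        omega
      · rw [src, if_neg hi0, if_pos (Or.inl his), val_ix] <;> omega
    · obtain rfl : i = o.s := by omega
      by_cases hm : Odd o.m
      · have hNs : o.N = 2 * o.s + 1 := by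
          rw [odd_m_iff, Nat.odd_iff] at hm
          omega
        refine Or.inr (Or.inr (Or.inr (Or.inl ⟨rfl, hNs, ?_, ?_⟩)))
        · rw [tgt, if_neg hi0, if_pos (Or.inr hm), val_ix]
          omega
        · rw [src, if_neg hi0, if_pos (Or.inr hm), val_ix] <;> omega
      · have hNs : o.N = 2 * o.s := by
          rw [odd_m_iff, Nat.odd_iff] at hm
          omega
        have hv : (o.src o.s : ℕ) = o.s := by
          rw [src, if_neg hi0, if_neg (by simp [hm]), val_ix] <;> omega
        by_cases hp : o.par (o.ix o.s) = 0
        · refine Or.inr (Or.inr (Or.inr (Or.inr (Or.inl ⟨rfl, hNs, by omega, ?_, ?_, hv⟩))))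
          · rw [← hp, ← o.par_rev]
            congr 1
            apply Fin.ext
            rw [Fin.val_rev, hv, val_ix] <;> omega
          · rw [tgt, if_neg hi0, if_neg (by simp [hm]), if_pos hp, val_ix] <;> omega
        · refine Or.inr (Or.inr (Or.inr (Or.inr (Or.inr ⟨rfl, hNs, ?_, ?_, hv⟩))))
          · rw [tgt, if_neg hi0, if_neg (by simp [hm]), if_neg hp]
            exact (zmod_two_cases _).resolve_left hp
          · rw [tgt, if_neg hi0, if_neg (by simp [hm]), if_neg hp, val_ix]
            omega

theorem ix_succ_s (hN : o.N = 2 * o.s) : o.ix (o.s + 1) = (o.ix o.s).rev := by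
  have hs := o.one_le_s
  apply Fin.ext
  rw [Fin.val_rev, val_ix, val_ix] <;> omega

theorem even_N_of {i : ℕ} (h : ¬ (i < o.s ∨ Odd o.m)) : o.N = 2 * o.s := by
  have h1 := o.two_s_le
  have h2 := o.le_two_s_add_one
  have : ¬ Odd o.m := fun h' => h (Or.inr h')
  rw [odd_m_iff, Nat.odd_iff] at this
  omega

theorem simpleRoot_eq (i : ℕ) : o.simpleRoot i = o.eps (o.tgt i) - o.eps (o.src i) := by
  unfold simpleRoot tgt src highestRoot
  split_ifs with h1 h2 h3 h4
  · rw [eps_rev]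
    abel
  · rw [eps_rev]
    module
  · rfl
  · rfl
  · rw [ix_succ_s o (o.even_N_of h3), eps_rev]
    module

theorem genPar_eq (i : ℕ) : o.genPar i = o.par (o.tgt i) + o.par (o.src i) := by
  unfold genPar tgt src
  split_ifs with h1 h2 h3 h4
  · rw [par_rev, add_comm]
  · rw [par_rev, zmod_two_self_add]
  · rfl
  · rfl
  · rw [ix_succ_s o (o.even_N_of h3), par_rev, zmod_two_self_add]

theorem hDiag_eq (i : ℕ) (c : Fin o.N) :
    o.hDiag i c = sgn (o.par (o.tgt i)) * o.xDiag (o.tgt i) c -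
      sgn (o.par (o.src i)) * o.xDiag (o.src i) c := by
  unfold hDiag tgt src
  by_cases h1 : i = 0
  · rw [if_pos h1, if_pos h1, if_pos h1]
    rcases zmod_two_cases (o.par (o.ix 1)) with h | h
    · rw [if_neg (by simp [h]), if_pos h, par_rev, xDiag_rev]
      ring
    · rw [if_pos h, if_neg (by simp [h]), par_rev, xDiag_rev, h, sgn_one]
      ring
  · rw [if_neg h1, if_neg h1, if_neg h1]
    by_cases h2 : i < o.s ∨ Odd o.m
    · rw [if_pos h2, if_pos h2, if_pos h2]
    · rw [if_neg h2, if_neg h2, if_neg h2, ix_succ_s o (o.even_N_of h2), xDiag_rev, par_rev]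
      rcases zmod_two_cases (o.par (o.ix o.s)) with h | h
      · rw [if_pos h, if_pos h]
      · rw [if_neg (by simp [h]), if_neg (by simp [h]), h, sgn_one]
        ring

theorem hDiag_eq_form (i : ℕ) (c : Fin o.N) :
    o.hDiag i c = o.form (o.simpleRoot i) (o.eps c) := by
  rw [hDiag_eq, simpleRoot_eq, form_sub_left, form_eps_eps, form_eps_eps]

theorem cartan_eq_hDiag (i j : ℕ) :
    o.cartan i j = o.hDiag i (o.tgt j) - o.hDiag i (o.src j) := by
  rw [cartan, simpleRoot_eq o j, form_sub_right, ← hDiag_eq_form, ← hDiag_eq_form]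

theorem cartan_comm (i j : ℕ) : o.cartan i j = o.cartan j i := form_comm _ _ _

theorem hDiag_rev (i : ℕ) (c : Fin o.N) : o.hDiag i c.rev = -o.hDiag i c := by
  rw [hDiag_eq_form, eps_rev, form_neg_right, hDiag_eq_form]

theorem braid_comm (i j : ℕ) : o.braid i j = o.braid j i := by
  rw [braid, braid, cartan_comm, mul_comm (o.genPar i)]

theorem tgt_ne_src {i : ℕ} (hi : i ≤ o.s) : o.tgt i ≠ o.src i := by
  intro h
  have h' := congrArg Fin.val h
  have := o.two_lt
  have := o.two_s_le
  have := o.le_two_s_add_one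
  rcases o.pair_cases hi with h | h | h | h | h | h <;> omega

theorem par_tgt_of_src_eq {i : ℕ} (hi : i ≤ o.s) (h : o.src i = (o.tgt i).rev) :
    o.par (o.tgt i) = 1 := by
  have h' := congrArg Fin.val h
  rw [Fin.val_rev] at h'
  have := o.two_lt
  have := o.two_s_le
  rcases o.pair_cases hi with h | h | h | h | h | h <;> first | omega | exact h.2.1 | exact h.2.2.1

/-- `(2ρ, α_i) = (α_i, α_i)` for the simple roots. -/
theorem rhoEps_simple {i : ℕ} (h0 : 0 < i) (hi : i ≤ o.s) :
    o.rhoEps (o.tgt i) - o.rhoEps (o.src i) = o.cartan i i := by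
  have hN := o.two_lt
  have h1 := o.two_s_le
  have h2 := o.le_two_s_add_one
  have hs := o.one_le_s
  rw [cartan_eq_hDiag, hDiag_eq, hDiag_eq]
  rcases o.pair_cases hi with h | h | ⟨-, hlt, hp, hr⟩ | ⟨-, hNs, hp, hr⟩ |
    ⟨-, hNs, h2s, hpar, hp, hr⟩ | ⟨-, hNs, hpar, hp, hr⟩
  · omega
  · omega
  all_goals
    generalize o.tgt i = p at *
    generalize o.src i = r at *
  · have hpp : p < p.rev := by rw [Fin.lt_def, Fin.val_rev]; omega
    have hrr : r < r.rev := by rw [Fin.lt_def, Fin.val_rev]; omega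
    have hpr : p ≠ r := fun e => by rw [e] at hp; omega
    have hpr' : p ≠ r.rev := fun e => by
      have := congrArg Fin.val e
      rw [Fin.val_rev] at this
      omega
    have hrp' : r ≠ p.rev := fun e => by
      have := congrArg Fin.val e
      rw [Fin.val_rev] at this
      omega
    rw [rhoEps_of_lt o hpp, rhoEps_of_lt o hrr, between_succ o (by omega) hrr]
    simp [xDiag, hpr, hpr.symm, hpr', hrp', hpp.ne, hrr.ne]
    ring
  · have hpp : p < p.rev := by rw [Fin.lt_def, Fin.val_rev]; omega
    have hrr : r.rev = r := by apply Fin.ext; rw [Fin.val_rev]; omega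
    have hpr : p ≠ r := fun e => by rw [e] at hp; omega
    have hrp' : r ≠ p.rev := fun e => by
      have := congrArg Fin.val e
      rw [Fin.val_rev] at this
      omega
    rw [rhoEps_of_lt o hpp, rhoEps_mid o hrr, between_mid o (by omega) hrr]
    simp [xDiag, hpr, hpr.symm, hrp', hpp.ne, hrr]
  · have hpp : p < p.rev := by rw [Fin.lt_def, Fin.val_rev]; omega
    have hrr : r.rev < r := by rw [Fin.lt_def, Fin.val_rev]; omega
    have hpr : p ≠ r := fun e => by rw [e] at hp; omega
    have hpr' : p ≠ r.rev := fun e => by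
      have := congrArg Fin.val e
      rw [Fin.val_rev] at this
      omega
    have hrp' : r ≠ p.rev := fun e => by
      have := congrArg Fin.val e
      rw [Fin.val_rev] at this
      omega
    -- At the forked end `r` lies past the middle, so ρ is evaluated at its mirror image, which is
    -- the last index of the first half and directly follows `p`.
    have hr2 : r.rev < r.rev.rev := by rwa [Fin.rev_rev]
    have e1 : (r.rev : ℕ) = p + 1 := by rw [Fin.val_rev]; omega
    have e2 : (r.rev.rev : ℕ) = r.rev + 1 := by rw [Fin.rev_rev, Fin.val_rev]; omega
    have e3 : o.rhoEps r = -o.rhoEps r.rev := by rw [rhoEps_rev, neg_neg]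
    rw [rhoEps_of_lt o hpp, e3, rhoEps_of_lt o hr2, between_succ o e1 hr2, between_last o e2,
      par_rev, hpar]
    simp [xDiag, hpr, hpr.symm, hpr', hrp', hpp.ne, hrr.ne']
    ring
  · have hpp : p < p.rev := by rw [Fin.lt_def, Fin.val_rev]; omega
    have e1 : r = p.rev := by apply Fin.ext; rw [Fin.val_rev]; omega
    subst e1
    rw [rhoEps_rev, rhoEps_of_lt o hpp, between_last o (by rw [hr, hp]; omega), par_rev, hpar]
    simp [xDiag, hpp.ne, hpp.ne']

/-- `(2ρ, α_0) - (α_0, α_0)` determines the crossing parameter. -/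
theorem rhoEps_zero :
    o.rhoEps (o.tgt 0) - o.rhoEps (o.src 0) - o.cartan 0 0 = 2 * (-(o.m : ℤ) + o.n + 2) := by
  have hN := o.two_lt
  have h1 := o.two_s_le
  have h2 := o.le_two_s_add_one
  have hs := o.one_le_s
  rw [cartan_eq_hDiag, hDiag_eq, hDiag_eq]
  rcases o.pair_cases (Nat.zero_le o.s) with ⟨-, hpar, hr, hp⟩ | ⟨-, hpar, hr, hp⟩ | h | h | h | h
  · generalize o.tgt 0 = p at *
    generalize o.src 0 = r at *
    have hrr : r < r.rev := by rw [Fin.lt_def, Fin.val_rev]; omega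
    have hpr : p ≠ r := fun e => by rw [e] at hp; omega
    have hpr' : p ≠ r.rev := fun e => by
      have := congrArg Fin.val e
      rw [Fin.val_rev] at this
      omega
    have hrp' : r ≠ p.rev := fun e => by
      have := congrArg Fin.val e
      rw [Fin.val_rev] at this
      omega
    have hb := o.between_first hr
    have hrho := o.rhoEps_of_lt hrr
    have e1 : (p.rev : ℕ) = r + 1 := by rw [Fin.val_rev]; omega
    -- Here p' is the second basis vector; it coincides with p exactly for N = 3, where it is the
    -- middle vector and has weight zero.
    by_cases hmid : p.rev = p
    · have hb2 := o.between_mid e1 (by rw [hmid, hmid])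
      have hpp := o.par_eq_zero_of_rev hmid
      rw [rhoEps_mid o hmid, hrho, hb, hpar]
      rw [hb, hpar] at hb2
      simp [xDiag, hpr, hpr.symm, hpr', hmid, hrr.ne]
      simp at hb2
      linarith
    · have hpp : p.rev < p.rev.rev := by
        have : (p.rev : ℕ) ≠ p := fun e => hmid (Fin.ext e)
        rw [Fin.rev_rev, Fin.lt_def]
        omega
      have hb2 := o.between_succ e1 hpp
      have hrho2 := o.rhoEps_of_lt hpp
      have e3 : o.rhoEps p = -o.rhoEps p.rev := by rw [rhoEps_rev, neg_neg]
      rw [par_rev] at hrho2 hb2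
      rw [Fin.rev_rev] at hpp
      rw [e3, hrho2, hrho]
      simp [xDiag, hpr, hpr.symm, hpr', hrp', hrr.ne, hpp.ne', hpar]
      simp [hpar] at hb
      linarith
  · have e1 : o.tgt 0 = (o.src 0).rev := by apply Fin.ext; rw [Fin.val_rev]; omega
    rw [e1] at hpar hp ⊢
    generalize o.src 0 = r at *
    have hrr : r < r.rev := by rw [Fin.lt_def, Fin.val_rev]; omega
    rw [par_rev] at hpar
    rw [rhoEps_rev, rhoEps_of_lt o hrr, o.between_first hr, par_rev, hpar]
    simp [xDiag, hrr.ne, hrr.ne']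
    ring
  all_goals omega

theorem crossing_eq : o.crossing =
    qHalf (o.rhoEps (o.tgt 0) - o.rhoEps (o.src 0) - o.cartan 0 0) := by
  rw [rhoEps_zero, crossing, q_zpow]

/-! ### The coefficients of the invariant vector -/

/-- The coefficient of `v_{i'} ⊗ v_i` in the invariant vector of `V ⊗ V`. -/
def coef (i : Fin o.N) : K := sgn (o.par i) * o.theta i * qHalf (o.rhoEps i)

theorem theta_cast_ne_zero (i : Fin o.N) : (o.theta i : K) ≠ 0 := by
  rcases o.theta_unit i with h | h <;> rw [h] <;> norm_num

theorem sgn_cast_ne_zero (x : ZMod 2) : (sgn x : K) ≠ 0 := by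
  rcases zmod_two_cases x with h | h <;> rw [h] <;> simp

theorem coef_ne_zero (i : Fin o.N) : o.coef i ≠ 0 :=
  mul_ne_zero (mul_ne_zero (sgn_cast_ne_zero _) (o.theta_cast_ne_zero i)) (qHalf_ne_zero _)

theorem coef_mul_rev (i : Fin o.N) : o.coef i * o.coef i.rev = sgn (o.par i) := by
  have h : ((o.theta i * o.theta i.rev : ℤ) : K) = sgn (o.par i) := by rw [theta_mul_rev]
  push_cast at h
  rw [coef, coef, par_rev, rhoEps_rev, qHalf_neg]
  have h2 := sgn_cast_mul_self (o.par i)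
  have h3 := mul_inv_cancel₀ (qHalf_ne_zero (o.rhoEps i))
  linear_combination (sgn (o.par i) * sgn (o.par i) : K) *
    (o.theta i * o.theta i.rev : K) * h3 + (sgn (o.par i) * sgn (o.par i) : K) * h +
    (sgn (o.par i) : K) * h2

theorem coef_rev (i : Fin o.N) : o.coef i.rev = sgn (o.par i) * (o.coef i)⁻¹ := by
  rw [eq_mul_inv_iff_mul_eq₀ (o.coef_ne_zero i), mul_comm, coef_mul_rev]

end OspAffine.OspDatum

namespace OspAffine.OspDatum

variable (o : OspDatum)

/-! ### Reachability of indices along the generators -/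

/-- `S` is closed under the maps `p ↦ r`, `r' ↦ p'` of the index pair of the `i`-th generator,
along which `f_i` moves basis vectors. -/
def ClosedDown (S : Fin o.N → Prop) (i : ℕ) : Prop :=
  (S (o.tgt i) → S (o.src i)) ∧ (S (o.src i).rev → S (o.tgt i).rev)

/-- `S` is closed under the maps `r ↦ p`, `p' ↦ r'`, along which `e_i` moves basis vectors. -/
def ClosedUp (S : Fin o.N → Prop) (i : ℕ) : Prop :=
  (S (o.src i) → S (o.tgt i)) ∧ (S (o.tgt i).rev → S (o.src i).rev)

/-- The first index. -/
def fst : Fin o.N := ⟨0, lt_trans Nat.zero_lt_two o.two_lt⟩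

/-- Every index except the first is hit from an earlier one: position n ≤ s by the first move of
generator n, a later position by the mirrored move of the generator attached to its mirror image.
Strong induction on the position concludes. -/
theorem all_of_closedDown {S : Fin o.N → Prop} (h : ∀ i, 0 < i → i ≤ o.s → o.ClosedDown S i)
    (h0 : S o.fst) (c : Fin o.N) : S c := by
  have hN := o.two_lt
  have h1 := o.two_s_le
  have h2 := o.le_two_s_add_one
  have key : ∀ (n : ℕ) (c : Fin o.N), (c : ℕ) = n → S c := by
    intro n
    induction n using Nat.strong_induction_on with
    | _ n ih =>
    intro c hc
    rcases Nat.eq_zero_or_pos n with rfl | hn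
    · rwa [show c = o.fst from Fin.ext hc]
    · rcases le_or_gt n o.s with hs | hs
      · have hcl := (h n hn hs).1
        have e : ∀ t : Fin o.N, (t : ℕ) = n → t = c := fun t ht => Fin.ext (by omega)
        rcases o.pair_cases hs with hh | hh | hh | hh | hh | hh
        · omega
        · omega
        all_goals
          rw [e (o.src n) (by omega)] at hcl
          exact hcl (ih _ (by omega) _ rfl)
      · have hv : (c.rev : ℕ) = o.N - (n + 1) := by rw [Fin.val_rev, hc]
        have hi : c.rev + 1 ≤ o.s := by omega
        have hcl := (h (c.rev + 1) (by omega) hi).2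
        rcases o.pair_cases hi with hh | hh | hh | hh | hh | hh
        · omega
        · omega
        · have e : (o.tgt (c.rev + 1)).rev = c := by
            rw [Fin.rev_eq_iff]
            exact Fin.ext (by omega)
          rw [e] at hcl
          exact hcl (ih _ (by rw [Fin.val_rev]; omega) _ rfl)
        · have e : (o.tgt (c.rev + 1)).rev = c := by
            rw [Fin.rev_eq_iff]
            exact Fin.ext (by omega)
          rw [e] at hcl
          exact hcl (ih _ (by rw [Fin.val_rev]; omega) _ rfl)
        · omega
        · omega
  exact key c c rfl

theorem all_of_closedUp {S : Fin o.N → Prop} (h : ∀ i, 0 < i → i ≤ o.s → o.ClosedUp S i)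
    (h0 : S o.fst.rev) (c : Fin o.N) : S c := by
  have := o.all_of_closedDown (S := fun c => S c.rev)
    (fun i hi his => ⟨(h i hi his).2, by simpa using (h i hi his).1⟩) h0 c.rev
  simpa using this

/-- From any position short of `t` some generator moves strictly to the right without passing `t`.
The longest jump near the middle goes from s - 1 to s + 1 at a forked end, which is why `t` is
required to be at least s + 1. -/
theorem chain_of_closedDown {S : Fin o.N → Prop} (h : ∀ i, 0 < i → i ≤ o.s → o.ClosedDown S i)
    {t : Fin o.N} (ht : o.s + 1 ≤ t) {c : Fin o.N} (hct : c ≤ t) (hc : S c) : S t := by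
  have hN := o.two_lt
  have h1 := o.two_s_le
  have h2 := o.le_two_s_add_one
  have key : ∀ (n : ℕ) (c : Fin o.N), c ≤ t → (t : ℕ) - c = n → S c → S t := by
    intro n
    induction n using Nat.strong_induction_on with
    | _ n ih =>
    intro c hct hn hc
    rw [Fin.le_def] at hct
    rcases Nat.eq_zero_or_pos n with rfl | hn0
    · rwa [show t = c from Fin.ext (by omega)]
    · have step : ∀ d : Fin o.N, (c : ℕ) < d → d ≤ t → S d → S t := fun d h3 h4 h5 =>
        ih (t - d) (by rw [Fin.le_def] at h4; omega) d h4 rfl h5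
      rcases le_or_gt (c + 1 : ℕ) o.s with hs | hs
      · have hcl := h (c + 1) (by omega) hs
        rcases o.pair_cases hs with hh | hh | hh | hh | hh | hh
        · omega
        · omega
        · refine step _ (by omega) (by rw [Fin.le_def]; omega) (hcl.1 ?_)
          rwa [show o.tgt (c + 1) = c from Fin.ext (by omega)]
        · refine step _ (by omega) (by rw [Fin.le_def]; omega) (hcl.1 ?_)
          rwa [show o.tgt (c + 1) = c from Fin.ext (by omega)]
        · refine step _ ?_ ?_ (hcl.2 ?_)
          · rw [Fin.val_rev]
            omega
          · rw [Fin.le_def, Fin.val_rev]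
            omega
          · rwa [show (o.src (c + 1)).rev = c from Fin.ext (by rw [Fin.val_rev]; omega)]
        · refine step _ (by omega) (by rw [Fin.le_def]; omega) (hcl.1 ?_)
          rwa [show o.tgt (c + 1) = c from Fin.ext (by omega)]
      · have hv : (c.rev : ℕ) = o.N - (c + 1) := Fin.val_rev c
        have ht' := t.2
        have hi : (c.rev : ℕ) ≤ o.s := by omega
        have hcl := (h c.rev (by omega) hi).2
        have e : ∀ x : Fin o.N, (x : ℕ) = c.rev → x.rev = c := fun x hx => by
          rw [Fin.rev_eq_iff]
          exact Fin.ext hx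
        rcases o.pair_cases hi with hh | hh | hh | hh | hh | hh
        · omega
        · omega
        · refine step _ ?_ ?_ (hcl ?_)
          · rw [Fin.val_rev]
            omega
          · rw [Fin.le_def, Fin.val_rev]
            omega
          · rwa [e _ (by omega)]
        · refine step _ ?_ ?_ (hcl ?_)
          · rw [Fin.val_rev]
            omega
          · rw [Fin.le_def, Fin.val_rev]
            omega
          · rwa [e _ (by omega)]
        · omega
        · omega
  exact key _ c hct rfl hc

/-- Under the lowering operators of the affine algebra every basis vector reaches all others,
except in the case of `so(4)`, where half of them do. -/
theorem all_of_closedDown_affine {S : Fin o.N → Prop} (h : ∀ i ≤ o.s, o.ClosedDown S i)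
    {c : Fin o.N} (hc : S c)
    (hso : (o.N = 4 ∧ o.par o.fst = 0 ∧ o.par (o.src 2) = 0) → Even (c : ℕ)) : ∀ d, S d := by
  have hN := o.two_lt
  have h1 := o.two_s_le
  have h2 := o.le_two_s_add_one
  have hs := o.one_le_s
  have h' : ∀ i, 0 < i → i ≤ o.s → o.ClosedDown S i := fun i _ hi => h i hi
  refine o.all_of_closedDown h' ?_
  have hl : (o.fst.rev : ℕ) = o.N - 1 := Fin.val_rev _
  have hlast : S o.fst.rev := by
    by_cases hl2 : c = o.fst.rev
    · rwa [← hl2]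
    · by_cases hN3 : o.N = 3 ∧ (c : ℕ) = 1
      · have hcl := (h' 1 one_pos hs).2
        rcases o.pair_cases hs with hh | hh | hh | hh | hh | hh
        any_goals omega
        rw [show (o.src 1).rev = c from Fin.ext (by rw [Fin.val_rev]; omega),
          show (o.tgt 1).rev = o.fst.rev from Fin.ext (by rw [Fin.val_rev]; omega)] at hcl
        exact hcl hc
      · exact o.chain_of_closedDown h' (by omega) (by rw [Fin.le_def]; omega) hc
  have hcl0 := h 0 (Nat.zero_le _)
  rcases o.pair_cases (Nat.zero_le o.s) with ⟨-, hpar, hr, hp⟩ | ⟨-, hpar, hr, hp⟩ | hh | hh | hh | hh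
  any_goals omega
  · have e1 : o.src 0 = o.fst := Fin.ext hr
    unfold ClosedDown at hcl0
    rw [e1] at hcl0 hpar
    refine hcl0.1 ?_
    -- The mirrored move of f_0 carries the last position to position 1. It remains to climb from
    -- there to N - 2, from which f_0 reaches the first vector.
    have hS1 := hcl0.2 hlast
    have hv1 : ((o.tgt 0).rev : ℕ) = 1 := by rw [Fin.val_rev]; omega
    by_cases hN3 : o.N = 3
    · rwa [show o.tgt 0 = (o.tgt 0).rev from Fin.ext (by omega)]
    -- Now N - 2 = s is too small for the chain lemma. For an even last node the parity hypothesis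
    -- places `c` at 0 or 2, from which position 2 is reached at once; for the odd last node f_2
    -- moves position 1 to position 2.
    · by_cases hN4 : o.N = 4
      · have hs2 : o.s = 2 := by omega
        have hcl2 := h 2 (by omega)
        rcases o.pair_cases (i := 2) (by omega) with hh | hh | hh | hh | hh | hh
        any_goals omega
        · have hev := hso ⟨hN4, hpar, hh.2.2.2.1⟩
          rw [Nat.even_iff] at hev
          have hc4 := c.2
          have : (c : ℕ) = 0 ∨ (c : ℕ) = 2 := by omega
          rcases this with hc0 | hc2
          · have := hcl2.1
            rw [show o.tgt 2 = c from Fin.ext (by omega),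
              show o.src 2 = o.tgt 0 from Fin.ext (by omega)] at this
            exact this hc
          · rwa [show o.tgt 0 = c from Fin.ext (by omega)]
        · have := hcl2.1
          rw [show o.tgt 2 = (o.tgt 0).rev from Fin.ext (by omega),
            show o.src 2 = o.tgt 0 from Fin.ext (by omega)] at this
          exact this hS1
      · exact o.chain_of_closedDown h' (by omega) (by rw [Fin.le_def]; omega) hS1
  · have := hcl0.1
    rw [show o.src 0 = o.fst from Fin.ext hr, show o.tgt 0 = o.fst.rev from Fin.ext (by omega)] at this
    exact this hlast

/-! ### Root operators -/

/-- Square matrices over `K` indexed by the basis of `V`. -/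
abbrev Mat : Type := Matrix (Fin o.N) (Fin o.N) K

/-- The sign of the second matrix unit in `X_{ab}`. -/
def kap (a b : Fin o.N) : ℤ := sgn (o.par a * (o.par a + o.par b)) * o.theta a * o.theta b

/-- The matrix of `X_{ab}`. -/
def rootMat (a b : Fin o.N) : o.Mat :=
  Matrix.single a b (1 : K) - (o.kap a b : K) • Matrix.single b.rev a.rev (1 : K)

theorem rootMat_apply (a b d c : Fin o.N) : o.rootMat a b d c =
    (if a = d ∧ b = c then 1 else 0) - o.kap a b * if b.rev = d ∧ a.rev = c then 1 else 0 := by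
  simp [rootMat, Matrix.single_apply]

theorem kap_mul_kap (a b : Fin o.N) : o.kap a b * o.kap b a = sgn (o.par a + o.par b) := by
  have h1 := o.theta_mul_self a
  have h2 := o.theta_mul_self b
  have h3 : sgn (o.par a * (o.par a + o.par b)) * sgn (o.par b * (o.par b + o.par a)) =
      sgn (o.par a + o.par b) := by
    generalize o.par a = x
    generalize o.par b = y
    revert x y
    decide
  unfold kap
  rw [← h3]
  linear_combination (sgn (o.par a * (o.par a + o.par b)) * sgn (o.par b * (o.par b + o.par a))) *
    (o.theta b * o.theta b * h1 + h2)

theorem kap_rev (a : Fin o.N) : o.kap a a.rev = sgn (o.par a) := by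
  rw [kap, par_rev, zmod_two_self_add, mul_zero, sgn_zero, one_mul, theta_mul_rev]

theorem kap_rev' (a : Fin o.N) : o.kap a.rev a = sgn (o.par a) := by
  have := o.kap_rev a.rev
  rwa [Fin.rev_rev, par_rev] at this

theorem single_mul_single (a b c d : Fin o.N) :
    (Matrix.single a b (1 : K) * Matrix.single c d (1 : K) : o.Mat) =
      if b = c then Matrix.single a d 1 else 0 := by
  split_ifs with h
  · subst h
    simp
  · simp [h]

theorem rootMat_mul (a b c d : Fin o.N) : o.rootMat a b * o.rootMat c d =
    (if b = c then Matrix.single a d 1 else 0 : o.Mat) +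
    (o.kap a b * o.kap c d : K) • (if a = d then Matrix.single b.rev c.rev 1 else 0 : o.Mat) -
    (o.kap c d : K) • (if b = d.rev then Matrix.single a c.rev 1 else 0 : o.Mat) -
    (o.kap a b : K) • (if a.rev = c then Matrix.single b.rev d 1 else 0 : o.Mat) := by
  simp only [rootMat, sub_mul, mul_sub, smul_mul_assoc, mul_smul_comm, single_mul_single,
    Fin.rev_inj]
  module

theorem mem_weight {a b d c : Fin o.N} (h : o.rootMat a b d c ≠ 0) :
    o.eps d = o.eps c + (o.eps a - o.eps b) := by
  rw [rootMat_apply] at h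
  by_cases h1 : a = d ∧ b = c
  · rw [h1.1, h1.2]
    abel
  · by_cases h2 : b.rev = d ∧ a.rev = c
    · rw [← h2.1, ← h2.2, eps_rev, eps_rev]
      abel
    · simp [h1, h2] at h

theorem mem_parity {a b d c : Fin o.N} (h : o.rootMat a b d c ≠ 0) :
    o.par d = o.par c + (o.par a + o.par b) := by
  rw [rootMat_apply] at h
  have key : ∀ x y : ZMod 2, x = y + (x + y) ∧ y = x + (x + y) := by decide
  by_cases h1 : a = d ∧ b = c
  · rw [h1.1, h1.2]
    exact (key _ _).1
  · by_cases h2 : b.rev = d ∧ a.rev = c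
    · rw [← h2.1, ← h2.2, par_rev, par_rev]
      exact (key _ _).2
    · simp [h1, h2] at h

/-- A sign with which `X_{ba}` is conjugate to the transpose of `X_{ab}`. -/
def halfSign (c : Fin o.N) : ℤ := if c.rev < c then sgn (o.par c) else 1

theorem halfSign_mul_self (c : Fin o.N) : o.halfSign c * o.halfSign c = 1 := by
  unfold halfSign
  split_ifs
  · exact sgn_mul_self _
  · rfl

theorem halfSign_mul_rev (c : Fin o.N) : o.halfSign c * o.halfSign c.rev = sgn (o.par c) := by
  unfold halfSign
  rw [Fin.rev_rev, par_rev]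
  rcases lt_trichotomy c c.rev with h | h | h
  · rw [if_neg (not_lt.2 h.le), if_pos h, one_mul]
  · rw [o.par_eq_zero_of_rev h.symm, ← h]
    simp
  · rw [if_pos h, if_neg (not_lt.2 h.le), mul_one]

/-- The signs multiply to the parity sign on mirror pairs, which is the ratio of the signs in X_{ba}
and in the transpose of X_{ab}. Hence a diagonal sign conjugation relates the two. -/
theorem rootMat_swap_apply (a b d c : Fin o.N) : o.rootMat b a d c =
    (o.halfSign a * o.halfSign b * (o.halfSign d * o.halfSign c) : ℤ) * o.rootMat a b c d := by
  rw [rootMat_apply, rootMat_apply]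
  have ha := o.halfSign_mul_self a
  have hb := o.halfSign_mul_self b
  have ha' := o.halfSign_mul_rev a
  have hb' := o.halfSign_mul_rev b
  have hk := o.kap_mul_kap a b
  have hkk : o.kap a b * o.kap a b = 1 := by
    unfold kap
    linear_combination sgn_mul_self (o.par a * (o.par a + o.par b)) * (o.theta a * o.theta a) *
      (o.theta b * o.theta b) + o.theta_mul_self a * (o.theta b * o.theta b) + o.theta_mul_self b
  have e1 : b = d ∧ a = c ∨ ¬ (b = d ∧ a = c) := em _
  have t1 : (if b = d ∧ a = c then (1 : K) else 0) =
      (o.halfSign a * o.halfSign b * (o.halfSign d * o.halfSign c) : ℤ) *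
        if a = c ∧ b = d then 1 else 0 := by
    by_cases h : b = d ∧ a = c
    · rw [if_pos h, if_pos h.symm, ← h.1, ← h.2]
      have : o.halfSign a * o.halfSign b * (o.halfSign b * o.halfSign a) = 1 := by
        linear_combination ha * (o.halfSign b * o.halfSign b) + hb
      rw [this]
      simp
    · rw [if_neg h, if_neg (fun h' => h h'.symm), mul_zero]
  have t2 : o.kap b a * (if a.rev = d ∧ b.rev = c then (1 : K) else 0) =
      (o.halfSign a * o.halfSign b * (o.halfSign d * o.halfSign c) : ℤ) *
        (o.kap a b * if b.rev = c ∧ a.rev = d then 1 else 0) := by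
    by_cases h : a.rev = d ∧ b.rev = c
    · rw [if_pos h, if_pos h.symm, ← h.1, ← h.2]
      have : o.halfSign a * o.halfSign b * (o.halfSign a.rev * o.halfSign b.rev) =
          sgn (o.par a + o.par b) := by
        rw [sgn_add]
        linear_combination ha' * (o.halfSign b * o.halfSign b.rev) + hb' * sgn (o.par a)
      rw [this, ← hk, mul_one, mul_one, ← Int.cast_mul]
      congr 1
      linear_combination -hkk * o.kap b a
    · rw [if_neg h, if_neg (fun h' => h h'.symm), mul_zero, mul_zero, mul_zero]
  rw [t1, t2]
  ring

/-! ### The generators as matrices -/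

/-- The coefficient of `X_{pr}` in `e_i`. -/
def cE (a : K) (i : ℕ) : K :=
  if i = 0 then (if o.par (o.ix 1) = 1 then a / 2 else a)
  else if i < o.s ∨ Odd o.m then 1
  else if o.par (o.ix o.s) = 0 then 1 else 1 / 2

/-- The coefficient of `X_{rp}` in `f_i`. -/
def cF (b : K) (i : ℕ) : K :=
  if i = 0 then (if o.par (o.ix 1) = 1 then b / 2 else b)
  else if i < o.s ∨ Odd o.m then (sgn (o.par (o.ix i)) : K)
  else if o.par (o.ix o.s) = 0 then (sgn (o.par (o.ix (o.s - 1))) : K)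
  else (q + q⁻¹) / 2 * -1

/-- The matrix of `e_i` for the spectral parameter `1`. -/
def eMat (a : K) (i : ℕ) : o.Mat := o.cE a i • o.rootMat (o.tgt i) (o.src i)

/-- The matrix of `f_i` for the spectral parameter `1`. -/
def fMat (b : K) (i : ℕ) : o.Mat := o.cF b i • o.rootMat (o.src i) (o.tgt i)

/-- The diagonal matrix `q^{x/2}` for a vector `x` of exponents. -/
def qDiag (x : Fin o.N → ℤ) : o.Mat := Matrix.diagonal fun c => qHalf (x c)

theorem qDiag_mul (x y : Fin o.N → ℤ) : o.qDiag x * o.qDiag y = o.qDiag (x + y) := by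
  simp [qDiag, Matrix.diagonal_mul_diagonal, qHalf_add]

theorem qDiag_zero : o.qDiag 0 = 1 := by
  simp [qDiag, qHalf_zero]

/-- For r = p' the operator X_{pp'} is twice a matrix unit, so both coefficients carry a factor 1/2
and the quantum integer q + q⁻¹ appears; otherwise they multiply to a sign. -/
theorem cE_mul_cF {a b : K} (hab : a * b = o.abValue) {i : ℕ} (hi : i ≤ o.s) :
    o.cE a i * o.cF b i =
      sgn (o.par (o.tgt i)) * if o.src i = (o.tgt i).rev then (q + q⁻¹) / 4 else 1 := by
  have hN := o.two_lt
  have h1 := o.two_s_le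
  have hs := o.one_le_s
  have hpr := o.par_tgt_of_src_eq hi
  have hne := o.tgt_ne_src hi
  revert hpr hne
  unfold cE cF tgt src
  by_cases h0 : i = 0
  · simp only [if_pos h0]
    rw [abValue] at hab
    rcases zmod_two_cases (o.par (o.ix 1)) with h | h
    · rw [if_neg (by simp [h])] at hab
      simp only [h, if_true, zero_ne_one, if_false, Fin.rev_rev, par_rev]
      intro hpr _
      rw [if_neg, hab, mul_one]
      intro e
      have e' := congrArg Fin.val e
      rw [val_ix, val_ix] at e' <;> omega
    · rw [if_pos h] at hab
      simp only [h, if_true, one_ne_zero, if_false, Fin.rev_rev, par_rev, sgn_one]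
      intro _ _
      linear_combination hab / 4
  · simp only [if_neg h0]
    by_cases h2 : i < o.s ∨ Odd o.m
    · simp only [if_pos h2]
      intro hpr hne
      rw [if_neg, one_mul, mul_one]
      intro e
      have h3 : o.N = 2 * o.s + 1 ∨ i < o.s := by
        rcases h2 with h | h
        · exact Or.inr h
        · rw [odd_m_iff, Nat.odd_iff] at h
          have := o.le_two_s_add_one
          omega
      have e' := congrArg Fin.val e
      rw [Fin.val_rev, val_ix, val_ix] at e' <;> omega
    · have hNs := o.even_N_of h2
      simp only [if_neg h2]
      rcases zmod_two_cases (o.par (o.ix o.s)) with h | h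
      · simp only [h, if_true]
        intro hpr hne
        rw [if_neg, one_mul, mul_one]
        intro e
        have e' := congrArg Fin.val e
        rw [Fin.val_rev, val_ix, val_ix] at e' <;> omega
      · simp only [h, one_ne_zero, if_false, sgn_one]
        intro hpr hne
        rw [if_pos (o.ix_succ_s hNs)]
        push_cast
        ring

/-- The supercommutator of `X_{pr}` and `X_{rp}`. -/
theorem rootMat_bracket_self {p r : Fin o.N} (hne : p ≠ r)
    (hpar : r = p.rev → o.par p = 1) :
    o.rootMat p r * o.rootMat r p -
        (sgn (o.par p + o.par r) : K) • (o.rootMat r p * o.rootMat p r) =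
      Matrix.diagonal fun c => (((if r = p.rev then 2 else 1) * (sgn (o.par p) *
        (sgn (o.par p) * o.xDiag p c - sgn (o.par r) * o.xDiag r c)) : ℤ) : K) := by
  have hkk : (o.kap p r * o.kap r p : K) = sgn (o.par p + o.par r) := by
    exact_mod_cast congrArg (Int.cast : ℤ → K) (o.kap_mul_kap p r)
  have hkk' : (o.kap r p * o.kap p r : K) = sgn (o.par p + o.par r) := by rw [mul_comm, hkk]
  have hss := sgn_cast_mul_self (o.par p + o.par r)
  have hdiag : ∀ x : Fin o.N, (Matrix.single x x 1 : o.Mat) =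
      Matrix.diagonal (fun c => if c = x then (1 : K) else 0) := by
    intro x
    rw [← Matrix.diagonal_single]
    congr 1
    funext c
    exact Pi.single_apply x (1 : K) c
  rw [rootMat_mul, rootMat_mul, hkk, hkk']
  by_cases h : r = p.rev
  · subst h
    have hp := hpar rfl
    have e1 : o.kap p p.rev = -1 := by rw [kap_rev, hp, sgn_one]
    have e2 : o.kap p.rev p = -1 := by rw [kap_rev', hp, sgn_one]
    simp only [Fin.rev_rev, if_true, par_rev, hp, e1, e2, zmod_two_self_add, sgn_zero, sgn_one,
      hdiag]
    ext x y
    by_cases hxy : x = y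
    · subst hxy
      simp only [Matrix.sub_apply, Matrix.add_apply, Matrix.smul_apply, Matrix.diagonal_apply_eq,
        xDiag, smul_eq_mul, Fin.rev_rev]
      push_cast
      ring
    · simp [Matrix.diagonal_apply_ne _ hxy]
  · have h' : ¬ p.rev = r := fun e => h e.symm
    have h'' : ¬ p = r.rev := fun e => h (by rw [e, Fin.rev_rev])
    have h3 : ¬ r.rev = p := fun e => h (by rw [← e, Fin.rev_rev])
    simp only [if_true, if_neg h, if_neg h', if_neg h'', if_neg h3, hdiag, smul_zero, sub_zero]
    ext x y
    by_cases hxy : x = y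
    · subst hxy
      simp only [Matrix.sub_apply, Matrix.add_apply, Matrix.smul_apply, Matrix.diagonal_apply_eq,
        xDiag, smul_eq_mul]
      rw [sgn_add] at hss ⊢
      push_cast at hss ⊢
      have hpp := sgn_cast_mul_self (o.par p)
      linear_combination (-(if x = p.rev then 1 else 0 : K)) * hss +
        ((if x = p.rev then 1 else 0 : K) - (if x = p then 1 else 0)) * hpp
    · simp [Matrix.diagonal_apply_ne _ hxy]

/-- The supports {p, p'} and {r, r'} are disjoint unless r = p'. Eigenvalues in {0, 1, -1} are
exactly those which equal their own quantum numbers. -/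
theorem hDiag_mem {i : ℕ} (hi : i ≤ o.s) (h : o.src i ≠ (o.tgt i).rev) (c : Fin o.N) :
    o.hDiag i c = 0 ∨ o.hDiag i c = 1 ∨ o.hDiag i c = -1 := by
  have hne := o.tgt_ne_src hi
  rw [hDiag_eq]
  generalize o.tgt i = p at *
  generalize o.src i = r at *
  have h1 : c = p ∨ c = p.rev → o.xDiag r c = 0 := by
    have h4 : p ≠ r.rev := fun e => h (by rw [e, Fin.rev_rev])
    rintro (rfl | rfl)
    · rw [xDiag, if_neg hne, if_neg h4, sub_zero]
    · rw [xDiag, if_neg h.symm, if_neg (fun e => hne (Fin.rev_inj.1 e)), sub_zero]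
  have h2 : ¬ (c = p ∨ c = p.rev) → o.xDiag p c = 0 := by
    intro hc
    rw [not_or] at hc
    rw [xDiag, if_neg hc.1, if_neg hc.2, sub_zero]
  have h3 : ∀ x : Fin o.N, o.xDiag x c = 0 ∨ o.xDiag x c = 1 ∨ o.xDiag x c = -1 := by
    intro x
    unfold xDiag
    split_ifs <;> simp
  have h5 : ∀ x : ZMod 2, sgn x = 1 ∨ sgn x = -1 := by decide
  by_cases hc : c = p ∨ c = p.rev
  · rw [h1 hc]
    rcases h3 p with h | h | h <;> rcases h5 (o.par p) with h' | h' <;> rw [h, h'] <;> simp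
  · rw [h2 hc]
    rcases h3 r with h | h | h <;> rcases h5 (o.par r) with h' | h' <;> rw [h, h'] <;> simp

theorem q_eq : q = qHalf 1 * qHalf 1 := by rw [← qHalf_add]; rfl

/-- The supercommutator is the classical diagonal element. Its eigenvalues are 0 and ±1, where (q^x
- q^{-x})/(q - q⁻¹) = x, except for a long root with eigenvalues 0 and ±2, where the factor q + q⁻¹
in f_i corrects the value. -/
theorem e_f_self {a b : K} (hab : a * b = o.abValue) {i : ℕ} (hi : i ≤ o.s) :
    o.eMat a i * o.fMat b i - (sgn (o.genPar i * o.genPar i) : K) • (o.fMat b i * o.eMat a i) =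
      (q - q⁻¹)⁻¹ • (o.qDiag (o.hDiag i) ^ 2 - o.qDiag (-o.hDiag i) ^ 2) := by
  have hq := q_sub_inv_ne_zero
  have hsg : sgn (o.genPar i * o.genPar i) = sgn (o.par (o.tgt i) + o.par (o.src i)) := by
    rw [genPar_eq]
    generalize o.par (o.tgt i) + o.par (o.src i) = x
    revert x
    decide
  have e1 : o.eMat a i * o.fMat b i -
      (sgn (o.genPar i * o.genPar i) : K) • (o.fMat b i * o.eMat a i) =
      (o.cE a i * o.cF b i) • (o.rootMat (o.tgt i) (o.src i) * o.rootMat (o.src i) (o.tgt i) -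
        (sgn (o.par (o.tgt i) + o.par (o.src i)) : K) •
          (o.rootMat (o.src i) (o.tgt i) * o.rootMat (o.tgt i) (o.src i))) := by
    rw [hsg, eMat, fMat]
    simp only [smul_mul_assoc, mul_smul_comm]
    module
  rw [e1, rootMat_bracket_self o (o.tgt_ne_src hi) (o.par_tgt_of_src_eq hi),
    o.cE_mul_cF hab hi]
  simp only [← hDiag_eq]
  simp only [qDiag, Matrix.diagonal_pow]
  ext x y
  by_cases hxy : x = y
  swap
  · simp [Matrix.diagonal_apply_ne _ hxy]
  subst hxy
  simp only [Matrix.sub_apply, Matrix.smul_apply, Matrix.diagonal_apply_eq, smul_eq_mul,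
    Pi.pow_apply, Pi.neg_apply]
  rw [eq_inv_mul_iff_mul_eq₀ hq]
  have hss := sgn_cast_mul_self (o.par (o.tgt i))
  by_cases h : o.src i = (o.tgt i).rev
  · have hp := o.par_tgt_of_src_eq hi h
    rw [if_pos h, if_pos h, hp, sgn_one]
    have hh : o.hDiag i x = -2 * o.xDiag (o.tgt i) x := by
      rw [hDiag_eq, h, xDiag_rev, par_rev, hp, sgn_one]
      ring
    have hx : o.xDiag (o.tgt i) x = 0 ∨ o.xDiag (o.tgt i) x = 1 ∨ o.xDiag (o.tgt i) x = -1 := by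
      unfold xDiag
      split_ifs <;> simp
    have e2 : q = qHalf 2 := rfl
    have e3 : q⁻¹ = qHalf (-2) := by rw [qHalf_neg]; rfl
    rw [hh]
    rcases hx with h' | h' | h' <;> rw [h'] <;> norm_num [← e2, ← e3] <;> ring
  · rw [if_neg h, if_neg h]
    rcases o.hDiag_mem hi h x with h' | h' | h' <;> rw [h'] <;>
      norm_num [q_eq, qHalf_neg]
    · linear_combination (qHalf 1 * qHalf 1 - (qHalf 1)⁻¹ * (qHalf 1)⁻¹) * hss
    · linear_combination -(qHalf 1 * qHalf 1 - (qHalf 1)⁻¹ * (qHalf 1)⁻¹) * hss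

theorem src_inj {i j : ℕ} (hi : i ≤ o.s) (hj : j ≤ o.s) (h : o.src i = o.src j) : i = j := by
  have hN := o.two_lt
  have h1 := o.two_s_le
  have hs := o.one_le_s
  have h' := congrArg Fin.val h
  rcases o.pair_cases hi with c | c | c | c | c | c <;>
    rcases o.pair_cases hj with d | d | d | d | d | d <;> omega

/-- Two generators share a target only at the forked end of the diagram for even N, where the two
sources are the middle pair of even vectors. -/
theorem tgt_eq_tgt {i j : ℕ} (hi : i ≤ o.s) (hj : j ≤ o.s) (h : o.tgt i = o.tgt j) (hij : i ≠ j) :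
    o.src i = (o.src j).rev ∧ o.par (o.src i) = 0 := by
  have hN := o.two_lt
  have h1 := o.two_s_le
  have hs := o.one_le_s
  have h' := congrArg Fin.val h
  have key : (o.src i : ℕ) = (o.src j).rev →
      (o.par (o.src i) = 0 ∨ o.par (o.src j) = 0) →
      o.src i = (o.src j).rev ∧ o.par (o.src i) = 0 := by
    intro e hp
    have e' := Fin.ext e
    refine ⟨e', ?_⟩
    rcases hp with hp | hp
    · exact hp
    · rw [e', par_rev, hp]
  rw [Fin.val_rev] at key
  rcases o.pair_cases hi with c | c | c | c | c | c <;>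
    rcases o.pair_cases hj with d | d | d | d | d | d <;>
    first
    | omega
    | exact key (by omega) (Or.inl c.2.2.2.1)
    | exact key (by omega) (Or.inr d.2.2.2.1)

/-- This coincidence occurs only at the affine fork, where ε_1 is an even weight and the generator
with α = ε_1 - ε_2 meets the one with α_0 = δ - ε_1 - ε_2. -/
theorem src_eq_tgt_rev {i j : ℕ} (hi : i ≤ o.s) (hj : j ≤ o.s) (h : o.src i = (o.tgt j).rev)
    (hij : i ≠ j) : o.tgt i = o.src j ∧ o.par (o.src j) = 0 := by
  have hN := o.two_lt
  have h1 := o.two_s_le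
  have hs := o.one_le_s
  have h' := congrArg Fin.val h
  rw [Fin.val_rev] at h'
  rcases o.pair_cases hi with c | c | c | c | c | c <;>
    rcases o.pair_cases hj with d | d | d | d | d | d <;>
    first
    | omega
    | exact ⟨Fin.ext (by omega), d.2.1⟩

/-- Different generators have different sources, so among the products of matrix units in
X_{pr}X_{r'p'} only those coming from a fork of the diagram can survive. At a fork the common weight
is even, and the two surviving terms match up to the supercommutation sign. -/
theorem e_f_ne {a b : K} {i j : ℕ} (hi : i ≤ o.s) (hj : j ≤ o.s) (hij : i ≠ j) :
    o.eMat a i * o.fMat b j - (sgn (o.genPar i * o.genPar j) : K) • (o.fMat b j * o.eMat a i) =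
      0 := by
  have h1 : ¬ o.src i = o.src j := fun h => hij (o.src_inj hi hj h)
  have h1' : ¬ o.src j = o.src i := fun h => h1 h.symm
  have hp := o.tgt_ne_src hi
  have hp' := o.tgt_ne_src hj
  have h2 := o.tgt_eq_tgt hi hj (hij := hij)
  have h3 := o.src_eq_tgt_rev hi hj (hij := hij)
  have h4 := o.src_eq_tgt_rev hj hi (hij := hij.symm)
  have key : o.rootMat (o.tgt i) (o.src i) * o.rootMat (o.src j) (o.tgt j) =
      (sgn (o.genPar i * o.genPar j) : K) •
        (o.rootMat (o.src j) (o.tgt j) * o.rootMat (o.tgt i) (o.src i)) := by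
    rw [genPar_eq, genPar_eq, rootMat_mul, rootMat_mul, if_neg h1, if_neg h1']
    generalize o.tgt i = p at *
    generalize o.src i = r at *
    generalize o.tgt j = p' at *
    generalize o.src j = r' at *
    have eB : (p' = r.rev) ↔ (r = p'.rev) := 
      ⟨fun h => by rw [h, Fin.rev_rev], fun h => by rw [h, Fin.rev_rev]⟩
    have eC : (r'.rev = p) ↔ (r' = p.rev) :=
      ⟨fun h => by rw [← h, Fin.rev_rev], fun h => by rw [h, Fin.rev_rev]⟩
    simp only [eB, eC, eq_comm (a := p.rev), eq_comm (a := p') (b := p)]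
    -- The three coincidences: the finite fork here, then the affine fork in either order of the two
    -- generators. If none occurs, both products vanish.
    by_cases hA : p = p'
    · subst hA
      obtain ⟨e, hr⟩ := h2 rfl
      subst e
      rw [par_rev] at hr
      have nB : ¬ r'.rev = p.rev := fun h => hp' (Fin.rev_inj.1 h).symm
      have nC : ¬ r' = p.rev := fun h => hp (by rw [h, Fin.rev_rev])
      have hk : (o.kap p r'.rev * o.kap r' p : K) = sgn ((o.par p + 0) * (o.par p + 0)) := by
        rw [← Int.cast_mul]
        congr 1
        unfold kap
        rw [par_rev, hr, o.theta_even r' hr, o.theta_even r'.rev (by rw [par_rev, hr])]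
        have := o.theta_mul_self p
        rw [zero_mul, sgn_zero, add_zero]
        linear_combination sgn (o.par p * o.par p) * this
      rw [if_neg nB, if_neg nC, if_neg nB, if_neg nC, if_pos rfl, if_pos rfl, hk, par_rev, hr,
        Fin.rev_rev]
      simp
    · by_cases hB : r = p'.rev
      · obtain ⟨e, hr⟩ := h3 hB
        subst e hB
        have nC : ¬ p = p.rev := fun h => by
          have h5 := (h4 h).1
          apply hp
          rw [← h5]
          have := congrArg Fin.val h
          have := congrArg Fin.val h5
          rw [Fin.val_rev] at *
          apply Fin.ext
          omega
        have hk : (o.kap p p' : K) =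
            sgn ((o.par p + o.par p') * (o.par p' + o.par p)) * o.kap p p'.rev := by
          rw [← Int.cast_mul]
          congr 1
          unfold kap
          have h5 := o.theta_mul_self p'
          have h6 := o.theta_mul_rev p'
          have h7 : o.theta p'.rev = sgn (o.par p') * o.theta p' := by
            linear_combination -o.theta p'.rev * h5 + o.theta p' * h6
          rw [h7, hr, par_rev]
          have h8 : sgn ((0 + o.par p') * (o.par p' + 0)) = sgn (o.par p') := by
            generalize o.par p' = x
            revert x
            decide
          rw [h8]
          linear_combination -sgn (0 * (0 + o.par p')) * o.theta p * o.theta p' *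
            sgn_mul_self (o.par p')
        rw [if_neg hA, if_neg nC, if_neg hA, if_neg nC, if_pos rfl, hk, par_rev]
        simp
      · by_cases hC : r' = p.rev
        · obtain ⟨e, hr⟩ := h4 hC
          subst e hC
          have hk : (o.kap p p' : K) =
              sgn ((o.par p + o.par p') * (o.par p' + o.par p)) * o.kap p.rev p' := by
            rw [← Int.cast_mul]
            congr 1
            unfold kap
            have h5 := o.theta_mul_self p
            have h6 := o.theta_mul_rev p
            have h7 : o.theta p.rev = sgn (o.par p) * o.theta p := by
              linear_combination -o.theta p.rev * h5 + o.theta p * h6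
            rw [h7, hr, par_rev]
            have h8 : sgn ((o.par p + 0) * (0 + o.par p)) = sgn (o.par p) := by
              generalize o.par p = x
              revert x
              decide
            rw [h8]
            linear_combination -sgn (o.par p * (o.par p + 0)) * o.theta p * o.theta p' *
              sgn_mul_self (o.par p)
          rw [if_neg hA, if_neg hB, if_neg hA, if_neg hB, if_pos rfl, hk, par_rev]
          simp
        · simp [hA, hB, hC]
  rw [eMat, fMat, smul_mul_smul_comm, smul_mul_smul_comm, key]
  module

/-! ### Weights and parities of the generators -/

/-- The matrix of the parity operator. -/
def parMat : o.Mat := Matrix.diagonal fun c => (sgn (o.par c) : K)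

theorem qDiag_mul_apply (x : Fin o.N → ℤ) (M : o.Mat) (d c : Fin o.N) :
    (o.qDiag x * M) d c = qHalf (x d) * M d c := Matrix.diagonal_mul _ _ _ _

theorem mul_qDiag_apply (x : Fin o.N → ℤ) (M : o.Mat) (d c : Fin o.N) :
    (M * o.qDiag x) d c = M d c * qHalf (x c) := Matrix.mul_diagonal _ _ _ _

theorem q_add_inv_ne_zero : (q + q⁻¹ : K) ≠ 0 := by
  have h3 := one_add_qHalf_ne_zero (-4)
  intro h4
  apply h3
  have h5 : qHalf (-4) = q⁻¹ * q⁻¹ := by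
    rw [show (-4 : ℤ) = -(2 + 2) by norm_num, qHalf_neg, qHalf_add, mul_inv]; rfl
  rw [h5]
  linear_combination q⁻¹ * h4 - mul_inv_cancel₀ q_ne_zero

theorem cF_ne_zero {a b : K} (hab : a * b = o.abValue) {i : ℕ} (hi : i ≤ o.s) : o.cF b i ≠ 0 := by
  intro h
  have h1 := o.cE_mul_cF hab hi
  rw [h, mul_zero] at h1
  have h3 := sgn_cast_ne_zero (o.par (o.tgt i))
  split_ifs at h1
  · exact mul_ne_zero h3 (div_ne_zero q_add_inv_ne_zero (by norm_num)) h1.symm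
  · exact mul_ne_zero h3 one_ne_zero h1.symm

theorem rootMat_weight {a b d c : Fin o.N} (h : o.rootMat a b d c ≠ 0) (i : ℕ) :
    o.hDiag i d = o.hDiag i c + (o.hDiag i a - o.hDiag i b) := by
  simp only [hDiag_eq_form]
  rw [o.mem_weight h, form_add_right, form_sub_right]

theorem qDiag_mul_rootMat (i : ℕ) (η : ℤ) (a b : Fin o.N) :
    o.qDiag (η • o.hDiag i) * o.rootMat a b =
      qHalf (η * (o.hDiag i a - o.hDiag i b)) • (o.rootMat a b * o.qDiag (η • o.hDiag i)) := by
  ext d c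
  rw [qDiag_mul_apply, Matrix.smul_apply, mul_qDiag_apply]
  by_cases h : o.rootMat a b d c = 0
  · simp [h]
  · rw [Pi.smul_apply, Pi.smul_apply, o.rootMat_weight h i, smul_eq_mul, smul_eq_mul, smul_eq_mul,
      mul_add, qHalf_add]
    ring

theorem qDiag_mul_eMat (a : K) (i j : ℕ) (η : ℤ) : o.qDiag (η • o.hDiag i) * o.eMat a j =
    qHalf (η * o.cartan i j) • (o.eMat a j * o.qDiag (η • o.hDiag i)) := by
  rw [eMat, mul_smul_comm, qDiag_mul_rootMat, ← cartan_eq_hDiag, smul_mul_assoc, smul_comm]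

theorem qDiag_mul_fMat (b : K) (i j : ℕ) (η : ℤ) : o.qDiag (η • o.hDiag i) * o.fMat b j =
    qHalf (-(η * o.cartan i j)) • (o.fMat b j * o.qDiag (η • o.hDiag i)) := by
  rw [fMat, mul_smul_comm, qDiag_mul_rootMat, cartan_eq_hDiag, smul_mul_assoc, smul_comm]
  congr 3
  ring

theorem parMat_mul_rootMat (a b : Fin o.N) : o.parMat * o.rootMat a b =
    (sgn (o.par a + o.par b) : K) • (o.rootMat a b * o.parMat) := by
  ext d c
  rw [parMat, Matrix.diagonal_mul, Matrix.smul_apply, Matrix.mul_diagonal]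
  by_cases h : o.rootMat a b d c = 0
  · simp [h]
  · rw [o.mem_parity h, sgn_add]
    push_cast
    rw [smul_eq_mul]
    ring

theorem parMat_mul_eMat (a : K) (i : ℕ) : o.parMat * o.eMat a i =
    (sgn (o.genPar i) : K) • (o.eMat a i * o.parMat) := by
  rw [eMat, mul_smul_comm, parMat_mul_rootMat, genPar_eq, smul_mul_assoc, smul_comm]

theorem parMat_mul_fMat (b : K) (i : ℕ) : o.parMat * o.fMat b i =
    (sgn (o.genPar i) : K) • (o.fMat b i * o.parMat) := by
  rw [fMat, mul_smul_comm, parMat_mul_rootMat, genPar_eq, smul_mul_assoc, smul_comm,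
    add_comm (o.par (o.src i))]

theorem parMat_mul_parMat : o.parMat * o.parMat = 1 := by
  rw [parMat, Matrix.diagonal_mul_diagonal, ← Matrix.diagonal_one]
  congr 1
  funext c
  exact sgn_cast_mul_self _

theorem parMat_mul_qDiag (x : Fin o.N → ℤ) : o.parMat * o.qDiag x = o.qDiag x * o.parMat := by
  rw [parMat, qDiag, Matrix.diagonal_mul_diagonal, Matrix.diagonal_mul_diagonal]
  congr 1
  funext c
  exact mul_comm _ _

/-! ### The invariant vector of the tensor square -/

/-- Square matrices over `K` indexed by the basis of `V ⊗ V`. -/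
abbrev Mat2 : Type := Matrix (Fin o.N × Fin o.N) (Fin o.N × Fin o.N) K

/-- The invariant vector `∑ g_i v_{i'} ⊗ v_i`. -/
def omega (x : Fin o.N × Fin o.N) : K := if x.1 = x.2.rev then o.coef x.2 else 0

/-- The invariant functional. -/
def omegaDual (x : Fin o.N × Fin o.N) : K := if x.2 = x.1.rev then (o.coef x.1)⁻¹ else 0

theorem kronecker_mulVec_omega (A B : o.Mat) (d e : Fin o.N) :
    ((A ⊗ₖ B) *ᵥ o.omega) (d, e) = ∑ c, A d c.rev * B e c * o.coef c := by
  rw [Matrix.mulVec, dotProduct, Fintype.sum_prod_type_right]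
  refine Finset.sum_congr rfl fun c _ => ?_
  rw [Finset.sum_eq_single c.rev]
  · simp [omega]
  · intro x _ hx
    simp [omega, hx]
  · simp

theorem omegaDual_vecMul_kronecker (A B : o.Mat) (d e : Fin o.N) :
    (o.omegaDual ᵥ* (A ⊗ₖ B)) (d, e) = ∑ c, A c d * B c.rev e * (o.coef c)⁻¹ := by
  rw [Matrix.vecMul, dotProduct, Fintype.sum_prod_type]
  refine Finset.sum_congr rfl fun c _ => ?_
  rw [Finset.sum_eq_single c.rev]
  · simp [omegaDual, mul_comm]
  · intro x _ hx
    simp [omegaDual, hx]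
  · simp

/-- The ratio of the coefficients of ω at b' and a' is a sign times a power of q given by (2ρ, ε_a -
ε_b). The scalar `z` absorbs the difference between this power and the one coming from q^{±h/2}. -/
theorem coef_weight {a b : Fin o.N} {h : Fin o.N → ℤ} {z : K}
    (hz : z = qHalf (o.rhoEps a - o.rhoEps b - (h a - h b))) :
    qHalf (h b) * o.coef b.rev = z * o.kap a b * (sgn (o.par a * (o.par a + o.par b)) : ℤ) *
      qHalf (h a) * o.coef a.rev := by
  have h1 : sgn (o.par b) * o.theta b.rev = o.kap a b *
      sgn (o.par a * (o.par a + o.par b)) * (sgn (o.par a) * o.theta a.rev) := by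
    unfold kap
    have h2 := o.theta_mul_self b.rev
    have h3 := sgn_mul_self (o.par a * (o.par a + o.par b))
    have h4 := sgn_mul_self (o.par a)
    linear_combination -o.theta b.rev * o.theta_mul_rev b + o.theta b * h2 -
      o.theta b * sgn (o.par a) * o.theta_mul_rev a * sgn (o.par a * (o.par a + o.par b)) ^ 2 -
      o.theta b * sgn (o.par a * (o.par a + o.par b)) ^ 2 * h4 - o.theta b * h3
  have h1' := congrArg (Int.cast : ℤ → K) h1
  push_cast at h1'
  have hRa := mul_inv_cancel₀ (qHalf_ne_zero (o.rhoEps a))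
  have hHa := mul_inv_cancel₀ (qHalf_ne_zero (h a))
  rw [hz, coef, coef, par_rev, par_rev, rhoEps_rev, rhoEps_rev, sub_sub_eq_add_sub, qHalf_sub,
    qHalf_add, qHalf_sub, qHalf_neg, qHalf_neg]
  linear_combination qHalf (h b) * (qHalf (o.rhoEps b))⁻¹ * h1' -
    (qHalf (o.rhoEps b))⁻¹ * qHalf (h b) * o.kap a b * sgn (o.par a * (o.par a + o.par b)) *
      sgn (o.par a) * o.theta a.rev * (hRa * (qHalf (h a) * (qHalf (h a))⁻¹) + hHa)

theorem kap_mul_kap_rev (a b : Fin o.N) : o.kap a b * o.kap b.rev a.rev = 1 := by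
  have h1 := o.theta_mul_rev a
  have h2 := o.theta_mul_rev b
  have h3 : sgn (o.par a * (o.par a + o.par b)) * sgn (o.par b * (o.par b + o.par a)) *
      (sgn (o.par a) * sgn (o.par b)) = 1 := by
    generalize o.par a = x
    generalize o.par b = y
    revert x y
    decide
  unfold kap
  rw [par_rev, par_rev]
  linear_combination h3 + sgn (o.par a * (o.par a + o.par b)) *
    sgn (o.par b * (o.par b + o.par a)) * (o.theta b * o.theta b.rev * h1 + sgn (o.par a) * h2)

theorem kap_mul_kap_self (a b : Fin o.N) : o.kap a b * o.kap a b = 1 := by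
  unfold kap
  linear_combination sgn_mul_self (o.par a * (o.par a + o.par b)) * (o.theta a * o.theta a) *
      (o.theta b * o.theta b) + o.theta_mul_self a * (o.theta b * o.theta b) + o.theta_mul_self b

theorem coef_inv (a : Fin o.N) : (o.coef a)⁻¹ = sgn (o.par a) * o.coef a.rev := by
  rw [coef_rev, ← mul_assoc, sgn_cast_mul_self, one_mul]

theorem coef_inv_weight {a b : Fin o.N} {h : Fin o.N → ℤ} {z : K}
    (hz : z = qHalf (h a - h b - (o.rhoEps a - o.rhoEps b))) :
    qHalf (h a) * (o.coef a)⁻¹ = z * o.kap a b * (sgn (o.par b * (o.par a + o.par b)) : ℤ) *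
      qHalf (h b) * (o.coef b)⁻¹ := by
  have h1 := o.coef_weight (a := a) (b := b) (h := h) rfl
  have hz' : z * qHalf (o.rhoEps a - o.rhoEps b - (h a - h b)) = 1 := by
    rw [hz, ← qHalf_add, ← qHalf_zero]
    congr 1
    ring
  have h2 : (sgn (o.par b * (o.par a + o.par b)) * sgn (o.par a * (o.par a + o.par b)) *
      sgn (o.par b) : K) = sgn (o.par a) := by
    rw [← Int.cast_mul, ← Int.cast_mul]
    congr 1
    generalize o.par a = x
    generalize o.par b = y
    revert x y
    decide
  have h3 : (o.kap a b * o.kap a b : K) = 1 := by exact_mod_cast o.kap_mul_kap_self a b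
  rw [coef_inv, coef_inv]
  generalize qHalf (o.rhoEps a - o.rhoEps b - (h a - h b)) = w at *
  generalize (sgn (o.par b * (o.par a + o.par b)) : K) = x at *
  generalize (sgn (o.par a * (o.par a + o.par b)) : K) = y at *
  generalize (o.kap a b : K) = k at *
  linear_combination -z * k * x * sgn (o.par b) * h1 - qHalf (h a) * o.coef a.rev * (h2 +
    x * y * sgn (o.par b) * (hz' * (k * k) + h3))

theorem parMat_pow (g : ZMod 2) :
    o.parMat ^ g.val = Matrix.diagonal fun c => (sgn (o.par c * g) : K) := by
  rcases zmod_two_cases g with rfl | rfl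
  · simp
  · simp [parMat, ZMod.val_one]

/-- Both summands send ω into the span of v_a ⊗ v_{b'} and v_{b'} ⊗ v_a. Comparing the two
coefficients gives `coef_weight` for (a, b) and for (b', a'), which require the same `z`. For a
simple root z = 1, and for α_0 it is the crossing parameter: this is where q^{-m+n+2} comes from. -/
theorem pair_mulVec_omega {a b : Fin o.N} {h : Fin o.N → ℤ} (hh : ∀ c, h c.rev = -h c) {z : K}
    (hz : z = qHalf (o.rhoEps a - o.rhoEps b - (h a - h b))) :
    (o.rootMat a b ⊗ₖ o.qDiag (-h)) *ᵥ o.omega + z • (((o.qDiag h *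
      o.parMat ^ (o.par a + o.par b).val) ⊗ₖ o.rootMat a b) *ᵥ o.omega) = 0 := by
  funext ⟨d, e⟩
  rw [Pi.add_apply, Pi.smul_apply, kronecker_mulVec_omega, kronecker_mulVec_omega]
  rw [Finset.sum_eq_single e, Finset.sum_eq_single d.rev]
  · simp only [qDiag, parMat_pow, Matrix.diagonal_mul_diagonal, Matrix.diagonal_apply_eq,
      Fin.rev_rev, Pi.neg_apply, rootMat_apply, Pi.zero_apply, smul_eq_mul]
    have c1 : (a = d ∧ b = e.rev) ↔ (d = a ∧ e = b.rev) := by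
      rw [eq_comm (a := a), eq_comm (a := b), Fin.rev_eq_iff]
    have c2 : (b.rev = d ∧ a.rev = e.rev) ↔ (d = b.rev ∧ e = a) := by
      rw [eq_comm (a := b.rev), Fin.rev_inj, eq_comm (a := a)]
    have c3 : (a = e ∧ b = d.rev) ↔ (d = b.rev ∧ e = a) := by
      rw [eq_comm (a := a), eq_comm (a := b), Fin.rev_eq_iff, and_comm]
    have c4 : (b.rev = e ∧ a.rev = d.rev) ↔ (d = a ∧ e = b.rev) := by
      rw [eq_comm (a := b.rev), Fin.rev_inj, eq_comm (a := a), and_comm]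
    simp only [c1, c2, c3, c4]
    -- `t1` is the coefficient at v_a ⊗ v_{b'}, `t2` the one at v_{b'} ⊗ v_a.
    have t1 : (if d = a ∧ e = b.rev then (1 : K) else 0) * (qHalf (-h e) * o.coef e -
        z * o.kap a b * qHalf (h d) * sgn (o.par d * (o.par a + o.par b)) * o.coef d.rev) = 0 := by
      split_ifs with hc
      · rw [hc.1, hc.2, hh, neg_neg]
        linear_combination o.coef_weight hz
      · rw [zero_mul]
    have t2 : (if d = b.rev ∧ e = a then (1 : K) else 0) * (-o.kap a b * qHalf (-h e) * o.coef e +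
        z * qHalf (h d) * sgn (o.par d * (o.par a + o.par b)) * o.coef d.rev) = 0 := by
      split_ifs with hc
      · have hw := o.coef_weight (a := b.rev) (b := a.rev) (h := h) (z := z)
          (by rw [hz, rhoEps_rev, rhoEps_rev, hh, hh]; congr 1; ring)
        have hk : (o.kap a b * o.kap b.rev a.rev : K) = 1 := by
          exact_mod_cast o.kap_mul_kap_rev a b
        rw [Fin.rev_rev, Fin.rev_rev, hh, par_rev, par_rev, add_comm (o.par b)] at hw
        rw [hc.1, hc.2, Fin.rev_rev, par_rev]
        linear_combination -o.kap a b * hw -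
          z * qHalf (h b.rev) * sgn (o.par b * (o.par a + o.par b)) * o.coef b * hk
      · rw [zero_mul]
    linear_combination t1 + t2
  · intro c _ hc
    simp only [qDiag, parMat_pow, Matrix.diagonal_mul_diagonal]
    rw [Matrix.diagonal_apply_ne, zero_mul, zero_mul]
    exact fun h => hc (by rw [h, Fin.rev_rev])
  · simp
  · intro c _ hc
    simp only [qDiag]
    rw [Matrix.diagonal_apply_ne _ hc.symm, mul_zero, zero_mul]
  · simp

/-- The coefficients of the dual vector are the inverses of those of ω, so the same computation
holds with the inverse scalar. -/
theorem pair_vecMul_omegaDual {a b : Fin o.N} {h : Fin o.N → ℤ} (hh : ∀ c, h c.rev = -h c) {z : K}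
    (hz : z = qHalf (h a - h b - (o.rhoEps a - o.rhoEps b))) :
    o.omegaDual ᵥ* (o.rootMat a b ⊗ₖ o.qDiag (-h)) + z • (o.omegaDual ᵥ* ((o.qDiag h *
      o.parMat ^ (o.par a + o.par b).val) ⊗ₖ o.rootMat a b)) = 0 := by
  funext ⟨d, e⟩
  rw [Pi.add_apply, Pi.smul_apply, omegaDual_vecMul_kronecker, omegaDual_vecMul_kronecker]
  rw [Finset.sum_eq_single e.rev, Finset.sum_eq_single d]
  · simp only [qDiag, parMat_pow, Matrix.diagonal_mul_diagonal, Matrix.diagonal_apply_eq,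
      Fin.rev_rev, Pi.neg_apply, rootMat_apply, Pi.zero_apply, smul_eq_mul]
    have c1 : (a = e.rev ∧ b = d) ↔ (d = b ∧ e = a.rev) := by
      rw [eq_comm (a := a), eq_comm (a := b), Fin.rev_eq_iff, and_comm]
    have c2 : (b.rev = e.rev ∧ a.rev = d) ↔ (d = a.rev ∧ e = b) := by
      rw [eq_comm (a := a.rev), Fin.rev_inj, eq_comm (a := b), and_comm]
    have c3 : (a = d.rev ∧ b = e) ↔ (d = a.rev ∧ e = b) := by
      rw [eq_comm (a := a), eq_comm (a := b), Fin.rev_eq_iff]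
    have c4 : (b.rev = d.rev ∧ a.rev = e) ↔ (d = b ∧ e = a.rev) := by
      rw [eq_comm (a := a.rev), Fin.rev_inj, eq_comm (a := b)]
    simp only [c1, c2, c3, c4]
    have t1 : (if d = b ∧ e = a.rev then (1 : K) else 0) * (qHalf (-h e) * (o.coef e.rev)⁻¹ -
        z * o.kap a b * qHalf (h d) * sgn (o.par d * (o.par a + o.par b)) * (o.coef d)⁻¹) = 0 := by
      split_ifs with hc
      · rw [hc.1, hc.2, hh, neg_neg, Fin.rev_rev]
        linear_combination o.coef_inv_weight hz
      · rw [zero_mul]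
    have t2 : (if d = a.rev ∧ e = b then (1 : K) else 0) * (-o.kap a b * qHalf (-h e) *
        (o.coef e.rev)⁻¹ +
        z * qHalf (h d) * sgn (o.par d * (o.par a + o.par b)) * (o.coef d)⁻¹) = 0 := by
      split_ifs with hc
      · have hw := o.coef_inv_weight (a := b.rev) (b := a.rev) (h := h) (z := z)
          (by rw [hz, rhoEps_rev, rhoEps_rev, hh, hh]; congr 1; ring)
        have hk : (o.kap a b * o.kap b.rev a.rev : K) = 1 := by
          exact_mod_cast o.kap_mul_kap_rev a b
        rw [hh b, par_rev, par_rev, add_comm (o.par b)] at hw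
        rw [hc.1, hc.2, par_rev]
        linear_combination -o.kap a b * hw -
          z * qHalf (h a.rev) * sgn (o.par a * (o.par a + o.par b)) * (o.coef a.rev)⁻¹ * hk
      · rw [zero_mul]
    linear_combination t1 + t2
  · intro c _ hc
    simp only [qDiag, parMat_pow, Matrix.diagonal_mul_diagonal]
    rw [Matrix.diagonal_apply_ne _ hc, zero_mul, zero_mul]
  · simp
  · intro c _ hc
    simp only [qDiag]
    rw [Matrix.diagonal_apply_ne, mul_zero, zero_mul]
    exact fun h => hc (by rw [← h, Fin.rev_rev])
  · simp

open SkewWords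

/-! ### The Serre relations in the vector representation -/

/-- The bicharacter of the Hopf pairing. -/
def chi (i j : Fin (o.s + 1)) : K := o.braid i j

theorem chi_comm (i j : Fin (o.s + 1)) : o.chi i j = o.chi j i := o.braid_comm i j

theorem wordPairing_eq (y w : List (Fin (o.s + 1))) : o.wordPairing y w = wpair o.chi y w := by
  have key : ∀ (i : Fin (o.s + 1)) (φ : List (Fin (o.s + 1)) → K) (w : List (Fin (o.s + 1))),
      (∑ k : Fin w.length, if w.get k = i then
        ((w.take k).map fun j : Fin (o.s + 1) => o.braid i j).prod * φ (w.eraseIdx k) else 0) =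
      skewDer o.chi i φ w := by
    intro i φ w
    induction w generalizing φ with
    | nil => simp [skewDer]
    | cons j w ih =>
      rw [skewDer, ← ih]
      simp only [List.length_cons]
      rw [Fin.sum_univ_succ]
      simp [chi, Finset.mul_sum, mul_assoc, mul_ite]
  induction y generalizing w with
  | nil => rw [wordPairing, wpair]
  | cons i y ih =>
    rw [wordPairing, wpair, ← key]
    simp only [ih, List.bind_eq_flatMap, List.pure_def, ← List.map_eq_flatMap, List.map_map]
    rfl

theorem isSerre_iff (x : List (Fin (o.s + 1)) →₀ K) : o.IsSerre x ↔ IsRad o.chi x := by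
  unfold IsSerre IsRad
  simp only [wordPairing_eq]

/-- A product of root vectors. -/
def eWord (a : K) (w : List (Fin (o.s + 1))) : o.Mat := (w.map fun i : Fin (o.s + 1) => o.eMat a i).prod

/-- The weight of a word as a function of the basis vectors. -/
def hSum (μ : Multiset (Fin (o.s + 1))) : Fin o.N → ℤ := (μ.map fun i : Fin (o.s + 1) => o.hDiag i).sum

/-- The weight of a word. -/
def rootSum (μ : Multiset (Fin (o.s + 1))) : Fin o.s → ℤ :=
  (μ.map fun i : Fin (o.s + 1) => o.simpleRoot i).sum

/-- The parity of a word, as a natural number. -/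
def valSum (μ : Multiset (Fin (o.s + 1))) : ℕ :=
  (μ.map fun i : Fin (o.s + 1) => (o.genPar i).val).sum

theorem hSum_cons (i : Fin (o.s + 1)) (w : List (Fin (o.s + 1))) :
    o.hSum ((i :: w : List _) : Multiset (Fin (o.s + 1))) = o.hDiag i + o.hSum w := by
  rw [hSum, hSum, ← Multiset.cons_coe, Multiset.map_cons, Multiset.sum_cons]

theorem rootSum_cons (i : Fin (o.s + 1)) (w : List (Fin (o.s + 1))) :
    o.rootSum ((i :: w : List _) : Multiset (Fin (o.s + 1))) = o.simpleRoot i + o.rootSum w := by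
  rw [rootSum, rootSum, ← Multiset.cons_coe, Multiset.map_cons, Multiset.sum_cons]

theorem valSum_cons (i : Fin (o.s + 1)) (w : List (Fin (o.s + 1))) :
    o.valSum ((i :: w : List _) : Multiset (Fin (o.s + 1))) = (o.genPar i).val + o.valSum w := by
  rw [valSum, valSum, ← Multiset.cons_coe, Multiset.map_cons, Multiset.sum_cons]

/-- The factor `e_i ⊗ q^{-h_i/2}` of `Δ(e_i)`. -/
def eLeft (a : K) (i : Fin (o.s + 1)) : o.Mat2 := o.eMat a i ⊗ₖ o.qDiag (-o.hDiag i)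

/-- The factor `q^{h_i/2} ⊗ e_i` of `Δ(e_i)`, where the spectral parameter of `e_0` is the
crossing parameter. -/
def eRight (a : K) (i : Fin (o.s + 1)) : o.Mat2 := (if i = 0 then o.crossing else 1) •
  ((o.qDiag (o.hDiag i) * o.parMat ^ (o.genPar i).val) ⊗ₖ o.eMat a i)

/-- For i ≠ 0 the scalar is 1 since (2ρ, α_i) = (α_i, α_i), and for i = 0 it is ζ. Thus all e_i
annihilate ω in V(1) ⊗ V(ζ). -/
theorem eLeft_add_eRight_mulVec (a : K) (i : Fin (o.s + 1)) :
    (o.eLeft a i + o.eRight a i) *ᵥ o.omega = 0 := by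
  have hz : (if i = 0 then o.crossing else 1) = qHalf (o.rhoEps (o.tgt i) - o.rhoEps (o.src i) -
      (o.hDiag i (o.tgt i) - o.hDiag i (o.src i))) := by
    rw [← cartan_eq_hDiag]
    split_ifs with h
    · rw [h]
      exact o.crossing_eq
    · rw [rhoEps_simple o (Nat.pos_of_ne_zero fun e => h (Fin.ext e)) (Nat.le_of_lt_succ i.2),
        sub_self, qHalf_zero]
  have := o.pair_mulVec_omega (o.hDiag_rev i) hz
  rw [eLeft, eRight, eMat, Matrix.smul_kronecker, Matrix.kronecker_smul, smul_comm, ← smul_add,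
    Matrix.smul_mulVec, Matrix.add_mulVec, Matrix.smul_mulVec, genPar_eq, this, smul_zero]

theorem parMat_pow_mul_eMat (a : K) (g : ZMod 2) (i : ℕ) : o.parMat ^ g.val * o.eMat a i =
    (sgn (g * o.genPar i) : K) • (o.eMat a i * o.parMat ^ g.val) := by
  rcases zmod_two_cases g with rfl | rfl
  · simp
  · simp [ZMod.val_one, parMat_mul_eMat]

/-- The weight factors of the two tensor legs contribute q^{(α_i,α_j)/2} each and the parity
operator contributes the sign, which together make up the bicharacter needed for `prod_add_eq_cop`.
-/
theorem eRight_mul_eLeft (a : K) (i j : Fin (o.s + 1)) :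
    o.eRight a i * o.eLeft a j = o.chi i j • (o.eLeft a j * o.eRight a i) := by
  have h1 := o.qDiag_mul_eMat a i j 1
  have h2 := o.qDiag_mul_eMat a j i (-1)
  rw [one_smul, one_mul] at h1
  rw [neg_one_smul, neg_one_mul, qHalf_neg] at h2
  have h3 : o.eMat a i * o.qDiag (-o.hDiag j) =
      qHalf (o.cartan i j) • (o.qDiag (-o.hDiag j) * o.eMat a i) := by
    rw [h2, smul_smul, cartan_comm, mul_inv_cancel₀ (qHalf_ne_zero _), one_smul]
  rw [eRight, eLeft, smul_mul_assoc, mul_smul_comm, ← Matrix.mul_kronecker_mul,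
    ← Matrix.mul_kronecker_mul, h3, mul_assoc, parMat_pow_mul_eMat, mul_smul_comm, ← mul_assoc, h1,
    smul_mul_assoc, Matrix.smul_kronecker, Matrix.smul_kronecker, Matrix.kronecker_smul, chi, braid,
    two_mul, qHalf_add, mul_assoc]
  module

theorem qDiag_mul_parMat_pow (x : Fin o.N → ℤ) (n : ℕ) :
    o.parMat ^ n * o.qDiag x = o.qDiag x * o.parMat ^ n := by
  have : Commute o.parMat (o.qDiag x) := o.parMat_mul_qDiag x
  exact this.pow_left n

theorem eLeft_word (a : K) (w : List (Fin (o.s + 1))) :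
    (w.map (o.eLeft a)).prod = o.eWord a w ⊗ₖ o.qDiag (-o.hSum w) := by
  induction w with
  | nil => simp [eWord, hSum, qDiag_zero]
  | cons i w ih =>
    rw [List.map_cons, List.prod_cons, ih, eLeft, ← Matrix.mul_kronecker_mul, qDiag_mul]
    congr 2
    rw [hSum_cons, neg_add]

theorem eRight_word (a : K) (w : List (Fin (o.s + 1))) :
    (w.map (o.eRight a)).prod = (w.map fun i => if i = 0 then o.crossing else 1).prod •
      ((o.qDiag (o.hSum w) * o.parMat ^ o.valSum w) ⊗ₖ o.eWord a w) := by
  induction w with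
  | nil => simp [eWord, hSum, valSum, qDiag_zero]
  | cons i w ih =>
    rw [List.map_cons, List.prod_cons, ih, eRight, smul_mul_smul_comm, ← Matrix.mul_kronecker_mul,
      List.map_cons, List.prod_cons]
    congr 2
    rw [hSum_cons, valSum_cons, ← qDiag_mul, pow_add, mul_assoc, mul_assoc,
      ← mul_assoc (o.parMat ^ _), qDiag_mul_parMat_pow, mul_assoc]

/-! ### Weights and parities of products of root operators. -/

theorem eWord_weight (a : K) (w : List (Fin (o.s + 1))) {d c : Fin o.N}
    (h : o.eWord a w d c ≠ 0) : o.eps d = o.eps c + o.rootSum w := by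
  induction w generalizing d with
  | nil =>
    have : d = c := by
      by_contra hdc
      exact h (Matrix.one_apply_ne hdc)
    simp [this, rootSum]
  | cons i w ih =>
    rw [eWord, List.map_cons, List.prod_cons, Matrix.mul_apply] at h
    obtain ⟨x, -, hx⟩ := Finset.exists_ne_zero_of_sum_ne_zero h
    have h1 := ih (right_ne_zero_of_mul hx)
    have h2 : o.rootMat (o.tgt i) (o.src i) d x ≠ 0 := by
      intro h0
      apply left_ne_zero_of_mul hx
      simp [eMat, h0]
    rw [o.mem_weight h2, h1, rootSum_cons, simpleRoot_eq]
    abel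

theorem eWord_parity (a : K) (w : List (Fin (o.s + 1))) {d c : Fin o.N}
    (h : o.eWord a w d c ≠ 0) : o.par d = o.par c + (o.valSum w : ZMod 2) := by
  induction w generalizing d with
  | nil =>
    have : d = c := by
      by_contra hdc
      exact h (Matrix.one_apply_ne hdc)
    simp [this, valSum]
  | cons i w ih =>
    rw [eWord, List.map_cons, List.prod_cons, Matrix.mul_apply] at h
    obtain ⟨x, -, hx⟩ := Finset.exists_ne_zero_of_sum_ne_zero h
    have h1 := ih (right_ne_zero_of_mul hx)
    have h2 : o.rootMat (o.tgt i) (o.src i) d x ≠ 0 := by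
      intro h0
      apply left_ne_zero_of_mul hx
      simp [eMat, h0]
    rw [o.mem_parity h2, h1, valSum_cons, ← genPar_eq, Nat.cast_add, ZMod.natCast_zmod_val]
    ring

theorem hSum_eq_form (μ : Multiset (Fin (o.s + 1))) (c : Fin o.N) :
    o.hSum μ c = o.form (o.rootSum μ) (o.eps c) := by
  induction μ using Multiset.induction with
  | empty => simp [hSum, rootSum, form_zero_left]
  | cons i μ ih =>
    rw [hSum, rootSum] at *
    rw [Multiset.map_cons, Multiset.sum_cons, Multiset.map_cons, Multiset.sum_cons, Pi.add_apply,
      form_add_left, ih, hDiag_eq_form]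

/-- The weights of V are multiplicity free: the coordinates identify any index outside the middle,
and zero occurs only at the middle. -/
theorem eps_inj {c d : Fin o.N} (h : o.eps c = o.eps d) : c = d := by
  have h1 := o.le_two_s_add_one
  have key : ∀ {x y : Fin o.N}, o.eps x = o.eps y → (x : ℕ) < o.s → x = y := by
    intro x y h hx
    have hk := congrFun h ⟨x, hx⟩
    rw [eps, if_pos rfl, eps] at hk
    split_ifs at hk with h2
    · exact Fin.ext h2.symm
    · omega
  by_cases hc : (c : ℕ) < o.s
  · exact key h hc
  by_cases hc' : (c.rev : ℕ) < o.s
  · exact Fin.rev_inj.1 (key (by rw [eps_rev, eps_rev, h]) hc')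
  by_cases hd : (d : ℕ) < o.s
  · exact (key h.symm hd).symm
  by_cases hd' : (d.rev : ℕ) < o.s
  · exact (Fin.rev_inj.1 (key (by rw [eps_rev, eps_rev, h]) hd')).symm
  have := c.2
  have := d.2
  rw [Fin.val_rev] at *
  exact Fin.ext (by omega)

/-- The part of the weight argument that concerns `so(4)`. -/
theorem rootSum_so_four (hN : o.N = 4) (h0 : o.par o.fst = 0) (h2 : o.par (o.src 2) = 0)
    (μ : Multiset (Fin (o.s + 1))) (k l : Fin o.s) (hk : (k : ℕ) = 0) (hl : (l : ℕ) = 1) :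
    o.rootSum μ l ≤ o.rootSum μ k := by
  have hs : o.s = 2 := by rw [s, hN]
  induction μ using Multiset.induction with
  | empty => simp [rootSum]
  | cons i μ ih =>
    rw [rootSum] at *
    rw [Multiset.map_cons, Multiset.sum_cons, Pi.add_apply, Pi.add_apply]
    refine add_le_add ?_ ih
    rw [simpleRoot_eq]
    have hi := Nat.le_of_lt_succ i.2
    have hm : ∀ {x y : Fin o.N}, (x : ℕ) = y → o.par y = 0 → o.par x ≠ 1 := by
      intro x y e h
      rw [Fin.ext e, h]
      decide
    have hsrc2 : (o.src 2 : ℕ) = 2 := by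
      rcases o.pair_cases hs.ge with c | c | c | c | c | c <;> omega
    rcases o.pair_cases hi with ⟨_, _, h3, h4⟩ | ⟨_, h5, h3, h4⟩ | ⟨_, _, h3, h4⟩ | ⟨_, _, h3, h4⟩ |
      ⟨_, _, _, _, h3, h4⟩ | ⟨_, _, h5, h3, h4⟩
    · simp [eps, h3, h4, hk, hl, hN]
    · refine absurd h5 (hm (y := o.fst.rev) ?_ (by rw [par_rev, h0]))
      rw [h4, Fin.val_rev]
      simp [fst]
    · simp [eps, h3, h4, hk, hl, hN]
      omega
    · omega
    · simp [eps, h3, h4, hk, hl, hN, hs]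
    · refine absurd h5 (hm (y := (o.src 2).rev) ?_ (by rw [par_rev, h2]))
      rw [h3, Fin.val_rev, hsrc2]
      omega

/-- If a weight is nonzero then it does not occur in some column. -/
theorem exists_column (μ : Multiset (Fin (o.s + 1))) (hμ : o.rootSum μ ≠ 0) :
    ∃ c : Fin o.N, (∀ d, o.eps d ≠ o.eps c + o.rootSum μ) ∧
      ((o.N = 4 ∧ o.par o.fst = 0 ∧ o.par (o.src 2) = 0) → Even (c : ℕ)) := by
  have bound : ∀ (x : Fin o.N) (k : Fin o.s), o.eps x k ≤ 1 ∧ -1 ≤ o.eps x k := by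
    intro x k
    unfold eps
    split_ifs <;> omega
  by_contra! hcon
  by_cases h4 : o.N = 4 ∧ o.par o.fst = 0 ∧ o.par (o.src 2) = 0
  · obtain ⟨hN, h0, h2⟩ := h4
    have hs : o.s = 2 := by rw [s, hN]
    have hle := o.rootSum_so_four hN h0 h2 μ ⟨0, by omega⟩ ⟨1, by omega⟩ rfl rfl
    have hA : ∀ c : Fin o.N, Even (c : ℕ) → ∃ d, o.eps d = o.eps c + o.rootSum μ := by
      intro c he
      by_contra! hc
      exact (hcon c hc).2 he
    have val0 : ∀ x : Fin o.N, o.eps x ⟨0, by omega⟩ =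
        if (x : ℕ) = 0 then 1 else if (x : ℕ) = 3 then -1 else 0 := by
      intro x
      have := x.2
      have e : ((x.rev : ℕ) = 0) ↔ (x : ℕ) = 3 := by rw [Fin.val_rev]; omega
      simp only [eps, e]
    have val1 : ∀ x : Fin o.N, o.eps x ⟨1, by omega⟩ =
        if (x : ℕ) = 1 then 1 else if (x : ℕ) = 2 then -1 else 0 := by
      intro x
      have := x.2
      have e : ((x.rev : ℕ) = 1) ↔ (x : ℕ) = 2 := by rw [Fin.val_rev]; omega
      simp only [eps, e]
    have val : ∀ x : Fin o.N,
        (o.eps x ⟨0, by omega⟩ = 1 ∧ o.eps x ⟨1, by omega⟩ = 0) ∨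
        (o.eps x ⟨0, by omega⟩ = -1 ∧ o.eps x ⟨1, by omega⟩ = 0) ∨
        (o.eps x ⟨0, by omega⟩ = 0 ∧ o.eps x ⟨1, by omega⟩ = 1) ∨
        (o.eps x ⟨0, by omega⟩ = 0 ∧ o.eps x ⟨1, by omega⟩ = -1) := by
      intro x
      rw [val0, val1]
      have := x.2
      split_ifs <;> omega
    -- For so(4) only even positions may be tested. Shifting ε_1 and -ε_2 by β must give weights
    -- again; together with β_2 ≤ β_1, valid for sums of simple roots, this forces β = 0.
    obtain ⟨d, hd⟩ := hA o.fst (by simp [fst])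
    obtain ⟨d', hd'⟩ := hA ⟨2, by omega⟩ (by simp)
    have e1 := congrFun hd ⟨0, by omega⟩
    have e2 := congrFun hd ⟨1, by omega⟩
    have e3 := congrFun hd' ⟨0, by omega⟩
    have e4 := congrFun hd' ⟨1, by omega⟩
    apply hμ
    rw [Pi.add_apply, val0 o.fst] at e1
    rw [Pi.add_apply, val1 o.fst] at e2
    rw [Pi.add_apply, val0 ⟨2, _⟩] at e3
    rw [Pi.add_apply, val1 ⟨2, _⟩] at e4
    simp only [fst, if_true, if_false, zero_ne_one, OfNat.ofNat_ne_zero, OfNat.ofNat_ne_one,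
      OfNat.zero_ne_ofNat, Nat.reduceEqDiff] at e1 e2 e3 e4
    have v1 := val d
    have v2 := val d'
    clear val val0 val1 hA hcon hd hd'
    funext k
    have hk : k = ⟨0, by omega⟩ ∨ k = ⟨1, by omega⟩ := by
      rcases Nat.lt_or_ge k 1 with h | h
      · exact Or.inl (Fin.ext (by simp; omega))
      · exact Or.inr (Fin.ext (by simp; omega))
    rcases hk with rfl | rfl <;> rw [Pi.zero_apply] <;> omega
  · apply hμ
    funext k
    have hA : ∀ c : Fin o.N, ∃ d, o.eps d = o.eps c + o.rootSum μ := by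
      intro c
      by_contra! hc
      exact (hcon c hc).1 |> h4
    -- Shifting both ε_k and -ε_k by β has to keep the k-th coordinate in [-1, 1], hence β_k = 0.
    obtain ⟨d, hd⟩ := hA (o.inc k)
    obtain ⟨d', hd'⟩ := hA (o.inc k).rev
    rw [eps_rev] at hd'
    rw [eps_inc] at hd hd'
    have e1 := congrFun hd k
    have e2 := congrFun hd' k
    simp at e1 e2
    have := bound d k
    have := bound d' k
    simp
    omega

/-- On words of content `μ` the derivation sees `φ` only in content `μ` minus `i`. That part of `φ`
comes from the pairing by hypothesis, so its derivative does as well and kills the radical. -/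
theorem sum_skewDerR_eq_zero {I k M : Type} [DecidableEq I] [Field k] [AddCommGroup M] [Module k M]
    {χ : I → I → k} (hχ : ∀ i j, χ i j = χ j i) {φ : List I → M} {μ : Multiset I}
    (hφ : ∀ ν < μ, cutc ν φ ∈ shuf χ M) {x : List I →₀ k} (hx : IsRad χ x)
    (hxμ : ∀ w ∈ x.support, (w : Multiset I) = μ) (i : I) :
    (x.sum fun w c => c • skewDerR χ i φ w) = 0 := by
  by_cases hi : i ∈ μ
  · have h1 := sum_eq_zero_of_mem_shuf (skewDerR_mem_shuf hχ i (hφ _ (Multiset.erase_lt.2 hi))) hx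
    rw [← h1]
    refine Finset.sum_congr rfl fun w hw => ?_
    refine congrArg (x w • ·) ?_
    refine skewDerR_congr i _ _ w fun v hv => ?_
    rw [cutc, if_pos]
    rw [← hxμ w hw, ← hv, Multiset.erase_cons_head]
  · refine Finset.sum_eq_zero fun w hw => ?_
    change x w • skewDerR χ i φ w = 0
    rw [skewDerR_congr i φ (fun _ => 0) w, skewDerR_zero, smul_zero]
    intro v hv
    exact absurd (by rw [← hxμ w hw, ← hv]; exact Multiset.mem_cons_self i _) hi

theorem sum_skewDer_eq_zero {I k M : Type} [DecidableEq I] [Field k] [AddCommGroup M] [Module k M]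
    {χ : I → I → k} {φ : List I → M} {μ : Multiset I}
    (hφ : ∀ ν < μ, cutc ν φ ∈ shuf χ M) {x : List I →₀ k} (hx : IsRad χ x)
    (hxμ : ∀ w ∈ x.support, (w : Multiset I) = μ) (i : I) :
    (x.sum fun w c => c • skewDer χ i φ w) = 0 := by
  by_cases hi : i ∈ μ
  · have h1 := sum_eq_zero_of_mem_shuf (skewDer_mem_shuf i (hφ _ (Multiset.erase_lt.2 hi))) hx
    rw [← h1]
    refine Finset.sum_congr rfl fun w hw => ?_
    refine congrArg (x w • ·) ?_
    refine skewDer_congr i _ _ w fun v hv => ?_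
    rw [cutc, if_pos]
    rw [← hxμ w hw, ← hv, Multiset.erase_cons_head]
  · refine Finset.sum_eq_zero fun w hw => ?_
    change x w • skewDer χ i φ w = 0
    rw [skewDer_eq_zero i φ w, smul_zero]
    intro v hv
    exact absurd (by rw [← hxμ w hw, ← hv]; exact Multiset.mem_cons_self i _) hi

theorem sgn_word (g : ZMod 2) (w : List (Fin (o.s + 1))) :
    (w.map fun j : Fin (o.s + 1) => (sgn (o.genPar j * g) : K)).prod =
      sgn ((o.valSum w : ZMod 2) * g) := by
  induction w with
  | nil => simp [valSum]
  | cons i w ih =>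
    rw [List.map_cons, List.prod_cons, ih, valSum_cons, Nat.cast_add, ZMod.natCast_zmod_val,
      add_mul, sgn_add]
    push_cast
    rfl

/-- A word in the `e_j` past `f_i`. -/
theorem eWord_mul_fMat {a b : K} (hab : a * b = o.abValue) (i : Fin (o.s + 1))
    (w : List (Fin (o.s + 1))) : o.eWord a w * o.fMat b i =
      (sgn ((o.valSum w : ZMod 2) * o.genPar i) : K) • (o.fMat b i * o.eWord a w) +
      skewDerR o.chi i (o.eWord a) w * ((q - q⁻¹)⁻¹ • o.qDiag (o.hDiag i) ^ 2) -
      ((sgn ((o.valSum w : ZMod 2) * o.genPar i) : K) * sgn (o.genPar i * o.genPar i)) •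
        (((q - q⁻¹)⁻¹ • o.qDiag (-o.hDiag i) ^ 2) * skewDer o.chi i (o.eWord a) w) := by
  have h1 := prod_mul_lower (χ := o.chi) (fun j : Fin (o.s + 1) => o.eMat a j) (o.fMat b i)
    ((q - q⁻¹)⁻¹ • o.qDiag (o.hDiag i) ^ 2) ((q - q⁻¹)⁻¹ • o.qDiag (-o.hDiag i) ^ 2) i
    (fun j => sgn (o.genPar j * o.genPar i)) (fun j => sgn_cast_mul_self _) ?_ ?_ ?_ w
  · rw [sgn_word] at h1
    exact h1
  · intro j
    have hj := Nat.le_of_lt_succ j.2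
    have hi := Nat.le_of_lt_succ i.2
    rw [← sub_eq_iff_eq_add']
    split_ifs with hij
    · subst hij
      rw [o.e_f_self hab hj, smul_sub]
    · exact o.e_f_ne hj hi fun e => hij (Fin.ext e)
  · intro j
    have h2 := o.qDiag_mul_eMat a i j 1
    rw [one_smul, one_mul] at h2
    rw [smul_mul_assoc, mul_smul_comm, pow_two, mul_assoc, h2, mul_smul_comm, ← mul_assoc, h2, chi,
      braid, two_mul, qHalf_add, mul_comm (o.genPar j)]
    simp only [smul_mul_assoc, mul_assoc]
    module
  · intro j
    have h2 := o.qDiag_mul_eMat a i j (-1)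
    rw [neg_one_smul, neg_one_mul, qHalf_neg] at h2
    have h4 : o.qDiag (-o.hDiag i) ^ 2 * o.eMat a j = ((qHalf (o.cartan i j))⁻¹ *
        (qHalf (o.cartan i j))⁻¹) • (o.eMat a j * o.qDiag (-o.hDiag i) ^ 2) := by
      rw [pow_two, mul_assoc, h2, mul_smul_comm, ← mul_assoc, h2, smul_mul_assoc, smul_smul,
        mul_assoc]
    rw [smul_mul_assoc, mul_smul_comm, h4, chi, braid, two_mul, qHalf_add, mul_comm (o.genPar j)]
    have h3 := inv_mul_cancel₀ (qHalf_ne_zero (o.cartan i j))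
    simp only [mul_assoc, smul_smul]
    congr 1
    linear_combination (-(sgn (o.genPar i * o.genPar j) : K) * (q - q⁻¹)⁻¹) *
      (h3 * (qHalf (o.cartan i j) * (qHalf (o.cartan i j))⁻¹) + h3)

/-- The defect of supercommutation with f_i is formed from the two skew derivatives of the word
functional, which vanish on the radical element by the induction hypothesis. -/
theorem sum_eWord_mul_fMat {a b : K} (hab : a * b = o.abValue) {μ : Multiset (Fin (o.s + 1))}
    (hμ : ∀ ν < μ, cutc ν (o.eWord a) ∈ shuf o.chi o.Mat) {x : List (Fin (o.s + 1)) →₀ K}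
    (hx : IsRad o.chi x) (hxμ : ∀ w ∈ x.support, (w : Multiset (Fin (o.s + 1))) = μ)
    (i : Fin (o.s + 1)) : (x.sum fun w c => c • o.eWord a w) * o.fMat b i =
      (sgn ((o.valSum μ : ZMod 2) * o.genPar i) : K) •
        (o.fMat b i * x.sum fun w c => c • o.eWord a w) := by
  have hR := sum_skewDerR_eq_zero o.chi_comm hμ hx hxμ i
  have hL := sum_skewDer_eq_zero hμ hx hxμ i
  have h1 : (x.sum fun w c => c • o.eWord a w) * o.fMat b i =
      (sgn ((o.valSum μ : ZMod 2) * o.genPar i) : K) •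
        (o.fMat b i * x.sum fun w c => c • o.eWord a w) +
      (x.sum fun w c => c • skewDerR o.chi i (o.eWord a) w) *
        ((q - q⁻¹)⁻¹ • o.qDiag (o.hDiag i) ^ 2) -
      ((sgn ((o.valSum μ : ZMod 2) * o.genPar i) : K) * sgn (o.genPar i * o.genPar i)) •
        (((q - q⁻¹)⁻¹ • o.qDiag (-o.hDiag i) ^ 2) *
          x.sum fun w c => c • skewDer o.chi i (o.eWord a) w) := by
    simp only [Finsupp.sum, Finset.sum_mul, Finset.mul_sum, Finset.smul_sum]
    rw [← Finset.sum_add_distrib, ← Finset.sum_sub_distrib]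
    refine Finset.sum_congr rfl fun w hw => ?_
    rw [smul_mul_assoc, o.eWord_mul_fMat hab, hxμ w hw]
    simp only [smul_mul_assoc, mul_smul_comm, smul_add, smul_sub, smul_smul]
    module
  rw [h1, hR, hL]
  simp

/-! ### Propagation of vanishing along the columns of the lowering operators. -/

theorem rootMat_apply_right {a b : Fin o.N} (hab : a = b.rev → o.par b = 1) (d : Fin o.N) :
    o.rootMat a b d b = if d = a then (if a = b.rev then 2 else 1) else 0 := by
  rw [rootMat_apply]
  by_cases h : a = b.rev
  · subst h
    have := o.kap_rev' b
    rw [hab rfl, sgn_one] at this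
    rw [this]
    by_cases hd : d = b.rev
    · subst hd
      norm_num
    · simp [hd, Ne.symm hd]
  · have h' : ¬ a.rev = b := fun e => h (by rw [← e, Fin.rev_rev])
    simp [h, h', eq_comm]

theorem rootMat_apply_rev {a b : Fin o.N} (hab : a = b.rev → o.par b = 1) (d : Fin o.N) :
    o.rootMat a b d a.rev = if d = b.rev then (if a = b.rev then 2 else -(o.kap a b : K)) else 0 := by
  by_cases h : a = b.rev
  · have := o.rootMat_apply_right hab d
    subst h
    rw [Fin.rev_rev, this, if_pos rfl, if_pos rfl]
  · rw [rootMat_apply]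
    have h' : ¬ b = a.rev := fun e => h (by rw [e, Fin.rev_rev])
    rw [if_neg fun e => h' e.2, if_neg h]
    by_cases hd : d = b.rev
    · simp [hd]
    · simp [hd, Ne.symm hd]

theorem kap_ne_zero (a b : Fin o.N) : (o.kap a b : K) ≠ 0 := by
  intro h
  have h1 := o.kap_mul_kap_self a b
  have h2 : (o.kap a b : K) * o.kap a b = 1 := by exact_mod_cast h1
  rw [h, mul_zero] at h2
  exact zero_ne_one h2

/-- The columns of `f_i` along which it moves basis vectors. -/
theorem fMat_apply_tgt {b : K} {i : ℕ} (hi : i ≤ o.s) (hF : o.cF b i ≠ 0) :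
    ∃ x ≠ 0, ∀ d, o.fMat b i d (o.tgt i) = if d = o.src i then x else 0 := by
  refine ⟨o.cF b i * if o.src i = (o.tgt i).rev then 2 else 1, mul_ne_zero hF ?_, fun d => ?_⟩
  · split_ifs <;> norm_num
  · rw [fMat, Matrix.smul_apply, o.rootMat_apply_right (o.par_tgt_of_src_eq hi), smul_eq_mul,
      mul_ite, mul_zero]

theorem fMat_apply_src_rev {b : K} {i : ℕ} (hi : i ≤ o.s) (hF : o.cF b i ≠ 0) :
    ∃ x ≠ 0, ∀ d, o.fMat b i d (o.src i).rev = if d = (o.tgt i).rev then x else 0 := by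
  refine ⟨o.cF b i * if o.src i = (o.tgt i).rev then 2 else -(o.kap (o.src i) (o.tgt i) : K),
    mul_ne_zero hF ?_, fun d => ?_⟩
  · split_ifs
    · norm_num
    · exact neg_ne_zero.2 (o.kap_ne_zero _ _)
  · rw [fMat, Matrix.smul_apply, o.rootMat_apply_rev (o.par_tgt_of_src_eq hi), smul_eq_mul,
      mul_ite, mul_zero]

theorem mul_apply_of_column {M F : o.Mat} {p r : Fin o.N} {x : K}
    (h : ∀ d, F d p = if d = r then x else 0) (d : Fin o.N) : (M * F) d p = M d r * x := by
  rw [Matrix.mul_apply, Finset.sum_eq_single r]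
  · rw [h, if_pos rfl]
  · intro e _ he
    rw [h, if_neg he, mul_zero]
  · simp

/-- Zero columns propagate along the `f_i`. -/
theorem closedDown_column {b : K} {i : ℕ} (hF : o.cF b i ≠ 0) {M : o.Mat} {c : K} (hi : i ≤ o.s)
    (h : M * o.fMat b i = c • (o.fMat b i * M)) :
    o.ClosedDown (fun x => ∀ d, M d x = 0) i := by
  have key : ∀ {p r : Fin o.N} {x : K}, x ≠ 0 → (∀ d, o.fMat b i d p = if d = r then x else 0) →
      (∀ d, M d p = 0) → ∀ d, M d r = 0 := by
    intro p r x hx hcol h0 d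
    have h1 := o.mul_apply_of_column (M := M) hcol d
    rw [h, Matrix.smul_apply, Matrix.mul_apply, Finset.sum_eq_zero fun e _ => by rw [h0, mul_zero],
      smul_zero] at h1
    exact (mul_eq_zero.1 h1.symm).resolve_right hx
  obtain ⟨x, hx, h1⟩ := o.fMat_apply_tgt hi hF
  obtain ⟨y, hy, h2⟩ := o.fMat_apply_src_rev hi hF
  exact ⟨key hx h1, key hy h2⟩

/-- Diagonal matrices that commute with the `f_i` are scalar. -/
theorem closedDown_diagonal {b : K} {i : ℕ} (hF : o.cF b i ≠ 0) {m : Fin o.N → K} (hi : i ≤ o.s)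
    (h : Matrix.diagonal m * o.fMat b i = o.fMat b i * Matrix.diagonal m) (t : K) :
    o.ClosedDown (fun x => m x = t) i := by
  have key : ∀ {p r : Fin o.N} {x : K}, x ≠ 0 → (∀ d, o.fMat b i d p = if d = r then x else 0) →
      m p = t → m r = t := by
    intro p r x hx hcol h0
    have h1 := congrFun (congrFun h r) p
    rw [Matrix.diagonal_mul, Matrix.mul_diagonal, hcol, if_pos rfl, h0, mul_comm x] at h1
    exact mul_right_cancel₀ hx h1
  obtain ⟨x, hx, h1⟩ := o.fMat_apply_tgt hi hF
  obtain ⟨y, hy, h2⟩ := o.fMat_apply_src_rev hi hF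
  exact ⟨key hx h1, key hy h2⟩

theorem omega_ne_zero : o.omega ≠ 0 := by
  intro h
  have := congrFun h (o.fst.rev, o.fst)
  simp [omega, o.coef_ne_zero] at this

/-- An element of the radical acts on the tensor square compatibly with the coproduct. -/
theorem sum_eWord_kronecker {a : K} {μ : Multiset (Fin (o.s + 1))} (hμ0 : μ ≠ 0)
    (hμ : ∀ ν < μ, cutc ν (o.eWord a) ∈ shuf o.chi o.Mat) {x : List (Fin (o.s + 1)) →₀ K}
    (hx : IsRad o.chi x) (hxμ : ∀ w ∈ x.support, (w : Multiset (Fin (o.s + 1))) = μ) :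
    ((x.sum fun w c => c • o.eWord a w) ⊗ₖ o.qDiag (-o.hSum μ)) *ᵥ o.omega +
      (μ.map fun i => if i = 0 then o.crossing else 1).prod • ((o.qDiag (o.hSum μ) *
        o.parMat ^ o.valSum μ) ⊗ₖ (x.sum fun w c => c • o.eWord a w)) *ᵥ o.omega = 0 := by
  let z : Multiset (Fin (o.s + 1)) → K := fun μ => (μ.map fun i => if i = 0 then o.crossing else 1).prod
  let L : Multiset (Fin (o.s + 1)) → o.Mat →ₗ[K] o.Mat2 := fun ν =>
    (Matrix.kroneckerBilinear : o.Mat →ₗ[K] o.Mat →ₗ[K] o.Mat2).flip (o.qDiag (-o.hSum ν))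
  let R : Multiset (Fin (o.s + 1)) → o.Mat →ₗ[K] o.Mat2 := fun ν =>
    z ν • (Matrix.kroneckerBilinear : o.Mat →ₗ[K] o.Mat →ₗ[K] o.Mat2) (o.qDiag (o.hSum ν) * o.parMat ^ o.valSum ν)
  have hLw : ∀ w : List (Fin (o.s + 1)), (w.map (o.eLeft a)).prod = L w (o.eWord a w) :=
    fun w => o.eLeft_word a w
  have hRw : ∀ w : List (Fin (o.s + 1)), (w.map (o.eRight a)).prod = R w (o.eWord a w) :=
    fun w => o.eRight_word a w
  have cut : ∀ (A : Multiset (Fin (o.s + 1)) → o.Mat →ₗ[K] o.Mat2) (φ : List (Fin (o.s + 1)) → o.Mat2),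
      (∀ w : List (Fin (o.s + 1)), φ w = A w (o.eWord a w)) → ∀ ν < μ, cutc ν φ ∈ shuf o.chi o.Mat2 := by
    intro A φ h ν hν
    convert content_mem_shuf (χ := o.chi) A (hμ ν hν) using 1
    funext w
    simp only [cutc, h]
    split_ifs <;> simp
  -- Modulo functionals that kill the radical, the coproduct of a word of content `μ` is the sum of
  -- its two extreme terms.
  obtain ⟨θ, hθ, hcop⟩ := exists_cop_eq o.chi_comm hμ0 (cut L _ hLw) (cut R _ hRw) rfl rfl
  have hsum : (x.sum fun w c => c • (w.map fun i => o.eLeft a i + o.eRight a i).prod) =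
      L μ (x.sum fun w c => c • o.eWord a w) + R μ (x.sum fun w c => c • o.eWord a w) := by
    have h0 := sum_eq_zero_of_mem_shuf hθ hx
    rw [← add_zero (L μ _ + R μ _), ← h0]
    simp only [Finsupp.sum, map_sum, map_smul]
    rw [← Finset.sum_add_distrib, ← Finset.sum_add_distrib]
    refine Finset.sum_congr rfl fun w hw => ?_
    rw [prod_add_eq_cop (χ := o.chi) _ _ (o.eRight_mul_eLeft a), hcop w (hxμ w hw), hLw, hRw,
      hxμ w hw, smul_add, smul_add]
  -- Already the last letter of a nonempty word annihilates ω.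
  have hkill : ∀ w : List (Fin (o.s + 1)), w ≠ [] →
      (w.map fun i => o.eLeft a i + o.eRight a i).prod *ᵥ o.omega = 0 := by
    intro w hw
    induction w with
    | nil => exact absurd rfl hw
    | cons i w ih =>
      rw [List.map_cons, List.prod_cons, ← Matrix.mulVec_mulVec]
      by_cases h : w = []
      · subst h
        rw [List.map_nil, List.prod_nil, Matrix.one_mulVec, eLeft_add_eRight_mulVec]
      · rw [ih h, Matrix.mulVec_zero]
  have h0 : (x.sum fun w c => c • (w.map fun i => o.eLeft a i + o.eRight a i).prod) *ᵥ o.omega =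
      0 := by
    rw [Finsupp.sum, Matrix.sum_mulVec]
    refine Finset.sum_eq_zero fun w hw => ?_
    rw [Matrix.smul_mulVec, hkill, smul_zero]
    rintro rfl
    exact hμ0 (hxμ _ hw).symm
  rw [hsum, Matrix.add_mulVec] at h0
  rw [← Matrix.smul_mulVec]
  exact h0

theorem exists_prod_crossing (μ : Multiset (Fin (o.s + 1))) :
    ∃ k : ℤ, (μ.map fun i => if i = 0 then o.crossing else 1).prod = qHalf k := by
  induction μ using Multiset.induction with
  | empty => exact ⟨0, by simp [qHalf_zero]⟩
  | cons i μ ih =>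
    obtain ⟨k, hk⟩ := ih
    rw [Multiset.map_cons, Multiset.prod_cons, hk]
    split_ifs
    · exact ⟨_, by rw [crossing_eq, ← qHalf_add]⟩
    · exact ⟨k, one_mul _⟩

/-- This is the Serre relations for the e_i on V, by induction on the content. A radical element of
content `μ` acts by some M which supercommutes with all f_i. For nonzero weight a column of M
vanishes and the f_i propagate this. For weight zero M is diagonal, hence zero if odd and a scalar
if even, and the scalar is removed by applying the coproduct to ω. -/
theorem eWord_cutc_mem {a b : K} (hab : a * b = o.abValue) (μ : Multiset (Fin (o.s + 1))) :
    cutc μ (o.eWord a) ∈ shuf o.chi o.Mat := by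
  induction μ using Multiset.strongInductionOn with
  | ih μ hμ =>
  by_cases hμ0 : μ = 0
  · subst hμ0
    convert wpair_mem_shuf (χ := o.chi) [] (1 : o.Mat) using 1
    funext w
    cases w with
    | nil => simp [cutc, wpair, eWord]
    | cons i w => simp [cutc, wpair]
  refine cutc_mem_shuf_of_sum_eq_zero μ fun x hx hxμ => ?_
  have hcomm := fun i => o.sum_eWord_mul_fMat hab hμ hx hxμ i
  have hkron := o.sum_eWord_kronecker hμ0 hμ hx hxμ
  have hent : ∀ d c, (x.sum fun w c => c • o.eWord a w) d c ≠ 0 →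
      o.eps d = o.eps c + o.rootSum μ ∧ o.par d = o.par c + (o.valSum μ : ZMod 2) := by
    intro d c h
    rw [Finsupp.sum, Matrix.sum_apply] at h
    obtain ⟨w, hw, h⟩ := Finset.exists_ne_zero_of_sum_ne_zero h
    rw [Matrix.smul_apply] at h
    have h' := right_ne_zero_of_smul h
    rw [← hxμ w hw]
    exact ⟨o.eWord_weight a w h', o.eWord_parity a w h'⟩
  generalize (x.sum fun w c => c • o.eWord a w) = M at *
  -- In weight zero M is diagonal, because the weights of V are multiplicity free.
  by_cases hβ : o.rootSum μ = 0
  · have hdiag : M = Matrix.diagonal fun c => M c c := by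
      ext d c
      by_cases hdc : d = c
      · rw [hdc, Matrix.diagonal_apply_eq]
      · rw [Matrix.diagonal_apply_ne _ hdc]
        by_contra h
        exact hdc (o.eps_inj (by rw [(hent d c h).1, hβ, add_zero]))
    rcases zmod_two_cases (o.valSum μ : ZMod 2) with hp | hp
    · have hsc := o.all_of_closedDown_affine (S := fun x => M x x = M o.fst o.fst)
        (fun i hi => o.closedDown_diagonal (o.cF_ne_zero hab hi) (m := fun c => M c c) hi (by
          have := hcomm ⟨i, Nat.lt_succ_of_le hi⟩
          rwa [hp, zero_mul, sgn_zero, Int.cast_one, one_smul, hdiag] at this) _)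
        (c := o.fst) rfl (fun _ => by simp [fst])
      -- The diagonal entries agree along all moves of the f_i, hence everywhere; starting at
      -- position 0 satisfies the parity condition for so(4).
      have hM : M = M o.fst o.fst • 1 := by
        rw [hdiag, Matrix.smul_one_eq_diagonal]
        congr 1
        funext c
        rw [Matrix.diagonal_apply_eq]
        exact hsc c
      have hh : o.hSum μ = 0 := by
        funext c
        rw [hSum_eq_form, hβ, form_zero_left]
        rfl
      obtain ⟨k, hk⟩ := o.exists_prod_crossing μ
      obtain ⟨l, hl⟩ := (ZMod.natCast_eq_zero_iff_even.1 hp)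
      rw [hh, neg_zero, qDiag_zero, hk, one_mul, hl, ← two_mul, pow_mul, pow_two,
        parMat_mul_parMat, one_pow, hM, Matrix.smul_kronecker, Matrix.kronecker_smul,
        Matrix.one_kronecker_one, Matrix.smul_mulVec, Matrix.one_mulVec, smul_smul,
        ← add_smul] at hkron
      have h1 := (smul_eq_zero.1 hkron).resolve_right o.omega_ne_zero
      -- With zero weight and even parity the Cartan and parity factors disappear, and the two legs
      -- give 1 and a product of crossing parameters, which is a power of q^{1/2}.
      have h2 : M o.fst o.fst * (1 + qHalf k) = 0 := by linear_combination h1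
      have h3 := (mul_eq_zero.1 h2).resolve_right (one_add_qHalf_ne_zero k)
      rw [hM, h3, zero_smul]
    · rw [hdiag]
      ext d c
      rw [Matrix.zero_apply, Matrix.diagonal_apply]
      split_ifs with hdc
      · by_contra h
        have := (hent d d h).2
        rw [hp] at this
        exact one_ne_zero (left_eq_add.1 this)
      · rfl
  -- A column whose weight, shifted by that of M, is no weight of V has to vanish.
  · obtain ⟨c, hc, hso⟩ := o.exists_column μ hβ
    have h0 := o.all_of_closedDown_affine (S := fun x => ∀ d, M d x = 0)
      (fun i hi => o.closedDown_column (o.cF_ne_zero hab hi) hi (hcomm ⟨i, Nat.lt_succ_of_le hi⟩))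
      (c := c) (fun d => by
        by_contra h
        exact hc d (hent d c h).1) hso
    ext d e
    exact h0 e d

theorem eWord_locally {a b : K} (hab : a * b = o.abValue) : Locally o.chi (o.eWord a) :=
  fun μ => o.eWord_cutc_mem hab μ

/-- A product of the `f_i`. -/
def fWord (b : K) (w : List (Fin (o.s + 1))) : o.Mat := (w.map fun i : Fin (o.s + 1) => o.fMat b i).prod

/-- The diagonal matrix by which `f_i` is conjugate to the transpose of `e_i`. -/
def halfMat : o.Mat := Matrix.diagonal fun c => (o.halfSign c : K)

theorem halfMat_mul_self : o.halfMat * o.halfMat = 1 := by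
  rw [halfMat, Matrix.diagonal_mul_diagonal, ← Matrix.diagonal_one]
  congr 1
  funext c
  exact_mod_cast o.halfSign_mul_self c

theorem fMat_eq {a b : K} (hab : a * b = o.abValue) (i : Fin (o.s + 1)) :
    ∃ x : K, o.fMat b i = x • (o.halfMat * (o.eMat a i)ᵀ * o.halfMat) := by
  have ha : o.cE a i ≠ 0 := by
    intro h
    have hi := Nat.le_of_lt_succ i.2
    have h1 := o.cE_mul_cF hab hi
    have h3 := sgn_cast_ne_zero (o.par (o.tgt i))
    rw [h, zero_mul] at h1
    split_ifs at h1
    · exact mul_ne_zero h3 (div_ne_zero q_add_inv_ne_zero (by norm_num)) h1.symm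
    · exact mul_ne_zero h3 one_ne_zero h1.symm
  refine ⟨o.cF b i * (o.cE a i)⁻¹ * (o.halfSign (o.tgt i) * o.halfSign (o.src i) : ℤ), ?_⟩
  ext d c
  rw [fMat, eMat, halfMat, Matrix.smul_apply, Matrix.smul_apply, Matrix.mul_diagonal,
    Matrix.diagonal_mul, Matrix.transpose_apply, Matrix.smul_apply, rootMat_swap_apply]
  have := inv_mul_cancel₀ ha
  push_cast
  simp only [smul_eq_mul]
  linear_combination (-o.cF b i * o.halfSign (o.tgt i) * o.halfSign (o.src i) * o.halfSign d *
    o.halfSign c * o.rootMat (o.tgt i) (o.src i) c d) * this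

/-- The f_i are multiples of conjugated transposes of the e_i. Transposition reverses words, the
pairing is compatible with reversal, and the scalars depend only on the content. -/
theorem fWord_locally {a b : K} (hab : a * b = o.abValue) : Locally o.chi (o.fWord b) := by
  choose x hx using o.fMat_eq hab
  let L : Multiset (Fin (o.s + 1)) → o.Mat →ₗ[K] o.Mat := fun μ => (μ.map x).prod •
    (LinearMap.mulLeft K o.halfMat ∘ₗ LinearMap.mulRight K o.halfMat ∘ₗ
      (Matrix.transposeLinearEquiv (Fin o.N) (Fin o.N) K K).toLinearMap)
  have hL : ∀ μ M, L μ M = (μ.map x).prod • (o.halfMat * (Mᵀ * o.halfMat)) := fun _ _ => rfl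
  convert ((o.eWord_locally hab).reverse o.chi_comm).content L using 1
  funext w
  induction w with
  | nil => simp [fWord, eWord, hL, halfMat_mul_self]
  | cons i w ih =>
    rw [fWord, List.map_cons, List.prod_cons, ← fWord, ih, hx, hL, hL, ← Multiset.cons_coe,
      Multiset.map_cons, Multiset.prod_cons, List.reverse_cons, eWord, eWord, List.map_append,
      List.prod_append, List.map_cons, List.map_nil, List.prod_cons, List.prod_nil, mul_one,
      Matrix.transpose_mul, smul_mul_smul_comm]
    congr 1
    have h := o.halfMat_mul_self
    simp only [mul_assoc]
    rw [← mul_assoc o.halfMat o.halfMat, h, one_mul]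

/-! ### The finite braiding as a matrix -/

/-- The scalar by which the braiding flips `v_a ⊗ v_c`. -/
def tw (a c : Fin o.N) : K := sgn (o.par a * o.par c) * qHalf (2 * o.form (o.eps a) (o.eps c))

/-- The scalar by which the inverse braiding flips `v_a ⊗ v_c`. -/
def twInv (a c : Fin o.N) : K := sgn (o.par a * o.par c) * qHalf (-(2 * o.form (o.eps a) (o.eps c)))

theorem tw_comm (a c : Fin o.N) : o.tw a c = o.tw c a := by
  rw [tw, tw, mul_comm (o.par a), form_comm]

theorem twInv_comm (a c : Fin o.N) : o.twInv a c = o.twInv c a := by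
  rw [twInv, twInv, mul_comm (o.par a), form_comm]

theorem tw_mul_twInv (a c : Fin o.N) : o.tw a c * o.twInv a c = 1 := by
  have h1 := sgn_cast_mul_self (o.par a * o.par c)
  have h2 := mul_inv_cancel₀ (qHalf_ne_zero (2 * o.form (o.eps a) (o.eps c)))
  rw [tw, twInv, qHalf_neg]
  linear_combination h1 + sgn (o.par a * o.par c) * sgn (o.par a * o.par c) * h2

/-- The exponent (ε_a, ε_c) is nonzero only for c = a or c = a'. There the parity sign of the flip
cancels the sign of the form, so the difference is ±(q - q⁻¹). At the middle index both corrections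
occur and cancel. -/
theorem twInv_eq (a c : Fin o.N) : o.twInv a c = o.tw a c -
    (if c = a then q - q⁻¹ else 0) + if c = a.rev then q - q⁻¹ else 0 := by
  have e2 : q = qHalf 2 := rfl
  have e3 : q⁻¹ = qHalf (-2) := by rw [qHalf_neg]; rfl
  rw [tw, twInv, form_eps_eps, e3, e2]
  by_cases h : c = a
  · subst h
    by_cases h' : c = c.rev
    · have := o.par_eq_zero_of_rev h'.symm
      rw [xDiag, ← h', this]
      simp
    · rw [xDiag, if_pos rfl, if_neg h', if_pos rfl, if_neg h']
      rcases zmod_two_cases (o.par c) with hp | hp <;> rw [hp] <;> simp <;> ring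
  · by_cases h' : c = a.rev
    · rw [xDiag, if_neg h, if_pos h', if_neg h, if_pos h', h', par_rev]
      rcases zmod_two_cases (o.par a) with hp | hp <;> rw [hp] <;> simp <;> ring
    · rw [xDiag, if_neg h, if_neg h', if_neg h, if_neg h']
      simp [qHalf_zero]

/-- The braiding of `V ⊗ V` defined with respect to an order of the basis. -/
def braidMat (rk : Fin o.N → ℕ) : o.Mat2 := Matrix.of fun x y =>
  o.tw y.1 y.2 * (if x.1 = y.2 ∧ x.2 = y.1 then 1 else 0) +
  (q - q⁻¹) * (if rk y.1 < rk y.2 then 1 else 0) * (if x.1 = y.1 ∧ x.2 = y.2 then 1 else 0) -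
  (q - q⁻¹) * (if rk y.1 < rk x.2 then 1 else 0) * (o.coef y.1)⁻¹ * o.coef x.2 *
    (if x.1 = x.2.rev ∧ y.2 = y.1.rev then 1 else 0)

theorem braidMat_apply (rk : Fin o.N → ℕ) (d e a c : Fin o.N) : o.braidMat rk (d, e) (a, c) =
    o.tw a c * (if d = c ∧ e = a then 1 else 0) +
    (q - q⁻¹) * (if rk a < rk c then 1 else 0) * (if d = a ∧ e = c then 1 else 0) -
    (q - q⁻¹) * (if rk a < rk e then 1 else 0) * (o.coef a)⁻¹ * o.coef e *
      (if d = e.rev ∧ c = a.rev then 1 else 0) := rfl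

/-! ### Commutation of the braiding with operators that move the basis by one step. -/

theorem mul_kronecker_diagonal_apply (T : o.Mat2) (X : o.Mat) (m : Fin o.N → K) (d e a c : Fin o.N) :
    (T * (X ⊗ₖ Matrix.diagonal m)) (d, e) (a, c) = m c * ∑ x, T (d, e) (x, c) * X x a := by
  rw [Matrix.mul_apply, Fintype.sum_prod_type, Finset.mul_sum]
  refine Finset.sum_congr rfl fun x _ => ?_
  rw [Finset.sum_eq_single c]
  · simp
    ring
  · intro y _ hy
    simp [hy]
  · simp

theorem mul_diagonal_kronecker_apply (T : o.Mat2) (X : o.Mat) (n : Fin o.N → K) (d e a c : Fin o.N) :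
    (T * (Matrix.diagonal n ⊗ₖ X)) (d, e) (a, c) = n a * ∑ y, T (d, e) (a, y) * X y c := by
  rw [Matrix.mul_apply, Fintype.sum_prod_type_right, Finset.mul_sum]
  refine Finset.sum_congr rfl fun x _ => ?_
  rw [Finset.sum_eq_single a]
  · simp
    ring
  · intro y _ hy
    simp [hy]
  · simp

theorem kronecker_diagonal_mul_apply (T : o.Mat2) (X : o.Mat) (m : Fin o.N → K) (d e a c : Fin o.N) :
    ((X ⊗ₖ Matrix.diagonal m) * T) (d, e) (a, c) = m e * ∑ x, X d x * T (x, e) (a, c) := by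
  rw [Matrix.mul_apply, Fintype.sum_prod_type, Finset.mul_sum]
  refine Finset.sum_congr rfl fun x _ => ?_
  rw [Finset.sum_eq_single e]
  · simp
    ring
  · intro y _ hy
    simp [hy.symm]
  · simp

theorem diagonal_kronecker_mul_apply (T : o.Mat2) (X : o.Mat) (n : Fin o.N → K) (d e a c : Fin o.N) :
    ((Matrix.diagonal n ⊗ₖ X) * T) (d, e) (a, c) = n d * ∑ y, X e y * T (d, y) (a, c) := by
  rw [Matrix.mul_apply, Fintype.sum_prod_type_right, Finset.mul_sum]
  refine Finset.sum_congr rfl fun x _ => ?_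
  rw [Finset.sum_eq_single d]
  · simp
    ring
  · intro y _ hy
    simp [hy.symm]
  · simp

theorem braidMat_mul_left (rk : Fin o.N → ℕ) (X : o.Mat) (m : Fin o.N → K) (d e a c : Fin o.N) :
    (o.braidMat rk * (X ⊗ₖ Matrix.diagonal m)) (d, e) (a, c) = m c * (
      (if d = c then 1 else 0) * (o.tw e c * X e a) +
      (q - q⁻¹) * ((if e = c then 1 else 0) * ((if rk d < rk c then 1 else 0) * X d a)) -
      (q - q⁻¹) * ((if d = e.rev then 1 else 0) * ((if rk c.rev < rk e then 1 else 0) * (o.coef c.rev)⁻¹ *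
        o.coef e * X c.rev a))) := by
  rw [mul_kronecker_diagonal_apply]
  congr 1
  simp only [braidMat_apply]
  generalize q - q⁻¹ = C
  simp only [sub_mul, add_mul, Finset.sum_sub_distrib, Finset.sum_add_distrib]
  congr 1
  · congr 1
    · rw [Finset.sum_eq_single e]
      · simp
      · intro x _ hx
        simp [hx.symm]
      · simp
    · rw [Finset.sum_eq_single d]
      · simp only [true_and, and_true, Fin.rev_rev]
        split_ifs <;> ring
      · intro x _ hx
        simp [hx.symm]
      · simp
  · rw [Finset.sum_eq_single c.rev]
    · simp only [true_and, and_true, Fin.rev_rev]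
      split_ifs <;> ring
    · intro x _ hx
      have : ¬ c = x.rev := fun e => hx (by rw [e, Fin.rev_rev])
      simp [this]
    · simp

theorem braidMat_mul_right (rk : Fin o.N → ℕ) (X : o.Mat) (n : Fin o.N → K) (d e a c : Fin o.N) :
    (o.braidMat rk * (Matrix.diagonal n ⊗ₖ X)) (d, e) (a, c) = n a * (
      (if e = a then 1 else 0) * (o.tw a d * X d c) +
      (q - q⁻¹) * ((if d = a then 1 else 0) * ((if rk a < rk e then 1 else 0) * X e c)) -
      (q - q⁻¹) * ((if d = e.rev then 1 else 0) * ((if rk a < rk e then 1 else 0) * (o.coef a)⁻¹ *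
        o.coef e * X a.rev c))) := by
  rw [mul_diagonal_kronecker_apply]
  congr 1
  simp only [braidMat_apply]
  generalize q - q⁻¹ = C
  simp only [sub_mul, add_mul, Finset.sum_sub_distrib, Finset.sum_add_distrib]
  congr 1
  · congr 1
    · rw [Finset.sum_eq_single d]
      · simp only [true_and, and_true, Fin.rev_rev]
        split_ifs <;> ring
      · intro x _ hx
        simp [hx.symm]
      · simp
    · rw [Finset.sum_eq_single e]
      · simp only [true_and, and_true, Fin.rev_rev]
        split_ifs <;> ring
      · intro x _ hx
        simp [hx.symm]
      · simp
  · rw [Finset.sum_eq_single a.rev]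
    · simp only [true_and, and_true, Fin.rev_rev]
      split_ifs <;> ring
    · intro x _ hx
      simp [hx]
    · simp

theorem left_mul_braidMat (rk : Fin o.N → ℕ) (X : o.Mat) (m : Fin o.N → K) (d e a c : Fin o.N) :
    ((X ⊗ₖ Matrix.diagonal m) * o.braidMat rk) (d, e) (a, c) = m e * (
      (if e = a then 1 else 0) * (o.tw a c * X d c) +
      (q - q⁻¹) * ((if e = c then 1 else 0) * ((if rk a < rk c then 1 else 0) * X d a)) -
      (q - q⁻¹) * ((if c = a.rev then 1 else 0) * ((if rk a < rk e then 1 else 0) * (o.coef a)⁻¹ *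
        o.coef e * X d e.rev))) := by
  rw [kronecker_diagonal_mul_apply]
  congr 1
  simp only [braidMat_apply]
  generalize q - q⁻¹ = C
  simp only [mul_sub, mul_add, Finset.sum_sub_distrib, Finset.sum_add_distrib]
  congr 1
  · congr 1
    · rw [Finset.sum_eq_single c]
      · simp only [true_and, and_true, Fin.rev_rev]
        split_ifs <;> ring
      · intro x _ hx
        simp [hx]
      · simp
    · rw [Finset.sum_eq_single a]
      · simp only [true_and, and_true, Fin.rev_rev]
        split_ifs <;> ring
      · intro x _ hx
        simp [hx]
      · simp
  · rw [Finset.sum_eq_single e.rev]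
    · simp only [true_and, and_true, Fin.rev_rev]
      split_ifs <;> ring
    · intro x _ hx
      simp [hx]
    · simp

theorem right_mul_braidMat (rk : Fin o.N → ℕ) (X : o.Mat) (n : Fin o.N → K) (d e a c : Fin o.N) :
    ((Matrix.diagonal n ⊗ₖ X) * o.braidMat rk) (d, e) (a, c) = n d * (
      (if d = c then 1 else 0) * (o.tw a c * X e a) +
      (q - q⁻¹) * ((if d = a then 1 else 0) * ((if rk a < rk c then 1 else 0) * X e c)) -
      (q - q⁻¹) * ((if c = a.rev then 1 else 0) * ((if rk a < rk d.rev then 1 else 0) * (o.coef a)⁻¹ *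
        o.coef d.rev * X e d.rev))) := by
  rw [diagonal_kronecker_mul_apply]
  congr 1
  simp only [braidMat_apply]
  generalize q - q⁻¹ = C
  simp only [mul_sub, mul_add, Finset.sum_sub_distrib, Finset.sum_add_distrib]
  congr 1
  · congr 1
    · rw [Finset.sum_eq_single a]
      · simp only [true_and, and_true, Fin.rev_rev]
        split_ifs <;> ring
      · intro x _ hx
        simp [hx]
      · simp
    · rw [Finset.sum_eq_single c]
      · simp only [true_and, and_true, Fin.rev_rev]
        split_ifs <;> ring
      · intro x _ hx
        simp [hx]
      · simp
  · rw [Finset.sum_eq_single d.rev]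
    · simp only [true_and, and_true, Fin.rev_rev]
      split_ifs <;> ring
    · intro x _ hx
      have : ¬ d = x.rev := fun e => hx (by rw [e, Fin.rev_rev])
      simp [this]
    · simp

/-- A number comparison changes by one when an argument is moved by one step. -/
theorem boole_lt_sub_left {N : ℕ} {rk : Fin N → ℕ} (hrk : Function.Injective rk) {d a : Fin N}
    (h : rk d + 1 = rk a) (c : Fin N) : ((if rk d < rk c then 1 else 0) : K) =
      (if rk a < rk c then 1 else 0) + if c = a then 1 else 0 := by
  by_cases hc : c = a
  · subst hc
    rw [if_pos (by omega), if_neg (by omega), if_pos rfl, zero_add]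
  · have : rk c ≠ rk a := fun e => hc (hrk e)
    rw [if_neg hc, add_zero]
    congr 1
    exact propext ⟨fun _ => by omega, fun _ => by omega⟩

theorem boole_lt_sub_right {N : ℕ} {rk : Fin N → ℕ} (hrk : Function.Injective rk) {d a : Fin N}
    (h : rk d + 1 = rk a) (c : Fin N) : ((if rk c < rk a then 1 else 0) : K) =
      (if rk c < rk d then 1 else 0) + if d = c then 1 else 0 := by
  by_cases hc : d = c
  · subst hc
    rw [if_pos (by omega), if_neg (by omega), if_pos rfl, zero_add]
  · have : rk c ≠ rk d := fun e => hc (hrk e.symm)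
    rw [if_neg hc, add_zero]
    congr 1
    exact propext ⟨fun _ => by omega, fun _ => by omega⟩

/-- Since X moves the rank by exactly one, every comparison of ranks before and after X agrees up to
a Kronecker delta. The flip part commutes by weights, the cup-cap part by invariance of ω and ω*,
and the deltas left over are what `twInv_eq` measures as the difference between the flip scalar and
its inverse. -/
theorem braidMat_comm_raise {rk : Fin o.N → ℕ} (hrk : Function.Injective rk) {X : o.Mat}
    {m n : Fin o.N → K} (hX : ∀ d a, X d a ≠ 0 → rk d + 1 = rk a)
    (hT : ∀ d a, X d a ≠ 0 → ∀ c, m c * o.tw d c = n c * o.tw a c)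
    (hT' : ∀ d a, X d a ≠ 0 → ∀ c, n c * o.twInv d c = m c * o.twInv a c)
    (hω : ∀ d e, m e * X d e.rev * o.coef e + n d * X e d.rev * o.coef d.rev = 0)
    (hω' : ∀ d e, m e * X e.rev d * (o.coef e.rev)⁻¹ + n d * X d.rev e * (o.coef d)⁻¹ = 0) :
    o.braidMat rk * (X ⊗ₖ Matrix.diagonal m + Matrix.diagonal n ⊗ₖ X) =
      (X ⊗ₖ Matrix.diagonal m + Matrix.diagonal n ⊗ₖ X) * o.braidMat rk := by
  ext ⟨d, e⟩ ⟨a, c⟩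
  rw [mul_add, add_mul, Matrix.add_apply, Matrix.add_apply, braidMat_mul_left, braidMat_mul_right,
    left_mul_braidMat, right_mul_braidMat]
  have f1 : (if d = c then 1 else 0) * (m c * (o.tw e c * X e a) - n d * (o.tw a c * X e a)) =
      0 := by
    split_ifs with h
    · subst h
      by_cases hx : X e a = 0
      · simp [hx]
      · linear_combination X e a * hT e a hx d
    · ring
  -- This half of the flip part is written with inverse scalars; replacing them by `twInv_eq` later
  -- supplies the boundary terms of `f3` to `f6`.
  have f2 : (if e = a then 1 else 0) * X d c * (n a * o.twInv a d - m e * o.twInv a c) = 0 := by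
    split_ifs with h
    · subst h
      by_cases hx : X d c = 0
      · simp [hx]
      · have := hT' d c hx e
        rw [twInv_comm, o.twInv_comm c] at this
        linear_combination X d c * this
    · ring
  have s1 : ∀ d a c, X d a * (if rk d < rk c then 1 else 0) =
      X d a * ((if rk a < rk c then 1 else 0) + if c = a then 1 else 0) := by
    intro d a c
    by_cases hx : X d a = 0
    · rw [hx, zero_mul, zero_mul]
    · rw [boole_lt_sub_left hrk (hX d a hx)]
  have s2 : ∀ d a c, X d a * (if rk c < rk a then 1 else 0) =
      X d a * ((if rk c < rk d then 1 else 0) + if d = c then 1 else 0) := by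
    intro d a c
    by_cases hx : X d a = 0
    · rw [hx, zero_mul, zero_mul]
    · rw [boole_lt_sub_right hrk (hX d a hx)]
  -- The step-function terms `f3`, `f4` and the cup-cap terms `f5`, `f6` each collapse to a single
  -- delta, since the bulk cancels by `s1`, `s2` or by invariance.
  have f3 : (if e = c then 1 else 0) * X d a * (m c * (if rk d < rk c then 1 else 0) -
      m e * (if rk a < rk c then 1 else 0)) =
      (if e = a then 1 else 0) * (if c = a then 1 else 0) * X d c * m e := by
    by_cases h : e = c
    · subst h
      have := s1 d a e
      by_cases h' : e = a
      · subst h'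
        rw [if_pos rfl] at this ⊢
        linear_combination m e * this
      · rw [if_neg h'] at this ⊢
        rw [if_pos rfl]
        linear_combination m e * this
    · by_cases h' : e = a
      · rw [if_neg h, if_neg (fun h2 : c = a => h (h'.trans h2.symm))]
        ring
      · rw [if_neg h, if_neg h']
        ring
  have f4 : (if d = a then 1 else 0) * X e c * (n a * (if rk a < rk e then 1 else 0) -
      n d * (if rk a < rk c then 1 else 0)) =
      -((if e = a then 1 else 0) * (if d = a then 1 else 0) * X d c * n a) := by
    by_cases h : d = a
    · subst h
      have := s2 e c d
      by_cases h' : e = d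
      · subst h'
        rw [if_pos rfl] at this ⊢
        linear_combination -n e * this
      · rw [if_neg h'] at this ⊢
        rw [if_pos rfl]
        linear_combination -n d * this
    · rw [if_neg h]
      ring
  have f5 : (if d = e.rev then 1 else 0) * o.coef e *
      (m c * (if rk c.rev < rk e then 1 else 0) * (o.coef c.rev)⁻¹ * X c.rev a +
        n a * (if rk a < rk e then 1 else 0) * (o.coef a)⁻¹ * X a.rev c) =
      -((if e = a then 1 else 0) * (if d = a.rev then 1 else 0) * n a * X d c) := by
    have h1 := s1 c.rev a e
    have h2 := hω' a c
    by_cases h' : e = a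
    · subst h'
      rw [if_pos rfl] at h1 ⊢
      by_cases h : d = e.rev
      · subst h
        rw [if_pos rfl]
        have h3 := inv_mul_cancel₀ (o.coef_ne_zero e)
        rw [if_neg (lt_irrefl (rk e))] at h1 ⊢
        linear_combination o.coef e * m c * (o.coef c.rev)⁻¹ * h1 + o.coef e * h2 -
          n e * X e.rev c * h3
      · rw [if_neg h]
        ring
    · rw [if_neg h'] at h1 ⊢
      linear_combination (if d = e.rev then 1 else 0) * o.coef e * (m c * (o.coef c.rev)⁻¹ * h1 +
        (if rk a < rk e then 1 else 0) * h2)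
  have f6 : (if c = a.rev then 1 else 0) * (o.coef a)⁻¹ *
      (m e * (if rk a < rk e then 1 else 0) * o.coef e * X d e.rev +
        n d * (if rk a < rk d.rev then 1 else 0) * o.coef d.rev * X e d.rev) =
      -((if e = a then 1 else 0) * (if c = a.rev then 1 else 0) * m e * X d c) := by
    have h1 := s2 e d.rev a
    have h2 := hω d e
    by_cases h' : e = a
    · subst h'
      rw [if_pos rfl] at h1 ⊢
      by_cases h : c = e.rev
      · subst h
        rw [if_pos rfl]
        have h3 := inv_mul_cancel₀ (o.coef_ne_zero e)
        rw [if_neg (lt_irrefl (rk e))] at h1 ⊢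
        linear_combination (o.coef e)⁻¹ * n d * o.coef d.rev * h1 + (o.coef e)⁻¹ * h2 -
          m e * X d e.rev * h3
      · rw [if_neg h]
        ring
    · rw [if_neg h'] at h1 ⊢
      linear_combination (if c = a.rev then 1 else 0) * (o.coef a)⁻¹ * (n d * o.coef d.rev * h1 +
        (if rk a < rk e then 1 else 0) * h2)
  rw [twInv_eq, twInv_eq] at f2
  have i1 : (if d = a then q - q⁻¹ else 0) = (q - q⁻¹) * (if d = a then 1 else 0) := by
    rw [mul_ite, mul_one, mul_zero]
  have i2 : (if d = a.rev then q - q⁻¹ else 0) = (q - q⁻¹) * (if d = a.rev then 1 else 0) := by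
    rw [mul_ite, mul_one, mul_zero]
  have i3 : (if c = a then q - q⁻¹ else 0) = (q - q⁻¹) * (if c = a then 1 else 0) := by
    rw [mul_ite, mul_one, mul_zero]
  have i4 : (if c = a.rev then q - q⁻¹ else 0) = (q - q⁻¹) * (if c = a.rev then 1 else 0) := by
    rw [mul_ite, mul_one, mul_zero]
  rw [i1, i2, i3, i4] at f2
  linear_combination f1 + f2 + (q - q⁻¹) * (f3 + f4 - f5 + f6)

/-- This is the mirror image of the raising case: X increases the rank by one, so the boundary terms
have the opposite sign and the inverse scalars enter the other half of the flip part. -/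
theorem braidMat_comm_lower {rk : Fin o.N → ℕ} (hrk : Function.Injective rk) {X : o.Mat}
    {m n : Fin o.N → K} (hX : ∀ d a, X d a ≠ 0 → rk a + 1 = rk d)
    (hT : ∀ d a, X d a ≠ 0 → ∀ c, n c * o.tw d c = m c * o.tw a c)
    (hT' : ∀ d a, X d a ≠ 0 → ∀ c, m c * o.twInv d c = n c * o.twInv a c)
    (hω : ∀ d e, m e * X d e.rev * o.coef e + n d * X e d.rev * o.coef d.rev = 0)
    (hω' : ∀ d e, m e * X e.rev d * (o.coef e.rev)⁻¹ + n d * X d.rev e * (o.coef d)⁻¹ = 0) :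
    o.braidMat rk * (X ⊗ₖ Matrix.diagonal m + Matrix.diagonal n ⊗ₖ X) =
      (X ⊗ₖ Matrix.diagonal m + Matrix.diagonal n ⊗ₖ X) * o.braidMat rk := by
  ext ⟨d, e⟩ ⟨a, c⟩
  rw [mul_add, add_mul, Matrix.add_apply, Matrix.add_apply, braidMat_mul_left, braidMat_mul_right,
    left_mul_braidMat, right_mul_braidMat]
  have f1 : (if d = c then 1 else 0) * X e a * (m c * o.twInv c e - n d * o.twInv c a) =
      0 := by
    split_ifs with h
    · subst h
      by_cases hx : X e a = 0
      · simp [hx]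
      · have := hT' e a hx d
        rw [twInv_comm, o.twInv_comm a] at this
        linear_combination X e a * this
    · ring
  have f2 : (if e = a then 1 else 0) * X d c * (n a * o.tw a d - m e * o.tw a c) = 0 := by
    split_ifs with h
    · subst h
      by_cases hx : X d c = 0
      · simp [hx]
      · have := hT d c hx e
        rw [tw_comm, o.tw_comm c] at this
        linear_combination X d c * this
    · ring
  have s1 : ∀ d a c, X d a * (if rk a < rk c then 1 else 0) =
      X d a * ((if rk d < rk c then 1 else 0) + if c = d then 1 else 0) := by
    intro d a c
    by_cases hx : X d a = 0
    · rw [hx, zero_mul, zero_mul]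
    · rw [boole_lt_sub_left hrk (hX d a hx)]
  have s2 : ∀ d a c, X d a * (if rk c < rk d then 1 else 0) =
      X d a * ((if rk c < rk a then 1 else 0) + if a = c then 1 else 0) := by
    intro d a c
    by_cases hx : X d a = 0
    · rw [hx, zero_mul, zero_mul]
    · rw [boole_lt_sub_right hrk (hX d a hx)]
  have f3 : (if e = c then 1 else 0) * X d a * (m c * (if rk d < rk c then 1 else 0) -
      m e * (if rk a < rk c then 1 else 0)) =
      -((if d = c then 1 else 0) * (if e = c then 1 else 0) * X e a * m c) := by
    by_cases h : e = c
    · subst h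
      have := s1 d a e
      by_cases h' : d = e
      · subst h'
        rw [if_pos rfl] at this ⊢
        linear_combination -m d * this
      · rw [if_neg (fun h2 : e = d => h' h2.symm)] at this
        rw [if_pos rfl, if_neg h']
        linear_combination -m e * this
    · rw [if_neg h]
      ring
  have f4 : (if d = a then 1 else 0) * X e c * (n a * (if rk a < rk e then 1 else 0) -
      n d * (if rk a < rk c then 1 else 0)) =
      (if d = c then 1 else 0) * (if a = c then 1 else 0) * X e a * n d := by
    by_cases h : d = a
    · subst h
      have := s2 e c d
      by_cases h' : d = c
      · subst h'
        rw [if_pos rfl] at this ⊢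
        linear_combination n d * this
      · rw [if_neg (fun h2 : c = d => h' h2.symm)] at this
        rw [if_pos rfl, if_neg h']
        linear_combination n d * this
    · by_cases h' : d = c
      · rw [if_neg h, if_neg (fun h2 : a = c => h (h'.trans h2.symm))]
        ring
      · rw [if_neg h, if_neg h']
        ring
  have f5 : (if d = e.rev then 1 else 0) * o.coef e *
      (m c * (if rk c.rev < rk e then 1 else 0) * (o.coef c.rev)⁻¹ * X c.rev a +
        n a * (if rk a < rk e then 1 else 0) * (o.coef a)⁻¹ * X a.rev c) =
      -((if d = c then 1 else 0) * (if e = c.rev then 1 else 0) * m c * X e a) := by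
    have h1 := s1 c.rev a e
    have h2 := hω' a c
    by_cases h' : e = c.rev
    · subst h'
      rw [if_pos rfl, if_neg (lt_irrefl _)] at h1 ⊢
      rw [Fin.rev_rev]
      have h3 := inv_mul_cancel₀ (o.coef_ne_zero c.rev)
      linear_combination (if d = c then 1 else 0) * o.coef c.rev * (-m c * (o.coef c.rev)⁻¹ * h1 +
        (if rk a < rk c.rev then 1 else 0) * h2) - (if d = c then 1 else 0) * m c * X c.rev a * h3
    · rw [if_neg h'] at h1 ⊢
      linear_combination (if d = e.rev then 1 else 0) * o.coef e * (-m c * (o.coef c.rev)⁻¹ * h1 +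
        (if rk a < rk e then 1 else 0) * h2)
  have f6 : (if c = a.rev then 1 else 0) * (o.coef a)⁻¹ *
      (m e * (if rk a < rk e then 1 else 0) * o.coef e * X d e.rev +
        n d * (if rk a < rk d.rev then 1 else 0) * o.coef d.rev * X e d.rev) =
      -((if d = c then 1 else 0) * (if c = a.rev then 1 else 0) * n d * X e a) := by
    have h1 := s2 e d.rev a
    have h2 := hω d e
    by_cases h : c = a.rev
    · subst h
      rw [if_pos rfl]
      by_cases h' : d = a.rev
      · subst h'
        have h3 := inv_mul_cancel₀ (o.coef_ne_zero a)
        rw [Fin.rev_rev] at *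
        rw [if_pos rfl, if_neg (lt_irrefl (rk a))] at *
        linear_combination -(o.coef a)⁻¹ * n a.rev * o.coef a * h1 + (o.coef a)⁻¹ *
          (if rk a < rk e then 1 else 0) * h2 - n a.rev * X e a * h3
      · rw [if_neg (fun h2 : d.rev = a => h' (by rw [← h2, Fin.rev_rev]))] at h1
        rw [if_neg h']
        linear_combination (o.coef a)⁻¹ * (-n d * o.coef d.rev * h1 +
          (if rk a < rk e then 1 else 0) * h2)
    · rw [if_neg h]
      ring
  rw [twInv_eq, twInv_eq] at f1
  have i1 : (if e = c then q - q⁻¹ else 0) = (q - q⁻¹) * (if e = c then 1 else 0) := by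
    rw [mul_ite, mul_one, mul_zero]
  have i2 : (if e = c.rev then q - q⁻¹ else 0) = (q - q⁻¹) * (if e = c.rev then 1 else 0) := by
    rw [mul_ite, mul_one, mul_zero]
  have i3 : (if a = c then q - q⁻¹ else 0) = (q - q⁻¹) * (if a = c then 1 else 0) := by
    rw [mul_ite, mul_one, mul_zero]
  have i4 : (if a = c.rev then q - q⁻¹ else 0) = (q - q⁻¹) * (if c = a.rev then 1 else 0) := by
    have : (a = c.rev) ↔ (c = a.rev) := by rw [eq_comm, Fin.rev_eq_iff]
    simp only [this, mul_ite, mul_one, mul_zero]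
  rw [i1, i2, i3, i4, o.tw_comm c, o.tw_comm c] at f1
  linear_combination f1 + f2 + (q - q⁻¹) * (f3 + f4 - f5 + f6)

/-- The first factor `x ⊗ q^{-h_i/2}` of the coproduct of a generator. -/
def dLeft (X : o.Mat) (i : ℕ) : o.Mat2 := X ⊗ₖ o.qDiag (-o.hDiag i)

/-- The second factor `q^{h_i/2} ⊗ x` of the coproduct of a generator. -/
def dRight (X : o.Mat) (i : ℕ) : o.Mat2 :=
  (o.qDiag (o.hDiag i) * o.parMat ^ (o.genPar i).val) ⊗ₖ X

/-- The finite braiding `τ R_∞`. -/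
def braid2 : o.Mat2 := o.braidMat fun c => (c : ℕ)

theorem qDiag_mul_parMat_pow_eq (h : Fin o.N → ℤ) (g : ZMod 2) : o.qDiag h * o.parMat ^ g.val =
    Matrix.diagonal fun c => qHalf (h c) * sgn (o.par c * g) := by
  rw [qDiag, parMat_pow, Matrix.diagonal_mul_diagonal]

theorem qDiag_neg_eq (h : Fin o.N → ℤ) : o.qDiag (-h) = Matrix.diagonal fun c => qHalf (-h c) := rfl

theorem kronecker_diagonal_mulVec_omega (X : o.Mat) (m : Fin o.N → K) (d e : Fin o.N) :
    ((X ⊗ₖ Matrix.diagonal m) *ᵥ o.omega) (d, e) = m e * X d e.rev * o.coef e := by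
  rw [kronecker_mulVec_omega, Finset.sum_eq_single e]
  · rw [Matrix.diagonal_apply_eq]
    ring
  · intro c _ hc
    rw [Matrix.diagonal_apply_ne _ hc.symm, mul_zero, zero_mul]
  · simp

theorem diagonal_kronecker_mulVec_omega (X : o.Mat) (n : Fin o.N → K) (d e : Fin o.N) :
    ((Matrix.diagonal n ⊗ₖ X) *ᵥ o.omega) (d, e) = n d * X e d.rev * o.coef d.rev := by
  rw [kronecker_mulVec_omega, Finset.sum_eq_single d.rev]
  · rw [Fin.rev_rev, Matrix.diagonal_apply_eq]
  · intro c _ hc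
    rw [Matrix.diagonal_apply_ne _ (fun h => hc (by rw [h, Fin.rev_rev])), zero_mul, zero_mul]
  · simp

theorem omegaDual_vecMul_kronecker_diagonal (X : o.Mat) (m : Fin o.N → K) (d e : Fin o.N) :
    (o.omegaDual ᵥ* (X ⊗ₖ Matrix.diagonal m)) (d, e) = m e * X e.rev d * (o.coef e.rev)⁻¹ := by
  rw [omegaDual_vecMul_kronecker, Finset.sum_eq_single e.rev]
  · rw [Fin.rev_rev, Matrix.diagonal_apply_eq]
    ring
  · intro c _ hc
    rw [Matrix.diagonal_apply_ne _ (fun h => hc (by rw [← h, Fin.rev_rev])), mul_zero, zero_mul]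
  · simp

theorem omegaDual_vecMul_diagonal_kronecker (X : o.Mat) (n : Fin o.N → K) (d e : Fin o.N) :
    (o.omegaDual ᵥ* (Matrix.diagonal n ⊗ₖ X)) (d, e) = n d * X d.rev e * (o.coef d)⁻¹ := by
  rw [omegaDual_vecMul_kronecker, Finset.sum_eq_single d]
  · rw [Matrix.diagonal_apply_eq]
  · intro c _ hc
    rw [Matrix.diagonal_apply_ne _ hc, zero_mul, zero_mul]
  · simp

theorem tw_weight {a d c : Fin o.N} {h : ℤ} {g : ZMod 2}
    (hw : o.form (o.eps d) (o.eps c) = o.form (o.eps a) (o.eps c) + h) (hp : o.par d = o.par a + g) :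
    qHalf (-h) * o.tw d c = qHalf h * sgn (o.par c * g) * o.tw a c := by
  have h1 := mul_inv_cancel₀ (qHalf_ne_zero h)
  rw [tw, tw, hw, hp, add_mul, sgn_add, mul_add, qHalf_add, two_mul h, qHalf_add, qHalf_neg,
    mul_comm g]
  push_cast
  linear_combination sgn (o.par a * o.par c) * sgn (o.par c * g) *
    qHalf (2 * o.form (o.eps a) (o.eps c)) * qHalf h * h1

theorem twInv_weight {a d c : Fin o.N} {h : ℤ} {g : ZMod 2}
    (hw : o.form (o.eps d) (o.eps c) = o.form (o.eps a) (o.eps c) + h) (hp : o.par d = o.par a + g) :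
    qHalf h * sgn (o.par c * g) * o.twInv d c = qHalf (-h) * o.twInv a c := by
  have h1 := mul_inv_cancel₀ (qHalf_ne_zero h)
  have h2 := sgn_cast_mul_self (o.par c * g)
  rw [twInv, twInv, hw, hp, add_mul, sgn_add, mul_add, neg_add, qHalf_add, two_mul h, neg_add,
    qHalf_add, qHalf_neg h, mul_comm g]
  push_cast
  linear_combination sgn (o.par a * o.par c) * (qHalf h)⁻¹ *
    qHalf (-(2 * o.form (o.eps a) (o.eps c))) * (h2 + sgn (o.par c * g) * sgn (o.par c * g) * h1)

theorem rootMat_cases {a b d c : Fin o.N} (h : o.rootMat a b d c ≠ 0) :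
    (d = a ∧ c = b) ∨ (d = b.rev ∧ c = a.rev) := by
  rw [rootMat_apply] at h
  by_contra! h'
  rw [if_neg (fun e => h'.1 e.1.symm e.2.symm), if_neg (fun e => h'.2 e.1.symm e.2.symm)] at h
  simp at h

/-- The order of the basis in which the two middle vectors are interchanged. -/
def swapRank (c : Fin o.N) : ℕ :=
  if (c : ℕ) + 1 = o.s then o.s else if (c : ℕ) = o.s then o.s - 1 else c

theorem swapRank_injective : Function.Injective o.swapRank := by
  have hs := o.one_le_s
  intro a c h
  unfold swapRank at h
  apply Fin.ext
  split_ifs at h <;> omega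

/-- The two middle even vectors have coefficient 1 in ω. Reversing their order changes the
step-function term and the cup-cap term at the same entries by equal amounts, and these terms enter
with opposite signs. -/
theorem braidMat_swapRank (hN : o.N = 2 * o.s) {u : Fin o.N} (hu : (u : ℕ) + 1 = o.s)
    (hp : o.par u = 0) : o.braidMat o.swapRank = o.braid2 := by
  have hru : (u.rev : ℕ) = o.s := by rw [Fin.val_rev]; omega
  have hc : o.coef u = 1 := by
    have hlt : u < u.rev := by rw [Fin.lt_def]; omega
    rw [coef, rhoEps_of_lt o hlt, between_last o (by omega), hp, o.theta_even u hp]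
    simp [qHalf_zero]
  have hc' : o.coef u.rev = 1 := by rw [coef_rev, hc, hp]; simp
  ext ⟨d, e⟩ ⟨a, c⟩
  rw [braid2, braidMat_apply, braidMat_apply]
  by_cases h1 : a = u
  · subst h1
    -- After the swap, the comparison with the first middle vector changes only at the second one.
    have key : ∀ x, (if o.swapRank a < o.swapRank x then (1 : K) else 0) =
        (if (a : ℕ) < x then 1 else 0) - if x = a.rev then 1 else 0 := by
      intro x
      by_cases hx : x = a.rev
      · subst hx
        rw [if_pos rfl, if_neg, if_pos (by omega), sub_self]
        unfold swapRank
        rw [if_pos hu, if_neg (by omega), if_pos hru]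
        omega
      · have hx' : (x : ℕ) ≠ o.s := fun e => hx (Fin.ext (e.trans hru.symm))
        rw [if_neg hx, sub_zero]
        congr 1
        unfold swapRank
        rw [if_pos hu]
        exact propext ⟨fun h => by split_ifs at h <;> omega, fun h => by split_ifs <;> omega⟩
    rw [key, key, hc]
    by_cases h2 : c = a.rev
    · subst h2
      by_cases h3 : e = a.rev
      · subst h3
        rw [hc', Fin.rev_rev]
        simp only [and_true, if_true, true_and]
        ring
      · rw [if_neg h3]
        simp [h3]
    · rw [if_neg h2]
      simp [h2]
  · by_cases h1' : a = u.rev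
    · subst h1'
      have key : ∀ x, (if o.swapRank u.rev < o.swapRank x then (1 : K) else 0) =
          (if (u.rev : ℕ) < x then 1 else 0) + if x = u then 1 else 0 := by
        intro x
        by_cases hx : x = u
        · subst hx
          rw [if_pos rfl, if_pos, if_neg (by omega), zero_add]
          unfold swapRank
          rw [if_pos hu, if_neg (by omega), if_pos hru]
          omega
        · have hx' : (x : ℕ) + 1 ≠ o.s := fun e => hx (Fin.ext (by omega))
          rw [if_neg hx, add_zero]
          congr 1
          unfold swapRank
          rw [if_neg (show ¬ (u.rev : ℕ) + 1 = o.s by omega), if_pos hru, if_neg hx']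
          exact propext ⟨fun h => by split_ifs at h <;> omega, fun h => by split_ifs <;> omega⟩
      rw [key, key, hc', Fin.rev_rev]
      by_cases h2 : c = u
      · subst h2
        by_cases h3 : e = c
        · subst h3
          rw [hc]
          simp only [and_true, if_true, true_and]
          ring
        · rw [if_neg h3]
          simp [h3]
      · rw [if_neg h2]
        simp [h2]
    · have key : ∀ x, (if o.swapRank a < o.swapRank x then (1 : K) else 0) =
          (if (a : ℕ) < x then 1 else 0) := by
        intro x
        have ha : (a : ℕ) + 1 ≠ o.s := fun e => h1 (Fin.ext (by omega))
        have ha' : (a : ℕ) ≠ o.s := fun e => h1' (Fin.ext (by omega))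
        congr 1
        unfold swapRank
        rw [if_neg ha, if_neg ha']
        exact propext ⟨fun h => by split_ifs at h <;> omega, fun h => by split_ifs <;> omega⟩
      rw [key, key]

/-- The generators of positive degree change the position of a basis vector by one step, in a
suitable order of the basis that defines the same braiding. -/
theorem exists_rank {i : ℕ} (h0 : 0 < i) (hi : i ≤ o.s) : ∃ rk : Fin o.N → ℕ,
    Function.Injective rk ∧ o.braidMat rk = o.braid2 ∧ rk (o.tgt i) + 1 = rk (o.src i) ∧
      rk (o.src i).rev + 1 = rk (o.tgt i).rev := by
  have hN := o.two_lt
  have h1 := o.two_s_le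
  have h2 := o.le_two_s_add_one
  have hs := o.one_le_s
  by_cases hcase : (o.src i : ℕ) = o.tgt i + 1
  -- For adjacent source and target the natural order works; the only other generator is the one at
  -- a forked end.
  · refine ⟨fun c => c, Fin.val_injective, rfl, hcase.symm, ?_⟩
    have := (o.src i).2
    simp only [Fin.val_rev]
    omega
  · obtain ⟨h3, h4, h5, h6⟩ : o.N = 2 * o.s ∧ o.par (o.src i) = 0 ∧ (o.tgt i : ℕ) = o.s - 2 ∧
        (o.src i : ℕ) = o.s := by
      rcases o.pair_cases hi with c | c | c | c | c | c
      · omega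
      · omega
      · omega
      · omega
      · exact ⟨c.2.1, c.2.2.2.1, c.2.2.2.2⟩
      · omega
    have h7 : 2 ≤ o.s := by omega
    -- The forked generator jumps from s - 2 to s, which becomes one step once the two middle
    -- vectors are interchanged.
    refine ⟨o.swapRank, o.swapRank_injective,
      o.braidMat_swapRank h3 (u := (o.src i).rev) (by rw [Fin.val_rev]; omega)
        (by rw [par_rev, h4]), ?_, ?_⟩ <;>
    · simp only [swapRank, Fin.val_rev, h5, h6]
      split_ifs <;> omega

/-! ### Invariance of the finite braiding under the generators of the finite algebra. -/

theorem rootMat_form {a b d c : Fin o.N} (h : o.rootMat a b d c ≠ 0) (x : Fin o.N) :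
    o.form (o.eps d) (o.eps x) = o.form (o.eps c) (o.eps x) +
      (o.form (o.eps a) (o.eps x) - o.form (o.eps b) (o.eps x)) := by
  rw [o.mem_weight h, form_add_left, form_sub_left]

theorem hDiag_eq_form_sub (i : ℕ) (c : Fin o.N) : o.hDiag i c =
    o.form (o.eps (o.tgt i)) (o.eps c) - o.form (o.eps (o.src i)) (o.eps c) := by
  rw [hDiag_eq_form, simpleRoot_eq, form_sub_left]

theorem pair_mulVec_omega_apply {a b : Fin o.N} {h : Fin o.N → ℤ} (hh : ∀ c, h c.rev = -h c) {z : K}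
    (hz : z = qHalf (o.rhoEps a - o.rhoEps b - (h a - h b))) (d e : Fin o.N) :
    qHalf (-h e) * o.rootMat a b d e.rev * o.coef e +
      z * (qHalf (h d) * sgn (o.par d * (o.par a + o.par b)) * o.rootMat a b e d.rev *
        o.coef d.rev) = 0 := by
  have := congrFun (o.pair_mulVec_omega hh hz) (d, e)
  rwa [qDiag_neg_eq, qDiag_mul_parMat_pow_eq, Pi.add_apply, Pi.smul_apply,
    kronecker_diagonal_mulVec_omega, diagonal_kronecker_mulVec_omega] at this

theorem pair_vecMul_omegaDual_apply {a b : Fin o.N} {h : Fin o.N → ℤ} (hh : ∀ c, h c.rev = -h c)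
    {z : K} (hz : z = qHalf (h a - h b - (o.rhoEps a - o.rhoEps b))) (d e : Fin o.N) :
    qHalf (-h e) * o.rootMat a b e.rev d * (o.coef e.rev)⁻¹ +
      z * (qHalf (h d) * sgn (o.par d * (o.par a + o.par b)) * o.rootMat a b d.rev e *
        (o.coef d)⁻¹) = 0 := by
  have := congrFun (o.pair_vecMul_omegaDual hh hz) (d, e)
  rwa [qDiag_neg_eq, qDiag_mul_parMat_pow_eq, Pi.add_apply, Pi.smul_apply,
    omegaDual_vecMul_kronecker_diagonal, omegaDual_vecMul_diagonal_kronecker] at this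

theorem braid2_comm_rootMat_raise {i : ℕ} (h0 : 0 < i) (hi : i ≤ o.s) :
    Commute o.braid2 (o.dLeft (o.rootMat (o.tgt i) (o.src i)) i +
      o.dRight (o.rootMat (o.tgt i) (o.src i)) i) := by
  obtain ⟨rk, hrk, hT, hr1, hr2⟩ := o.exists_rank h0 hi
  have hz : o.rhoEps (o.tgt i) - o.rhoEps (o.src i) -
      (o.hDiag i (o.tgt i) - o.hDiag i (o.src i)) = 0 := by
    rw [← cartan_eq_hDiag, rhoEps_simple o h0 hi, sub_self]
  have hw : ∀ d a, o.rootMat (o.tgt i) (o.src i) d a ≠ 0 → ∀ c,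
      o.form (o.eps d) (o.eps c) = o.form (o.eps a) (o.eps c) + o.hDiag i c := fun d a h c => by
    rw [o.rootMat_form h, hDiag_eq_form_sub]
  have hp : ∀ d a, o.rootMat (o.tgt i) (o.src i) d a ≠ 0 → o.par d = o.par a + o.genPar i :=
    fun d a h => by rw [o.mem_parity h, genPar_eq]
  rw [← hT, dLeft, dRight, qDiag_neg_eq, qDiag_mul_parMat_pow_eq]
  refine o.braidMat_comm_raise hrk ?_ (fun d a h c => o.tw_weight (hw d a h c) (hp d a h))
    (fun d a h c => o.twInv_weight (hw d a h c) (hp d a h)) (fun d e => ?_) (fun d e => ?_)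
  · intro d a h
    rcases o.rootMat_cases h with ⟨rfl, rfl⟩ | ⟨rfl, rfl⟩
    exacts [hr1, hr2]
  · have := o.pair_mulVec_omega_apply (o.hDiag_rev i) (z := 1) (a := o.tgt i) (b := o.src i)
      (by rw [hz, qHalf_zero]) d e
    rwa [one_mul, ← genPar_eq] at this
  · have := o.pair_vecMul_omegaDual_apply (o.hDiag_rev i) (z := 1) (a := o.tgt i) (b := o.src i)
      (by rw [← neg_sub, hz, neg_zero, qHalf_zero]) d e
    rwa [one_mul, ← genPar_eq] at this

theorem braid2_comm_rootMat_lower {i : ℕ} (h0 : 0 < i) (hi : i ≤ o.s) :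
    Commute o.braid2 (o.dLeft (o.rootMat (o.src i) (o.tgt i)) i +
      o.dRight (o.rootMat (o.src i) (o.tgt i)) i) := by
  obtain ⟨rk, hrk, hT, hr1, hr2⟩ := o.exists_rank h0 hi
  have hz : o.rhoEps (o.src i) - o.rhoEps (o.tgt i) -
      (o.hDiag i (o.src i) - o.hDiag i (o.tgt i)) = 0 := by
    have := o.rhoEps_simple h0 hi
    rw [cartan_eq_hDiag] at this
    linarith
  have hg : o.par (o.src i) + o.par (o.tgt i) = o.genPar i := by rw [genPar_eq, add_comm]
  have hw : ∀ d a, o.rootMat (o.src i) (o.tgt i) d a ≠ 0 → ∀ c,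
      o.form (o.eps a) (o.eps c) = o.form (o.eps d) (o.eps c) + o.hDiag i c := fun d a h c => by
    rw [o.rootMat_form h, hDiag_eq_form_sub]
    ring
  have hp : ∀ d a, o.rootMat (o.src i) (o.tgt i) d a ≠ 0 → o.par a = o.par d + o.genPar i :=
    fun d a h => by
      rw [o.mem_parity h, hg, add_assoc, zmod_two_self_add, add_zero]
  rw [← hT, dLeft, dRight, qDiag_neg_eq, qDiag_mul_parMat_pow_eq]
  refine o.braidMat_comm_lower hrk ?_ (fun d a h c => (o.tw_weight (hw d a h c) (hp d a h)).symm)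
    (fun d a h c => (o.twInv_weight (hw d a h c) (hp d a h)).symm) (fun d e => ?_) (fun d e => ?_)
  · intro d a h
    rcases o.rootMat_cases h with ⟨rfl, rfl⟩ | ⟨rfl, rfl⟩
    exacts [hr1, hr2]
  · have := o.pair_mulVec_omega_apply (o.hDiag_rev i) (z := 1) (a := o.src i) (b := o.tgt i)
      (by rw [hz, qHalf_zero]) d e
    rwa [one_mul, hg] at this
  · have := o.pair_vecMul_omegaDual_apply (o.hDiag_rev i) (z := 1) (a := o.src i) (b := o.tgt i)
      (by rw [← neg_sub, hz, neg_zero, qHalf_zero]) d e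
    rwa [one_mul, hg] at this

theorem dLeft_smul (x : K) (X : o.Mat) (i : ℕ) : o.dLeft (x • X) i = x • o.dLeft X i :=
  Matrix.smul_kronecker _ _ _

theorem dRight_smul (x : K) (X : o.Mat) (i : ℕ) : o.dRight (x • X) i = x • o.dRight X i :=
  Matrix.kronecker_smul _ _ _

theorem braid2_comm_eMat (a : K) {i : ℕ} (h0 : 0 < i) (hi : i ≤ o.s) :
    Commute o.braid2 (o.dLeft (o.eMat a i) i + o.dRight (o.eMat a i) i) := by
  rw [eMat, dLeft_smul, dRight_smul, ← smul_add]
  exact (o.braid2_comm_rootMat_raise h0 hi).smul_right _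

theorem braid2_comm_fMat (b : K) {i : ℕ} (h0 : 0 < i) (hi : i ≤ o.s) :
    Commute o.braid2 (o.dLeft (o.fMat b i) i + o.dRight (o.fMat b i) i) := by
  rw [fMat, dLeft_smul, dRight_smul, ← smul_add]
  exact (o.braid2_comm_rootMat_lower h0 hi).smul_right _

/-! ### The affine generators and the finite braiding -/

theorem src_zero_val : (o.src 0 : ℕ) = 0 := by
  rcases o.pair_cases (i := 0) (Nat.zero_le _) with h | h | h | h | h | h <;>
    have := o.one_le_s <;> omega

theorem tgt_zero_cases : (o.par (o.src 0) = 0 ∧ (o.tgt 0 : ℕ) = o.N - 2) ∨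
    (o.tgt 0 : ℕ) = o.N - 1 := by
  have := o.one_le_s
  rcases o.pair_cases (i := 0) (Nat.zero_le _) with h | h | h | h | h | h
  · exact Or.inl ⟨h.2.1, h.2.2.2⟩
  · exact Or.inr h.2.2.2
  all_goals omega

/-- In this case α_0 restricts to -(ε_1 + ε_2), while α_1 = ε_1 - ε_2. The claim is (2ρ, α_1) =
(α_1, α_1) together with (α_1, α_1) = (α_0, α_0), since ε_1 and ε_2 are orthogonal. -/
theorem rhoEps_src_add_tgt_zero (ht : (o.tgt 0 : ℕ) = o.N - 2) :
    o.rhoEps (o.src 0) + o.rhoEps (o.tgt 0) = o.cartan 0 0 := by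
  have hN := o.two_lt
  have hs := o.one_le_s
  have h1 := o.two_s_le
  have h2 := o.le_two_s_add_one
  have h3 : (o.tgt 1 : ℕ) = 0 ∧ (o.src 1 : ℕ) = 1 := by
    rcases o.pair_cases hs with h | h | h | h | h | h <;> omega
  have e1 : o.tgt 1 = o.src 0 := Fin.ext (by rw [h3.1, src_zero_val])
  have e2 : (o.src 1) = (o.tgt 0).rev := Fin.ext (by rw [h3.2, Fin.val_rev]; omega)
  have h4 := o.rhoEps_simple one_pos hs
  have h5 : o.form (o.eps (o.src 0)) (o.eps (o.tgt 0)) = 0 := by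
    have h6 := o.src_zero_val
    have n1 : o.tgt 0 ≠ o.src 0 := fun e => by rw [e] at ht; omega
    have n2 : o.tgt 0 ≠ (o.src 0).rev := fun e => by
      rw [e, Fin.val_rev] at ht
      omega
    rw [form_eps_eps, xDiag, if_neg n1, if_neg n2]
    simp
  have h5' := o.form_comm (o.eps (o.src 0)) (o.eps (o.tgt 0))
  rw [e1, e2, rhoEps_rev, cartan, simpleRoot_eq, e1, e2, eps_rev] at h4
  rw [cartan, simpleRoot_eq]
  simp only [sub_neg_eq_add, form_add_left, form_add_right, form_sub_left, form_sub_right] at h4 ⊢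
  linarith

theorem coef_mul_self (i : Fin o.N) : o.coef i * o.coef i = qHalf (2 * o.rhoEps i) := by
  have h1 : (o.theta i * o.theta i : K) = 1 := by exact_mod_cast o.theta_mul_self i
  rw [coef, two_mul, qHalf_add]
  linear_combination qHalf (o.rhoEps i) * qHalf (o.rhoEps i) * (sgn_cast_mul_self (o.par i) *
    (o.theta i * o.theta i) + h1)

theorem boole_mul_eq_zero {P : Prop} [Decidable P] {x : K} (h : P → x = 0) :
    (if P then (1 : K) else 0) * x = 0 := by
  split_ifs with hp
  · rw [h hp, mul_zero]
  · rw [zero_mul]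

theorem rootMat_eq_zero {a b d c : Fin o.N} (h1 : d = a → c = b → False)
    (h2 : d = b.rev → c = a.rev → False) : o.rootMat a b d c = 0 := by
  by_contra h
  rcases o.rootMat_cases h with h' | h'
  exacts [h1 h'.1 h'.2, h2 h'.1 h'.2]

/-- This is one entry of the invariance of ω* under the pair of α_0, with the exponent rewritten
through (2ρ, ε_1). It balances the corner entries that remain in the exchange with T. -/
theorem affine_raise_identity (ht : (o.tgt 0 : ℕ) = o.N - 2) :
    qHalf (o.hDiag 0 (o.tgt 0)) * o.rootMat (o.tgt 0) (o.src 0) (o.tgt 0) (o.src 0) *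
        (o.coef (o.tgt 0))⁻¹ + qHalf (2 * o.rhoEps (o.src 0)) *
      (qHalf (o.hDiag 0 (o.src 0)) * sgn (o.par (o.src 0) * o.genPar 0) *
        o.rootMat (o.tgt 0) (o.src 0) (o.src 0).rev (o.tgt 0).rev * (o.coef (o.src 0))⁻¹) = 0 := by
  have h1 := o.pair_vecMul_omegaDual_apply (o.hDiag_rev 0) (a := o.tgt 0) (b := o.src 0)
    rfl (o.src 0) (o.tgt 0).rev
  rw [← cartan_eq_hDiag, ← rhoEps_src_add_tgt_zero o ht, hDiag_rev, neg_neg, Fin.rev_rev,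
    ← genPar_eq, show ∀ x y : ℤ, x + y - (y - x) = 2 * x from fun x y => by ring] at h1
  exact h1

theorem affine_lower_identity (ht : (o.tgt 0 : ℕ) = o.N - 2) :
    qHalf (o.hDiag 0 (o.src 0)) * o.rootMat (o.src 0) (o.tgt 0) (o.src 0) (o.tgt 0) *
        (o.coef (o.src 0))⁻¹ + qHalf (-(2 * o.rhoEps (o.src 0))) *
      (qHalf (o.hDiag 0 (o.tgt 0)) * sgn (o.par (o.tgt 0) * o.genPar 0) *
        o.rootMat (o.src 0) (o.tgt 0) (o.tgt 0).rev (o.src 0).rev * (o.coef (o.tgt 0))⁻¹) = 0 := by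
  have h1 := o.pair_vecMul_omegaDual_apply (o.hDiag_rev 0) (a := o.src 0) (b := o.tgt 0)
    rfl (o.tgt 0) (o.src 0).rev
  have h2 := o.rhoEps_src_add_tgt_zero ht
  rw [cartan_eq_hDiag] at h2
  rw [hDiag_rev, neg_neg, Fin.rev_rev, add_comm (o.par (o.src 0)), ← genPar_eq,
    show o.hDiag 0 (o.src 0) - o.hDiag 0 (o.tgt 0) - (o.rhoEps (o.src 0) - o.rhoEps (o.tgt 0)) =
      -(2 * o.rhoEps (o.src 0)) by linarith] at h1
  exact h1

theorem affine_scalars (ht : (o.tgt 0 : ℕ) = o.N - 2) (hp : o.par (o.src 0) = 0) :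
    o.coef (o.src 0).rev = (o.coef (o.src 0))⁻¹ ∧
    sgn (o.par (o.tgt 0) * o.genPar 0) * o.coef (o.tgt 0).rev = (o.coef (o.tgt 0))⁻¹ ∧
    (sgn (o.par (o.tgt 0) * o.genPar 0) : K) = sgn (o.par (o.tgt 0)) ∧
    (sgn (o.par (o.src 0) * o.genPar 0) : K) = 1 ∧
    qHalf (2 * o.rhoEps (o.src 0)) = o.coef (o.src 0) * o.coef (o.src 0) ∧
    qHalf (o.hDiag 0 (o.tgt 0)) * qHalf (o.hDiag 0 (o.tgt 0)) =
      qHalf (o.hDiag 0 (o.src 0)) * qHalf (o.hDiag 0 (o.src 0)) *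
        (o.coef (o.tgt 0) * o.coef (o.tgt 0) * (o.coef (o.src 0) * o.coef (o.src 0))) := by
  have h2 := o.rhoEps_src_add_tgt_zero ht
  rw [cartan_eq_hDiag] at h2
  have h3 : (sgn (o.par (o.tgt 0) * o.genPar 0) : K) = sgn (o.par (o.tgt 0)) := by
    rw [genPar_eq, hp, add_zero]
    rcases zmod_two_cases (o.par (o.tgt 0)) with h | h <;> rw [h] <;> simp
  refine ⟨?_, ?_, h3, ?_, (o.coef_mul_self _).symm, ?_⟩
  · rw [coef_rev, hp, sgn_zero, Int.cast_one, one_mul]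
  · rw [h3, coef_rev, ← mul_assoc, sgn_cast_mul_self, one_mul]
  · rw [hp, zero_mul, sgn_zero, Int.cast_one]
  · rw [coef_mul_self, coef_mul_self]
    simp only [← qHalf_add]
    congr 1
    linarith

theorem rootMat_weights_raise (i : ℕ) (d a : Fin o.N)
    (h : o.rootMat (o.tgt i) (o.src i) d a ≠ 0) (c : Fin o.N) :
    qHalf (-o.hDiag i c) * o.tw d c = qHalf (o.hDiag i c) * sgn (o.par c * o.genPar i) * o.tw a c :=
  o.tw_weight (by rw [o.rootMat_form h, hDiag_eq_form_sub]) (by rw [o.mem_parity h, genPar_eq])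

theorem rootMat_weights_lower (i : ℕ) (d a : Fin o.N)
    (h : o.rootMat (o.src i) (o.tgt i) d a ≠ 0) (c : Fin o.N) :
    qHalf (-o.hDiag i c) * o.tw a c = qHalf (o.hDiag i c) * sgn (o.par c * o.genPar i) * o.tw d c :=
  o.tw_weight (by rw [o.rootMat_form h, hDiag_eq_form_sub]; ring) (by
    rw [o.mem_parity h, genPar_eq, add_comm (o.par (o.tgt i)), add_assoc, zmod_two_self_add,
      add_zero])

/-- The affine generator moves between the two ends of the basis, so T exchanges one half of its
coproduct with the other instead of commuting with the sum. The flip part matches by weights. The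
other terms involve comparisons that fail at the ends of the basis, apart from corner entries which
cancel in pairs. -/
theorem braid2_mul_dLeft_zero : o.braid2 * o.dLeft (o.rootMat (o.tgt 0) (o.src 0)) 0 =
    o.dRight (o.rootMat (o.tgt 0) (o.src 0)) 0 * o.braid2 := by
  have hN := o.two_lt
  have hr := o.src_zero_val
  ext ⟨d, e⟩ ⟨a, c⟩
  rw [dLeft, dRight, qDiag_neg_eq, qDiag_mul_parMat_pow_eq, braid2, braidMat_mul_left,
    right_mul_braidMat]
  have hp := o.tgt_zero_cases
  have hlt := fun x : Fin o.N => x.2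
  have t1 : (if d = c then (1 : K) else 0) * ((qHalf (-o.hDiag 0 c) * o.tw e c -
      qHalf (o.hDiag 0 d) * sgn (o.par d * o.genPar 0) * o.tw a c) *
      o.rootMat (o.tgt 0) (o.src 0) e a) = 0 := by
    refine boole_mul_eq_zero fun h => ?_
    subst h
    by_cases hX : o.rootMat (o.tgt 0) (o.src 0) e a = 0
    · rw [hX, mul_zero]
    · rw [o.rootMat_weights_raise 0 e a hX, sub_self, zero_mul]
  have t2 : qHalf (-o.hDiag 0 c) * ((if e = c then (1 : K) else 0) *
      ((if (d : ℕ) < c then 1 else 0) * o.rootMat (o.tgt 0) (o.src 0) d a)) +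
      qHalf (o.hDiag 0 d) * sgn (o.par d * o.genPar 0) * ((if c = a.rev then 1 else 0) *
        ((if (a : ℕ) < d.rev then 1 else 0) * ((o.coef a)⁻¹ * o.coef d.rev *
          o.rootMat (o.tgt 0) (o.src 0) e d.rev))) = 0 := by
    -- The only quadruple of indices at which the comparisons hold. For an odd first vector α_0
    -- joins the extreme positions and there is none.
    by_cases hc : (o.par (o.src 0) = 0 ∧ (o.tgt 0 : ℕ) = o.N - 2) ∧ d = o.tgt 0 ∧
        e = (o.src 0).rev ∧ a = o.src 0 ∧ c = (o.src 0).rev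
    · obtain ⟨⟨h1, h2⟩, rfl, rfl, rfl, rfl⟩ := hc
      simp only [if_true]
      rw [if_pos (by rw [Fin.val_rev]; omega), if_pos (by rw [Fin.val_rev]; omega)]
      obtain ⟨_, s2, s3, s4, s5, s6⟩ := o.affine_scalars h2 h1
      have hid := o.affine_raise_identity h2
      rw [hDiag_rev, neg_neg]
      rw [s4, s5] at hid
      have hP := o.coef_ne_zero (o.tgt 0)
      have hR := o.coef_ne_zero (o.src 0)
      have hA := qHalf_ne_zero (o.hDiag 0 (o.tgt 0))
      have hB := qHalf_ne_zero (o.hDiag 0 (o.src 0))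
      generalize qHalf (o.hDiag 0 (o.tgt 0)) = A at *
      generalize qHalf (o.hDiag 0 (o.src 0)) = B at *
      generalize o.coef (o.tgt 0).rev = P' at *
      generalize (sgn (o.par (o.tgt 0) * o.genPar 0) : K) = σ at *
      generalize o.coef (o.tgt 0) = P at *
      generalize o.coef (o.src 0) = R at *
      generalize o.rootMat (o.tgt 0) (o.src 0) (o.src 0).rev (o.tgt 0).rev = y at *
      generalize o.rootMat (o.tgt 0) (o.src 0) (o.tgt 0) (o.src 0) = x at *
      -- The needed identity follows from `affine_raise_identity` after multiplying by the nonzero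
      -- `A` and trading A² for B²P²R² by `s6`.
      have e1 : B * x + A * y * R⁻¹ * P⁻¹ = 0 := by
        field_simp at hid ⊢
        have : A * (B * x * P * R + A * y) = 0 := by linear_combination B * P * R * hid + y * s6
        linear_combination (mul_eq_zero.1 this).resolve_left hA
      linear_combination e1 + A * y * R⁻¹ * s2
    · have z1 : (if e = c then (1 : K) else 0) *
          ((if (d : ℕ) < c then 1 else 0) * o.rootMat (o.tgt 0) (o.src 0) d a) = 0 := by
        refine boole_mul_eq_zero fun h1 => boole_mul_eq_zero fun h2 => o.rootMat_eq_zero ?_ ?_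
        · rintro rfl rfl
          have := hlt c
          have hcr : c = (o.src 0).rev := Fin.ext (by rw [Fin.val_rev]; omega)
          rcases hp with hp | hp
          · exact hc ⟨hp, rfl, h1.trans hcr, rfl, hcr⟩
          · omega
        · rintro rfl rfl
          have := hlt c
          rw [Fin.val_rev] at h2
          omega
      have z2 : (if c = a.rev then (1 : K) else 0) *
        ((if (a : ℕ) < d.rev then 1 else 0) * ((o.coef a)⁻¹ * o.coef d.rev *
          o.rootMat (o.tgt 0) (o.src 0) e d.rev)) = 0 := by
        refine boole_mul_eq_zero fun h1 => boole_mul_eq_zero fun h2 => ?_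
        rw [o.rootMat_eq_zero, mul_zero]
        · intro _ h3
          rw [h3] at h2
          omega
        · intro h3 h4
          rw [h4, Fin.val_rev] at h2
          have := hlt (o.tgt 0)
          have hcr : a = o.src 0 := Fin.ext (by omega)
          rcases hp with hp | hp
          · exact hc ⟨hp, Fin.rev_inj.1 h4, h3, hcr, by rw [h1, hcr]⟩
          · omega
      rw [z1, z2, mul_zero, mul_zero, add_zero]
  have t3 : qHalf (-o.hDiag 0 c) * ((if d = e.rev then (1 : K) else 0) *
      ((if (c.rev : ℕ) < e then 1 else 0) * ((o.coef c.rev)⁻¹ * o.coef e *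
        o.rootMat (o.tgt 0) (o.src 0) c.rev a))) +
      qHalf (o.hDiag 0 d) * sgn (o.par d * o.genPar 0) * ((if d = a then 1 else 0) *
        ((if (a : ℕ) < c then 1 else 0) * o.rootMat (o.tgt 0) (o.src 0) e c)) = 0 := by
    by_cases hc : (o.par (o.src 0) = 0 ∧ (o.tgt 0 : ℕ) = o.N - 2) ∧ d = o.src 0 ∧
        e = (o.src 0).rev ∧ a = o.src 0 ∧ c = (o.tgt 0).rev
    · obtain ⟨⟨h1, h2⟩, rfl, rfl, rfl, rfl⟩ := hc
      simp only [Fin.rev_rev, if_true]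
      rw [if_pos (by rw [Fin.val_rev]; omega), if_pos (by rw [Fin.val_rev]; omega)]
      obtain ⟨s1, _, _, s4, s5, _⟩ := o.affine_scalars h2 h1
      have hid := o.affine_raise_identity h2
      rw [hDiag_rev, neg_neg, s1, s4]
      rw [s4, s5] at hid
      have hR := mul_inv_cancel₀ (o.coef_ne_zero (o.src 0))
      linear_combination (o.coef (o.src 0))⁻¹ * hid - qHalf (o.hDiag 0 (o.src 0)) *
        o.rootMat (o.tgt 0) (o.src 0) (o.src 0).rev (o.tgt 0).rev *
          (o.coef (o.src 0) * (o.coef (o.src 0))⁻¹ + 1) * hR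
    · have z1 : (if d = e.rev then (1 : K) else 0) *
          ((if (c.rev : ℕ) < e then 1 else 0) * ((o.coef c.rev)⁻¹ * o.coef e *
            o.rootMat (o.tgt 0) (o.src 0) c.rev a)) = 0 := by
        refine boole_mul_eq_zero fun h1 => boole_mul_eq_zero fun h2 => ?_
        rw [o.rootMat_eq_zero, mul_zero]
        · intro h3 h4
          have := hlt e
          rw [h3] at h2
          have hcr : e = (o.src 0).rev := Fin.ext (by rw [Fin.val_rev]; omega)
          rcases hp with hp | hp
          · exact hc ⟨hp, by rw [h1, hcr, Fin.rev_rev], hcr, h4, by rw [← h3, Fin.rev_rev]⟩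
          · omega
        · intro h3 h4
          have := hlt e
          rw [h3, Fin.val_rev] at h2
          omega
      have z2 : (if d = a then (1 : K) else 0) *
          ((if (a : ℕ) < c then 1 else 0) * o.rootMat (o.tgt 0) (o.src 0) e c) = 0 := by
        refine boole_mul_eq_zero fun h1 => boole_mul_eq_zero fun h2 => o.rootMat_eq_zero ?_ ?_
        · rintro rfl rfl
          omega
        · rintro rfl rfl
          rw [Fin.val_rev] at h2
          have := hlt (o.tgt 0)
          have hcr : a = o.src 0 := Fin.ext (by omega)
          rcases hp with hp | hp
          · exact hc ⟨hp, h1.trans hcr, rfl, hcr, rfl⟩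
          · omega
      rw [z1, z2, mul_zero, mul_zero, add_zero]
  linear_combination t1 + (q - q⁻¹) * t2 - (q - q⁻¹) * t3

/-- For f_0 the two halves of the coproduct change roles, and the corner entries cancel by
`affine_lower_identity`. -/
theorem dLeft_mul_braid2_zero : o.braid2 * o.dRight (o.rootMat (o.src 0) (o.tgt 0)) 0 =
    o.dLeft (o.rootMat (o.src 0) (o.tgt 0)) 0 * o.braid2 := by
  have hN := o.two_lt
  have hr := o.src_zero_val
  ext ⟨d, e⟩ ⟨a, c⟩
  rw [dLeft, dRight, qDiag_neg_eq, qDiag_mul_parMat_pow_eq, braid2, braidMat_mul_right,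
    left_mul_braidMat]
  have hp := o.tgt_zero_cases
  have hlt := fun x : Fin o.N => x.2
  have t1 : (if e = a then (1 : K) else 0) * ((qHalf (o.hDiag 0 a) * sgn (o.par a * o.genPar 0) *
      o.tw a d - qHalf (-o.hDiag 0 e) * o.tw a c) * o.rootMat (o.src 0) (o.tgt 0) d c) = 0 := by
    refine boole_mul_eq_zero fun h => ?_
    subst h
    by_cases hX : o.rootMat (o.src 0) (o.tgt 0) d c = 0
    · rw [hX, mul_zero]
    · rw [o.tw_comm e d, o.tw_comm e c, o.rootMat_weights_lower 0 d c hX, sub_self, zero_mul]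
  have t2 : qHalf (o.hDiag 0 a) * sgn (o.par a * o.genPar 0) * ((if d = a then (1 : K) else 0) *
      ((if (a : ℕ) < e then 1 else 0) * o.rootMat (o.src 0) (o.tgt 0) e c)) +
      qHalf (-o.hDiag 0 e) * ((if c = a.rev then 1 else 0) *
        ((if (a : ℕ) < e then 1 else 0) * ((o.coef a)⁻¹ * o.coef e *
          o.rootMat (o.src 0) (o.tgt 0) d e.rev))) = 0 := by
    by_cases hc : (o.par (o.src 0) = 0 ∧ (o.tgt 0 : ℕ) = o.N - 2) ∧ d = o.src 0 ∧
        e = (o.tgt 0).rev ∧ a = o.src 0 ∧ c = (o.src 0).rev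
    · obtain ⟨⟨h1, h2⟩, rfl, rfl, rfl, rfl⟩ := hc
      simp only [Fin.rev_rev, if_true]
      rw [if_pos (by rw [Fin.val_rev]; omega)]
      obtain ⟨_, s2, s3, s4, s5, s6⟩ := o.affine_scalars h2 h1
      have hid := o.affine_lower_identity h2
      rw [hDiag_rev, neg_neg, s4]
      rw [qHalf_neg, s5, s3] at hid
      rw [s3] at s2
      have hsg := sgn_cast_mul_self (o.par (o.tgt 0))
      have hP := o.coef_ne_zero (o.tgt 0)
      have hR := o.coef_ne_zero (o.src 0)
      have hA := qHalf_ne_zero (o.hDiag 0 (o.tgt 0))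
      have hB := qHalf_ne_zero (o.hDiag 0 (o.src 0))
      generalize qHalf (o.hDiag 0 (o.tgt 0)) = A at *
      generalize qHalf (o.hDiag 0 (o.src 0)) = B at *
      generalize o.coef (o.tgt 0).rev = P' at *
      generalize (sgn (o.par (o.tgt 0)) : K) = σ at *
      generalize o.coef (o.tgt 0) = P at *
      generalize o.coef (o.src 0) = R at *
      generalize o.rootMat (o.src 0) (o.tgt 0) (o.tgt 0).rev (o.src 0).rev = y at *
      generalize o.rootMat (o.src 0) (o.tgt 0) (o.src 0) (o.tgt 0) = x at *
      have hP' : P' = σ * P⁻¹ := by linear_combination σ * s2 - P' * hsg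
      rw [hP']
      have e1 : B * y + A * R⁻¹ * σ * P⁻¹ * x = 0 := by
        field_simp at hid ⊢
        have : B * (B * y * P * R + A * x * σ) = 0 := by
          have : (R * P) * (B * (B * y * P * R + A * x * σ)) = 0 := by
            linear_combination A * σ * hid - y * s6 - y * A ^ 2 * hsg
          exact (mul_eq_zero.1 this).resolve_left (mul_ne_zero hR hP)
        linear_combination (mul_eq_zero.1 this).resolve_left hB
      linear_combination e1
    · have z1 : (if d = a then (1 : K) else 0) *
          ((if (a : ℕ) < e then 1 else 0) * o.rootMat (o.src 0) (o.tgt 0) e c) = 0 := by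
        refine boole_mul_eq_zero fun h1 => boole_mul_eq_zero fun h2 => o.rootMat_eq_zero ?_ ?_
        · rintro rfl rfl
          omega
        · rintro rfl rfl
          rw [Fin.val_rev] at h2
          have := hlt (o.tgt 0)
          have hcr : a = o.src 0 := Fin.ext (by omega)
          rcases hp with hp | hp
          · exact hc ⟨hp, h1.trans hcr, rfl, hcr, rfl⟩
          · omega
      have z2 : (if c = a.rev then (1 : K) else 0) *
        ((if (a : ℕ) < e then 1 else 0) * ((o.coef a)⁻¹ * o.coef e *
          o.rootMat (o.src 0) (o.tgt 0) d e.rev)) = 0 := by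
        refine boole_mul_eq_zero fun h1 => boole_mul_eq_zero fun h2 => ?_
        rw [o.rootMat_eq_zero, mul_zero]
        · intro h3 h4
          have h5 : e = (o.tgt 0).rev := by rw [← h4, Fin.rev_rev]
          rw [h5, Fin.val_rev] at h2
          have := hlt (o.tgt 0)
          have hcr : a = o.src 0 := Fin.ext (by omega)
          rcases hp with hp | hp
          · exact hc ⟨hp, h3, h5, hcr, by rw [h1, hcr]⟩
          · omega
        · intro h3 h4
          rw [Fin.rev_inj.1 h4] at h2
          omega
      rw [z1, z2, mul_zero, mul_zero, add_zero]
  have t3 : qHalf (o.hDiag 0 a) * sgn (o.par a * o.genPar 0) * ((if d = e.rev then (1 : K) else 0) *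
      ((if (a : ℕ) < e then 1 else 0) * ((o.coef a)⁻¹ * o.coef e *
        o.rootMat (o.src 0) (o.tgt 0) a.rev c))) +
      qHalf (-o.hDiag 0 e) * ((if e = c then 1 else 0) *
        ((if (a : ℕ) < c then 1 else 0) * o.rootMat (o.src 0) (o.tgt 0) d a)) = 0 := by
    by_cases hc : (o.par (o.src 0) = 0 ∧ (o.tgt 0 : ℕ) = o.N - 2) ∧ d = o.src 0 ∧
        e = (o.src 0).rev ∧ a = o.tgt 0 ∧ c = (o.src 0).rev
    · obtain ⟨⟨h1, h2⟩, rfl, rfl, rfl, rfl⟩ := hc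
      simp only [Fin.rev_rev, if_true]
      rw [if_pos (by rw [Fin.val_rev]; omega)]
      obtain ⟨s1, _, _, s4, s5, _⟩ := o.affine_scalars h2 h1
      have hid := o.affine_lower_identity h2
      rw [hDiag_rev, neg_neg, s1]
      rw [qHalf_neg, s5, mul_inv] at hid
      have hR := mul_inv_cancel₀ (o.coef_ne_zero (o.src 0))
      linear_combination (o.coef (o.src 0)) * hid - (qHalf (o.hDiag 0 (o.src 0)) *
        o.rootMat (o.src 0) (o.tgt 0) (o.src 0) (o.tgt 0) + qHalf (o.hDiag 0 (o.tgt 0)) *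
        sgn (o.par (o.tgt 0) * o.genPar 0) * (o.coef (o.tgt 0))⁻¹ * (o.coef (o.src 0))⁻¹ *
        o.rootMat (o.src 0) (o.tgt 0) (o.tgt 0).rev (o.src 0).rev) * hR
    · have z1 : (if d = e.rev then (1 : K) else 0) *
          ((if (a : ℕ) < e then 1 else 0) * ((o.coef a)⁻¹ * o.coef e *
            o.rootMat (o.src 0) (o.tgt 0) a.rev c)) = 0 := by
        refine boole_mul_eq_zero fun h1 => boole_mul_eq_zero fun h2 => ?_
        rw [o.rootMat_eq_zero, mul_zero]
        · intro h3 h4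
          have := hlt e
          rw [show a = (o.src 0).rev by rw [← h3, Fin.rev_rev], Fin.val_rev] at h2
          omega
        · intro h3 h4
          have := hlt e
          have h5 := Fin.rev_inj.1 h3
          rw [h5] at h2
          have hcr : e = (o.src 0).rev := Fin.ext (by rw [Fin.val_rev]; omega)
          rcases hp with hp | hp
          · exact hc ⟨hp, by rw [h1, hcr, Fin.rev_rev], hcr, h5, h4⟩
          · omega
      have z2 : (if e = c then (1 : K) else 0) *
          ((if (a : ℕ) < c then 1 else 0) * o.rootMat (o.src 0) (o.tgt 0) d a) = 0 := by
        refine boole_mul_eq_zero fun h1 => boole_mul_eq_zero fun h2 => o.rootMat_eq_zero ?_ ?_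
        · rintro rfl rfl
          have := hlt c
          have hcr : c = (o.src 0).rev := Fin.ext (by rw [Fin.val_rev]; omega)
          rcases hp with hp | hp
          · exact hc ⟨hp, rfl, h1.trans hcr, rfl, hcr⟩
          · omega
        · rintro rfl rfl
          have := hlt c
          rw [Fin.val_rev] at h2
          omega
      rw [z1, z2, mul_zero, mul_zero, add_zero]
  linear_combination t1 + (q - q⁻¹) * t2 - (q - q⁻¹) * t3

theorem braid2_mul_dLeft_eMat_zero (a : K) : o.braid2 * o.dLeft (o.eMat a 0) 0 =
    o.dRight (o.eMat a 0) 0 * o.braid2 := by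
  rw [eMat, dLeft_smul, dRight_smul, mul_smul_comm, smul_mul_assoc, braid2_mul_dLeft_zero]

theorem braid2_mul_dRight_fMat_zero (b : K) : o.braid2 * o.dRight (o.fMat b 0) 0 =
    o.dLeft (o.fMat b 0) 0 * o.braid2 := by
  rw [fMat, dLeft_smul, dRight_smul, mul_smul_comm, smul_mul_assoc, dLeft_mul_braid2_zero]

/-! ### Propagation along root vectors -/

theorem src_eq_rev_of_tgt {i : ℕ} (hi : i ≤ o.s) (h : o.tgt i = (o.src i).rev) :
    o.par (o.src i) = 1 := by
  have h1 := o.par_tgt_of_src_eq hi (by rw [h, Fin.rev_rev])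
  rwa [h, par_rev] at h1

theorem raise_src {i : ℕ} (hi : i ≤ o.s) : ∃ x ≠ 0, ∀ d,
    o.rootMat (o.tgt i) (o.src i) d (o.src i) = if d = o.tgt i then x else 0 := by
  refine ⟨if o.tgt i = (o.src i).rev then 2 else 1, ?_, fun d =>
    o.rootMat_apply_right (o.src_eq_rev_of_tgt hi) d⟩
  split_ifs <;> norm_num

theorem raise_tgt_rev {i : ℕ} (hi : i ≤ o.s) : ∃ x ≠ 0, ∀ d,
    o.rootMat (o.tgt i) (o.src i) d (o.tgt i).rev = if d = (o.src i).rev then x else 0 := by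
  refine ⟨_, ?_, fun d => o.rootMat_apply_rev (o.src_eq_rev_of_tgt hi) d⟩
  split_ifs
  · norm_num
  · exact neg_ne_zero.2 (o.kap_ne_zero _ _)

/-- A subspace stable under the raising operators that contains the lowest vector is everything. -/
theorem all_of_raise {M : Type} [AddCommGroup M] [Module K M] {Z : Fin o.N → M}
    (h0 : Z o.fst.rev = 0) (h : ∀ i, 0 < i → i ≤ o.s → ∀ c, Z c = 0 →
      ∑ d, o.rootMat (o.tgt i) (o.src i) d c • Z d = 0) (c : Fin o.N) : Z c = 0 := by
  have key : ∀ {i : ℕ} {p r : Fin o.N} {x : K}, x ≠ 0 →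
      (∀ d, o.rootMat (o.tgt i) (o.src i) d p = if d = r then x else 0) →
      ∑ d, o.rootMat (o.tgt i) (o.src i) d p • Z d = 0 → Z r = 0 := by
    intro i p r x hx hcol hs
    simp only [hcol, ite_smul, zero_smul, Finset.sum_ite_eq', Finset.mem_univ, if_true] at hs
    exact (smul_eq_zero.1 hs).resolve_left hx
  refine o.all_of_closedUp (S := fun c => Z c = 0) (fun i hi0 hi => ⟨fun hc => ?_, fun hc => ?_⟩) h0 c
  · obtain ⟨x, hx, hcol⟩ := o.raise_src hi
    exact key hx hcol (h i hi0 hi _ hc)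
  · obtain ⟨x, hx, hcol⟩ := o.raise_tgt_rev hi
    exact key hx hcol (h i hi0 hi _ hc)

/-! ### The projector onto the invariant vector and the inverse braiding -/

/-- The rank one operator `ω ω^*`. -/
def capCup : o.Mat2 := Matrix.vecMulVec o.omega o.omegaDual

theorem capCup_apply (d e a c : Fin o.N) : o.capCup (d, e) (a, c) =
    (if d = e.rev then o.coef e else 0) * (if c = a.rev then (o.coef a)⁻¹ else 0) := rfl

theorem mul_capCup (A : o.Mat2) : A * o.capCup = Matrix.vecMulVec (A *ᵥ o.omega) o.omegaDual := by
  rw [capCup, Matrix.mul_vecMulVec]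

theorem capCup_mul (A : o.Mat2) : o.capCup * A = Matrix.vecMulVec o.omega (o.omegaDual ᵥ* A) := by
  rw [capCup, Matrix.vecMulVec_mul]

theorem raise_scalar {i : ℕ} (h0 : 0 < i) (hi : i ≤ o.s) :
    o.rhoEps (o.tgt i) - o.rhoEps (o.src i) -
      (o.hDiag i (o.tgt i) - o.hDiag i (o.src i)) = 0 := by
  rw [← cartan_eq_hDiag, rhoEps_simple o h0 hi, sub_self]

theorem raise_mulVec_omega {i : ℕ} (h0 : 0 < i) (hi : i ≤ o.s) :
    (o.dLeft (o.rootMat (o.tgt i) (o.src i)) i + o.dRight (o.rootMat (o.tgt i) (o.src i)) i) *ᵥ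
      o.omega = 0 := by
  have := o.pair_mulVec_omega (o.hDiag_rev i) (z := 1) (a := o.tgt i) (b := o.src i)
    (by rw [o.raise_scalar h0 hi, qHalf_zero])
  rwa [one_smul, ← genPar_eq, ← Matrix.add_mulVec] at this

theorem omegaDual_vecMul_raise {i : ℕ} (h0 : 0 < i) (hi : i ≤ o.s) :
    o.omegaDual ᵥ* (o.dLeft (o.rootMat (o.tgt i) (o.src i)) i +
      o.dRight (o.rootMat (o.tgt i) (o.src i)) i) = 0 := by
  have := o.pair_vecMul_omegaDual (o.hDiag_rev i) (z := 1) (a := o.tgt i) (b := o.src i)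
    (by rw [← neg_sub, o.raise_scalar h0 hi, neg_zero, qHalf_zero])
  rwa [one_smul, ← genPar_eq, ← Matrix.vecMul_add] at this

theorem lower_scalar {i : ℕ} (h0 : 0 < i) (hi : i ≤ o.s) :
    o.rhoEps (o.src i) - o.rhoEps (o.tgt i) -
      (o.hDiag i (o.src i) - o.hDiag i (o.tgt i)) = 0 := by
  have := o.raise_scalar h0 hi
  linarith

theorem lower_mulVec_omega {i : ℕ} (h0 : 0 < i) (hi : i ≤ o.s) :
    (o.dLeft (o.rootMat (o.src i) (o.tgt i)) i + o.dRight (o.rootMat (o.src i) (o.tgt i)) i) *ᵥ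
      o.omega = 0 := by
  have := o.pair_mulVec_omega (o.hDiag_rev i) (z := 1) (a := o.src i) (b := o.tgt i)
    (by rw [o.lower_scalar h0 hi, qHalf_zero])
  rwa [one_smul, add_comm (o.par (o.src i)), ← genPar_eq, ← Matrix.add_mulVec] at this

theorem omegaDual_vecMul_lower {i : ℕ} (h0 : 0 < i) (hi : i ≤ o.s) :
    o.omegaDual ᵥ* (o.dLeft (o.rootMat (o.src i) (o.tgt i)) i +
      o.dRight (o.rootMat (o.src i) (o.tgt i)) i) = 0 := by
  have := o.pair_vecMul_omegaDual (o.hDiag_rev i) (z := 1) (a := o.src i) (b := o.tgt i)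
    (by rw [← neg_sub, o.lower_scalar h0 hi, neg_zero, qHalf_zero])
  rwa [one_smul, add_comm (o.par (o.src i)), ← genPar_eq, ← Matrix.vecMul_add] at this

theorem capCup_comm_of_invariant {A : o.Mat2} (h1 : A *ᵥ o.omega = 0) (h2 : o.omegaDual ᵥ* A = 0) :
    Commute o.capCup A := by
  rw [Commute, SemiconjBy, mul_capCup, capCup_mul, h1, h2, Matrix.vecMulVec_zero,
    Matrix.zero_vecMulVec]

/-- The inverse of the finite braiding. -/
def braid2Inv : o.Mat2 := o.braid2 - (q - q⁻¹) • 1 + (q - q⁻¹) • o.capCup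

/-- An operator that commutes with the raising operators is determined by its values on
`v_N ⊗ V`. -/
theorem eq_zero_of_comm_raise {Z : o.Mat2} (h : ∀ i, 0 < i → i ≤ o.s → Commute Z
      (o.dLeft (o.rootMat (o.tgt i) (o.src i)) i + o.dRight (o.rootMat (o.tgt i) (o.src i)) i))
    (h0 : ∀ x c, Z x (o.fst.rev, c) = 0) : Z = 0 := by
  have key := o.all_of_raise (Z := fun a => fun (y : (Fin o.N × Fin o.N) × Fin o.N) => Z y.1 (a, y.2))
    (funext fun y => h0 _ _) (fun i hi0 hi a ha => ?_)
  · ext x ⟨a, c⟩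
    exact congrFun (key a) (x, c)
  · funext ⟨⟨d, e⟩, c⟩
    -- The summand with a diagonal first leg stays within first index `a` and vanishes; what remains
    -- is the raising operator acting on the first factor alone.
    have ha' : ∀ x c, Z x (a, c) = 0 := fun x c => congrFun ha (x, c)
    have h1 := congrFun (congrFun (h i hi0 hi).eq (d, e)) (a, c)
    rw [dLeft, dRight, qDiag_neg_eq, qDiag_mul_parMat_pow_eq, mul_add, Matrix.add_apply,
      mul_kronecker_diagonal_apply, mul_diagonal_kronecker_apply, Matrix.mul_apply] at h1
    simp only [ha', zero_mul, mul_zero, Finset.sum_const_zero, add_zero] at h1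
    have h2 := (mul_eq_zero.1 h1).resolve_left (qHalf_ne_zero _)
    simp only [Finset.sum_apply, Pi.smul_apply, Pi.zero_apply, smul_eq_mul]
    rw [← h2]
    exact Finset.sum_congr rfl fun x _ => mul_comm _ _

theorem fst_val : (o.fst : ℕ) = 0 := rfl

theorem braid2_apply (d e a c : Fin o.N) : o.braid2 (d, e) (a, c) =
    o.tw a c * (if d = c ∧ e = a then 1 else 0) +
    (q - q⁻¹) * (if (a : ℕ) < c then 1 else 0) * (if d = a ∧ e = c then 1 else 0) -
    (q - q⁻¹) * (if (a : ℕ) < e then 1 else 0) * (o.coef a)⁻¹ * o.coef e *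
      (if d = e.rev ∧ c = a.rev then 1 else 0) := rfl

theorem not_last_lt (c : Fin o.N) : ¬ (o.fst.rev : ℕ) < c := by
  have := c.2
  rw [Fin.val_rev, fst_val]
  omega

/-- Nothing follows v_N in the order of the basis, so the step-function and cup-cap terms are
absent. -/
theorem braid2_last (d e c : Fin o.N) : o.braid2 (d, e) (o.fst.rev, c) =
    if d = c ∧ e = o.fst.rev then o.tw o.fst.rev c else 0 := by
  rw [braid2_apply, if_neg (o.not_last_lt _), if_neg (o.not_last_lt _)]
  split_ifs <;> ring

/-- The skein terms remove the step-function and cup-cap parts on these columns and turn the flip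
scalar into its inverse by `twInv_eq`. -/
theorem braid2Inv_last (d e c : Fin o.N) : o.braid2Inv (d, e) (c, o.fst.rev) =
    if d = o.fst.rev ∧ e = c then o.twInv o.fst.rev c else 0 := by
  have hN := o.two_lt
  have hl := o.not_last_lt
  rw [braid2Inv, Matrix.add_apply, Matrix.sub_apply, Matrix.smul_apply, Matrix.smul_apply,
    capCup_apply, braid2_apply, Matrix.one_apply, twInv_eq, o.tw_comm c, Fin.rev_rev]
  simp only [smul_eq_mul, Prod.mk.injEq]
  have e2 : o.fst.rev = c.rev ↔ c = o.fst := by rw [Fin.rev_inj, eq_comm]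
  simp only [e2]
  by_cases hc : c = o.fst
  · subst hc
    have hne : o.fst ≠ o.fst.rev := fun h => by
      have := congrArg Fin.val h
      rw [Fin.val_rev, fst_val] at this
      omega
    have h1 : (o.fst : ℕ) < o.fst.rev := by rw [Fin.val_rev, fst_val]; omega
    have h4 := mul_inv_cancel₀ (o.coef_ne_zero o.fst)
    simp only [if_pos h1, if_neg hne, and_true, if_true]
    by_cases he : e = o.fst
    · subst he
      simp only [lt_irrefl, if_false, and_true, hne, and_false]
      split_ifs
      · linear_combination (q - q⁻¹) * h4
      · ring
    · have h3 : (o.fst : ℕ) < e := by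
        have : (e : ℕ) ≠ 0 := fun h => he (Fin.ext h)
        rw [fst_val]
        omega
      simp only [if_pos h3, he, and_false, if_false]
      split_ifs <;> ring
  · simp only [hc, and_false, if_false, mul_zero, sub_zero, add_zero]
    by_cases hc' : c = o.fst.rev
    · subst hc'
      simp only [lt_irrefl, if_false, if_true, Fin.rev_inj]
      split_ifs <;> ring
    · have h1 : (c : ℕ) < o.fst.rev := by
        have h2 := c.2
        have h3 : (c : ℕ) ≠ (o.fst.rev : ℕ) := fun h => hc' (Fin.ext h)
        rw [Fin.val_rev, fst_val] at *
        omega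
      simp only [if_pos h1, if_neg hc']
      split_ifs <;> ring

/-- Both sides commute with the raising operators, hence it suffices to compare them on v_N ⊗ V,
where the two factors are flips with mutually inverse scalars. -/
theorem braid2Inv_mul_braid2 : o.braid2Inv * o.braid2 = 1 := by
  rw [← sub_eq_zero]
  refine o.eq_zero_of_comm_raise (fun i h0 hi => ?_) (fun x c => ?_)
  · have h1 := o.braid2_comm_rootMat_raise h0 hi
    have h2 := o.capCup_comm_of_invariant (o.raise_mulVec_omega h0 hi) (o.omegaDual_vecMul_raise h0 hi)
    exact ((((h1.sub_left ((Commute.one_left _).smul_left _)).add_left (h2.smul_left _)).mul_left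
      h1).sub_left (Commute.one_left _))
  · obtain ⟨d, e⟩ := x
    rw [Matrix.sub_apply, Matrix.mul_apply, Finset.sum_eq_single (c, o.fst.rev)]
    · rw [braid2Inv_last, braid2_last, if_pos (show c = c ∧ o.fst.rev = o.fst.rev from ⟨rfl, rfl⟩),
        Matrix.one_apply]
      have := o.tw_mul_twInv o.fst.rev c
      simp only [Prod.mk.injEq]
      split_ifs
      · linear_combination this
      · ring
    · rintro ⟨x, y⟩ _ hxy
      rw [braid2_last, if_neg, mul_zero]
      rintro ⟨rfl, rfl⟩
      exact hxy rfl
    · simp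

theorem braid2_mul_braid2Inv : o.braid2 * o.braid2Inv = 1 :=
  mul_eq_one_comm.1 o.braid2Inv_mul_braid2

theorem braid2_comm_diagonal {f : Fin o.N → K} (hf : ∀ c, f c * f c.rev = 1) :
    Commute o.braid2 (Matrix.diagonal f ⊗ₖ Matrix.diagonal f) := by
  rw [Matrix.diagonal_kronecker_diagonal]
  ext ⟨d, e⟩ ⟨a, c⟩
  rw [Matrix.mul_diagonal, Matrix.diagonal_mul, braid2_apply]
  have h1 : (if d = c ∧ e = a then (1 : K) else 0) * (f a * f c - f d * f e) = 0 :=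
    boole_mul_eq_zero fun h => by rw [h.1, h.2]; ring
  have h2 : (if d = a ∧ e = c then (1 : K) else 0) * (f a * f c - f d * f e) = 0 :=
    boole_mul_eq_zero fun h => by rw [h.1, h.2]; ring
  have h3 : (if d = e.rev ∧ c = a.rev then (1 : K) else 0) * (f a * f c - f d * f e) = 0 :=
    boole_mul_eq_zero fun h => by rw [h.1, h.2, hf, mul_comm, hf, sub_self]
  linear_combination o.tw a c * h1 + (q - q⁻¹) * (if (a : ℕ) < c then 1 else 0) * h2 -
    (q - q⁻¹) * (if (a : ℕ) < e then 1 else 0) * (o.coef a)⁻¹ * o.coef e * h3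

theorem diagonal_mulVec_omega {f : Fin o.N → K} (hf : ∀ c, f c * f c.rev = 1) :
    (Matrix.diagonal f ⊗ₖ Matrix.diagonal f) *ᵥ o.omega = o.omega := by
  rw [Matrix.diagonal_kronecker_diagonal]
  funext ⟨d, e⟩
  rw [Matrix.mulVec_diagonal, omega]
  split_ifs with h
  · simp only at h
    rw [h, mul_comm (f _), hf, one_mul]
  · rw [mul_zero]

theorem omegaDual_vecMul_diagonal {f : Fin o.N → K} (hf : ∀ c, f c * f c.rev = 1) :
    o.omegaDual ᵥ* (Matrix.diagonal f ⊗ₖ Matrix.diagonal f) = o.omegaDual := by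
  rw [Matrix.diagonal_kronecker_diagonal]
  funext ⟨d, e⟩
  rw [Matrix.vecMul_diagonal, omegaDual]
  split_ifs with h
  · simp only at h
    rw [h, hf, mul_one]
  · rw [zero_mul]

/-! ### The braiding and the invariant vector -/

/-- The twist, the eigenvalue of the braiding on the invariant vector. -/
def twist : K := o.tw o.fst o.fst.rev * o.coef o.fst.rev * (o.coef o.fst)⁻¹

theorem fst_ne_rev : o.fst ≠ o.fst.rev := fun h => by
  have h1 := congrArg Fin.val h
  have hN := o.two_lt
  rw [Fin.val_rev, fst_val] at h1
  omega

theorem braid2_eq_zero {d e a c : Fin o.N} (h1 : d = c → e = a → False)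
    (h2 : (a : ℕ) < c → d = a → e = c → False) (h3 : (a : ℕ) < e → d = e.rev → c = a.rev → False) :
    o.braid2 (d, e) (a, c) = 0 := by
  have t2 : (if (a : ℕ) < c then (1 : K) else 0) * (if d = a ∧ e = c then 1 else 0) = 0 :=
    boole_mul_eq_zero fun h => if_neg fun h' => h2 h h'.1 h'.2
  have t3 : (if (a : ℕ) < e then (1 : K) else 0) * (if d = e.rev ∧ c = a.rev then 1 else 0) = 0 :=
    boole_mul_eq_zero fun h => if_neg fun h' => h3 h h'.1 h'.2
  rw [braid2_apply, if_neg (fun h' => h1 h'.1 h'.2)]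
  linear_combination (q - q⁻¹) * t2 - (q - q⁻¹) * (o.coef a)⁻¹ * o.coef e * t3

theorem braid2_last_fst (a c : Fin o.N) : o.braid2 (o.fst.rev, o.fst) (a, c) =
    if a = o.fst ∧ c = o.fst.rev then o.tw a c else 0 := by
  have h0 : ∀ x : Fin o.N, ¬ (x : ℕ) < o.fst := fun x => Nat.not_lt_zero _
  split_ifs with h
  · rw [h.1, h.2, braid2_apply, if_neg (h0 _), if_pos ⟨rfl, rfl⟩,
      if_neg (c := o.fst.rev = o.fst ∧ _) (fun h => o.fst_ne_rev h.1.symm)]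
    ring
  · refine o.braid2_eq_zero (fun h1 h2 => h ⟨h2.symm, h1.symm⟩) (fun h1 _ h2 => ?_)
      (fun h1 => absurd h1 (h0 _))
    rw [← h2] at h1
    exact h0 _ h1

theorem kronecker_mulVec_of_support {v : Fin o.N × Fin o.N → K}
    (hv : ∀ d e, d ≠ e.rev → v (d, e) = 0) (A B : o.Mat) (d e : Fin o.N) :
    ((A ⊗ₖ B) *ᵥ v) (d, e) = ∑ c, A d c.rev * B e c * v (c.rev, c) := by
  rw [Matrix.mulVec, dotProduct, Fintype.sum_prod_type_right]
  refine Finset.sum_congr rfl fun c _ => ?_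
  rw [Finset.sum_eq_single c.rev]
  · simp
  · intro x _ hx
    rw [hv _ _ hx, mul_zero]
  · simp

theorem vecMul_kronecker_of_support {v : Fin o.N × Fin o.N → K}
    (hv : ∀ d e, e ≠ d.rev → v (d, e) = 0) (A B : o.Mat) (d e : Fin o.N) :
    (v ᵥ* (A ⊗ₖ B)) (d, e) = ∑ c, A c d * B c.rev e * v (c, c.rev) := by
  rw [Matrix.vecMul, dotProduct, Fintype.sum_prod_type]
  refine Finset.sum_congr rfl fun c _ => ?_
  rw [Finset.sum_eq_single c.rev]
  · simp [mul_comm]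
  · intro x _ hx
    rw [hv _ _ hx, zero_mul]
  · simp

/-- A vector supported on the v_{c'} ⊗ v_c and killed by the raising operators has its coefficients
linked pairwise along the moves of the generators, so the coefficient at v_N ⊗ v_1 determines all of
them. -/
theorem invariant_eq_zero {v : Fin o.N × Fin o.N → K} (hv : ∀ d e, d ≠ e.rev → v (d, e) = 0)
    (h0 : v (o.fst.rev, o.fst) = 0) (h : ∀ i, 0 < i → i ≤ o.s →
      (o.dLeft (o.rootMat (o.tgt i) (o.src i)) i + o.dRight (o.rootMat (o.tgt i) (o.src i)) i) *ᵥ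
        v = 0) : v = 0 := by
  have key := o.all_of_closedDown (S := fun c => v (c.rev, c) = 0) (fun i hi0 hi => ?_) h0
  · funext ⟨d, e⟩
    by_cases hde : d = e.rev
    · rw [hde]
      exact key e
    · exact hv _ _ hde
  · have h1 : ∀ d e, qHalf (-o.hDiag i e) * o.rootMat (o.tgt i) (o.src i) d e.rev * v (e.rev, e) +
        qHalf (o.hDiag i d) * sgn (o.par d * o.genPar i) *
          o.rootMat (o.tgt i) (o.src i) e d.rev * v (d, d.rev) = 0 := by
      intro d e
      have h2 := congrFun (h i hi0 hi) (d, e)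
      rw [Matrix.add_mulVec, Pi.add_apply, dLeft, dRight, qDiag_neg_eq, qDiag_mul_parMat_pow_eq,
        kronecker_mulVec_of_support o hv, kronecker_mulVec_of_support o hv,
        Finset.sum_eq_single e, Finset.sum_eq_single d.rev, Matrix.diagonal_apply_eq, Fin.rev_rev,
        Matrix.diagonal_apply_eq] at h2
      · rw [Pi.zero_apply] at h2
        linear_combination h2
      · intro c _ hc
        rw [Matrix.diagonal_apply_ne _ (fun h => hc (by rw [h, Fin.rev_rev])), zero_mul, zero_mul]
      · simp
      · intro c _ hc
        rw [Matrix.diagonal_apply_ne _ hc.symm, mul_zero, zero_mul]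
      · simp
    have hn : ∀ d, qHalf (o.hDiag i d) * (sgn (o.par d * o.genPar i) : K) ≠ 0 := fun d =>
      mul_ne_zero (qHalf_ne_zero _) (sgn_cast_ne_zero _)
    obtain ⟨x, hx, hcol⟩ := o.raise_src hi
    obtain ⟨x', hx', hcol'⟩ := o.raise_tgt_rev hi
    refine ⟨fun hc => ?_, fun hc => ?_⟩
    · have h3 := h1 (o.src i).rev (o.tgt i)
      rw [Fin.rev_rev, hc, mul_zero, zero_add, hcol, if_pos rfl] at h3
      exact (mul_eq_zero.1 h3).resolve_left (mul_ne_zero (hn _) hx)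
    · have h3 := h1 (o.tgt i) (o.src i).rev
      rw [hc, mul_zero, zero_add, hcol', if_pos rfl] at h3
      simp only [Fin.rev_rev]
      exact (mul_eq_zero.1 h3).resolve_left (mul_ne_zero (hn _) hx')

theorem invariant_dual_eq_zero {v : Fin o.N × Fin o.N → K}
    (hv : ∀ d e, e ≠ d.rev → v (d, e) = 0)
    (h0 : v (o.fst.rev, o.fst) = 0) (h : ∀ i, 0 < i → i ≤ o.s →
      v ᵥ* (o.dLeft (o.rootMat (o.tgt i) (o.src i)) i + o.dRight (o.rootMat (o.tgt i) (o.src i)) i) =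
        0) : v = 0 := by
  have key := o.all_of_closedUp (S := fun c => v (c, c.rev) = 0) (fun i hi0 hi => ?_)
    (by rwa [Fin.rev_rev])
  · funext ⟨d, e⟩
    by_cases hde : e = d.rev
    · rw [hde]
      exact key d
    · exact hv _ _ hde
  · have h1 : ∀ d e, qHalf (-o.hDiag i e) * o.rootMat (o.tgt i) (o.src i) e.rev d * v (e.rev, e) +
        qHalf (o.hDiag i d) * sgn (o.par d * o.genPar i) *
          o.rootMat (o.tgt i) (o.src i) d.rev e * v (d, d.rev) = 0 := by
      intro d e
      have h2 := congrFun (h i hi0 hi) (d, e)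
      rw [Matrix.vecMul_add, Pi.add_apply, dLeft, dRight, qDiag_neg_eq, qDiag_mul_parMat_pow_eq,
        vecMul_kronecker_of_support o hv, vecMul_kronecker_of_support o hv,
        Finset.sum_eq_single e.rev, Finset.sum_eq_single d, Fin.rev_rev, Matrix.diagonal_apply_eq,
        Matrix.diagonal_apply_eq] at h2
      · rw [Pi.zero_apply] at h2
        linear_combination h2
      · intro c _ hc
        rw [Matrix.diagonal_apply_ne _ hc, zero_mul, zero_mul]
      · simp
      · intro c _ hc
        rw [Matrix.diagonal_apply_ne _ (fun h => hc (by rw [← h, Fin.rev_rev])), mul_zero, zero_mul]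
      · simp
    have hm : ∀ d, qHalf (-o.hDiag i d) ≠ 0 := fun d => qHalf_ne_zero _
    obtain ⟨x, hx, hcol⟩ := o.raise_src hi
    obtain ⟨x', hx', hcol'⟩ := o.raise_tgt_rev hi
    refine ⟨fun hc => ?_, fun hc => ?_⟩
    · have h3 := h1 (o.src i) (o.tgt i).rev
      rw [Fin.rev_rev, hc, mul_zero, add_zero, hcol, if_pos rfl] at h3
      exact (mul_eq_zero.1 h3).resolve_left (mul_ne_zero (hm _) hx)
    · have h3 := h1 (o.tgt i).rev (o.src i)
      rw [hc, mul_zero, add_zero, hcol', if_pos rfl] at h3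
      simp only [Fin.rev_rev]
      exact (mul_eq_zero.1 h3).resolve_left (mul_ne_zero (hm _) hx')

/-- The vector Tω is again killed by the raising operators and supported on the pairs v_{c'} ⊗ v_c,
hence proportional to ω. -/
theorem braid2_mulVec_omega : o.braid2 *ᵥ o.omega = o.twist • o.omega := by
  rw [← sub_eq_zero]
  refine o.invariant_eq_zero (fun d e h => ?_) ?_ fun i h0 hi => ?_
  · rw [Pi.sub_apply, Pi.smul_apply, omega, if_neg h, smul_zero, sub_zero, Matrix.mulVec, dotProduct]
    refine Finset.sum_eq_zero fun ⟨a, c⟩ _ => ?_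
    by_cases hac : a = c.rev
    · rw [o.braid2_eq_zero, zero_mul]
      · intro h1 h2
        exact h (by rw [h1, h2, hac, Fin.rev_rev])
      · intro _ h1 h2
        exact h (by rw [h1, h2, hac])
      · intro _ h1
        exact absurd h1 h
    · rw [omega, if_neg hac, mul_zero]
  -- The row of T at v_N ⊗ v_1 has a single entry, at v_1 ⊗ v_N; this yields the formula for the
  -- twist.
  · rw [Pi.sub_apply, Pi.smul_apply, Matrix.mulVec, dotProduct,
      Finset.sum_eq_single (o.fst, o.fst.rev)]
    · rw [braid2_last_fst, if_pos ⟨rfl, rfl⟩, omega, omega, if_pos (Fin.rev_rev _).symm, if_pos rfl,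
        twist, smul_eq_mul]
      have := inv_mul_cancel₀ (o.coef_ne_zero o.fst)
      linear_combination -o.tw o.fst o.fst.rev * o.coef o.fst.rev * this
    · rintro ⟨a, c⟩ _ hac
      rw [braid2_last_fst, if_neg, zero_mul]
      rintro ⟨rfl, rfl⟩
      exact hac rfl
    · simp
  · rw [Matrix.mulVec_sub, Matrix.mulVec_smul, o.raise_mulVec_omega h0 hi, smul_zero, sub_zero,
      Matrix.mulVec_mulVec, ← (o.braid2_comm_rootMat_raise h0 hi).eq, ← Matrix.mulVec_mulVec,
      o.raise_mulVec_omega h0 hi, Matrix.mulVec_zero]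

theorem omegaDual_vecMul_braid2 : o.omegaDual ᵥ* o.braid2 = o.twist • o.omegaDual := by
  rw [← sub_eq_zero]
  refine o.invariant_dual_eq_zero (fun a c h => ?_) ?_ fun i h0 hi => ?_
  · rw [Pi.sub_apply, Pi.smul_apply, omegaDual, if_neg h, smul_zero, sub_zero, Matrix.vecMul,
      dotProduct]
    refine Finset.sum_eq_zero fun ⟨d, e⟩ _ => ?_
    by_cases hac : e = d.rev
    · rw [o.braid2_eq_zero, mul_zero]
      · intro h1 h2
        exact h (by rw [← h2, ← h1, hac, Fin.rev_rev])
      · intro _ h1 h2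
        exact h (by rw [← h1, ← h2, hac])
      · intro _ _ h1
        exact absurd h1 h
    · rw [omegaDual, if_neg hac, zero_mul]
  · rw [Pi.sub_apply, Pi.smul_apply, Matrix.vecMul, dotProduct,
      Finset.sum_eq_single (o.fst, o.fst.rev)]
    · rw [braid2_last, if_pos ⟨rfl, rfl⟩, omegaDual, omegaDual, if_pos rfl, if_pos (Fin.rev_rev _).symm,
        twist, smul_eq_mul, tw_comm]
      have := mul_inv_cancel₀ (o.coef_ne_zero o.fst.rev)
      linear_combination -o.tw o.fst o.fst.rev * (o.coef o.fst)⁻¹ * this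
    · rintro ⟨a, c⟩ _ hac
      rw [braid2_last, if_neg, mul_zero]
      rintro ⟨rfl, rfl⟩
      exact hac rfl
    · simp
  · rw [Matrix.sub_vecMul, Matrix.smul_vecMul, o.omegaDual_vecMul_raise h0 hi, smul_zero, sub_zero,
      Matrix.vecMul_vecMul, (o.braid2_comm_rootMat_raise h0 hi).eq, ← Matrix.vecMul_vecMul,
      o.omegaDual_vecMul_raise h0 hi, Matrix.zero_vecMul]

theorem braid2_mul_capCup : o.braid2 * o.capCup = o.twist • o.capCup := by
  rw [mul_capCup, braid2_mulVec_omega, Matrix.smul_vecMulVec, capCup]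

theorem capCup_mul_braid2 : o.capCup * o.braid2 = o.twist • o.capCup := by
  rw [capCup_mul, omegaDual_vecMul_braid2, Matrix.vecMulVec_smul, capCup]

/-- The value of the loop. -/
def loop : K := o.omegaDual ⬝ᵥ o.omega

theorem capCup_mul_capCup : o.capCup * o.capCup = o.loop • o.capCup := by
  rw [mul_capCup, capCup, Matrix.vecMulVec_mulVec, loop, op_smul_eq_smul, Matrix.smul_vecMulVec]

theorem capCup_ne_zero : o.capCup ≠ 0 := by
  intro h
  have h1 := congrFun (congrFun h (o.fst.rev, o.fst)) (o.fst, o.fst.rev)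
  rw [capCup_apply, if_pos rfl, if_pos rfl] at h1
  exact mul_ne_zero (o.coef_ne_zero _) (inv_ne_zero (o.coef_ne_zero _)) h1

/-- Apply T⁻¹T = 1 to Q. In particular the twist is invertible. -/
theorem twist_relation : o.twist * (o.twist - (q - q⁻¹) + (q - q⁻¹) * o.loop) = 1 := by
  have h1 : o.braid2Inv * o.braid2 * o.capCup = o.capCup := by rw [braid2Inv_mul_braid2, one_mul]
  rw [mul_assoc, braid2_mul_capCup, mul_smul_comm, braid2Inv, add_mul, sub_mul, braid2_mul_capCup,
    smul_mul_assoc, smul_mul_assoc, one_mul, capCup_mul_capCup] at h1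
  have h2 : (o.twist * (o.twist - (q - q⁻¹) + (q - q⁻¹) * o.loop) - 1) • o.capCup = 0 := by
    rw [sub_smul, one_smul, sub_eq_zero]
    refine Eq.trans ?_ h1
    module
  exact sub_eq_zero.1 ((smul_eq_zero.1 h2).resolve_right o.capCup_ne_zero)

/-- Both sides are powers of q^{1/2}, and the exponents are expressed through (2ρ, ε_1). This
relation between crossing parameter and twist is exactly what the Baxterization requires. -/
theorem crossing_eq_twist : o.crossing = o.twist * q := by
  have hf : o.src 0 = o.fst := Fin.ext (by rw [src_zero_val, fst_val])
  have h1 : o.form (o.eps o.fst) (o.eps o.fst) = sgn (o.par o.fst) := by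
    rw [form_eps_eps, xDiag, if_pos rfl, if_neg o.fst_ne_rev]
    ring
  have h2 : o.twist = qHalf (-(2 * sgn (o.par o.fst)) - 2 * o.rhoEps o.fst) := by
    have h3 := sgn_cast_mul_self (o.par o.fst)
    have h4 : o.coef o.fst * o.coef o.fst * ((o.coef o.fst)⁻¹ * (o.coef o.fst)⁻¹) = 1 := by
      have := mul_inv_cancel₀ (o.coef_ne_zero o.fst)
      linear_combination (o.coef o.fst * (o.coef o.fst)⁻¹ + 1) * this
    rw [coef_mul_self] at h4
    rw [twist, coef_rev, tw, eps_rev, form_neg_right, h1, par_rev, mul_neg, qHalf_sub,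
      show o.par o.fst * o.par o.fst = o.par o.fst by
        rcases zmod_two_cases (o.par o.fst) with h | h <;> rw [h] <;> rfl]
    have h5 := eq_inv_of_mul_eq_one_right h4
    rw [← h5]
    linear_combination qHalf (-(2 * sgn (o.par o.fst))) *
      ((o.coef o.fst)⁻¹ * (o.coef o.fst)⁻¹) * h3
  rw [h2, crossing_eq, show q = qHalf 2 from rfl, ← qHalf_add]
  congr 1
  -- For an even first vector the exponents are compared through (2ρ, ε_1 - ε_2); for an odd one α_0
  -- restricts to -2ε_1, of square length -4.
  rcases o.tgt_zero_cases with h | h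
  · have h3 := o.rhoEps_src_add_tgt_zero h.2
    rw [← h3, hf]
    rw [hf] at h
    rw [h.1, sgn_zero]
    ring
  · have h3 : o.tgt 0 = o.fst.rev := Fin.ext (by rw [h, Fin.val_rev, fst_val])
    have h4 : o.par o.fst = 1 := by
      have := o.par_tgt_of_src_eq (i := 0) (Nat.zero_le _) (by rw [h3, hf, Fin.rev_rev])
      rwa [h3, par_rev] at this
    have h5 : o.cartan 0 0 = -4 := by
      rw [cartan, simpleRoot_eq, h3, hf, eps_rev]
      simp only [form_sub_left, form_sub_right, form_neg_left, form_neg_right, h1, h4, sgn_one]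
      norm_num
    rw [h5, h3, hf, rhoEps_rev, h4, sgn_one]
    ring

end OspAffine.OspDatum

namespace OspAffine.OspDatum

variable (o : OspDatum) (A : Type) [CommRing A] [Algebra K A]

/-! ### Matrices acting on `V ⊗ A` -/

/-- The action of matrices on `V ⊗ A`. -/
def act : o.Mat →ₐ[K] Module.End K (o.VV A) where
  toFun M :=
    { toFun := fun f i => ∑ j, M i j • f j
      map_add' := fun f g => by
        funext i
        simp [smul_add, Finset.sum_add_distrib]
      map_smul' := fun c f => by
        funext i
        simp [Finset.smul_sum, smul_comm c] }
  map_one' := by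
    refine LinearMap.ext fun f => funext fun i => ?_
    simp [Matrix.one_apply, ite_smul]
  map_mul' M M' := by
    refine LinearMap.ext fun f => funext fun i => ?_
    simp only [LinearMap.coe_mk, AddHom.coe_mk, Module.End.mul_apply, Matrix.mul_apply,
      Finset.sum_smul, Finset.smul_sum, mul_smul]
    exact Finset.sum_comm
  map_zero' := by
    refine LinearMap.ext fun f => funext fun i => ?_
    simp
  map_add' M M' := by
    refine LinearMap.ext fun f => funext fun i => ?_
    simp [add_smul, Finset.sum_add_distrib]
  commutes' c := by
    refine LinearMap.ext fun f => funext fun i => ?_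
    simp [Matrix.algebraMap_matrix_apply, ite_smul, Module.algebraMap_end_apply]

theorem act_apply (M : o.Mat) (f : o.VV A) (i : Fin o.N) : o.act A M f i = ∑ j, M i j • f j := rfl

theorem act_single (i j : Fin o.N) : o.act A (Matrix.single i j 1) = o.E A i j := by
  refine LinearMap.ext fun f => funext fun k => ?_
  rw [act_apply, E, LinearMap.comp_apply, LinearMap.single_apply, LinearMap.proj_apply,
    Finset.sum_eq_single j]
  · rw [Matrix.single_apply, Pi.single_apply]
    by_cases h : i = k
    · simp [h]
    · rw [if_neg (fun h' => h h'.1), if_neg (fun h' => h h'.symm), zero_smul]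
  · intro l _ hl
    rw [Matrix.single_apply, if_neg (fun h => hl h.2.symm), zero_smul]
  · simp

theorem act_diagonal (f : Fin o.N → K) : o.act A (Matrix.diagonal f) = ∑ r, f r • o.E A r r := by
  have h : Matrix.diagonal f = ∑ r, Matrix.single r r (f r) := by
    ext d c
    rw [Matrix.sum_apply, Matrix.diagonal_apply]
    simp only [Matrix.single_apply]
    by_cases hdc : d = c
    · subst hdc
      simp
    · rw [if_neg hdc, Finset.sum_eq_zero]
      intro r _
      rw [if_neg]
      rintro ⟨rfl, rfl⟩
      exact hdc rfl
  rw [h, map_sum]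
  refine Finset.sum_congr rfl fun r _ => ?_
  rw [← act_single, ← map_smul, Matrix.smul_single, smul_eq_mul, mul_one]

theorem intCast_smul_end {M : Type} [AddCommGroup M] [Module K M] (n : ℤ) (F : Module.End K M) :
    (n : K) • F = n • F := by
  refine LinearMap.ext fun x => ?_
  rw [LinearMap.smul_apply, LinearMap.smul_apply, Int.cast_smul_eq_zsmul]

theorem act_rootMat (i j : Fin o.N) : o.act A (o.rootMat i j) = o.X A i j := by
  rw [rootMat, X, map_sub, act_single, map_smul, act_single, kap, intCast_smul_end]

theorem act_parMat : o.act A o.parMat = o.parityOp A := by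
  rw [parMat, act_diagonal, parityOp]
  simp only [intCast_smul_end]

theorem mulBy_apply (x : A) (f : o.VV A) (i : Fin o.N) : o.mulBy A x f i = x * f i := rfl

theorem mulBy_comm_act (x : A) (M : o.Mat) : Commute (o.mulBy A x) (o.act A M) := by
  refine LinearMap.ext fun f => funext fun i => ?_
  rw [Module.End.mul_apply, Module.End.mul_apply, mulBy_apply, act_apply, act_apply, Finset.mul_sum]
  refine Finset.sum_congr rfl fun j _ => ?_
  rw [mulBy_apply, mul_smul_comm]

theorem mulBy_mul (x y : A) : o.mulBy A x * o.mulBy A y = o.mulBy A (x * y) :=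
  (map_mul (Algebra.lsmul K K (o.VV A)) x y).symm

theorem mulBy_one : o.mulBy A 1 = 1 := map_one (Algebra.lsmul K K (o.VV A))

/-- The action of matrices on the tensor square of `V ⊗ A`. -/
def act2 : o.Mat2 →ₐ[K] Module.End K (o.VV2 A) :=
  ((Module.endTensorEndAlgHom (R := K) (S := K) (A := K) (M := o.VV A) (N := o.VV A)).comp
    (Algebra.TensorProduct.map (o.act A) (o.act A))).comp
      (Matrix.kroneckerAlgEquiv (Fin o.N) (Fin o.N) K).symm.toAlgHom

theorem act2_kronecker (M M' : o.Mat) :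
    o.act2 A (M ⊗ₖ M') = TensorProduct.map (o.act A M) (o.act A M') := by
  have h : (Matrix.kroneckerAlgEquiv (Fin o.N) (Fin o.N) K).symm (M ⊗ₖ M') = M ⊗ₜ[K] M' := by
    rw [AlgEquiv.symm_apply_eq]
    simp
  change Module.endTensorEndAlgHom (Algebra.TensorProduct.map (o.act A) (o.act A)
    ((Matrix.kroneckerAlgEquiv (Fin o.N) (Fin o.N) K).symm (M ⊗ₖ M'))) = _
  rw [h, Algebra.TensorProduct.map_tmul]
  exact Module.endTensorEndAlgHom_apply _ _

/-- A linear property of matrices holds if it holds for Kronecker products. -/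
theorem mat2_induction {P : o.Mat2 → Prop} (h0 : P 0) (hadd : ∀ x y, P x → P y → P (x + y))
    (h : ∀ M M' : o.Mat, P (M ⊗ₖ M')) (x : o.Mat2) : P x := by
  obtain ⟨t, rfl⟩ := (Matrix.kroneckerAlgEquiv (Fin o.N) (Fin o.N) K).surjective x
  induction t using TensorProduct.induction_on with
  | zero => rwa [map_zero]
  | tmul M M' =>
    have := h M M'
    convert this using 1
    simp
  | add x y hx hy =>
    rw [map_add]
    exact hadd _ _ hx hy

theorem single_kronecker_single (i j k l : Fin o.N) :
    (Matrix.single i j (1 : K) ⊗ₖ Matrix.single k l (1 : K) : o.Mat2) =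
      Matrix.single (i, k) (j, l) 1 := by
  rw [Matrix.single_kronecker_single, mul_one]

/-- The matrix of `E_{ij} ⊗ E_{kl}`. -/
def eeMat (i j k l : Fin o.N) : o.Mat2 :=
  (sgn (o.par j * (o.par k + o.par l)) : K) • Matrix.single (i, k) (j, l) 1

theorem eeMat_apply (i j k l x y a c : Fin o.N) : o.eeMat i j k l (x, y) (a, c) =
    sgn (o.par j * (o.par k + o.par l)) * if (i = x ∧ j = a) ∧ k = y ∧ l = c then 1 else 0 := by
  rw [eeMat, Matrix.smul_apply, Matrix.single_apply, smul_eq_mul]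
  congr 2
  simp only [Prod.mk.injEq]
  exact propext (by tauto)

theorem act2_eeMat (i j k l : Fin o.N) : o.act2 A (o.eeMat i j k l) = o.EE A i j k l := by
  rw [eeMat, EE, superTensor, ← act_parMat, ← map_pow, ← act_single, ← act_single, ← map_mul,
    ← act2_kronecker, ← single_kronecker_single, ← Matrix.smul_kronecker, parMat_pow]
  congr 2
  ext d c
  rw [Matrix.mul_diagonal, Matrix.smul_apply, Matrix.single_apply, smul_eq_mul]
  split_ifs with h
  · rw [h.2]
    ring
  · ring

theorem sum_sum_apply (F : Fin o.N → Fin o.N → o.Mat2) (x y a c : Fin o.N)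
    (h : ∀ i j, ¬ (i = x ∧ j = a) → F i j (x, y) (a, c) = 0) :
    (∑ i, ∑ j, F i j) (x, y) (a, c) = F x a (x, y) (a, c) := by
  rw [Matrix.sum_apply, Finset.sum_eq_single x]
  · rw [Matrix.sum_apply, Finset.sum_eq_single a]
    · intro j _ hj
      exact h _ _ fun h' => hj h'.2
    · simp
  · intro i _ hi
    rw [Matrix.sum_apply]
    exact Finset.sum_eq_zero fun j _ => h _ _ fun h' => hi h'.1
  · simp

/-- The matrix of the graded flip. -/
def swapMat : o.Mat2 := ∑ i, ∑ j, (sgn (o.par j) : K) • o.eeMat i j j i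

theorem swapMat_apply (x y a c : Fin o.N) : o.swapMat (x, y) (a, c) =
    sgn (o.par x * o.par y) * if y = a ∧ x = c then 1 else 0 := by
  rw [swapMat, sum_sum_apply]
  · rw [Matrix.smul_apply, eeMat_apply, smul_eq_mul]
    by_cases h : y = a ∧ x = c
    · rw [if_pos h, if_pos ⟨⟨rfl, rfl⟩, h.1.symm, h.2⟩, h.1, ← mul_assoc, ← Int.cast_mul, ← sgn_add]
      congr 3
      generalize o.par a = s
      generalize o.par x = t
      revert s t
      decide
    · rw [if_neg h, if_neg (fun h' => h ⟨h'.2.1.symm, h'.2.2⟩)]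
      ring
  · intro i j hij
    rw [Matrix.smul_apply, eeMat_apply, if_neg (fun h => hij h.1), mul_zero, smul_zero]

theorem act2_swapMat : o.act2 A o.swapMat = o.tauOp A := by
  rw [swapMat, tauOp]
  simp only [map_sum, map_smul, act2_eeMat, intCast_smul_end]

theorem swapMat_mul_apply (M : o.Mat2) (d e a c : Fin o.N) :
    (o.swapMat * M) (d, e) (a, c) = sgn (o.par d * o.par e) * M (e, d) (a, c) := by
  rw [Matrix.mul_apply, Finset.sum_eq_single (e, d)]
  · rw [swapMat_apply, if_pos ⟨rfl, rfl⟩, mul_one]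
  · rintro ⟨x, y⟩ _ h
    rw [swapMat_apply, if_neg, mul_zero, zero_mul]
    rintro ⟨rfl, rfl⟩
    exact h rfl
  · simp

theorem swapMat_mul_swapMat : o.swapMat * o.swapMat = 1 := by
  ext ⟨d, e⟩ ⟨a, c⟩
  rw [swapMat_mul_apply, swapMat_apply, Matrix.one_apply, ← mul_assoc, ← Int.cast_mul, mul_comm (o.par e),
    sgn_mul_self, Int.cast_one, one_mul]
  simp only [Prod.mk.injEq]

/-- The matrix of `R_∞`. -/
def rInfMat : o.Mat2 :=
  1 + (qHalf 1 - qHalf (-1)) • ∑ i : Fin o.N, (sgn (o.par i) : K) •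
      (qHalf (o.form (o.eps i) (o.eps i)) • o.eeMat i i i i -
        qHalf (-o.form (o.eps i) (o.eps i)) • o.eeMat i i i.rev i.rev) +
    (q - q⁻¹) • ∑ i : Fin o.N, ∑ j : Fin o.N,
      if j < i then (sgn (o.par j) : K) •
        (o.eeMat i j j i -
          ((sgn (o.par j * (o.par i + o.par j)) * o.theta i * o.theta j : ℤ) : K) •
            qHalf (o.form o.twoRho (o.eps i - o.eps j)) • o.eeMat i j i.rev j.rev)
      else 0

theorem act2_rInfMat : o.act2 A o.rInfMat = o.RInf A := by
  rw [rInfMat, RInf]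
  simp only [map_add, map_one, map_smul, map_sum, map_sub, act2_eeMat, intCast_smul_end,
    apply_ite (o.act2 A), map_zero]

/-! ### Identification of the given R-matrix with the braiding and the cup-cap. -/

theorem coef_inv_eq (a : Fin o.N) :
    (o.coef a)⁻¹ = sgn (o.par a) * o.theta a * qHalf (-o.rhoEps a) := by
  refine inv_eq_of_mul_eq_one_right ?_
  have h1 := mul_inv_cancel₀ (qHalf_ne_zero (o.rhoEps a))
  have h2 : (o.theta a * o.theta a : K) = 1 := by exact_mod_cast o.theta_mul_self a
  have h3 := sgn_cast_mul_self (o.par a)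
  rw [coef, qHalf_neg]
  linear_combination (sgn (o.par a) * sgn (o.par a) * (o.theta a * o.theta a)) * h1 +
    (sgn (o.par a) * sgn (o.par a)) * h2 + h3

/-- Here (q^{1/2} - q^{-1/2})q^{±1/2} = ±(q^{±1} - 1), so the correction to 1 produces q^{±1} at c =
a and c = a'. At a middle index the two corrections cancel. This converts the diagonal part of R_∞
into the flip scalars. -/
theorem qHalf_two_form (a c : Fin o.N) : 1 + (qHalf 1 - qHalf (-1)) * (sgn (o.par a) *
    (qHalf (o.form (o.eps a) (o.eps a)) * (if a = c then 1 else 0) -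
      qHalf (-o.form (o.eps a) (o.eps a)) * if a.rev = c then 1 else 0)) =
    qHalf (2 * o.form (o.eps a) (o.eps c)) := by
  have h1 : qHalf 1 * qHalf (-1) = 1 := by rw [← qHalf_add, add_neg_cancel, qHalf_zero]
  have h2 : qHalf 2 = qHalf 1 * qHalf 1 := by rw [← qHalf_add]; rfl
  have h3 : qHalf (-2) = qHalf (-1) * qHalf (-1) := by rw [← qHalf_add]; rfl
  have e1 : a = c ↔ c = a := eq_comm
  have e2 : a.rev = c ↔ c = a.rev := eq_comm
  simp only [form_eps_eps, xDiag, e1, e2, if_true]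
  by_cases h : c = a
  · subst h
    by_cases h' : c = c.rev
    · simp only [if_pos h', if_true, sub_self, mul_zero, neg_zero]
      rw [qHalf_zero, add_zero]
    · simp only [if_neg h', if_true, sub_zero, mul_one, mul_zero]
      rcases zmod_two_cases (o.par c) with hp | hp <;> rw [hp] <;> simp
      · linear_combination -h1 - h2
      · linear_combination -h1 - h3
  · by_cases h' : c = a.rev
    · have h4 : ¬ a = a.rev := fun h4 => h (by rw [h', ← h4])
      simp only [if_neg h, if_pos h', if_neg h4]
      rcases zmod_two_cases (o.par a) with hp | hp <;> rw [hp] <;> simp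
      · linear_combination -h1 - h3
      · linear_combination -h1 - h2
    · simp [h, h', qHalf_zero]

/-- The three summands of R_∞ become the flip, step-function and cup-cap parts of T; the super signs
reduce to identities for parities in ℤ/2. -/
theorem swapMat_mul_rInfMat : o.swapMat * o.rInfMat = o.braid2 := by
  ext ⟨d, e⟩ ⟨a, c⟩
  rw [swapMat_mul_apply, rInfMat, Matrix.add_apply, Matrix.add_apply, Matrix.smul_apply,
    Matrix.smul_apply, sum_sum_apply, Matrix.sum_apply, Finset.sum_eq_single a, braid2_apply]
  · have t1 : sgn (o.par d * o.par e) * ((1 : o.Mat2) (e, d) (a, c) + (qHalf 1 - qHalf (-1)) *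
        ((sgn (o.par a) : K) • (qHalf (o.form (o.eps a) (o.eps a)) • o.eeMat a a a a -
          qHalf (-o.form (o.eps a) (o.eps a)) • o.eeMat a a a.rev a.rev)) (e, d) (a, c)) =
        o.tw a c * (if d = c ∧ e = a then 1 else 0) := by
      simp only [Matrix.smul_apply, Matrix.sub_apply, eeMat_apply, Matrix.one_apply, smul_eq_mul,
        Prod.mk.injEq, zmod_two_self_add, mul_zero, sgn_zero, Int.cast_one, one_mul]
      by_cases h : e = a ∧ d = c
      · obtain ⟨rfl, rfl⟩ := h
        simp only [and_self, if_true, true_and, mul_one]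
        rw [tw, ← qHalf_two_form, mul_comm (o.par d)]
      · rw [if_neg h, if_neg (fun h' => h ⟨h'.1.1.symm, h'.2.1.symm.trans h'.2.2⟩),
          if_neg (fun h' => h ⟨h'.1.1.symm, h'.2.1.symm.trans h'.2.2⟩), if_neg (fun h' => h h'.symm)]
        ring
    have t2 : sgn (o.par d * o.par e) * ((sgn (o.par a) : K) * o.eeMat e a a e (e, d) (a, c)) =
        if d = a ∧ e = c then 1 else 0 := by
      rw [eeMat_apply]
      by_cases h : d = a ∧ e = c
      · obtain ⟨rfl, rfl⟩ := h
        simp only [and_self, if_true, mul_one]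
        rw [← Int.cast_mul, ← Int.cast_mul, ← Int.cast_one]
        congr 1
        generalize o.par d = s
        generalize o.par e = t
        revert s t
        decide
      · rw [if_neg h, if_neg (fun h' => h ⟨h'.2.1.symm, h'.2.2⟩)]
        ring
    have t3 : sgn (o.par d * o.par e) * ((sgn (o.par a) : K) *
        (((sgn (o.par a * (o.par e + o.par a)) * o.theta e * o.theta a : ℤ) : K) *
          (qHalf (o.form o.twoRho (o.eps e - o.eps a)) * o.eeMat e a e.rev a.rev (e, d) (a, c)))) =
        (o.coef a)⁻¹ * o.coef e * (if d = e.rev ∧ c = a.rev then 1 else 0) := by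
      rw [eeMat_apply, form_sub_right, ← rhoEps, ← rhoEps]
      by_cases h : d = e.rev ∧ c = a.rev
      · obtain ⟨rfl, rfl⟩ := h
        simp only [and_self, if_true, mul_one, par_rev]
        have h5 : sgn (o.par e * o.par e) * (sgn (o.par a) * (sgn (o.par a * (o.par e + o.par a)) *
            sgn (o.par a * (o.par e + o.par a)))) = sgn (o.par a) * sgn (o.par e) := by
          generalize o.par a = s
          generalize o.par e = t
          revert s t
          decide
        have h6 := congrArg (Int.cast : ℤ → K) h5
        rw [coef_inv_eq, coef, sub_eq_add_neg, qHalf_add]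
        push_cast at h6 ⊢
        linear_combination o.theta e * o.theta a * qHalf (o.rhoEps e) * qHalf (-o.rhoEps a) * h6
      · rw [if_neg h, if_neg (fun h' => h ⟨h'.2.1.symm, h'.2.2.symm⟩)]
        ring
    have e1 : (if a < e then (1 : K) else 0) = if (a : ℕ) < e then 1 else 0 := by
      simp only [Fin.lt_def]
    -- R_∞ compares row and column indices, T compares the two column indices; they agree where the
    -- matrix unit is nonzero.
    have e2 : (if (a : ℕ) < e then (1 : K) else 0) * (if d = a ∧ e = c then 1 else 0) =
        (if (a : ℕ) < c then 1 else 0) * (if d = a ∧ e = c then 1 else 0) := by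
      by_cases h : d = a ∧ e = c
      · rw [h.2]
      · rw [if_neg h, mul_zero, mul_zero]
    generalize (sgn (o.par a) : K) • (qHalf (o.form (o.eps a) (o.eps a)) • o.eeMat a a a a -
      qHalf (-o.form (o.eps a) (o.eps a)) • o.eeMat a a a.rev a.rev) = M at *
    by_cases h : a < e
    · rw [if_pos h] at e1 ⊢
      rw [Matrix.smul_apply, Matrix.sub_apply, Matrix.smul_apply, Matrix.smul_apply]
      simp only [smul_eq_mul]
      rw [← e1] at e2 ⊢
      linear_combination t1 + (q - q⁻¹) * t2 - (q - q⁻¹) * t3 + (q - q⁻¹) * e2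
    · rw [if_neg h] at e1 ⊢
      rw [Matrix.zero_apply]
      rw [← e1] at e2 ⊢
      simp only [smul_eq_mul]
      linear_combination t1 + (q - q⁻¹) * e2
  · intro i _ hi
    simp [eeMat_apply, hi]
  · simp
  · intro i j hij
    split_ifs
    · simp [eeMat_apply, hij]
    · rfl

/-- The matrix of `Q`. -/
def qMat : o.Mat2 := ∑ i : Fin o.N, ∑ j : Fin o.N,
    ((sgn (o.par i * o.par j) * o.theta i * o.theta j : ℤ) : K) •
      qHalf (o.form o.twoRho (o.eps i - o.eps j)) • o.eeMat i j i.rev j.rev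

theorem act2_qMat : o.act2 A o.qMat = o.QOp A := by
  rw [qMat, QOp]
  simp only [map_smul, map_sum, act2_eeMat, intCast_smul_end]

theorem swapMat_mul_qMat : o.swapMat * o.qMat = o.capCup := by
  ext ⟨d, e⟩ ⟨a, c⟩
  rw [swapMat_mul_apply, qMat, sum_sum_apply, capCup_apply]
  · rw [Matrix.smul_apply, Matrix.smul_apply, eeMat_apply, form_sub_right, ← rhoEps, ← rhoEps]
    by_cases h : d = e.rev ∧ c = a.rev
    · obtain ⟨rfl, rfl⟩ := h
      simp only [and_self, if_true, mul_one, par_rev, smul_eq_mul]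
      have h5 : sgn (o.par e * o.par e) * (sgn (o.par e * o.par a) *
          sgn (o.par a * (o.par e + o.par a))) = sgn (o.par a) * sgn (o.par e) := by
        generalize o.par a = s
        generalize o.par e = t
        revert s t
        decide
      have h6 := congrArg (Int.cast : ℤ → K) h5
      rw [coef_inv_eq, coef, sub_eq_add_neg, qHalf_add]
      push_cast at h6 ⊢
      linear_combination o.theta e * o.theta a * qHalf (o.rhoEps e) * qHalf (-o.rhoEps a) * h6
    · rw [if_neg (fun h' => h ⟨h'.2.1.symm, h'.2.2.symm⟩)]
      have : (if d = e.rev then o.coef e else 0) * (if c = a.rev then (o.coef a)⁻¹ else 0) = 0 := by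
        by_cases h1 : d = e.rev
        · rw [if_neg (fun h2 => h ⟨h1, h2⟩), mul_zero]
        · rw [if_neg h1, zero_mul]
      rw [this]
      simp
  · intro i j hij
    simp [eeMat_apply, hij]

end OspAffine.OspDatum

namespace OspAffine.OspDatum

variable (o : OspDatum) (A : Type) [CommRing A] [Algebra K A]

/-! ### Multiplication by spectral parameters and the flip of the coefficients -/

/-- Multiplication by `x ⊗ y` on the tensor square of `V ⊗ A`. -/
def scal (x y : A) : Module.End K (o.VV2 A) := TensorProduct.map (o.mulBy A x) (o.mulBy A y)

theorem scal_mul (x y x' y' : A) : o.scal A x y * o.scal A x' y' = o.scal A (x * x') (y * y') := by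
  rw [scal, scal, scal, ← TensorProduct.map_mul, mulBy_mul, mulBy_mul]

theorem scal_one : o.scal A 1 1 = 1 := by
  rw [scal, mulBy_one, TensorProduct.map_one]

theorem scal_comm_act2 (x y : A) (M : o.Mat2) : Commute (o.scal A x y) (o.act2 A M) := by
  induction M using o.mat2_induction with
  | h0 => rw [map_zero]; exact Commute.zero_right _
  | hadd M M' h h' => rw [map_add]; exact h.add_right h'
  | h M M' =>
    rw [act2_kronecker, Commute, SemiconjBy, scal, ← TensorProduct.map_mul, ← TensorProduct.map_mul,
      (o.mulBy_comm_act A x M).eq, (o.mulBy_comm_act A y M').eq]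

theorem scal_comm_scal (x y x' y' : A) : Commute (o.scal A x y) (o.scal A x' y') := by
  rw [Commute, SemiconjBy, scal_mul, scal_mul, mul_comm x, mul_comm y]

/-- The matrix of the flip of `V ⊗ V`. -/
def flipMat : o.Mat2 := ∑ i, ∑ j, Matrix.single i j (1 : K) ⊗ₖ Matrix.single j i (1 : K)

theorem flipMat_apply (x y a c : Fin o.N) :
    o.flipMat (x, y) (a, c) = if x = c ∧ y = a then 1 else 0 := by
  rw [flipMat, sum_sum_apply]
  · rw [single_kronecker_single, Matrix.single_apply]
    simp only [Prod.mk.injEq, true_and, and_true]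
    congr 1
    exact propext ⟨fun h => ⟨h.2, h.1.symm⟩, fun h => ⟨h.2.symm, h.1⟩⟩
  · intro i j hij
    rw [single_kronecker_single, Matrix.single_apply, if_neg]
    simp only [Prod.mk.injEq]
    exact fun h => hij ⟨h.1.1, h.2.1⟩

theorem flipMat_mul (M : o.Mat2) : o.flipMat * M = M.submatrix Prod.swap id := by
  ext ⟨d, e⟩ y
  rw [Matrix.mul_apply, Finset.sum_eq_single (e, d)]
  · rw [flipMat_apply, if_pos ⟨rfl, rfl⟩, one_mul]
    rfl
  · rintro ⟨x, z⟩ _ h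
    rw [flipMat_apply, if_neg, zero_mul]
    rintro ⟨rfl, rfl⟩
    exact h rfl
  · simp

theorem mul_flipMat (M : o.Mat2) : M * o.flipMat = M.submatrix id Prod.swap := by
  ext y ⟨d, e⟩
  rw [Matrix.mul_apply, Finset.sum_eq_single (e, d)]
  · rw [flipMat_apply, if_pos ⟨rfl, rfl⟩, mul_one]
    rfl
  · rintro ⟨x, z⟩ _ h
    rw [flipMat_apply, if_neg, mul_zero]
    rintro ⟨rfl, rfl⟩
    exact h rfl
  · simp

theorem flipMat_kronecker (M M' : o.Mat) : o.flipMat * (M ⊗ₖ M') = (M' ⊗ₖ M) * o.flipMat := by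
  rw [flipMat_mul, mul_flipMat]
  ext ⟨d, e⟩ ⟨a, c⟩
  simp [mul_comm]

/-- The flip `x ⊗ y ↦ y ⊗ x` as an operator. -/
def tcomm : Module.End K (o.VV2 A) := (TensorProduct.comm K (o.VV A) (o.VV A)).toLinearMap

theorem tcomm_map (F G : Module.End K (o.VV A)) :
    o.tcomm A * TensorProduct.map F G = TensorProduct.map G F * o.tcomm A :=
  TensorProduct.ext' fun x y => by simp [tcomm]

/-- The flip of the coefficient algebras of the two factors. -/
def coefSwap : Module.End K (o.VV2 A) := o.tcomm A * o.act2 A o.flipMat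

theorem coefSwap_comm_act2 (M : o.Mat2) : Commute (o.coefSwap A) (o.act2 A M) := by
  induction M using o.mat2_induction with
  | h0 => rw [map_zero]; exact Commute.zero_right _
  | hadd M M' h h' => rw [map_add]; exact h.add_right h'
  | h M M' =>
    rw [Commute, SemiconjBy, coefSwap, mul_assoc, ← map_mul, flipMat_kronecker, map_mul, ← mul_assoc,
      ← mul_assoc, act2_kronecker, act2_kronecker, tcomm_map]

theorem coefSwap_mul_scal (x y : A) :
    o.coefSwap A * o.scal A x y = o.scal A y x * o.coefSwap A := by
  rw [coefSwap, mul_assoc, ← (o.scal_comm_act2 A x y o.flipMat).eq, ← mul_assoc, scal, tcomm_map,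
    mul_assoc, scal]

/-- The flip of V(u) ⊗ V(v) factors into the graded flip of the copies of V and the flip of the
coefficients. Only the first is a matrix; the second exchanges the spectral parameters. -/
theorem superSwap_eq : o.superSwap A = o.coefSwap A * o.tauOp A := by
  rw [superSwap, coefSwap, mul_assoc, ← act2_swapMat, ← map_mul]
  change o.tcomm A * _ = _
  congr 1
  have h : o.flipMat * o.swapMat = ∑ i, ∑ j, (sgn (o.par i * o.par j) : K) •
      (Matrix.single i i (1 : K) ⊗ₖ Matrix.single j j (1 : K)) := by
    rw [flipMat_mul]
    ext ⟨d, e⟩ ⟨a, c⟩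
    rw [Matrix.sum_apply, Finset.sum_eq_single d, Matrix.sum_apply, Finset.sum_eq_single e]
    · rw [Matrix.submatrix_apply, Prod.swap_prod_mk, id, swapMat_apply, Matrix.smul_apply,
        single_kronecker_single, Matrix.single_apply, smul_eq_mul, mul_comm (o.par d)]
      simp only [Prod.mk.injEq, true_and]
    · intro j _ hj
      rw [Matrix.smul_apply, single_kronecker_single, Matrix.single_apply, if_neg, smul_zero]
      simp [hj]
    · simp
    · intro i _ hi
      rw [Matrix.sum_apply]
      refine Finset.sum_eq_zero fun j _ => ?_
      rw [Matrix.smul_apply, single_kronecker_single, Matrix.single_apply, if_neg, smul_zero]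
      simp [hi]
    · simp
  rw [h]
  simp only [map_sum, map_smul, act2_kronecker, act_single, intCast_smul_end]

theorem E_apply (k l : Fin o.N) (x : o.VV A) : o.E A k l x = Pi.single k (x l) := rfl

/-- Over `K` the coefficients may slide across the tensor sign, so there is nothing to exchange. -/
theorem coefSwap_field : o.coefSwap K = 1 := by
  refine TensorProduct.ext' fun x y => ?_
  have h : ∀ i j : Fin o.N, (Pi.single j (y i) : o.VV K) ⊗ₜ[K] (Pi.single i (x j) : o.VV K) =
      Pi.single j (x j) ⊗ₜ[K] Pi.single i (y i) := by
    intro i j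
    have h1 : ∀ (k : Fin o.N) (c : K), (Pi.single k c : o.VV K) = c • Pi.single k 1 := fun k c => by
      rw [← Pi.single_smul, smul_eq_mul, mul_one]
    rw [h1 j (y i), h1 i (x j), h1 j (x j), h1 i (y i), TensorProduct.smul_tmul_smul,
      TensorProduct.smul_tmul_smul, mul_comm]
  simp only [coefSwap, Module.End.mul_apply, Module.End.one_apply, flipMat, map_sum, act2_kronecker,
    act_single, LinearMap.sum_apply, TensorProduct.map_tmul, tcomm, LinearEquiv.coe_coe,
    TensorProduct.comm_tmul, E_apply, h]
  rw [Finset.sum_comm]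
  simp only [← TensorProduct.tmul_sum, ← TensorProduct.sum_tmul]
  rw [Finset.univ_sum_single, Finset.univ_sum_single]

/-! ### The R-matrix in terms of matrices -/

theorem spectralRHat_eq (z : K) : o.spectralRHat z = o.act2 K ((z - o.crossing) • o.braid2 +
    ((q - q⁻¹) * ((z - o.crossing) / (z - 1))) • 1 - ((q - q⁻¹) * o.crossing) • o.capCup) := by
  rw [spectralRHat, superSwap_eq, coefSwap_field, one_mul, spectralR, ← act2_rInfMat,
    ← act2_swapMat, ← act2_qMat, ← map_smul, ← map_smul, ← map_smul, ← map_add,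
    ← map_sub (o.act2 K), ← map_mul, mul_sub, mul_add, mul_smul_comm, mul_smul_comm, mul_smul_comm, swapMat_mul_rInfMat,
    swapMat_mul_swapMat, swapMat_mul_qMat]

/-- The operator `(z - 1) τ R(z)`, where `τ` permutes the factors `V` only and `z = x ⊗ y`. -/
def clearedRHat (x y : A) : Module.End K (o.VV2 A) :=
  (o.scal A x y - 1) * (o.scal A x y - o.crossing • 1) * o.act2 A o.braid2 +
    (q - q⁻¹) • (o.scal A x y - o.crossing • 1) -
    ((q - q⁻¹) * o.crossing) • ((o.scal A x y - 1) * o.act2 A o.capCup)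

theorem swap_mul_cleared {B : Type} [Ring B] [Algebra K B] {t z R Q T Q' : B} (hz : Commute t z)
    (h1 : t * t = 1) (h2 : t * R = T) (h3 : t * Q = Q') (c d e : K) :
    t * ((z - 1) * (z - c • 1) * R + d • ((z - c • 1) * t) - e • ((z - 1) * Q)) =
      (z - 1) * (z - c • 1) * T + d • (z - c • 1) - e • ((z - 1) * Q') := by
  have c2 : Commute t (z - 1) := hz.sub_right (Commute.one_right _)
  have c3 : Commute t (z - c • 1) := hz.sub_right ((Commute.one_right _).smul_right _)
  rw [mul_sub, mul_add, mul_smul_comm, mul_smul_comm, ← mul_assoc, (c2.mul_right c3).eq, mul_assoc,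
    h2, ← mul_assoc t (z - c • 1), c3.eq, mul_assoc _ t t, h1, mul_one, ← mul_assoc t (z - 1), c2.eq,
    mul_assoc (z - 1) t, h3]

theorem superSwap_mul_clearedR (x y : A) : o.superSwap A * o.clearedR A (o.scal A x y) =
    o.coefSwap A * o.clearedRHat A x y := by
  rw [superSwap_eq, mul_assoc]
  congr 1
  rw [clearedR, clearedRHat, ← act2_rInfMat, ← act2_swapMat, ← act2_qMat]
  exact swap_mul_cleared (B := Module.End K (o.VV2 A)) (o.scal_comm_act2 A x y _).symm
    (by rw [← map_mul, swapMat_mul_swapMat, map_one]) (by rw [← map_mul, swapMat_mul_rInfMat])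
    (by rw [← map_mul, swapMat_mul_qMat]) _ _ _

end OspAffine.OspDatum

namespace OspAffine.OspDatum

variable (o : OspDatum) (A : Type) [CommRing A] [Algebra K A]

/-! ### The intertwining property -/

/-- The R-matrix intertwines `z L + R` with `L + z R`, if the finite braiding exchanges `L` and `R`
suitably. -/
theorem cleared_intertwines {B : Type} [Ring B] [Algebra K B] {T Q L R z : B} {C ζ : K}
    (hzT : Commute z T) (hzQ : Commute z Q) (hzL : Commute z L) (hzR : Commute z R)
    (h1 : T * L = R * T) (h2 : (T - C • 1 + C • Q) * R = L * (T - C • 1 + C • Q))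
    (h3 : L * Q + ζ • (R * Q) = 0) (h4 : Q * R + ζ • (Q * L) = 0) :
    ((z - 1) * (z - ζ • 1) * T + C • (z - ζ • 1) - (C * ζ) • ((z - 1) * Q)) * (z * L + R) =
      (L + z * R) * ((z - 1) * (z - ζ • 1) * T + C • (z - ζ • 1) - (C * ζ) • ((z - 1) * Q)) := by
  -- The exchange relation for T⁻¹ is turned into a rule for TR with skein corrections.
  have h2' : T * R = L * T + C • R - C • L - C • (Q * R) + C • (L * Q) := by
    simp only [sub_mul, add_mul, mul_sub, mul_add, smul_mul_assoc, mul_smul_comm, one_mul,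
      mul_one] at h2
    rw [← sub_eq_zero] at h2 ⊢
    rw [← h2]
    module
  have h3' : L * Q = -ζ • (R * Q) := by rw [neg_smul, ← add_eq_zero_iff_eq_neg, h3]
  have h4' : Q * R = -ζ • (Q * L) := by rw [neg_smul, ← add_eq_zero_iff_eq_neg, h4]
  have mv : ∀ {x : B}, Commute z x → ∀ y, x * (z * y) = z * (x * y) := fun hx y => by
    rw [← mul_assoc, ← hx.eq, mul_assoc]
  -- With the central powers of `z` moved to the left and TL, TR, LQ, QR rewritten, both sides
  -- become combinations of the same words with equal coefficients.
  simp only [sub_mul, add_mul, mul_sub, mul_add, smul_mul_assoc, mul_smul_comm, one_mul, mul_one,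
    mul_assoc, mv hzT, mv hzQ, mv hzL, mv hzR, ← hzL.eq, ← hzR.eq, h1, h2', h3', h4', smul_add,
    smul_sub, smul_smul]
  module

theorem cleared_comm {B : Type} [Ring B] [Algebra K B] {T Q X z : B} {C ζ : K}
    (hzX : Commute z X) (hT : Commute T X) (hQ : Commute Q X) :
    Commute ((z - 1) * (z - ζ • 1) * T + C • (z - ζ • 1) - (C * ζ) • ((z - 1) * Q)) X := by
  have c1 : Commute (z - 1) X := hzX.sub_left (Commute.one_left _)
  have c2 : Commute (z - ζ • 1) X := hzX.sub_left ((Commute.one_left _).smul_left _)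
  exact (((c1.mul_left c2).mul_left hT).add_left (c2.smul_left _)).sub_left
    ((c1.mul_left hQ).smul_left _)

/-! ### Exchange relations between R̂ and the affine generators. -/

theorem crossing_raise : o.crossing⁻¹ = qHalf (o.hDiag 0 (o.tgt 0) - o.hDiag 0 (o.src 0) -
    (o.rhoEps (o.tgt 0) - o.rhoEps (o.src 0))) := by
  rw [crossing_eq, ← qHalf_neg, cartan_eq_hDiag]
  congr 1
  ring

theorem crossing_ne_zero : o.crossing ≠ 0 := by
  rw [crossing_eq]
  exact qHalf_ne_zero _

/-- The affine generator `e_0` kills the invariant vector when its spectral parameters differ by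
the crossing parameter. -/
theorem eMat_zero_capCup (a : K) : o.dLeft (o.eMat a 0) 0 * o.capCup +
    o.crossing • (o.dRight (o.eMat a 0) 0 * o.capCup) = 0 := by
  have h := o.pair_mulVec_omega (o.hDiag_rev 0) (a := o.tgt 0) (b := o.src 0) (z := o.crossing)
    (by rw [crossing_eq, cartan_eq_hDiag])
  rw [← genPar_eq] at h
  rw [eMat, dLeft_smul, dRight_smul, smul_mul_assoc, smul_mul_assoc, smul_comm, ← smul_add,
    mul_capCup, mul_capCup, ← Matrix.smul_vecMulVec, ← Matrix.add_vecMulVec]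
  change _ • Matrix.vecMulVec ((_ *ᵥ _) + _) _ = _
  rw [dLeft, dRight, h, Matrix.zero_vecMulVec, smul_zero]

theorem capCup_eMat_zero (a : K) : o.capCup * o.dRight (o.eMat a 0) 0 +
    o.crossing • (o.capCup * o.dLeft (o.eMat a 0) 0) = 0 := by
  have h := o.pair_vecMul_omegaDual (o.hDiag_rev 0) (a := o.tgt 0) (b := o.src 0)
    (z := o.crossing⁻¹) o.crossing_raise
  rw [← genPar_eq] at h
  rw [eMat, dLeft_smul, dRight_smul, mul_smul_comm, mul_smul_comm, smul_comm, ← smul_add,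
    capCup_mul, capCup_mul, ← Matrix.vecMulVec_smul, ← Matrix.vecMulVec_add]
  rw [← smul_eq_zero_iff_right o.crossing_ne_zero, smul_add, smul_smul,
    mul_inv_cancel₀ o.crossing_ne_zero, one_smul, add_comm] at h
  rw [dLeft, dRight, h, Matrix.vecMulVec_zero, smul_zero]

theorem fMat_zero_capCup (b : K) : o.dRight (o.fMat b 0) 0 * o.capCup +
    o.crossing • (o.dLeft (o.fMat b 0) 0 * o.capCup) = 0 := by
  have h := o.pair_mulVec_omega (o.hDiag_rev 0) (a := o.src 0) (b := o.tgt 0) (z := o.crossing⁻¹)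
    (by rw [crossing_raise]; congr 1; ring)
  rw [add_comm (o.par (o.src 0)), ← genPar_eq] at h
  rw [fMat, dLeft_smul, dRight_smul, smul_mul_assoc, smul_mul_assoc, smul_comm, ← smul_add,
    mul_capCup, mul_capCup, ← Matrix.smul_vecMulVec, ← Matrix.add_vecMulVec]
  rw [← smul_eq_zero_iff_right o.crossing_ne_zero, smul_add, smul_smul,
    mul_inv_cancel₀ o.crossing_ne_zero, one_smul, add_comm] at h
  rw [dLeft, dRight, h, Matrix.zero_vecMulVec, smul_zero]

theorem capCup_fMat_zero (b : K) : o.capCup * o.dLeft (o.fMat b 0) 0 +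
    o.crossing • (o.capCup * o.dRight (o.fMat b 0) 0) = 0 := by
  have h := o.pair_vecMul_omegaDual (o.hDiag_rev 0) (a := o.src 0) (b := o.tgt 0)
    (z := o.crossing) (by rw [crossing_eq, cartan_eq_hDiag]; congr 1; ring)
  rw [add_comm (o.par (o.src 0)), ← genPar_eq] at h
  rw [fMat, dLeft_smul, dRight_smul, mul_smul_comm, mul_smul_comm, smul_comm, ← smul_add,
    capCup_mul, capCup_mul, ← Matrix.vecMulVec_smul, ← Matrix.vecMulVec_add]
  rw [dLeft, dRight, h, Matrix.vecMulVec_zero, smul_zero]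

/-- The exchange relation for the inverse braiding. -/
theorem inv_exchange {X Y : o.Mat2} (h : o.braid2 * X = Y * o.braid2) :
    o.braid2Inv * Y = X * o.braid2Inv := by
  have h1 := congrArg (fun M => o.braid2Inv * M * o.braid2Inv) h
  simp only [← mul_assoc] at h1
  rw [braid2Inv_mul_braid2, one_mul, mul_assoc _ o.braid2, braid2_mul_braid2Inv, mul_one] at h1
  exact h1.symm

/-- The hypotheses are the exchange of the halves `X`, `Y` by T and the vanishing of X + ζY on ω and
of Y + ζX under ω*; the exchange by T⁻¹ is automatic. -/
theorem clearedRHat_exchange (x y : A) {X Y : o.Mat2} (h : o.braid2 * X = Y * o.braid2)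
    (h3 : X * o.capCup + o.crossing • (Y * o.capCup) = 0)
    (h4 : o.capCup * Y + o.crossing • (o.capCup * X) = 0) :
    o.clearedRHat A x y * (o.scal A x y * o.act2 A X + o.act2 A Y) =
      (o.act2 A X + o.scal A x y * o.act2 A Y) * o.clearedRHat A x y := by
  have hz := o.scal_comm_act2 A x y
  have h2 := congrArg (o.act2 A) (o.inv_exchange h)
  rw [map_mul, map_mul, braid2Inv, map_add, map_sub, map_smul, map_smul, map_one] at h2
  refine cleared_intertwines (B := Module.End K (o.VV2 A)) (hz _) (hz _) (hz _) (hz _) ?_ h2 ?_ ?_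
  · rw [← map_mul, h, map_mul]
  · rw [← map_mul, ← map_mul, ← map_smul, ← map_add, h3, map_zero]
  · rw [← map_mul, ← map_mul, ← map_smul, ← map_add, h4, map_zero]

theorem clearedRHat_comm (x y : A) {X : o.Mat2} (h : Commute o.braid2 X)
    (h' : Commute o.capCup X) : Commute (o.clearedRHat A x y) (o.act2 A X) :=
  cleared_comm (B := Module.End K (o.VV2 A)) (o.scal_comm_act2 A x y X) (h.map (o.act2 A))
    (h'.map (o.act2 A))

theorem capCup_comm_eMat (a : K) {i : ℕ} (h0 : 0 < i) (hi : i ≤ o.s) :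
    Commute o.capCup (o.dLeft (o.eMat a i) i + o.dRight (o.eMat a i) i) := by
  rw [eMat, dLeft_smul, dRight_smul, ← smul_add]
  exact (o.capCup_comm_of_invariant (o.raise_mulVec_omega h0 hi)
    (o.omegaDual_vecMul_raise h0 hi)).smul_right _

theorem capCup_comm_fMat (b : K) {i : ℕ} (h0 : 0 < i) (hi : i ≤ o.s) :
    Commute o.capCup (o.dLeft (o.fMat b i) i + o.dRight (o.fMat b i) i) := by
  rw [fMat, dLeft_smul, dRight_smul, ← smul_add]
  exact (o.capCup_comm_of_invariant (o.lower_mulVec_omega h0 hi)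
    (o.omegaDual_vecMul_lower h0 hi)).smul_right _

theorem capCup_comm_diagonal {f : Fin o.N → K} (hf : ∀ c, f c * f c.rev = 1) :
    Commute o.capCup (Matrix.diagonal f ⊗ₖ Matrix.diagonal f) := by
  rw [Commute, SemiconjBy, mul_capCup, capCup_mul, o.diagonal_mulVec_omega hf,
    o.omegaDual_vecMul_diagonal hf]

/-! ### The operators of the generators in terms of matrices -/

/-- The spectral parameter, which enters only the affine generators. -/
def upar {A : Type} [CommRing A] (u : Aˣ) (i : ℕ) : Aˣ := if i = 0 then u else 1

end OspAffine.OspDatum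

namespace OspAffine.OspDatum

variable (o : OspDatum)

open SkewWords

section Generators

variable {A : Type} [CommRing A] [Algebra K A]

theorem upar_val (u : Aˣ) {i : ℕ} (hi : i ≠ 0) : upar u i = 1 := if_neg hi

theorem rootMat_rev_left {p : Fin o.N} (hp : o.par p = 1) :
    o.rootMat p.rev p = (2 : K) • Matrix.single p.rev p 1 := by
  rw [rootMat, kap_rev', hp, Fin.rev_rev]
  simp only [sgn, one_ne_zero, if_false]
  push_cast
  module

theorem rootMat_rev_right {p : Fin o.N} (hp : o.par p = 1) :
    o.rootMat p p.rev = (2 : K) • Matrix.single p p.rev 1 := by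
  have := o.rootMat_rev_left (p := p.rev) (by rw [par_rev, hp])
  rwa [Fin.rev_rev] at this

theorem evalGen_e (a b : K) (u : Aˣ) (i : Fin (o.s + 1)) : o.evalGen a b u (.e i) =
    o.mulBy A (upar u i : Aˣ) * o.act A (o.eMat a i) := by
  by_cases h0 : (i : ℕ) = 0
  · rw [evalGen, if_pos h0, upar, if_pos h0, ← mul_smul_comm, h0]
    congr 1
    rcases zmod_two_cases (o.par (o.ix 1)) with hp | hp
    · have hp' : ¬ o.par (o.ix 1) = 1 := by rw [hp]; decide
      rw [if_neg hp', eMat, cE, tgt, src, if_pos rfl, if_neg hp', if_pos rfl, if_pos hp, if_pos rfl,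
        map_smul, act_rootMat]
    · have hp' : ¬ o.par (o.ix 1) = 0 := by rw [hp]; decide
      rw [if_pos hp, eMat, cE, tgt, src, if_pos rfl, if_pos hp, if_pos rfl, if_neg hp', if_pos rfl,
        o.rootMat_rev_left hp, smul_smul, div_mul_cancel₀ _ two_ne_zero, map_smul, act_single]
  · rw [evalGen, if_neg h0, upar_val u h0, Units.val_one, mulBy_one, one_mul, eFin, eMat, cE, tgt,
      src, if_neg h0, if_neg h0, if_neg h0]
    by_cases h1 : (i : ℕ) < o.s ∨ Odd o.m
    · rw [if_pos h1, if_pos h1, if_pos h1, if_pos h1, one_smul, act_rootMat]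
    · rw [if_neg h1, if_neg h1, if_neg h1, if_neg h1]
      rcases zmod_two_cases (o.par (o.ix o.s)) with hp | hp
      · rw [if_pos hp, if_pos hp, if_pos hp, one_smul, act_rootMat]
      · have hp' : ¬ o.par (o.ix o.s) = 0 := by rw [hp]; decide
        rw [if_neg hp', if_neg hp', if_neg hp', o.ix_succ_s (o.even_N_of h1),
          o.rootMat_rev_right hp, smul_smul, div_mul_cancel₀ _ two_ne_zero, one_smul, act_single]

theorem evalGen_f (a b : K) (u : Aˣ) (i : Fin (o.s + 1)) : o.evalGen a b u (.f i) =
    o.mulBy A (upar u⁻¹ i : Aˣ) * o.act A (o.fMat b i) := by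
  by_cases h0 : (i : ℕ) = 0
  · rw [evalGen, if_pos h0, upar, if_pos h0, ← mul_smul_comm, h0]
    congr 1
    rcases zmod_two_cases (o.par (o.ix 1)) with hp | hp
    · have hp' : ¬ o.par (o.ix 1) = 1 := by rw [hp]; decide
      rw [if_neg hp', fMat, cF, tgt, src, if_pos rfl, if_neg hp', if_pos rfl, if_pos hp, if_pos rfl,
        map_smul, act_rootMat]
    · have hp' : ¬ o.par (o.ix 1) = 0 := by rw [hp]; decide
      rw [if_pos hp, fMat, cF, tgt, src, if_pos rfl, if_pos hp, if_pos rfl, if_neg hp', if_pos rfl,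
        o.rootMat_rev_right hp, smul_smul, div_mul_cancel₀ _ two_ne_zero, map_smul, act_single]
  · rw [evalGen, if_neg h0, upar_val u⁻¹ h0, Units.val_one, mulBy_one, one_mul, fFin, fMat, cF, tgt,
      src, if_neg h0, if_neg h0, if_neg h0]
    by_cases h1 : (i : ℕ) < o.s ∨ Odd o.m
    · rw [if_pos h1, if_pos h1, if_pos h1, if_pos h1, map_smul, act_rootMat, intCast_smul_end]
    · rw [if_neg h1, if_neg h1, if_neg h1, if_neg h1]
      rcases zmod_two_cases (o.par (o.ix o.s)) with hp | hp
      · rw [if_pos hp, if_pos hp, if_pos hp, map_smul, act_rootMat, intCast_smul_end]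
      · have hp' : ¬ o.par (o.ix o.s) = 0 := by rw [hp]; decide
        rw [if_neg hp', if_neg hp', if_neg hp', o.ix_succ_s (o.even_N_of h1),
          o.rootMat_rev_left hp, smul_smul, map_smul, act_single, ← intCast_smul_end, smul_smul]
        congr 1
        push_cast
        ring

theorem evalGen_k (a b : K) (u : Aˣ) (i : Fin (o.s + 1)) :
    o.evalGen a b u (.k i) = o.act A (o.qDiag (o.hDiag i)) := by
  rw [evalGen, qDiag, act_diagonal]

theorem evalGen_kInv (a b : K) (u : Aˣ) (i : Fin (o.s + 1)) :
    o.evalGen a b u (.kInv i) = o.act A (o.qDiag (-o.hDiag i)) := by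
  rw [evalGen, qDiag, act_diagonal]
  rfl

/-- The operators of the generators on the tensor product of two evaluation modules. -/
def tensorGen (a b : K) (u v : Aˣ) : Gen o → Module.End K (o.VV2 A) :=
  o.coprodGen (o.evalGen a b u) (o.evalGen a b v)

theorem superTensor_act (d : ZMod 2) (x y : A) (M M' : o.Mat) :
    o.superTensor d (o.mulBy A x * o.act A M) (o.mulBy A y * o.act A M') =
      o.scal A x y * o.act2 A ((M * o.parMat ^ d.val) ⊗ₖ M') := by
  rw [superTensor, ← act_parMat, mul_assoc, ← map_pow, ← map_mul, act2_kronecker, scal,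
    ← TensorProduct.map_mul]

theorem tensorGen_e (a b : K) (u v : Aˣ) (i : Fin (o.s + 1)) : o.tensorGen a b u v (.e i) =
    o.scal A (upar u i : Aˣ) 1 * o.act2 A (o.dLeft (o.eMat a i) i) +
      o.scal A 1 (upar v i : Aˣ) * o.act2 A (o.dRight (o.eMat a i) i) := by
  have h1 := o.superTensor_act (o.genPar i) (1 : A) (upar v i : Aˣ) (o.qDiag (o.hDiag i)) (o.eMat a i)
  have h2 := o.superTensor_act 0 ((upar u i : Aˣ) : A) (1 : A) (o.eMat a i) (o.qDiag (-o.hDiag i))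
  rw [mulBy_one, one_mul] at h1 h2
  rw [tensorGen, coprodGen, evalGen_e, evalGen_e, evalGen_k, evalGen_kInv, h1, h2, ZMod.val_zero,
    pow_zero, mul_one, add_comm]
  rfl

theorem tensorGen_f (a b : K) (u v : Aˣ) (i : Fin (o.s + 1)) : o.tensorGen a b u v (.f i) =
    o.scal A (upar u⁻¹ i : Aˣ) 1 * o.act2 A (o.dLeft (o.fMat b i) i) +
      o.scal A 1 (upar v⁻¹ i : Aˣ) * o.act2 A (o.dRight (o.fMat b i) i) := by
  have h1 := o.superTensor_act (o.genPar i) (1 : A) (upar v⁻¹ i : Aˣ) (o.qDiag (o.hDiag i))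
    (o.fMat b i)
  have h2 := o.superTensor_act 0 ((upar u⁻¹ i : Aˣ) : A) (1 : A) (o.fMat b i) (o.qDiag (-o.hDiag i))
  rw [mulBy_one, one_mul] at h1 h2
  rw [tensorGen, coprodGen, evalGen_f, evalGen_f, evalGen_k, evalGen_kInv, h1, h2, ZMod.val_zero,
    pow_zero, mul_one, add_comm]
  rfl

theorem tensorGen_k (a b : K) (u v : Aˣ) (i : Fin (o.s + 1)) : o.tensorGen a b u v (.k i) =
    o.act2 A (o.qDiag (o.hDiag i) ⊗ₖ o.qDiag (o.hDiag i)) := by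
  have h1 := o.superTensor_act 0 (1 : A) (1 : A) (o.qDiag (o.hDiag i)) (o.qDiag (o.hDiag i))
  rw [mulBy_one, one_mul, scal_one, one_mul, ZMod.val_zero, pow_zero, mul_one] at h1
  rw [tensorGen, coprodGen, evalGen_k, evalGen_k, h1]

theorem tensorGen_kInv (a b : K) (u v : Aˣ) (i : Fin (o.s + 1)) : o.tensorGen a b u v (.kInv i) =
    o.act2 A (o.qDiag (-o.hDiag i) ⊗ₖ o.qDiag (-o.hDiag i)) := by
  have h1 := o.superTensor_act 0 (1 : A) (1 : A) (o.qDiag (-o.hDiag i)) (o.qDiag (-o.hDiag i))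
  rw [mulBy_one, one_mul, scal_one, one_mul, ZMod.val_zero, pow_zero, mul_one] at h1
  rw [tensorGen, coprodGen, evalGen_kInv, evalGen_kInv, h1]

theorem tensorGen_gam (a b : K) (u v : Aˣ) : o.tensorGen a b u v .gam = 1 := by
  rw [tensorGen, coprodGen, evalGen, superTensor, ZMod.val_zero, pow_zero, mul_one, evalGen,
    TensorProduct.map_one]

theorem tensorGen_gamInv (a b : K) (u v : Aˣ) : o.tensorGen a b u v .gamInv = 1 := by
  rw [tensorGen, coprodGen, evalGen, superTensor, ZMod.val_zero, pow_zero, mul_one, evalGen,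
    TensorProduct.map_one]

end Generators

/-! ### Verification of the defining relations -/

/-- Pair the expansion of θ in simple roots with each weight of V. As the finite part of α_0 is -θ,
the central element acts trivially. -/
theorem sum_smul_hDiag {κ : Fin o.s → ℕ}
    (hκ : ∑ i : Fin o.s, κ i • o.simpleRoot ((i : ℕ) + 1) = o.highestRoot) :
    o.hDiag 0 + ∑ i : Fin o.s, κ i • o.hDiag ((i : ℕ) + 1) = 0 := by
  funext c
  let F : (Fin o.s → ℤ) →+ ℤ := AddMonoidHom.mk' (fun x => o.form x (o.eps c))
    fun x y => o.form_add_left x y _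
  have h := congrArg F hκ
  rw [map_sum] at h
  simp only [map_nsmul] at h
  have h0 : o.hDiag 0 c = -F o.highestRoot := by
    rw [hDiag_eq_form, simpleRoot, if_pos rfl, form_neg_left]
    rfl
  rw [Pi.add_apply, h0, ← h, Finset.sum_apply]
  simp only [Pi.smul_apply, hDiag_eq_form]
  exact neg_add_cancel _

/-- A criterion for the defining relations, if the `q^{h_i/2}` act through a representation of the
weight lattice. -/
theorem affineRel_eq {B : Type} [Ring B] [Algebra K B] {g : Gen o → B}
    (κ : Multiplicative (Fin o.N → ℤ) →* B) (hgam : g .gam = 1) (hgamInv : g .gamInv = 1)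
    (hk : ∀ i : Fin (o.s + 1), g (.k i) = κ (.ofAdd (o.hDiag i)))
    (hkInv : ∀ i : Fin (o.s + 1), g (.kInv i) = κ (.ofAdd (-o.hDiag i)))
    (hke : ∀ i j : Fin (o.s + 1), κ (.ofAdd (o.hDiag i)) * g (.e j) =
      qHalf (o.cartan i j) • (g (.e j) * κ (.ofAdd (o.hDiag i))))
    (hkf : ∀ i j : Fin (o.s + 1), κ (.ofAdd (o.hDiag i)) * g (.f j) =
      qHalf (-o.cartan i j) • (g (.f j) * κ (.ofAdd (o.hDiag i))))
    (hef : ∀ i j : Fin (o.s + 1), g (.e i) * g (.f j) -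
      (sgn (o.genPar i * o.genPar j) : K) • (g (.f j) * g (.e i)) =
      if i = j then (q - q⁻¹)⁻¹ • (g (.k i) ^ 2 - g (.kInv i) ^ 2) else 0)
    (he : Locally o.chi fun w => (w.map fun i => g (.e i)).prod)
    (hf : Locally o.chi fun w => (w.map fun i => g (.f i)).prod) {x y : B}
    (h : o.AffineRel g x y) : x = y := by
  have hinv : ∀ i : Fin (o.s + 1), κ (.ofAdd (o.hDiag i)) * κ (.ofAdd (-o.hDiag i)) = 1 := fun i => by
    rw [← map_mul, ← ofAdd_add, add_neg_cancel, ofAdd_zero, map_one]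
  have hinv' : ∀ i : Fin (o.s + 1), κ (.ofAdd (-o.hDiag i)) * κ (.ofAdd (o.hDiag i)) = 1 := fun i => by
    rw [← map_mul, ← ofAdd_add, neg_add_cancel, ofAdd_zero, map_one]
  cases h with
  | gam_gamInv => rw [hgam, hgamInv, one_mul]
  | gamInv_gam => rw [hgam, hgamInv, one_mul]
  | gam_eq n hn =>
    have h1 : (List.ofFn fun i : Fin o.s => g (.k i.succ) ^ n i).prod =
        κ (.ofAdd (∑ i : Fin o.s, n i • o.hDiag ((i : ℕ) + 1))) := by
      have : (fun i : Fin o.s => g (.k i.succ) ^ n i) =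
          κ ∘ fun i : Fin o.s => Multiplicative.ofAdd (n i • o.hDiag ((i : ℕ) + 1)) := by
        funext i
        rw [hk, Function.comp_apply, ofAdd_nsmul, map_pow]
        rfl
      rw [this, ← List.map_ofFn, ← map_list_prod, List.prod_ofFn, ← ofAdd_sum]
    rw [h1, hk, hgam, ← map_mul, ← ofAdd_add]
    change 1 = κ (.ofAdd (o.hDiag 0 + _))
    rw [o.sum_smul_hDiag hn, ofAdd_zero, map_one]
  | gam_central => rw [hgam, one_mul, mul_one]
  | k_comm i j => rw [hk, hk, ← map_mul, mul_comm, map_mul]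
  | k_kInv i => rw [hk, hkInv, hinv]
  | kInv_k i => rw [hk, hkInv, hinv']
  | k_e i j => rw [hk, hkInv, hke, smul_mul_assoc, mul_assoc, hinv, mul_one]
  | k_f i j => rw [hk, hkInv, hkf, smul_mul_assoc, mul_assoc, hinv, mul_one]
  | e_f i j => rw [← hef i j, Int.cast_smul_eq_zsmul]
  | serre_e x hx => exact sum_eq_zero_of_locally he ((o.isSerre_iff x).1 hx)
  | serre_f x hx => exact sum_eq_zero_of_locally hf ((o.isSerre_iff x).1 hx)

/-- The action of `q^{x/2}` as a representation of the group of exponents. -/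
def qDiagHom : Multiplicative (Fin o.N → ℤ) →* o.Mat where
  toFun x := o.qDiag x.toAdd
  map_one' := o.qDiag_zero
  map_mul' _ _ := (o.qDiag_mul _ _).symm

/-- The action of `q^{x/2} ⊗ q^{x/2}`. -/
def qDiagHom2 : Multiplicative (Fin o.N → ℤ) →* o.Mat2 where
  toFun x := o.qDiag x.toAdd ⊗ₖ o.qDiag x.toAdd
  map_one' := by rw [toAdd_one, qDiag_zero, Matrix.one_kronecker_one]
  map_mul' x y := by rw [toAdd_mul, ← qDiag_mul, Matrix.mul_kronecker_mul]

theorem qDiag_eMat (a : K) (i j : ℕ) : o.qDiag (o.hDiag i) * o.eMat a j =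
    qHalf (o.cartan i j) • (o.eMat a j * o.qDiag (o.hDiag i)) := by
  have h := o.qDiag_mul_eMat a i j 1
  rwa [one_smul, one_mul] at h

theorem qDiag_fMat (b : K) (i j : ℕ) : o.qDiag (o.hDiag i) * o.fMat b j =
    qHalf (-o.cartan i j) • (o.fMat b j * o.qDiag (o.hDiag i)) := by
  have h := o.qDiag_mul_fMat b i j 1
  rwa [one_smul, one_mul] at h

theorem e_f_mat {a b : K} (hab : a * b = o.abValue) (i j : Fin (o.s + 1)) :
    o.eMat a i * o.fMat b j - (sgn (o.genPar i * o.genPar j) : K) • (o.fMat b j * o.eMat a i) =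
      if i = j then (q - q⁻¹)⁻¹ • (o.qDiag (o.hDiag i) ^ 2 - o.qDiag (-o.hDiag i) ^ 2) else 0 := by
  by_cases h : i = j
  · subst h
    rw [if_pos rfl, o.e_f_self hab (Nat.le_of_lt_succ i.2)]
  · rw [if_neg h, o.e_f_ne (Nat.le_of_lt_succ i.2) (Nat.le_of_lt_succ j.2)
      fun h' => h (Fin.ext h')]

section Module

variable {A : Type} [CommRing A] [Algebra K A]

theorem mulBy_act_word (z : Fin (o.s + 1) → A) (X : Fin (o.s + 1) → o.Mat)
    (w : List (Fin (o.s + 1))) : (w.map fun i => o.mulBy A (z i) * o.act A (X i)).prod =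
      o.mulBy A (w.map z).prod * o.act A (w.map X).prod := by
  induction w with
  | nil => simp [mulBy_one]
  | cons i w ih =>
    rw [List.map_cons, List.prod_cons, ih, List.map_cons, List.prod_cons, List.map_cons,
      List.prod_cons, ← mulBy_mul, map_mul, mul_assoc, mul_assoc, ← mul_assoc (o.act A (X i)),
      ← (o.mulBy_comm_act A _ (X i)).eq, mul_assoc]

theorem scal_act2_word (z z' : Fin (o.s + 1) → A) (X : Fin (o.s + 1) → o.Mat2)
    (w : List (Fin (o.s + 1))) : (w.map fun i => o.scal A (z i) (z' i) * o.act2 A (X i)).prod =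
      o.scal A (w.map z).prod (w.map z').prod * o.act2 A (w.map X).prod := by
  induction w with
  | nil => simp [scal_one]
  | cons i w ih =>
    simp only [List.map_cons, List.prod_cons]
    rw [ih, ← scal_mul, map_mul, mul_assoc, mul_assoc, ← mul_assoc (o.act2 A (X i)),
      ← (o.scal_comm_act2 A _ _ (X i)).eq, mul_assoc]

theorem scal_act2_mul (x y x' y' : A) (M M' : o.Mat2) :
    (o.scal A x y * o.act2 A M) * (o.scal A x' y' * o.act2 A M') =
      o.scal A (x * x') (y * y') * o.act2 A (M * M') := by
  rw [← scal_mul, map_mul, mul_assoc, mul_assoc, ← mul_assoc (o.act2 A M),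
    ← (o.scal_comm_act2 A _ _ M).eq, mul_assoc]

/-- The product of the spectral parameters along a word depends only on its content, so the Serre
relations survive the introduction of `u`. -/
theorem locally_mulBy_act (z : Fin (o.s + 1) → A) {X : Fin (o.s + 1) → o.Mat}
    (hX : Locally o.chi fun w => (w.map X).prod) :
    Locally o.chi fun w => (w.map fun i => o.mulBy A (z i) * o.act A (X i)).prod := by
  convert hX.content (fun μ => LinearMap.mulLeft K (o.mulBy A (μ.map z).prod) ∘ₗ
    (o.act A).toLinearMap) using 2 with w
  rw [mulBy_act_word]
  rfl

theorem affineRel_evalGen {a b : K} (hab : a * b = o.abValue) (u : Aˣ)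
    {x y : Module.End K (o.VV A)} (h : o.AffineRel (o.evalGen a b u) x y) : x = y := by
  refine o.affineRel_eq (((o.act A : o.Mat →* Module.End K (o.VV A))).comp o.qDiagHom) rfl rfl
    (o.evalGen_k a b u) (o.evalGen_kInv a b u) (fun i j => ?_) (fun i j => ?_) (fun i j => ?_) ?_ ?_ h
  · change o.act A (o.qDiag _) * _ = _ • (_ * o.act A (o.qDiag _))
    rw [evalGen_e, ← mul_assoc, ← (o.mulBy_comm_act A _ _).eq, mul_assoc, mul_assoc,
      ← mul_smul_comm, ← map_mul, ← map_mul, ← map_smul, toAdd_ofAdd, qDiag_eMat]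
  · change o.act A (o.qDiag _) * _ = _ • (_ * o.act A (o.qDiag _))
    rw [evalGen_f, ← mul_assoc, ← (o.mulBy_comm_act A _ _).eq, mul_assoc, mul_assoc,
      ← mul_smul_comm, ← map_mul, ← map_mul, ← map_smul, toAdd_ofAdd, qDiag_fMat]
  · have hm : ∀ (z z' : A) (M M' : o.Mat), (o.mulBy A z * o.act A M) * (o.mulBy A z' * o.act A M') =
        o.mulBy A (z * z') * o.act A (M * M') := fun z z' M M' => by
      rw [← mulBy_mul, map_mul, mul_assoc, mul_assoc, ← mul_assoc (o.act A M),
        ← (o.mulBy_comm_act A _ M).eq, mul_assoc]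
    have h1 := o.e_f_mat hab i j
    rw [evalGen_e, evalGen_f, evalGen_k, evalGen_kInv, hm, hm, mul_comm (((upar u⁻¹ j : Aˣ)) : A),
      ← mul_smul_comm, ← mul_sub, ← map_smul, ← map_sub (o.act A), h1]
    split_ifs with hij
    · subst hij
      have : ((upar u i : Aˣ) : A) * (upar u⁻¹ i : Aˣ) = 1 := by
        rw [upar, upar]
        split_ifs <;> simp
      rw [this, mulBy_one, one_mul, map_smul, map_sub, map_pow, map_pow]
    · rw [map_zero, mul_zero]
  · simp only [evalGen_e]
    exact o.locally_mulBy_act (fun i => ((upar u i : Aˣ) : A)) (o.eWord_locally hab)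
  · simp only [evalGen_f]
    exact o.locally_mulBy_act (fun i => ((upar u⁻¹ i : Aˣ) : A)) (o.fWord_locally hab)

end Module

theorem dLeft_word (X : Fin (o.s + 1) → o.Mat) (w : List (Fin (o.s + 1))) :
    (w.map fun i : Fin (o.s + 1) => o.dLeft (X i) i).prod =
      (w.map X).prod ⊗ₖ o.qDiag (-o.hSum w) := by
  induction w with
  | nil => simp [hSum, qDiag_zero]
  | cons i w ih =>
    rw [List.map_cons, List.prod_cons, ih, dLeft, ← Matrix.mul_kronecker_mul, qDiag_mul,
      hSum_cons, neg_add, List.map_cons, List.prod_cons]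

theorem dRight_word (X : Fin (o.s + 1) → o.Mat) (w : List (Fin (o.s + 1))) :
    (w.map fun i : Fin (o.s + 1) => o.dRight (X i) i).prod =
      (o.qDiag (o.hSum w) * o.parMat ^ o.valSum w) ⊗ₖ (w.map X).prod := by
  induction w with
  | nil => simp [hSum, valSum, qDiag_zero]
  | cons i w ih =>
    rw [List.map_cons, List.prod_cons, ih, dRight, ← Matrix.mul_kronecker_mul, hSum_cons,
      valSum_cons, List.map_cons, List.prod_cons, pow_add, ← qDiag_mul, mul_assoc, mul_assoc,
      ← mul_assoc (o.parMat ^ _) (o.qDiag _), qDiag_mul_parMat_pow, mul_assoc]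

theorem qDiag_neg_eMat (a : K) (i j : ℕ) : o.qDiag (-o.hDiag i) * o.eMat a j =
    qHalf (-o.cartan i j) • (o.eMat a j * o.qDiag (-o.hDiag i)) := by
  have h := o.qDiag_mul_eMat a i j (-1)
  rwa [neg_one_smul, neg_one_mul] at h

theorem qDiag_neg_fMat (b : K) (i j : ℕ) : o.qDiag (-o.hDiag i) * o.fMat b j =
    qHalf (o.cartan i j) • (o.fMat b j * o.qDiag (-o.hDiag i)) := by
  have h := o.qDiag_mul_fMat b i j (-1)
  rwa [neg_one_smul, neg_one_mul, neg_neg] at h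

theorem parMat_pow_mul_fMat (b : K) (g : ZMod 2) (i : ℕ) : o.parMat ^ g.val * o.fMat b i =
    (sgn (g * o.genPar i) : K) • (o.fMat b i * o.parMat ^ g.val) := by
  rcases zmod_two_cases g with rfl | rfl
  · simp
  · simp [ZMod.val_one, parMat_mul_fMat]

/-- The commutation of the two halves of the coproducts, for root vectors `X` and `Y` of weights
proportional to `x` and `y`. -/
theorem dRight_mul_dLeft {X Y : o.Mat} {i j : ℕ} {x y : ℤ}
    (hX : o.qDiag (o.hDiag i) * X = qHalf x • (X * o.qDiag (o.hDiag i)))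
    (hP : o.parMat ^ (o.genPar i).val * X =
      (sgn (o.genPar i * o.genPar j) : K) • (X * o.parMat ^ (o.genPar i).val))
    (hY : o.qDiag (-o.hDiag j) * Y = qHalf y • (Y * o.qDiag (-o.hDiag j))) :
    o.dRight Y i * o.dLeft X j = (sgn (o.genPar i * o.genPar j) * qHalf (x - y)) •
      (o.dLeft X j * o.dRight Y i) := by
  rw [dLeft, dRight, ← Matrix.mul_kronecker_mul, ← Matrix.mul_kronecker_mul, hY, mul_assoc, hP,
    mul_smul_comm, ← mul_assoc, hX, smul_mul_assoc, Matrix.smul_kronecker, Matrix.smul_kronecker,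
    Matrix.kronecker_smul, smul_smul, smul_smul, mul_assoc, mul_assoc, qHalf_sub, mul_assoc,
    inv_mul_cancel₀ (qHalf_ne_zero _), mul_one]

theorem dRight_eMat_mul_dLeft_eMat (a : K) (i j : Fin (o.s + 1)) :
    o.dRight (o.eMat a i) i * o.dLeft (o.eMat a j) j =
      o.chi i j • (o.dLeft (o.eMat a j) j * o.dRight (o.eMat a i) i) := by
  rw [o.dRight_mul_dLeft (o.qDiag_eMat a i j) (o.parMat_pow_mul_eMat a _ j)
    (o.qDiag_neg_eMat a j i), chi, braid, o.cartan_comm j i, sub_neg_eq_add, two_mul]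

theorem dRight_fMat_mul_dLeft_fMat (b : K) (i j : Fin (o.s + 1)) :
    o.dRight (o.fMat b i) i * o.dLeft (o.fMat b j) j = (sgn (o.genPar i * o.genPar j) *
      qHalf (-(2 * o.cartan i j))) • (o.dLeft (o.fMat b j) j * o.dRight (o.fMat b i) i) := by
  rw [o.dRight_mul_dLeft (o.qDiag_fMat b i j) (o.parMat_pow_mul_fMat b _ j)
    (o.qDiag_neg_fMat b j i), o.cartan_comm j i, two_mul, neg_add, sub_eq_add_neg]

theorem dLeft_fMat_mul_dRight_fMat (b : K) (i j : Fin (o.s + 1)) :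
    o.dLeft (o.fMat b i) i * o.dRight (o.fMat b j) j =
      o.chi i j • (o.dRight (o.fMat b j) j * o.dLeft (o.fMat b i) i) := by
  rw [dRight_fMat_mul_dLeft_fMat, smul_smul, chi, braid, mul_comm (o.genPar j), o.cartan_comm j i,
    mul_mul_mul_comm, sgn_cast_mul_self, ← qHalf_add, add_neg_cancel, qHalf_zero, mul_one, one_smul]

theorem dRight_eMat_mul_dLeft_fMat (a b : K) (i j : Fin (o.s + 1)) :
    o.dRight (o.eMat a i) i * o.dLeft (o.fMat b j) j =
      (sgn (o.genPar i * o.genPar j) : K) • (o.dLeft (o.fMat b j) j * o.dRight (o.eMat a i) i) := by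
  rw [o.dRight_mul_dLeft (o.qDiag_fMat b i j) (o.parMat_pow_mul_fMat b _ j)
    (o.qDiag_neg_eMat a j i), o.cartan_comm j i, sub_self, qHalf_zero, mul_one]

theorem dRight_fMat_mul_dLeft_eMat (a b : K) (i j : Fin (o.s + 1)) :
    o.dRight (o.fMat b i) i * o.dLeft (o.eMat a j) j =
      (sgn (o.genPar i * o.genPar j) : K) • (o.dLeft (o.eMat a j) j * o.dRight (o.fMat b i) i) := by
  rw [o.dRight_mul_dLeft (o.qDiag_eMat a i j) (o.parMat_pow_mul_eMat a _ j)
    (o.qDiag_neg_fMat b j i), o.cartan_comm j i, sub_self, qHalf_zero, mul_one]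

theorem dLeft_mul_dLeft (X Y : o.Mat) (i j : ℕ) : o.dLeft X i * o.dLeft Y j =
    (X * Y) ⊗ₖ o.qDiag (-o.hDiag i + -o.hDiag j) := by
  rw [dLeft, dLeft, ← Matrix.mul_kronecker_mul, qDiag_mul]

theorem dRight_mul_dRight (X Y : o.Mat) (i j : ℕ) : o.dRight X i * o.dRight Y j =
    (o.qDiag (o.hDiag i + o.hDiag j) * o.parMat ^ ((o.genPar i).val + (o.genPar j).val)) ⊗ₖ
      (X * Y) := by
  rw [dRight, dRight, ← Matrix.mul_kronecker_mul, mul_assoc, ← mul_assoc (o.parMat ^ _),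
    qDiag_mul_parMat_pow, mul_assoc, ← pow_add, ← mul_assoc, qDiag_mul]

theorem sub_kronecker (X Y Z : o.Mat) : (X - Y) ⊗ₖ Z = X ⊗ₖ Z - Y ⊗ₖ Z := by
  ext
  simp [sub_mul]

theorem kronecker_sub (X Y Z : o.Mat) : X ⊗ₖ (Y - Z) = X ⊗ₖ Y - X ⊗ₖ Z := by
  ext
  simp [mul_sub]

theorem dLeft_bracket {a b : K} (hab : a * b = o.abValue) (i j : Fin (o.s + 1)) :
    o.dLeft (o.eMat a i) i * o.dLeft (o.fMat b j) j -
      (sgn (o.genPar i * o.genPar j) : K) • (o.dLeft (o.fMat b j) j * o.dLeft (o.eMat a i) i) =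
    if i = j then (q - q⁻¹)⁻¹ • ((o.qDiag (o.hDiag i) ^ 2 - o.qDiag (-o.hDiag i) ^ 2) ⊗ₖ
      (o.qDiag (-o.hDiag i) ^ 2)) else 0 := by
  rw [dLeft_mul_dLeft, dLeft_mul_dLeft, add_comm (-o.hDiag j), ← Matrix.smul_kronecker,
    ← sub_kronecker, o.e_f_mat hab]
  split_ifs with h
  · subst h
    rw [Matrix.smul_kronecker, sq (o.qDiag (-o.hDiag i)), qDiag_mul]
  · rw [Matrix.zero_kronecker]

theorem dRight_bracket {a b : K} (hab : a * b = o.abValue) (i j : Fin (o.s + 1)) :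
    o.dRight (o.eMat a i) i * o.dRight (o.fMat b j) j -
      (sgn (o.genPar i * o.genPar j) : K) • (o.dRight (o.fMat b j) j * o.dRight (o.eMat a i) i) =
    if i = j then (q - q⁻¹)⁻¹ • ((o.qDiag (o.hDiag i) ^ 2) ⊗ₖ
      (o.qDiag (o.hDiag i) ^ 2 - o.qDiag (-o.hDiag i) ^ 2)) else 0 := by
  rw [dRight_mul_dRight, dRight_mul_dRight, add_comm (o.hDiag j), add_comm (o.genPar j).val,
    ← Matrix.kronecker_smul, ← kronecker_sub, o.e_f_mat hab]
  split_ifs with h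
  · subst h
    rw [Matrix.kronecker_smul, sq (o.qDiag (o.hDiag i)), qDiag_mul, pow_add, ← (Commute.refl o.parMat).mul_pow,
      parMat_mul_parMat, one_pow, mul_one]
  · rw [Matrix.kronecker_zero]

section Module

variable {A : Type} [CommRing A] [Algebra K A]

/-- In a word of left halves the second leg is q^{-h/2} for the total weight, which depends only on
the content; hence the first leg alone decides the Serre relations. -/
theorem locally_left (z : Fin (o.s + 1) → A) {X : Fin (o.s + 1) → o.Mat}
    (hX : Locally o.chi fun w => (w.map X).prod) : Locally o.chi fun w =>
      (w.map fun i : Fin (o.s + 1) => o.scal A (z i) 1 * o.act2 A (o.dLeft (X i) i)).prod := by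
  let L : Multiset (Fin (o.s + 1)) → o.Mat →ₗ[K] Module.End K (o.VV2 A) := fun μ =>
    LinearMap.mulLeft K (o.scal A (μ.map z).prod 1) ∘ₗ (o.act2 A).toLinearMap ∘ₗ
      (Matrix.kroneckerBilinear (R := K) (α := K) (l := Fin o.N) (m := Fin o.N) (n := Fin o.N) (p := Fin o.N)).flip (o.qDiag (-o.hSum μ))
  convert hX.content (M' := Module.End K (o.VV2 A)) L using 2 with w
  rw [o.scal_act2_word z fun _ => 1, dLeft_word, List.map_const', List.prod_replicate, one_pow]
  rfl

theorem locally_right (z : Fin (o.s + 1) → A) {X : Fin (o.s + 1) → o.Mat}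
    (hX : Locally o.chi fun w => (w.map X).prod) : Locally o.chi fun w =>
      (w.map fun i : Fin (o.s + 1) => o.scal A 1 (z i) * o.act2 A (o.dRight (X i) i)).prod := by
  let L : Multiset (Fin (o.s + 1)) → o.Mat →ₗ[K] Module.End K (o.VV2 A) := fun μ =>
    LinearMap.mulLeft K (o.scal A 1 (μ.map z).prod) ∘ₗ (o.act2 A).toLinearMap ∘ₗ
      Matrix.kroneckerBilinear (R := K) (α := K) (o.qDiag (o.hSum μ) * o.parMat ^ o.valSum μ)
  convert hX.content (M' := Module.End K (o.VV2 A)) L using 2 with w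
  rw [o.scal_act2_word (fun _ => 1) z, dRight_word, List.map_const', List.prod_replicate, one_pow]
  rfl

theorem scal_act2_exchange {z z' w w' : A} {M M' : o.Mat2} {c : K} (h : M * M' = c • (M' * M)) :
    (o.scal A z z' * o.act2 A M) * (o.scal A w w' * o.act2 A M') =
      c • ((o.scal A w w' * o.act2 A M') * (o.scal A z z' * o.act2 A M)) := by
  rw [scal_act2_mul, scal_act2_mul, h, map_smul, mul_smul_comm, mul_comm z, mul_comm z']

theorem bracket_add {B : Type} [Ring B] [Algebra K B] {s : K} {x y x' y' : B}
    (h1 : y * x' = s • (x' * y)) (h2 : x * y' = s • (y' * x)) :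
    (x + y) * (x' + y') - s • ((x' + y') * (x + y)) =
      (x * x' - s • (x' * x)) + (y * y' - s • (y' * y)) := by
  rw [add_mul, mul_add, mul_add, h1, h2, mul_add, add_mul, add_mul]
  module

/-- In the bracket of e_i and f_j the mixed products supercommute, and the two pure ones telescope
to the required Cartan element. The Serre relations come from writing each generator as a sum of two
braided-commuting halves and applying `Locally.cop`. -/
theorem affineRel_tensorGen {a b : K} (hab : a * b = o.abValue) (u v : Aˣ)
    {x y : Module.End K (o.VV2 A)} (h : o.AffineRel (o.tensorGen a b u v) x y) : x = y := by
  have ce : ∀ (i j : Fin (o.s + 1)) (g : o.Mat2) (X Y : o.Mat2) (c : K) (z z' : A),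
      g * X = c • (X * g) → g * Y = c • (Y * g) →
      o.act2 A g * (o.scal A z 1 * o.act2 A X + o.scal A 1 z' * o.act2 A Y) =
        c • ((o.scal A z 1 * o.act2 A X + o.scal A 1 z' * o.act2 A Y) * o.act2 A g) := by
    intro i j g X Y c z z' hX hY
    have e1 := o.scal_act2_exchange (A := A) (z := 1) (z' := 1) (w := z) (w' := 1) hX
    have e2 := o.scal_act2_exchange (A := A) (z := 1) (z' := 1) (w := 1) (w' := z') hY
    rw [scal_one, one_mul] at e1 e2
    rw [mul_add, e1, e2, add_mul, smul_add]
  refine o.affineRel_eq (((o.act2 A : o.Mat2 →* Module.End K (o.VV2 A))).comp o.qDiagHom2)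
    (o.tensorGen_gam a b u v) (o.tensorGen_gamInv a b u v) (o.tensorGen_k a b u v)
    (o.tensorGen_kInv a b u v) (fun i j => ?_) (fun i j => ?_) (fun i j => ?_) ?_ ?_ h
  · rw [tensorGen_e]
    refine ce i j _ _ _ _ _ _ ?_ ?_
    · change (o.qDiag _ ⊗ₖ o.qDiag _) * _ = _
      rw [dLeft, ← Matrix.mul_kronecker_mul, toAdd_ofAdd, qDiag_eMat, qDiag_mul,
        add_comm (o.hDiag i), ← qDiag_mul, Matrix.smul_kronecker, Matrix.mul_kronecker_mul]
      rfl
    · change (o.qDiag _ ⊗ₖ o.qDiag _) * _ = _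
      rw [dRight, ← Matrix.mul_kronecker_mul, toAdd_ofAdd, qDiag_eMat, ← mul_assoc, qDiag_mul,
        add_comm (o.hDiag i), ← qDiag_mul, mul_assoc, ← qDiag_mul_parMat_pow, ← mul_assoc,
        Matrix.kronecker_smul, Matrix.mul_kronecker_mul]
      rfl
  · rw [tensorGen_f]
    refine ce i j _ _ _ _ _ _ ?_ ?_
    · change (o.qDiag _ ⊗ₖ o.qDiag _) * _ = _
      rw [dLeft, ← Matrix.mul_kronecker_mul, toAdd_ofAdd, qDiag_fMat, qDiag_mul,
        add_comm (o.hDiag i), ← qDiag_mul, Matrix.smul_kronecker, Matrix.mul_kronecker_mul]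
      rfl
    · change (o.qDiag _ ⊗ₖ o.qDiag _) * _ = _
      rw [dRight, ← Matrix.mul_kronecker_mul, toAdd_ofAdd, qDiag_fMat, ← mul_assoc, qDiag_mul,
        add_comm (o.hDiag i), ← qDiag_mul, mul_assoc, ← qDiag_mul_parMat_pow, ← mul_assoc,
        Matrix.kronecker_smul, Matrix.mul_kronecker_mul]
      rfl
  · have hu : ∀ t : Aˣ, ((upar t i : Aˣ) : A) * (upar t⁻¹ i : Aˣ) = 1 := fun t => by
      rw [upar, upar]
      split_ifs <;> simp
    have t2 : ∀ (z z' w w' : A) (M M' : o.Mat2) (c : K),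
        o.scal A z z' * o.act2 A M * (o.scal A w w' * o.act2 A M') -
          c • (o.scal A w w' * o.act2 A M' * (o.scal A z z' * o.act2 A M)) =
        o.scal A (z * w) (z' * w') * o.act2 A (M * M' - c • (M' * M)) := by
      intro z z' w w' M M' c
      rw [scal_act2_mul, scal_act2_mul, mul_comm w, mul_comm w', map_sub (o.act2 A), map_smul,
        ← mul_smul_comm]
      exact (mul_sub (o.scal A (z * w) (z' * w')) _ _).symm
    have h2 : o.dLeft (o.eMat a i) i * o.dRight (o.fMat b j) j =
        (sgn (o.genPar i * o.genPar j) : K) •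
          (o.dRight (o.fMat b j) j * o.dLeft (o.eMat a i) i) := by
      rw [dRight_fMat_mul_dLeft_eMat, smul_smul, mul_comm (o.genPar j), sgn_cast_mul_self, one_smul]
    rw [tensorGen_e, tensorGen_f, bracket_add (B := Module.End K (o.VV2 A))
      (o.scal_act2_exchange (o.dRight_eMat_mul_dLeft_fMat a b i j)) (o.scal_act2_exchange h2), t2, t2,
      o.dLeft_bracket hab, o.dRight_bracket hab, tensorGen_k, tensorGen_kInv]
    split_ifs with hij
    · subst hij
      rw [hu, hu, mul_one, scal_one, one_mul, one_mul, ← map_add, ← map_pow, ← map_pow,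
        ← map_sub (o.act2 A), ← map_smul, ← smul_add]
      congr 2
      simp only [sq, ← Matrix.mul_kronecker_mul, sub_kronecker, kronecker_sub]
      abel
    · rw [map_zero, mul_zero, mul_zero, add_zero]
  · simp only [tensorGen_e]
    have key := Locally.cop (B := Module.End K (o.VV2 A)) o.chi_comm
      (o.locally_left (fun i => ((upar u i : Aˣ) : A)) (o.eWord_locally hab))
      (o.locally_right (fun i => ((upar v i : Aˣ) : A)) (o.eWord_locally hab))
      List.prod_nil List.prod_nil
    convert key using 1
    funext w
    exact prod_add_eq_cop (B := Module.End K (o.VV2 A)) _ _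
      (fun i j => o.scal_act2_exchange (o.dRight_eMat_mul_dLeft_eMat a i j)) w
  -- For the f_i the halves commute with the inverse exponents, so the right halves must be taken
  -- first to obtain the bicharacter itself.
  · simp only [tensorGen_f]
    have key := Locally.cop (B := Module.End K (o.VV2 A)) o.chi_comm
        (o.locally_right (fun i => ((upar v⁻¹ i : Aˣ) : A)) (o.fWord_locally hab))
        (o.locally_left (fun i => ((upar u⁻¹ i : Aˣ) : A)) (o.fWord_locally hab))
        List.prod_nil List.prod_nil
    convert key using 1
    funext w
    simp only [add_comm (o.scal A _ 1 * _)]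
    exact prod_add_eq_cop (B := Module.End K (o.VV2 A)) _ _
      (fun i j => o.scal_act2_exchange (o.dLeft_fMat_mul_dRight_fMat b i j)) w

end Module

/-! ### The modules -/

variable {o} in
theorem AffineRel.map {B B' : Type} [Ring B] [Algebra K B] [Ring B'] [Algebra K B']
    (F : B →ₐ[K] B') {g : Gen o → B} {x y : B} (h : o.AffineRel g x y) :
    o.AffineRel (fun t => F (g t)) (F x) (F y) := by
  cases h with
  | gam_gamInv => rw [map_mul, map_one]; exact .gam_gamInv
  | gamInv_gam => rw [map_mul, map_one]; exact .gamInv_gam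
  | gam_eq κ hκ =>
    rw [map_mul, map_list_prod, List.map_ofFn]
    simp only [Function.comp_def, map_pow]
    exact .gam_eq (g := fun t => F (g t)) κ hκ
  | gam_central x => rw [map_mul, map_mul]; exact .gam_central (g := fun t => F (g t)) x
  | k_comm i j => rw [map_mul, map_mul]; exact .k_comm (g := fun t => F (g t)) i j
  | k_kInv i => rw [map_mul, map_one]; exact .k_kInv (g := fun t => F (g t)) i
  | kInv_k i => rw [map_mul, map_one]; exact .kInv_k (g := fun t => F (g t)) i
  | k_e i j => rw [map_mul, map_mul, map_smul]; exact .k_e (g := fun t => F (g t)) i j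
  | k_f i j => rw [map_mul, map_mul, map_smul]; exact .k_f (g := fun t => F (g t)) i j
  | e_f i j =>
    have := AffineRel.e_f (o := o) (g := fun t => F (g t)) i j
    rw [apply_ite F, map_sub, map_mul, map_zsmul, map_mul, map_smul, map_sub, map_pow, map_pow,
      map_zero]
    exact this
  | serre_e x hx =>
    have := AffineRel.serre_e (o := o) (g := fun t => F (g t)) x hx
    rw [map_finsuppSum, map_zero]
    simpa only [map_smul, map_list_prod, List.map_map, Function.comp_def] using this
  | serre_f x hx =>
    have := AffineRel.serre_f (o := o) (g := fun t => F (g t)) x hx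
    rw [map_finsuppSum, map_zero]
    simpa only [map_smul, map_list_prod, List.map_map, Function.comp_def] using this

/-- A representation of `U'_q` from operators that satisfy the defining relations. -/
theorem exists_hom_reduced {B : Type} [Ring B] [Algebra K B] {g : Gen o → B}
    (hg : ∀ {x y}, o.AffineRel g x y → x = y) :
    ∃ ρ : o.UReduced →ₐ[K] B, ∀ x, ρ (UReduced.gen o x) = g x := by
  refine ⟨RingQuot.liftAlgHom K ⟨FreeAlgebra.lift K g, fun x y h => hg ?_⟩, fun x => ?_⟩
  · have := h.map (FreeAlgebra.lift K g)
    simpa only [FreeAlgebra.lift_ι_apply] using this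
  · rw [UReduced.gen, RingQuot.liftAlgHom_mkAlgHom_apply, FreeAlgebra.lift_ι_apply]

/-- A representation of `U_q` from operators that satisfy the defining relations. -/
theorem exists_hom_full {B : Type} [Ring B] [Algebra K B] {g : Gen o → B} {D D' : B}
    (hg : ∀ {x y}, o.AffineRel g x y → x = y) (h1 : D * D' = 1) (h2 : D' * D = 1)
    (hk : ∀ i, D * g (.k i) = g (.k i) * D)
    (he : ∀ i, D * g (.e i) = (if i = 0 then q else 1) • (g (.e i) * D))
    (hf : ∀ i, D * g (.f i) = (if i = 0 then q⁻¹ else 1) • (g (.f i) * D)) :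
    ∃ ρ : o.U →ₐ[K] B, (∀ x, ρ (U.gen o (.inl x)) = g x) ∧ ρ (U.gen o (.inr .D)) = D ∧
      ρ (U.gen o (.inr .DInv)) = D' := by
  let G : Gen o ⊕ DGen → B := Sum.elim g fun x => match x with
    | .D => D
    | .DInv => D'
  have hι : ∀ x, FreeAlgebra.lift K G (FreeAlgebra.ι K x) = G x := FreeAlgebra.lift_ι_apply G
  have hG1 : G (.inr .D) = D := rfl
  have hG2 : G (.inr .DInv) = D' := rfl
  have hG3 : ∀ x, G (.inl x) = g x := fun _ => rfl
  refine ⟨RingQuot.liftAlgHom K ⟨FreeAlgebra.lift K G, fun x y h => ?_⟩, fun x => ?_, ?_, ?_⟩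
  · cases h with
    | affine _ _ h =>
      refine hg ?_
      have := h.map (FreeAlgebra.lift K G)
      simp only [hι, hG3] at this
      exact this
    | D_DInv => rw [map_mul, map_one, hι, hι, hG1, hG2, h1]
    | DInv_D => rw [map_mul, map_one, hι, hι, hG1, hG2, h2]
    | D_k i => rw [map_mul, map_mul, hι, hι, hG1, hG3, hk]
    | D_e i =>
      rw [map_mul, map_mul, map_smul, hι, hι, hι, hG1, hG2, hG3, he, smul_mul_assoc, mul_assoc, h1,
        mul_one]
    | D_f i =>
      rw [map_mul, map_mul, map_smul, hι, hι, hι, hG1, hG2, hG3, hf, smul_mul_assoc, mul_assoc, h1,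
        mul_one]
  · rw [U.gen, RingQuot.liftAlgHom_mkAlgHom_apply, hι, hG3]
  · rw [U.gen, RingQuot.liftAlgHom_mkAlgHom_apply, hι, hG1]
  · rw [U.gen, RingQuot.liftAlgHom_mkAlgHom_apply, hι, hG2]

/-- Elements of a quotient of a free algebra intertwine if the generators do. -/
theorem intertwines_of_gen {X B : Type} [Ring B] [Algebra K B]
    {r : FreeAlgebra K X → FreeAlgebra K X → Prop} {ρ ρ' : RingQuot r →ₐ[K] B} {P : B}
    (h : ∀ x, P * ρ (RingQuot.mkAlgHom K r (FreeAlgebra.ι K x)) =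
      ρ' (RingQuot.mkAlgHom K r (FreeAlgebra.ι K x)) * P) (x : RingQuot r) :
    P * ρ x = ρ' x * P := by
  obtain ⟨x, rfl⟩ := RingQuot.mkAlgHom_surjective K r x
  induction x using FreeAlgebra.induction with
  | grade0 c => rw [AlgHom.commutes, AlgHom.commutes, AlgHom.commutes, Algebra.commutes]
  | grade1 x => exact h x
  | mul x y hx hy => rw [map_mul, map_mul, map_mul, ← mul_assoc, hx, mul_assoc, hy, mul_assoc]
  | add x y hx hy => rw [map_add, map_add, map_add, mul_add, add_mul, hx, hy]

/-! ### The action of the degree generator -/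

/-- The automorphism `T ↦ c T` of `K[T;T⁻¹]`. -/
def dilate (c : Kˣ) : K[T;T⁻¹] →+* K[T;T⁻¹] :=
  LaurentPolynomial.eval₂ LaurentPolynomial.C
    (Units.map (LaurentPolynomial.C : K →+* K[T;T⁻¹]) c * unitT)

theorem unitT_zpow (n : ℤ) : ((unitT ^ n : (K[T;T⁻¹])ˣ) : K[T;T⁻¹]) = LaurentPolynomial.T n := by
  have hT : (unitT : (K[T;T⁻¹])ˣ).val = LaurentPolynomial.T 1 := rfl
  have hT' : (unitT⁻¹ : (K[T;T⁻¹])ˣ).val = LaurentPolynomial.T (-1) := rfl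
  cases n with
  | ofNat n => rw [Int.ofNat_eq_natCast, zpow_natCast, Units.val_pow_eq_pow_val, hT, LaurentPolynomial.T_pow, mul_one]
  | negSucc n =>
    rw [zpow_negSucc, ← inv_pow, Units.val_pow_eq_pow_val, hT', LaurentPolynomial.T_pow, mul_neg_one, Int.negSucc_eq]
    rfl

theorem dilate_T (c : Kˣ) (n : ℤ) : dilate c (LaurentPolynomial.T n) =
    ((c : K) ^ n) • (LaurentPolynomial.T n : K[T;T⁻¹]) := by
  rw [dilate, LaurentPolynomial.eval₂_T, mul_zpow, Units.val_mul, unitT_zpow, ← map_zpow,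
    LaurentPolynomial.smul_eq_C_mul, Units.coe_map, Units.val_zpow_eq_zpow_val]
  rfl

theorem dilate_smul (c : Kˣ) (r : K) (x : K[T;T⁻¹]) : dilate c (r • x) = r • dilate c x := by
  rw [LaurentPolynomial.smul_eq_C_mul, LaurentPolynomial.smul_eq_C_mul, map_mul, dilate,
    LaurentPolynomial.eval₂_C]

theorem dilate_dilate (c d : Kˣ) (h : c * d = 1) (x : K[T;T⁻¹]) : dilate c (dilate d x) = x := by
  induction x using LaurentPolynomial.induction_on' with
  | add x y hx hy => rw [map_add, map_add, hx, hy]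
  | C_mul_T n a =>
    rw [← LaurentPolynomial.smul_eq_C_mul, dilate_smul, dilate_T, dilate_smul, dilate_smul, dilate_T, smul_smul, smul_smul,
      mul_assoc, ← mul_zpow, mul_comm (d : K), ← Units.val_mul, h, Units.val_one, one_zpow, mul_one]

/-- The action of the degree generator on `V ⊗ K[T;T⁻¹]`. -/
def dOp (c : Kˣ) : Module.End K o.FormalV where
  toFun f i := dilate c (f i)
  map_add' _ _ := funext fun _ => map_add _ _ _
  map_smul' r f := funext fun i => dilate_smul c r (f i)

theorem dOp_apply (c : Kˣ) (f : o.FormalV) (i : Fin o.N) : o.dOp c f i = dilate c (f i) := rfl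

theorem dOp_mul_dOp (c d : Kˣ) (h : c * d = 1) : o.dOp c * o.dOp d = 1 :=
  LinearMap.ext fun f => funext fun i => dilate_dilate c d h (f i)

theorem dOp_mul_mulBy (c : Kˣ) (x : K[T;T⁻¹]) :
    o.dOp c * o.mulBy K[T;T⁻¹] x = o.mulBy K[T;T⁻¹] (dilate c x) * o.dOp c :=
  LinearMap.ext fun f => funext fun i => map_mul (dilate c) x (f i)

theorem dOp_mul_act (c : Kˣ) (M : o.Mat) :
    o.dOp c * o.act K[T;T⁻¹] M = o.act K[T;T⁻¹] M * o.dOp c := by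
  refine LinearMap.ext fun f => funext fun i => ?_
  rw [Module.End.mul_apply, Module.End.mul_apply, dOp_apply, act_apply, act_apply, map_sum]
  exact Finset.sum_congr rfl fun j _ => dilate_smul c _ _

theorem dOp_single (c : Kˣ) (i : Fin o.N) (k : ℤ) :
    o.dOp c (Pi.single i (LaurentPolynomial.T k)) =
      (c : K) ^ k • (Pi.single i (LaurentPolynomial.T k) : o.FormalV) := by
  funext j
  rw [dOp_apply, Pi.smul_apply, Pi.single_apply]
  split_ifs
  · exact dilate_T c k
  · rw [map_zero, smul_zero]

theorem dilate_upar (c : Kˣ) {t : (K[T;T⁻¹])ˣ} {k : K} (h : dilate c t = k • (t : K[T;T⁻¹]))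
    (i : Fin (o.s + 1)) : dilate c (upar t i : (K[T;T⁻¹])ˣ) =
      (if i = 0 then k else 1) • ((upar t i : (K[T;T⁻¹])ˣ) : K[T;T⁻¹]) := by
  by_cases hi : i = 0
  · rw [if_pos hi, hi]
    exact h
  · have hi' : (i : ℕ) ≠ 0 := fun h' => hi (Fin.ext h')
    rw [if_neg hi, upar_val t hi', Units.val_one, map_one, one_smul]

/-- The parameter `q` as a unit. -/
def qUnit : Kˣ := Units.mk0 q q_ne_zero

theorem dilate_unitT : dilate qUnit unitT = q • ((unitT : (K[T;T⁻¹])ˣ) : K[T;T⁻¹]) := by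
  have := dilate_T qUnit 1
  rw [zpow_one] at this
  exact this

theorem dilate_unitT_inv :
    dilate qUnit (unitT⁻¹ : (K[T;T⁻¹])ˣ) = q⁻¹ • ((unitT⁻¹ : (K[T;T⁻¹])ˣ) : K[T;T⁻¹]) := by
  have := dilate_T qUnit (-1)
  rw [zpow_neg_one] at this
  exact this

/-- The action of the degree generator on the tensor square. -/
def dOp2 (c : Kˣ) : Module.End K (o.VV2 K[T;T⁻¹]) := TensorProduct.map (o.dOp c) (o.dOp c)

theorem dOp2_mul_dOp2 (c d : Kˣ) (h : c * d = 1) : o.dOp2 c * o.dOp2 d = 1 := by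
  rw [dOp2, dOp2, ← TensorProduct.map_mul, o.dOp_mul_dOp c d h, TensorProduct.map_one]

theorem dOp2_mul_scal (c : Kˣ) (x y : K[T;T⁻¹]) : o.dOp2 c * o.scal K[T;T⁻¹] x y =
    o.scal K[T;T⁻¹] (dilate c x) (dilate c y) * o.dOp2 c := by
  rw [dOp2, scal, scal, ← TensorProduct.map_mul, ← TensorProduct.map_mul, dOp_mul_mulBy,
    dOp_mul_mulBy]

theorem dOp2_comm_act2 (c : Kˣ) (M : o.Mat2) : Commute (o.dOp2 c) (o.act2 K[T;T⁻¹] M) := by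
  induction M using o.mat2_induction with
  | h0 => rw [map_zero]; exact Commute.zero_right _
  | hadd M M' h h' => rw [map_add]; exact h.add_right h'
  | h M M' =>
    rw [Commute, SemiconjBy, dOp2, act2_kronecker, ← TensorProduct.map_mul, ← TensorProduct.map_mul,
      dOp_mul_act, dOp_mul_act]

theorem dOp2_comm_coefSwap (c : Kˣ) : Commute (o.dOp2 c) (o.coefSwap K[T;T⁻¹]) := by
  have h : Commute (o.dOp2 c) (o.tcomm K[T;T⁻¹]) := by
    rw [Commute, SemiconjBy, dOp2, tcomm_map]
  exact h.mul_right (o.dOp2_comm_act2 c o.flipMat)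

theorem smul_scal_left (c : K) (x y : K[T;T⁻¹]) :
    o.scal K[T;T⁻¹] (c • x) y = c • o.scal K[T;T⁻¹] x y := by
  have : o.mulBy K[T;T⁻¹] (c • x) = c • o.mulBy K[T;T⁻¹] x := map_smul (Algebra.lsmul K K _) c x
  rw [scal, scal, this, TensorProduct.map_smul_left]

theorem smul_scal_right (c : K) (x y : K[T;T⁻¹]) :
    o.scal K[T;T⁻¹] x (c • y) = c • o.scal K[T;T⁻¹] x y := by
  have : o.mulBy K[T;T⁻¹] (c • y) = c • o.mulBy K[T;T⁻¹] y := map_smul (Algebra.lsmul K K _) c y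
  rw [scal, scal, this, TensorProduct.map_smul_right]

theorem dOp_gen {k : K} {t : (K[T;T⁻¹])ˣ} (h : dilate qUnit t = k • (t : K[T;T⁻¹]))
    (i : Fin (o.s + 1)) (M : o.Mat) :
    o.dOp qUnit * (o.mulBy K[T;T⁻¹] (upar t i : (K[T;T⁻¹])ˣ) * o.act K[T;T⁻¹] M) =
      (if i = 0 then k else 1) •
        (o.mulBy K[T;T⁻¹] (upar t i : (K[T;T⁻¹])ˣ) * o.act K[T;T⁻¹] M * o.dOp qUnit) := by
  have hs : ∀ (c : K) (x : K[T;T⁻¹]), o.mulBy K[T;T⁻¹] (c • x) = c • o.mulBy K[T;T⁻¹] x :=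
    map_smul (Algebra.lsmul K K _)
  rw [← mul_assoc, dOp_mul_mulBy, o.dilate_upar qUnit h, hs, mul_assoc, dOp_mul_act, smul_mul_assoc,
    mul_assoc]

theorem dOp2_gen {k : K} {t : (K[T;T⁻¹])ˣ} (h : dilate qUnit t = k • (t : K[T;T⁻¹]))
    (i : Fin (o.s + 1)) (M M' : o.Mat2) :
    o.dOp2 qUnit * (o.scal K[T;T⁻¹] (upar t i : (K[T;T⁻¹])ˣ) 1 * o.act2 K[T;T⁻¹] M +
        o.scal K[T;T⁻¹] 1 (upar t i : (K[T;T⁻¹])ˣ) * o.act2 K[T;T⁻¹] M') =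
      (if i = 0 then k else 1) •
        ((o.scal K[T;T⁻¹] (upar t i : (K[T;T⁻¹])ˣ) 1 * o.act2 K[T;T⁻¹] M +
        o.scal K[T;T⁻¹] 1 (upar t i : (K[T;T⁻¹])ˣ) * o.act2 K[T;T⁻¹] M') * o.dOp2 qUnit) := by
  rw [mul_add, add_mul, ← mul_assoc, ← mul_assoc, dOp2_mul_scal, dOp2_mul_scal,
    o.dilate_upar qUnit h, map_one, smul_scal_left, smul_scal_right, mul_assoc, mul_assoc,
    (o.dOp2_comm_act2 qUnit M).eq, (o.dOp2_comm_act2 qUnit M').eq, smul_mul_assoc, smul_mul_assoc,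
    mul_assoc, mul_assoc, smul_add]

/-! ### The intertwining property for the generators -/

section Intertwiner

variable (A : Type) [CommRing A] [Algebra K A]

theorem clearedRHat_comm_scal (x y x' y' : A) :
    Commute (o.clearedRHat A x y) (o.scal A x' y') :=
  cleared_comm (B := Module.End K (o.VV2 A)) (o.scal_comm_scal A x y x' y')
    (o.scal_comm_act2 A x' y' _).symm (o.scal_comm_act2 A x' y' _).symm

variable {A}

/-- The element aL + a'R is a'(zL + R) for the ratio z of the two spectral multiplications. P
exchanges the roles of L and R, and the flip S of the coefficients then turns a, a' into b', b. -/
theorem intertwines_exchange {B : Type} [Ring B] {P S a a' b b' z L R : B} (hP : Commute P a')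
    (h : P * (z * L + R) = (L + z * R) * P) (ha : a' * z = a) (hb : S * a' = b * S)
    (hb' : S * a = b' * S) (hL : Commute S L) (hR : Commute S R) :
    (S * P) * (a * L + a' * R) = (b * L + b' * R) * (S * P) := by
  have h1 : a * L + a' * R = a' * (z * L + R) := by rw [mul_add, ← ha, mul_assoc]
  have h2 : S * a' * (L + z * R) = (b * L + b' * R) * S := by
    rw [mul_add, mul_assoc S a' (z * R), ← mul_assoc a' z, ha, ← mul_assoc, hb, hb', mul_assoc,
      mul_assoc, hL.eq, hR.eq, add_mul, mul_assoc, mul_assoc]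
  rw [h1, mul_assoc S, ← mul_assoc P, hP.eq, mul_assoc a', h, ← mul_assoc, ← mul_assoc, h2, mul_assoc]

/-- The finite and Cartan generators carry no spectral parameter and commute with T and Q
separately. Only e_0 and f_0 use the dependence on z. -/
theorem rHat_tensorGen (a b : K) (u v : Aˣ) (g : Gen o) :
    o.coefSwap A * o.clearedRHat A u (v⁻¹ : Aˣ) * o.tensorGen a b u v g =
      o.tensorGen a b v u g * (o.coefSwap A * o.clearedRHat A u (v⁻¹ : Aˣ)) := by
  have comm : ∀ X : o.Mat2, Commute o.braid2 X → Commute o.capCup X →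
      o.coefSwap A * o.clearedRHat A u (v⁻¹ : Aˣ) * o.act2 A X =
        o.act2 A X * (o.coefSwap A * o.clearedRHat A u (v⁻¹ : Aˣ)) := fun X h h' =>
    ((o.coefSwap_comm_act2 A X).mul_left (o.clearedRHat_comm A _ _ h h')).eq
  have hdiag : ∀ i : ℕ, ∀ x : Fin o.N → ℤ, (∀ c, x c.rev = -x c) →
      o.coefSwap A * o.clearedRHat A u (v⁻¹ : Aˣ) * o.act2 A (o.qDiag x ⊗ₖ o.qDiag x) =
        o.act2 A (o.qDiag x ⊗ₖ o.qDiag x) * (o.coefSwap A * o.clearedRHat A u (v⁻¹ : Aˣ)) := by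
    intro i x hx
    have hf : ∀ c, qHalf (x c) * qHalf (x c.rev) = 1 := fun c => by
      rw [hx, ← qHalf_add, add_neg_cancel, qHalf_zero]
    exact comm _ (o.braid2_comm_diagonal hf) (o.capCup_comm_diagonal hf)
  have hvv : ((v : Aˣ) : A) * ((v⁻¹ : Aˣ) : A) = 1 := Units.mul_inv v
  have huu : ((u⁻¹ : Aˣ) : A) * ((u : Aˣ) : A) = 1 := Units.inv_mul u
  have hS := o.coefSwap_comm_act2 A
  have hSs := o.coefSwap_mul_scal A
  have hPs := o.clearedRHat_comm_scal A u (v⁻¹ : Aˣ)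
  cases g with
  | e i =>
    rw [tensorGen_e, tensorGen_e]
    by_cases hi : (i : ℕ) = 0
    · rw [hi]
      have hu : ∀ t : Aˣ, upar t 0 = t := fun t => if_pos rfl
      rw [hu, hu]
      refine intertwines_exchange (B := Module.End K (o.VV2 A)) (hPs _ _)
        (o.clearedRHat_exchange A u (v⁻¹ : Aˣ) (o.braid2_mul_dLeft_eMat_zero a)
        (o.eMat_zero_capCup a) (o.capCup_eMat_zero a)) ?_ (hSs _ _) (hSs _ _) (hS _) (hS _)
      rw [scal_mul, one_mul, hvv]
    · rw [upar_val _ hi, upar_val _ hi, Units.val_one, scal_one, one_mul, one_mul, ← map_add]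
      exact comm _ (o.braid2_comm_eMat a (Nat.pos_of_ne_zero hi) (Nat.le_of_lt_succ i.2))
        (o.capCup_comm_eMat a (Nat.pos_of_ne_zero hi) (Nat.le_of_lt_succ i.2))
  | f i =>
    rw [tensorGen_f, tensorGen_f]
    by_cases hi : (i : ℕ) = 0
    · rw [hi]
      have hu : ∀ t : Aˣ, upar t 0 = t := fun t => if_pos rfl
      -- For f_0 the parameters are inverted, so the roles of the two halves are exchanged in order
      -- to keep the ratio z = u/v.
      rw [hu, hu, add_comm, add_comm (_ * o.act2 A (o.dLeft _ _))]
      refine intertwines_exchange (B := Module.End K (o.VV2 A)) (hPs _ _)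
        (o.clearedRHat_exchange A u (v⁻¹ : Aˣ) (o.braid2_mul_dRight_fMat_zero b)
        (o.fMat_zero_capCup b) (o.capCup_fMat_zero b)) ?_ (hSs _ _) (hSs _ _) (hS _) (hS _)
      rw [scal_mul, one_mul, huu]
    · rw [upar_val _ hi, upar_val _ hi, Units.val_one, scal_one, one_mul, one_mul, ← map_add]
      exact comm _ (o.braid2_comm_fMat b (Nat.pos_of_ne_zero hi) (Nat.le_of_lt_succ i.2))
        (o.capCup_comm_fMat b (Nat.pos_of_ne_zero hi) (Nat.le_of_lt_succ i.2))
  | k i =>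
    rw [tensorGen_k, tensorGen_k]
    exact hdiag i _ (o.hDiag_rev i)
  | kInv i =>
    rw [tensorGen_kInv, tensorGen_kInv]
    exact hdiag i _ fun c => congrArg Neg.neg (o.hDiag_rev i c)
  | gam => rw [tensorGen_gam, tensorGen_gam, mul_one, one_mul]
  | gamInv => rw [tensorGen_gamInv, tensorGen_gamInv, mul_one, one_mul]

end Intertwiner

/-- The intertwining property for formal spectral parameters. -/
theorem formal_intertwiner {a b : K} (hab : a * b = o.abValue) :
    ∃ ρ : o.U →ₐ[K] Module.End K o.FormalV, IsFormalEvaluation a b ρ ∧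
      ∃ π : o.U →ₐ[K] Module.End K (o.VV2 K[T;T⁻¹]), IsFormalTensor ρ ρ π ∧
        ∀ x : o.U, o.formalRHat * π x = π x * o.formalRHat := by
  have hq1 : qUnit * qUnit⁻¹ = 1 := mul_inv_cancel _
  have hq2 : qUnit⁻¹ * qUnit = 1 := inv_mul_cancel _
  obtain ⟨ρ, hρ, hρD, hρD'⟩ := o.exists_hom_full (g := o.evalGen a b unitT)
    (o.affineRel_evalGen hab unitT) (o.dOp_mul_dOp _ _ hq1) (o.dOp_mul_dOp _ _ hq2)
    (fun i => by rw [evalGen_k, dOp_mul_act])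
    (fun i => by rw [evalGen_e, o.dOp_gen dilate_unitT])
    (fun i => by rw [evalGen_f, o.dOp_gen dilate_unitT_inv])
  obtain ⟨π, hπ, hπD, hπD'⟩ := o.exists_hom_full (g := o.tensorGen a b unitT unitT)
    (o.affineRel_tensorGen hab unitT unitT) (o.dOp2_mul_dOp2 _ _ hq1) (o.dOp2_mul_dOp2 _ _ hq2)
    (fun i => by rw [tensorGen_k, (o.dOp2_comm_act2 _ _).eq])
    (fun i => by rw [tensorGen_e, o.dOp2_gen dilate_unitT])
    (fun i => by rw [tensorGen_f, o.dOp2_gen dilate_unitT_inv])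
  have hR : o.formalRHat = o.coefSwap K[T;T⁻¹] *
      o.clearedRHat K[T;T⁻¹] (unitT : (K[T;T⁻¹])ˣ) (unitT⁻¹ : (K[T;T⁻¹])ˣ) :=
    o.superSwap_mul_clearedR K[T;T⁻¹] _ _
  -- The degree operator rescales u and v by the same factor, and R̂ depends on u/v only.
  have hD : Commute (o.dOp2 qUnit) o.formalRHat := by
    rw [hR]
    refine (o.dOp2_comm_coefSwap _).mul_right ?_
    refine (cleared_comm (B := Module.End K (o.VV2 K[T;T⁻¹])) ?_ (o.dOp2_comm_act2 _ _).symm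
      (o.dOp2_comm_act2 _ _).symm).symm
    rw [Commute, SemiconjBy, dOp2_mul_scal, dilate_unitT, dilate_unitT_inv, smul_scal_left,
      smul_scal_right, smul_smul, mul_inv_cancel₀ q_ne_zero, one_smul]
  have hD' : Commute (o.dOp2 qUnit⁻¹) o.formalRHat := by
    have h1 := o.dOp2_mul_dOp2 _ _ hq1
    have h2 := o.dOp2_mul_dOp2 _ _ hq2
    calc o.dOp2 qUnit⁻¹ * o.formalRHat
        = o.dOp2 qUnit⁻¹ * (o.formalRHat * o.dOp2 qUnit) * o.dOp2 qUnit⁻¹ := by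
          rw [mul_assoc, mul_assoc, h1, mul_one]
      _ = o.formalRHat * o.dOp2 qUnit⁻¹ := by rw [← hD.eq, ← mul_assoc, h2, one_mul]
  refine ⟨ρ, ⟨hρ, fun i k => ?_, fun i k => ?_⟩, π, ⟨fun x => ?_, fun x => ?_⟩,
    intertwines_of_gen (B := Module.End K (o.VV2 K[T;T⁻¹])) fun x => ?_⟩
  · rw [hρD, dOp_single]
    rfl
  · rw [hρD', dOp_single, Units.val_inv_eq_inv_val, inv_zpow']
    rfl
  · simp only [hρ]
    exact hπ x
  · cases x
    · rw [hρD]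
      exact hπD
    · rw [hρD']
      exact hπD'
  · change o.formalRHat * π (U.gen o x) = π (U.gen o x) * o.formalRHat
    rcases x with x | x | x
    · rw [hπ, hR]
      exact o.rHat_tensorGen a b unitT unitT x
    · rw [hπD, hD.eq]
    · rw [hπD', hD'.eq]

theorem scal_field (x y : K) : o.scal K x y = (x * y) • 1 := by
  have h : ∀ z : K, o.mulBy K z = z • 1 := fun z => LinearMap.ext fun f => rfl
  rw [scal, h, h, TensorProduct.map_smul_left, TensorProduct.map_smul_right, TensorProduct.map_one,
    smul_smul]

theorem clearedRHat_field (x y : K) (h : x * y ≠ 1) :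
    o.clearedRHat K x y = (x * y - 1) • o.spectralRHat (x * y) := by
  have h' : x * y - 1 ≠ 0 := sub_ne_zero.2 h
  have key : ∀ {B : Type} [Ring B] [Algebra K B] (T Q : B) (z c d : K), z - 1 ≠ 0 →
      (z • (1 : B) - 1) * (z • (1 : B) - c • 1) * T + d • (z • (1 : B) - c • 1) -
        (d * c) • ((z • (1 : B) - 1) * Q) =
      (z - 1) • ((z - c) • T + (d * ((z - c) / (z - 1))) • (1 : B) - (d * c) • Q) := by
    intro B _ _ T Q z c d hz
    have e : (z - 1) * (d * ((z - c) / (z - 1))) = d * (z - c) := by field_simp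
    rw [smul_sub (z - 1), smul_add (z - 1), smul_smul, smul_smul (z - 1), smul_smul (z - 1), e]
    simp only [sub_mul, mul_sub, smul_mul_assoc, one_mul, mul_smul_comm, mul_one]
    module
  rw [spectralRHat_eq, map_sub, map_add, map_smul, map_smul, map_smul, map_one, clearedRHat,
    scal_field]
  exact key (B := Module.End K (o.VV2 K)) _ _ _ _ _ h'

/-- The intertwining property for numerical spectral parameters. -/
theorem numeric_intertwiner {a b : K} (hab : a * b = o.abValue) {u v : Kˣ} (huv : u ≠ v) :
    ∃ ρu ρv : o.UReduced →ₐ[K] Module.End K (o.VV K),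
      IsEvaluation a b u ρu ∧ IsEvaluation a b v ρv ∧
      ∃ πuv πvu : o.UReduced →ₐ[K] Module.End K (o.VV2 K),
        IsTensor ρu ρv πuv ∧ IsTensor ρv ρu πvu ∧
        ∀ x : o.UReduced, o.spectralRHat ((u : K) / v) * πuv x =
          πvu x * o.spectralRHat ((u : K) / v) := by
  obtain ⟨ρu, hu⟩ := o.exists_hom_reduced (o.affineRel_evalGen (A := K) hab u)
  obtain ⟨ρv, hv⟩ := o.exists_hom_reduced (o.affineRel_evalGen (A := K) hab v)
  obtain ⟨πuv, huv'⟩ := o.exists_hom_reduced (o.affineRel_tensorGen (A := K) hab u v)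
  obtain ⟨πvu, hvu'⟩ := o.exists_hom_reduced (o.affineRel_tensorGen (A := K) hab v u)
  refine ⟨ρu, ρv, hu, hv, πuv, πvu, fun x => ?_, fun x => ?_,
    intertwines_of_gen (B := Module.End K (o.VV2 K)) fun x => ?_⟩
  · simp only [hu, hv]
    exact huv' x
  · simp only [hu, hv]
    exact hvu' x
  · change _ * πuv (UReduced.gen o x) = πvu (UReduced.gen o x) * _
    have hz : (u : K) * ((v⁻¹ : Kˣ) : K) = u / v := by
      rw [Units.val_inv_eq_inv_val, div_eq_mul_inv]
    have hne : (u : K) / v ≠ 1 := by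
      rw [Ne, div_eq_one_iff_eq v.ne_zero]
      exact fun h => huv (Units.ext h)
    have h := o.rHat_tensorGen (A := K) a b u v x
    rw [coefSwap_field, one_mul, o.clearedRHat_field _ _ (by rwa [hz]), hz, smul_mul_assoc,
      mul_smul_comm] at h
    rw [huv', hvu']
    -- For u ≠ v the factor z - 1, by which the polynomial form differs from R̂(z), can be
    -- cancelled.
    exact smul_right_injective _ (sub_ne_zero.2 hne) h

end OspAffine.OspDatum

namespace OspAffine

/-! ### Baxterization in the Birman–Wenzl–Murakami algebra on three strands -/

section Baxter

variable {k B : Type} [Field k] [Ring B] [Algebra k B]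

/-- The relations of the Birman–Wenzl–Murakami algebra on three strands. -/
structure IsBMW (C ν : k) (T₁ T₂ Q₁ Q₂ : B) : Prop where
  ne_zero : C ≠ 0
  ν_ne_zero : ν ≠ 0
  left_inv₁ : (T₁ - C • 1 + C • Q₁) * T₁ = 1
  right_inv₁ : T₁ * (T₁ - C • 1 + C • Q₁) = 1
  left_inv₂ : (T₂ - C • 1 + C • Q₂) * T₂ = 1
  right_inv₂ : T₂ * (T₂ - C • 1 + C • Q₂) = 1
  mul_cup₁ : T₁ * Q₁ = ν • Q₁
  cap_mul₁ : Q₁ * T₁ = ν • Q₁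
  mul_cup₂ : T₂ * Q₂ = ν • Q₂
  cap_mul₂ : Q₂ * T₂ = ν • Q₂
  braid : T₂ * (T₁ * T₂) = T₁ * (T₂ * T₁)
  cap_slide : Q₁ * (T₂ * T₁) = Q₁ * Q₂
  zigzag₁ : Q₁ * (Q₂ * Q₁) = Q₁
  zigzag₂ : Q₂ * (Q₁ * Q₂) = Q₂

namespace IsBMW

variable {C ν : k} {T₁ T₂ Q₁ Q₂ : B}

/-- Write the braid relation as T₂T₁T₂⁻¹ = T₁⁻¹T₂T₁ and expand both inverses by the skein relation.
All terms agree except the cup-cap ones, and C ≠ 0 can be cancelled. -/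
theorem slide_cup (h : IsBMW C ν T₁ T₂ Q₁ Q₂) : T₂ * (T₁ * Q₂) = Q₁ * Q₂ := by
  have h1 : T₂ * (T₁ * (T₂ - C • 1 + C • Q₂)) = (T₁ - C • 1 + C • Q₁) * (T₂ * T₁) := by
    calc T₂ * (T₁ * (T₂ - C • 1 + C • Q₂))
        = ((T₁ - C • 1 + C • Q₁) * T₁) * (T₂ * (T₁ * (T₂ - C • 1 + C • Q₂))) := by
          rw [h.left_inv₁, one_mul]
      _ = (T₁ - C • 1 + C • Q₁) * (T₁ * (T₂ * T₁)) * (T₂ - C • 1 + C • Q₂) := by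
          simp only [mul_assoc]
      _ = (T₁ - C • 1 + C • Q₁) * (T₂ * T₁) * (T₂ * (T₂ - C • 1 + C • Q₂)) := by
          rw [← h.braid]
          simp only [mul_assoc]
      _ = _ := by rw [h.right_inv₂, mul_one]
  simp only [mul_add, mul_sub, add_mul, sub_mul, mul_smul_comm, smul_mul_assoc, mul_one, one_mul,
    h.braid, h.cap_slide] at h1
  exact smul_right_injective B h.ne_zero (add_left_cancel h1)

theorem cup₂ (h : IsBMW C ν T₁ T₂ Q₁ Q₂) : T₁ * Q₂ = (T₂ - C • 1 + C • Q₂) * (Q₁ * Q₂) := by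
  rw [← h.slide_cup, ← mul_assoc, h.left_inv₂, one_mul]

theorem cup₁ (h : IsBMW C ν T₁ T₂ Q₁ Q₂) : T₂ * Q₁ = (T₁ - C • 1 + C • Q₁) * (Q₂ * Q₁) := by
  have h1 : (T₂ - C • 1 + C • Q₂) * Q₁ = T₁ * (Q₂ * Q₁) := by
    calc (T₂ - C • 1 + C • Q₂) * Q₁ = (T₂ - C • 1 + C • Q₂) * (Q₁ * Q₂) * Q₁ := by
          rw [mul_assoc, mul_assoc, h.zigzag₁]
      _ = _ := by rw [← h.cup₂, mul_assoc]
  have h2 := h.zigzag₁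
  simp only [add_mul, sub_mul, smul_mul_assoc, one_mul] at h1 ⊢
  rw [h2, ← h1]
  abel

theorem cap₁ (h : IsBMW C ν T₁ T₂ Q₁ Q₂) : Q₁ * T₂ = Q₁ * Q₂ * (T₁ - C • 1 + C • Q₁) := by
  rw [← h.cap_slide, mul_assoc, mul_assoc, h.right_inv₁, mul_one]

theorem cap₂ (h : IsBMW C ν T₁ T₂ Q₁ Q₂) : Q₂ * T₁ = Q₂ * Q₁ * (T₂ - C • 1 + C • Q₂) := by
  have h1 : Q₂ * (T₁ - C • 1 + C • Q₁) = Q₂ * (Q₁ * T₂) := by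
    calc Q₂ * (T₁ - C • 1 + C • Q₁) = Q₂ * (Q₁ * Q₂) * (T₁ - C • 1 + C • Q₁) := by rw [h.zigzag₂]
      _ = _ := by rw [h.cap₁]; simp only [mul_assoc]
  have h2 := h.zigzag₂
  simp only [mul_add, mul_sub, mul_smul_comm, mul_one, mul_assoc] at h1 ⊢
  rw [h2, ← h1]
  abel

/-- The relations are symmetric in the two strands. Only the sliding of the second cap needs an
argument, so every later identity has a mirror image at no cost. -/
theorem symm (h : IsBMW C ν T₁ T₂ Q₁ Q₂) : IsBMW C ν T₂ T₁ Q₂ Q₁ where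
  ne_zero := h.ne_zero
  ν_ne_zero := h.ν_ne_zero
  left_inv₁ := h.left_inv₂
  right_inv₁ := h.right_inv₂
  left_inv₂ := h.left_inv₁
  right_inv₂ := h.right_inv₁
  mul_cup₁ := h.mul_cup₂
  cap_mul₁ := h.cap_mul₂
  mul_cup₂ := h.mul_cup₁
  cap_mul₂ := h.cap_mul₁
  braid := h.braid.symm
  cap_slide := by
    rw [← mul_assoc, h.cap₂, mul_assoc, h.left_inv₂, mul_one]
  zigzag₁ := h.zigzag₂
  zigzag₂ := h.zigzag₁

theorem sq₁ (h : IsBMW C ν T₁ T₂ Q₁ Q₂) : T₁ * T₁ = 1 + C • T₁ - (C * ν) • Q₁ := by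
  have h1 := h.right_inv₁
  rw [mul_add, mul_sub, mul_smul_comm, mul_smul_comm, mul_one, h.mul_cup₁, smul_smul] at h1
  rw [← h1]
  abel

/-- Express T₂Q₁ through T₁⁻¹Q₂Q₁; then Q₁T₁⁻¹ = ν⁻¹Q₁ and the zigzag relation finish. -/
theorem cup_twist (h : IsBMW C ν T₁ T₂ Q₁ Q₂) : Q₁ * (T₂ * Q₁) = ν⁻¹ • Q₁ := by
  have h1 : Q₁ * (T₁ - C • 1 + C • Q₁) = ν⁻¹ • Q₁ := by
    refine smul_right_injective B h.ν_ne_zero ?_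
    change ν • _ = ν • _
    rw [smul_smul, mul_inv_cancel₀ h.ν_ne_zero, one_smul, ← smul_mul_assoc, ← h.cap_mul₁, mul_assoc,
      h.right_inv₁, mul_one]
  rw [h.cup₁, ← mul_assoc, h1, smul_mul_assoc, h.zigzag₁]

/-- The skein relation, for the square of a cup-cap. -/
theorem cup_mul_cup (h : IsBMW C ν T₁ T₂ Q₁ Q₂) : Q₁ * Q₁ = ((ν⁻¹ - ν + C) / C) • Q₁ := by
  have h1 := congrArg (fun x => ν⁻¹ • (Q₁ * x)) h.right_inv₁
  simp only [mul_one] at h1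
  rw [← mul_assoc, h.cap_mul₁, smul_mul_assoc, smul_smul, inv_mul_cancel₀ h.ν_ne_zero, one_smul,
    mul_add, mul_sub, h.cap_mul₁, mul_smul_comm, mul_smul_comm, mul_one] at h1
  have h2 : C • (Q₁ * Q₁) = (ν⁻¹ - ν + C) • Q₁ := by
    rw [add_smul, sub_smul, ← h1]
    abel
  rw [div_eq_inv_mul, mul_smul, ← h2, smul_smul, inv_mul_cancel₀ h.ne_zero, one_smul]

theorem slide₁ (h : IsBMW C ν T₁ T₂ Q₁ Q₂) : T₁ * (Q₂ * Q₁) = T₂ * Q₁ + C • (Q₂ * Q₁) - C • Q₁ := by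
  rw [h.cup₁, add_mul, sub_mul, smul_mul_assoc, smul_mul_assoc, one_mul, h.zigzag₁]
  abel

theorem slide₂ (h : IsBMW C ν T₁ T₂ Q₁ Q₂) : Q₁ * (Q₂ * T₁) = Q₁ * T₂ + C • (Q₁ * Q₂) - C • Q₁ := by
  rw [h.cap₁, mul_add, mul_sub, mul_smul_comm, mul_smul_comm, mul_one, mul_assoc, mul_assoc,
    h.zigzag₁]
  abel

/-- By the cup, cap and zigzag relations T₂Q₁T₂ = T₁⁻¹Q₂T₁⁻¹. Expanding the inverses eliminates this
word in favour of T₁Q₂T₁ and shorter ones. -/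
theorem conj₂ (h : IsBMW C ν T₁ T₂ Q₁ Q₂) : T₂ * (Q₁ * T₂) = T₁ * (Q₂ * T₁) - C • (T₁ * Q₂) -
    C • (Q₂ * T₁) + C • (T₂ * Q₁) + C • (Q₁ * T₂) + (C * C) • Q₂ -
      (C * C) • Q₁ := by
  have h1 : T₂ * (Q₁ * T₂) = (T₁ - C • 1 + C • Q₁) * (Q₂ * (T₁ - C • 1 + C • Q₁)) := by
    calc T₂ * (Q₁ * T₂) = (T₁ - C • 1 + C • Q₁) * (Q₂ * (Q₁ * T₂)) := by
          rw [← mul_assoc, h.cup₁]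
          simp only [mul_assoc]
      _ = (T₁ - C • 1 + C • Q₁) * ((Q₂ * (Q₁ * Q₂)) * (T₁ - C • 1 + C • Q₁)) := by
          rw [h.cap₁]
          simp only [mul_assoc]
      _ = _ := by rw [h.zigzag₂]
  rw [h1]
  simp only [mul_add, mul_sub, add_mul, sub_mul, mul_smul_comm, smul_mul_assoc, mul_one, one_mul,
    h.slide₁, h.slide₂, h.zigzag₁, smul_add, smul_sub, smul_smul]
  abel

/-- The Yang–Baxter equation for the Baxterization `R(x)`. -/
theorem yangBaxter (h : IsBMW C ν T₁ T₂ Q₁ Q₂) {q ζ x y : k} (hq : q ≠ 0) (hC : C = q - q⁻¹)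
    (hζ : ζ = ν * q) (hx : x - 1 ≠ 0) (hy : y - 1 ≠ 0) (hxy : x * y - 1 ≠ 0) :
    ((x - ζ) • T₁ + (C * ((x - ζ) / (x - 1))) • 1 - (C * ζ) • Q₁) *
      (((x * y - ζ) • T₂ + (C * ((x * y - ζ) / (x * y - 1))) • 1 - (C * ζ) • Q₂) *
        ((y - ζ) • T₁ + (C * ((y - ζ) / (y - 1))) • 1 - (C * ζ) • Q₁)) =
    ((y - ζ) • T₂ + (C * ((y - ζ) / (y - 1))) • 1 - (C * ζ) • Q₂) *
      (((x * y - ζ) • T₁ + (C * ((x * y - ζ) / (x * y - 1))) • 1 - (C * ζ) • Q₁) *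
        ((x - ζ) • T₂ + (C * ((x - ζ) / (x - 1))) • 1 - (C * ζ) • Q₂)) := by
  have h' := h.symm
  have hν := h.ν_ne_zero
  have hC0 := h.ne_zero
  -- After expansion all words are reduced by the BMW relations to a common list, and the
  -- coefficients are compared as rational functions of x, y, ν and q.
  simp only [mul_add, mul_sub, add_mul, sub_mul, mul_smul_comm, smul_mul_assoc, mul_one, one_mul]
  rw [h.sq₁, h'.sq₁, h.cup_mul_cup, h'.cup_mul_cup, h.slide₁, h'.slide₁, h.slide₂, h'.slide₂,
    h.cup_twist, h'.cup_twist, h.zigzag₁, h'.zigzag₁, h.mul_cup₁, h.mul_cup₂, h.cap_mul₁, h.cap_mul₂,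
    h.braid, h.cap_slide, h'.cap_slide, h.slide_cup, h'.slide_cup, h.conj₂]
  subst hζ
  generalize hz : x * y = z at *
  -- Some coefficients agree identically; the others need ζ = νq together with C = q - q⁻¹.
  match_scalars <;> field_simp <;> subst hz <;> first | ring1 | (rw [hC]; field_simp; ring1)

end IsBMW

end Baxter

end OspAffine

namespace OspAffine.OspDatum

variable (o : OspDatum)

/-! ### Matrices on the tensor cube -/

/-- Square matrices over `K` indexed by the basis of `V ⊗ (V ⊗ V)`. -/
abbrev Mat3 : Type := Matrix (Fin o.N × Fin o.N × Fin o.N) (Fin o.N × Fin o.N × Fin o.N) K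

/-- Matrices whose source is the tensor square and whose target is the tensor cube. -/
abbrev Mat32 : Type := Matrix (Fin o.N × Fin o.N × Fin o.N) (Fin o.N × Fin o.N) K

/-- The embedding `M ↦ M ⊗ 1`. -/
def mat12 : o.Mat2 →ₐ[K] o.Mat3 := (Matrix.reindexAlgEquiv K K
  (Equiv.prodAssoc (Fin o.N) (Fin o.N) (Fin o.N))).toAlgHom.comp <|
    AlgHom.ofLinearMap ((Matrix.kroneckerBilinear (R := K) (α := K) (l := Fin o.N × Fin o.N)
      (m := Fin o.N × Fin o.N) (n := Fin o.N) (p := Fin o.N)).flip 1)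
      (by change (1 : o.Mat2) ⊗ₖ (1 : o.Mat) = 1; exact Matrix.one_kronecker_one)
      fun M M' => by
        change (M * M') ⊗ₖ (1 : o.Mat) = (M ⊗ₖ (1 : o.Mat)) * (M' ⊗ₖ (1 : o.Mat))
        rw [← Matrix.mul_kronecker_mul, mul_one]

/-- The embedding `M ↦ 1 ⊗ M`. -/
def mat23 : o.Mat2 →ₐ[K] o.Mat3 := AlgHom.ofLinearMap (Matrix.kroneckerBilinear (R := K) (α := K)
  (1 : o.Mat)) Matrix.one_kronecker_one fun M M' => by
    change (1 : o.Mat) ⊗ₖ (M * M') = ((1 : o.Mat) ⊗ₖ M) * ((1 : o.Mat) ⊗ₖ M')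
    rw [← Matrix.mul_kronecker_mul, mul_one]

theorem mat12_apply (M : o.Mat2) (x y z a b c : Fin o.N) : o.mat12 M (x, y, z) (a, b, c) =
    M (x, y) (a, b) * (1 : o.Mat) z c := rfl

theorem mat23_eq (M : o.Mat2) : o.mat23 M = (1 : o.Mat) ⊗ₖ M := rfl

theorem mat23_apply (M : o.Mat2) (x y z a b c : Fin o.N) : o.mat23 M (x, y, z) (a, b, c) =
    (1 : o.Mat) x a * M (y, z) (b, c) := rfl

theorem mat12_kronecker (M M' : o.Mat) : o.mat12 (M ⊗ₖ M') = M ⊗ₖ (M' ⊗ₖ (1 : o.Mat)) := by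
  ext ⟨x, y, z⟩ ⟨a, b, c⟩
  exact mul_assoc _ _ _

/-- The restriction of an operator to `v_c ⊗ (V ⊗ V)`. -/
def col (W : o.Mat3) (c : Fin o.N) : o.Mat32 := W.submatrix id fun p => (c, p)

theorem col_mul (Y W : o.Mat3) (c : Fin o.N) : o.col (Y * W) c = Y * o.col W c := rfl

theorem col_sub (Y W : o.Mat3) (c : Fin o.N) : o.col (Y - W) c = o.col Y c - o.col W c := rfl

theorem col_injective {W : o.Mat3} (h : ∀ c, o.col W c = 0) : W = 0 := by
  ext x ⟨c, p⟩
  exact congrFun (congrFun (h c) x) p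

theorem col_add (Y W : o.Mat3) (c : Fin o.N) : o.col (Y + W) c = o.col Y c + o.col W c := rfl

theorem col_mul_kronecker (W : o.Mat3) (A : o.Mat) (M : o.Mat2) (c : Fin o.N) :
    o.col (W * (A ⊗ₖ M)) c = ∑ d, A d c • (o.col W d * M) := by
  ext x p
  rw [Matrix.sum_apply]
  change ∑ y, W x y * (A ⊗ₖ M) y (c, p) = _
  rw [Fintype.sum_prod_type]
  refine Finset.sum_congr rfl fun d _ => ?_
  rw [Matrix.smul_apply, Matrix.mul_apply, smul_eq_mul, Finset.mul_sum]
  refine Finset.sum_congr rfl fun y _ => ?_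
  rw [Matrix.kroneckerMap_apply]
  simp only [col, Matrix.submatrix_apply, id]
  ring

theorem col_mul_mat23 (W : o.Mat3) (M : o.Mat2) (c : Fin o.N) :
    o.col (W * o.mat23 M) c = o.col W c * M := by
  rw [mat23_eq, col_mul_kronecker, Finset.sum_eq_single c]
  · rw [Matrix.one_apply_eq, one_smul]
  · intro d _ hd
    rw [Matrix.one_apply_ne hd, zero_smul]
  · simp

/-- The insertion `w ↦ w ⊗ v_t`. -/
def ins (t : Fin o.N) : o.Mat32 := fun x y => if x.2.2 = t ∧ (x.1, x.2.1) = y then 1 else 0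

theorem ins_mul_apply (t : Fin o.N) (M : o.Mat2) (x y z : Fin o.N) (p : Fin o.N × Fin o.N) :
    (o.ins t * M) (x, y, z) p = if z = t then M (x, y) p else 0 := by
  rw [Matrix.mul_apply, Finset.sum_eq_single (x, y)]
  · simp [ins]
  · intro w _ hw
    simp [ins, Ne.symm hw]
  · simp

theorem mat12_mul_ins (t : Fin o.N) (M : o.Mat2) : o.mat12 M * o.ins t = o.ins t * M := by
  ext ⟨x, y, z⟩ ⟨a, c⟩
  rw [ins_mul_apply, Matrix.mul_apply, Finset.sum_eq_single (a, c, t)]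
  · rw [mat12_apply, Matrix.one_apply]
    simp [ins]
  · rintro ⟨a', c', t'⟩ _ h
    simp only [ins]
    rw [if_neg, mul_zero]
    rintro ⟨rfl, h'⟩
    obtain ⟨rfl, rfl⟩ := Prod.mk.inj h'
    exact h rfl
  · simp

/-- An operator that flips `v_t ⊗ v_c` up to a scalar slides `v_t` past the other factors. -/
theorem col_slide {M : o.Mat2} {t : Fin o.N} {f : Fin o.N → K}
    (hM : ∀ x y c, M (x, y) (t, c) = if x = c ∧ y = t then f c else 0) :
    o.col (o.mat23 M * o.mat12 M) t = o.ins t * (Matrix.diagonal f ⊗ₖ Matrix.diagonal f) := by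
  ext ⟨x, y, z⟩ ⟨a, c⟩
  rw [ins_mul_apply, Matrix.kroneckerMap_apply, Matrix.diagonal_apply, Matrix.diagonal_apply]
  change ∑ p, o.mat23 M (x, y, z) p * o.mat12 M p (t, a, c) = _
  rw [Finset.sum_eq_single (a, t, c)]
  · rw [mat23_apply, mat12_apply, hM, hM, Matrix.one_apply, Matrix.one_apply]
    by_cases h1 : x = a
    · by_cases h2 : y = c
      · by_cases h3 : z = t
        · simp [h1, h2, h3, mul_comm]
        · simp [h3]
      · simp [h2]
    · simp [h1]
  · rintro ⟨b, p, r⟩ _ h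
    rw [mat12_apply, hM, Matrix.one_apply]
    by_cases h1 : b = a ∧ p = t
    · rw [if_neg (c := r = c), mul_zero, mul_zero]
      rintro rfl
      exact h (by rw [h1.1, h1.2])
    · rw [if_neg h1, zero_mul, mul_zero]
  · simp

/-- The action of a generator on the tensor cube. -/
def raise3 (i : ℕ) : o.Mat3 :=
  o.rootMat (o.tgt i) (o.src i) ⊗ₖ (o.qDiag (-o.hDiag i) ⊗ₖ o.qDiag (-o.hDiag i)) +
    (o.qDiag (o.hDiag i) * o.parMat ^ (o.genPar i).val) ⊗ₖ
      (o.dLeft (o.rootMat (o.tgt i) (o.src i)) i + o.dRight (o.rootMat (o.tgt i) (o.src i)) i)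

/-- An even invariant operator on the tensor square. -/
structure IsInvariant (M : o.Mat2) : Prop where
  raise : ∀ {i : ℕ}, 0 < i → i ≤ o.s → Commute M
    (o.dLeft (o.rootMat (o.tgt i) (o.src i)) i + o.dRight (o.rootMat (o.tgt i) (o.src i)) i)
  diag : ∀ {f : Fin o.N → K}, (∀ c, f c * f c.rev = 1) →
    Commute M (Matrix.diagonal f ⊗ₖ Matrix.diagonal f)

theorem braid2_isInvariant : o.IsInvariant o.braid2 :=
  ⟨o.braid2_comm_rootMat_raise, o.braid2_comm_diagonal⟩

theorem capCup_isInvariant : o.IsInvariant o.capCup :=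
  ⟨fun h0 hi => o.capCup_comm_of_invariant (o.raise_mulVec_omega h0 hi)
    (o.omegaDual_vecMul_raise h0 hi), o.capCup_comm_diagonal⟩

theorem qHalf_hDiag_mul_rev (x : ℤ) : qHalf x * qHalf (-x) = 1 := by
  rw [← qHalf_add, add_neg_cancel, qHalf_zero]

variable {o}

theorem IsInvariant.comm_mat23 {M : o.Mat2} (hM : o.IsInvariant M) {i : ℕ} (h0 : 0 < i)
    (hi : i ≤ o.s) : Commute (o.mat23 M) (o.raise3 i) := by
  have h1 : Commute M (o.qDiag (-o.hDiag i) ⊗ₖ o.qDiag (-o.hDiag i)) :=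
    hM.diag fun c => by
      rw [Pi.neg_apply, Pi.neg_apply, hDiag_rev, qHalf_hDiag_mul_rev]
  have key : ∀ (A : o.Mat) {M' : o.Mat2}, Commute M M' → Commute (o.mat23 M) (A ⊗ₖ M') := by
    intro A M' h
    rw [Commute, SemiconjBy, mat23_eq, ← Matrix.mul_kronecker_mul, ← Matrix.mul_kronecker_mul, h.eq,
      one_mul, mul_one]
  exact (key _ h1).add_right (key _ (hM.raise h0 hi))

/-- This is coassociativity: the coproduct on three factors is also grouped by the first two, which
makes commutation with operators of the form M ⊗ 1 visible. -/
theorem raise3_eq (i : ℕ) : o.raise3 i =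
    o.mat12 (o.dLeft (o.rootMat (o.tgt i) (o.src i)) i + o.dRight (o.rootMat (o.tgt i) (o.src i)) i) *
      ((1 : o.Mat) ⊗ₖ ((1 : o.Mat) ⊗ₖ o.qDiag (-o.hDiag i))) +
    o.mat12 ((o.qDiag (o.hDiag i) * o.parMat ^ (o.genPar i).val) ⊗ₖ
      (o.qDiag (o.hDiag i) * o.parMat ^ (o.genPar i).val)) *
      ((1 : o.Mat) ⊗ₖ ((1 : o.Mat) ⊗ₖ o.rootMat (o.tgt i) (o.src i))) := by
  rw [map_add, dLeft, dRight, mat12_kronecker, mat12_kronecker, mat12_kronecker, add_mul]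
  simp only [← Matrix.mul_kronecker_mul, mul_one, one_mul]
  rw [raise3, Matrix.kronecker_add, add_assoc]
  rfl

theorem mat12_comm_third (M : o.Mat2) (X : o.Mat) :
    Commute (o.mat12 M) ((1 : o.Mat) ⊗ₖ ((1 : o.Mat) ⊗ₖ X)) := by
  induction M using o.mat2_induction with
  | h0 => rw [map_zero]; exact Commute.zero_left _
  | hadd M M' h h' => rw [map_add]; exact h.add_left h'
  | h M M' =>
    rw [mat12_kronecker, Commute, SemiconjBy]
    simp only [← Matrix.mul_kronecker_mul, one_mul, mul_one]

theorem IsInvariant.comm_mat12 {M : o.Mat2} (hM : o.IsInvariant M) {i : ℕ} (h0 : 0 < i)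
    (hi : i ≤ o.s) : Commute (o.mat12 M) (o.raise3 i) := by
  have h1 : Commute M ((o.qDiag (o.hDiag i) * o.parMat ^ (o.genPar i).val) ⊗ₖ
      (o.qDiag (o.hDiag i) * o.parMat ^ (o.genPar i).val)) := by
    rw [qDiag_mul_parMat_pow_eq]
    refine hM.diag fun c => ?_
    rw [hDiag_rev, par_rev, mul_mul_mul_comm, qHalf_hDiag_mul_rev, sgn_cast_mul_self, one_mul]
  rw [raise3_eq]
  exact (((hM.raise h0 hi).map o.mat12).mul_right (mat12_comm_third _ _)).add_right
    ((h1.map o.mat12).mul_right (mat12_comm_third _ _))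

variable (o)

/-- An operator on the tensor cube that commutes with the raising operators is determined by its
values on `v_N ⊗ V ⊗ V`. -/
theorem eq_zero_of_comm_raise3 {W : o.Mat3}
    (h : ∀ {i : ℕ}, 0 < i → i ≤ o.s → Commute W (o.raise3 i)) (h0 : o.col W o.fst.rev = 0) :
    W = 0 := by
  refine o.col_injective (o.all_of_raise h0 fun i hi0 hi c hc => ?_)
  have h1 : o.col (W * o.raise3 i) c = 0 := by
    rw [(h hi0 hi).eq, col_mul, hc, Matrix.mul_zero]
  have h2 : o.col (W * ((o.qDiag (o.hDiag i) * o.parMat ^ (o.genPar i).val) ⊗ₖ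
      (o.dLeft (o.rootMat (o.tgt i) (o.src i)) i +
        o.dRight (o.rootMat (o.tgt i) (o.src i)) i))) c = 0 := by
    rw [col_mul_kronecker, qDiag_mul_parMat_pow_eq]
    refine Finset.sum_eq_zero fun d _ => ?_
    by_cases hd : d = c
    · rw [hd, hc, Matrix.zero_mul, smul_zero]
    · rw [Matrix.diagonal_apply_ne _ hd, zero_smul]
  rw [raise3, mul_add, col_add, h2, add_zero, col_mul_kronecker] at h1
  -- The invertible Cartan factors on the last two legs are removed, leaving the raising operator on
  -- the first factor.
  have h3 := congrArg (· * (o.qDiag (o.hDiag i) ⊗ₖ o.qDiag (o.hDiag i) : o.Mat2)) h1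
  simp only [Matrix.sum_mul, Matrix.smul_mul, Matrix.mul_assoc, ← Matrix.mul_kronecker_mul,
    qDiag_mul, neg_add_cancel, qDiag_zero, Matrix.one_kronecker_one, Matrix.mul_one,
    Matrix.zero_mul] at h3
  exact h3

/-! ### The Birman–Wenzl–Murakami relations on the tensor cube. -/

theorem tw_mul_rev (a c : Fin o.N) : o.tw a c * o.tw a c.rev = 1 := by
  rw [tw, tw, par_rev, eps_rev, form_neg_right, mul_mul_mul_comm, sgn_cast_mul_self, one_mul,
    mul_neg, qHalf_hDiag_mul_rev]

/-- Both sides commute with the raising operators, so v_N ⊗ V ⊗ V suffices. There T₂T₁ slides v_N to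
the end with a diagonal factor, after which the remaining T acts on the other two factors and
commutes with that diagonal. -/
theorem braid_relation : o.mat23 o.braid2 * (o.mat12 o.braid2 * o.mat23 o.braid2) =
    o.mat12 o.braid2 * (o.mat23 o.braid2 * o.mat12 o.braid2) := by
  have hT := o.braid2_isInvariant
  have hD := o.braid2_comm_diagonal (o.tw_mul_rev o.fst.rev)
  rw [← sub_eq_zero]
  refine o.eq_zero_of_comm_raise3 (fun h0 hi => ?_) ?_
  · have h1 := hT.comm_mat12 h0 hi
    have h2 := hT.comm_mat23 h0 hi
    exact (h2.mul_left (h1.mul_left h2)).sub_left (h1.mul_left (h2.mul_left h1))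
  · rw [col_sub, ← mul_assoc, col_mul_mat23, o.col_slide o.braid2_last, col_mul,
      o.col_slide o.braid2_last, ← Matrix.mul_assoc, mat12_mul_ins, Matrix.mul_assoc, Matrix.mul_assoc,
      hD.eq, sub_self]

theorem sum_omega_mul_omegaDual (x c : Fin o.N) :
    ∑ a, o.omega (x, a) * o.omegaDual (a, c) = if x = c then 1 else 0 := by
  rw [Finset.sum_eq_single x.rev]
  · simp only [omega, omegaDual, Fin.rev_rev, if_true]
    by_cases h : x = c
    · rw [if_pos h.symm, if_pos h, mul_inv_cancel₀ (o.coef_ne_zero _)]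
    · rw [if_neg (Ne.symm h), if_neg h, mul_zero]
  · intro a _ ha
    rw [omega, if_neg, zero_mul]
    intro h'
    exact ha (by rw [show x = a.rev from h', Fin.rev_rev])
  · simp

theorem sum_omegaDual_mul_omega (b c : Fin o.N) :
    ∑ a, o.omegaDual (b, a) * o.omega (a, c) = if b = c then 1 else 0 := by
  rw [Finset.sum_eq_single b.rev]
  · simp only [omega, omegaDual, if_true, Fin.rev_inj]
    by_cases h : b = c
    · rw [if_pos h, if_pos h, h, inv_mul_cancel₀ (o.coef_ne_zero _)]
    · rw [if_neg h, if_neg h, mul_zero]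
  · intro a _ ha
    rw [omegaDual, if_neg ha, zero_mul]
  · simp

theorem capCup_eq (x y : Fin o.N × Fin o.N) : o.capCup x y = o.omega x * o.omegaDual y := rfl

theorem cap_cup_apply (x y z b a c : Fin o.N) : (o.mat12 o.capCup * o.mat23 o.capCup)
    (x, y, z) (b, a, c) = o.omega (x, y) * (if z = b then 1 else 0) * o.omegaDual (a, c) := by
  have h := o.sum_omegaDual_mul_omega b z
  rw [Matrix.mul_apply, Fintype.sum_prod_type, Finset.sum_eq_single b, Fintype.sum_prod_type]
  · simp only [mat12_apply, mat23_apply, capCup_eq, Matrix.one_apply, if_true, mul_ite, ite_mul,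
      mul_one, mul_zero, one_mul, zero_mul]
    have : ∀ e, (∑ r, if z = r then o.omega (x, y) * o.omegaDual (b, e) *
        (o.omega (e, r) * o.omegaDual (a, c)) else 0) = o.omega (x, y) * o.omegaDual (a, c) *
          (o.omegaDual (b, e) * o.omega (e, z)) := fun e => by
      rw [Finset.sum_ite_eq, if_pos (Finset.mem_univ _)]
      ring
    simp only [this]
    rw [← Finset.mul_sum, h]
    simp only [eq_comm (a := z)]
    split_ifs <;> ring
  · intro d _ hd
    refine Finset.sum_eq_zero fun p _ => ?_
    obtain ⟨p, r⟩ := p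
    rw [mat23_apply, Matrix.one_apply_ne hd, zero_mul, mul_zero]
  · simp

/-- Contracting ω with ω* over one common factor gives the identity, so the three cup-caps
straighten to one. -/
theorem zigzag_left : o.mat12 o.capCup * (o.mat23 o.capCup * o.mat12 o.capCup) =
    o.mat12 o.capCup := by
  rw [← mul_assoc]
  ext ⟨x, y, z⟩ ⟨b, a, c⟩
  rw [Matrix.mul_apply, Fintype.sum_prod_type, Finset.sum_eq_single z, Fintype.sum_prod_type]
  · simp only [cap_cup_apply, mat12_apply, capCup_eq, Matrix.one_apply, if_true, mul_ite, mul_one,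
      mul_zero]
    have h := o.sum_omega_mul_omegaDual z c
    have : ∀ e, (∑ r, if r = c then o.omega (x, y) * o.omegaDual (e, r) *
        (o.omega (z, e) * o.omegaDual (b, a)) else 0) = o.omega (x, y) * o.omegaDual (b, a) *
          (o.omega (z, e) * o.omegaDual (e, c)) := fun e => by
      rw [Finset.sum_ite_eq', if_pos (Finset.mem_univ _)]
      ring
    simp only [this]
    rw [← Finset.mul_sum, h]
    split_ifs <;> ring
  · intro d _ hd
    refine Finset.sum_eq_zero fun p _ => ?_
    obtain ⟨p, r⟩ := p
    rw [cap_cup_apply, if_neg (Ne.symm hd)]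
    ring
  · simp

theorem zigzag_right : o.mat23 o.capCup * (o.mat12 o.capCup * o.mat23 o.capCup) =
    o.mat23 o.capCup := by
  ext ⟨x, y, z⟩ ⟨b, a, c⟩
  rw [Matrix.mul_apply, Fintype.sum_prod_type, Finset.sum_eq_single x, Fintype.sum_prod_type]
  · simp only [cap_cup_apply, mat23_apply, capCup_eq, Matrix.one_apply, if_true, mul_ite, ite_mul,
      mul_one, mul_zero, one_mul, zero_mul]
    have h := o.sum_omega_mul_omegaDual x b
    have : ∀ e, (∑ r, if r = b then o.omega (y, z) * o.omegaDual (e, r) *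
        (o.omega (x, e) * o.omegaDual (a, c)) else 0) = o.omega (y, z) * o.omegaDual (a, c) *
          (o.omega (x, e) * o.omegaDual (e, b)) := fun e => by
      rw [Finset.sum_ite_eq', if_pos (Finset.mem_univ _)]
      ring
    simp only [this]
    rw [← Finset.mul_sum, h]
    split_ifs <;> ring
  · intro d _ hd
    refine Finset.sum_eq_zero fun p _ => ?_
    obtain ⟨p, r⟩ := p
    rw [mat23_apply, Matrix.one_apply_ne (Ne.symm hd), zero_mul, zero_mul]
  · simp

/-- Again it suffices to evaluate on v_N ⊗ V ⊗ V. T₂T₁ carries v_N to the end, and the diagonal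
factor it leaves is absorbed by ω*, since its scalars at c and c' are inverse. -/
theorem cap_slide : o.mat12 o.capCup * (o.mat23 o.braid2 * o.mat12 o.braid2) =
    o.mat12 o.capCup * o.mat23 o.capCup := by
  have hT := o.braid2_isInvariant
  have hQ := o.capCup_isInvariant
  have hD := o.omegaDual_vecMul_diagonal (o.tw_mul_rev o.fst.rev)
  rw [← sub_eq_zero]
  refine o.eq_zero_of_comm_raise3 (fun h0 hi => ?_) ?_
  · have h1 := hT.comm_mat12 h0 hi
    have h2 := hT.comm_mat23 h0 hi
    exact ((hQ.comm_mat12 h0 hi).mul_left (h2.mul_left h1)).sub_left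
      ((hQ.comm_mat12 h0 hi).mul_left (hQ.comm_mat23 h0 hi))
  · rw [col_sub, col_mul, o.col_slide (o.braid2_last), ← Matrix.mul_assoc, mat12_mul_ins,
      Matrix.mul_assoc, capCup_mul, hD, sub_eq_zero]
    ext ⟨x, y, z⟩ ⟨a, c⟩
    rw [ins_mul_apply]
    change _ = (o.mat12 o.capCup * o.mat23 o.capCup) (x, y, z) (o.fst.rev, a, c)
    rw [cap_cup_apply]
    change (if _ then o.omega _ * o.omegaDual _ else 0) = _
    split_ifs <;> ring

theorem isBMW : IsBMW (q - q⁻¹) o.twist (o.mat12 o.braid2) (o.mat23 o.braid2)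
    (o.mat12 o.capCup) (o.mat23 o.capCup) := by
  have hS : ∀ F : o.Mat2 →ₐ[K] o.Mat3, F o.braid2Inv =
      F o.braid2 - (q - q⁻¹) • 1 + (q - q⁻¹) • F o.capCup := fun F => by
    rw [braid2Inv, map_add, map_sub, map_smul, map_smul, map_one]
  have hl : ∀ F : o.Mat2 →ₐ[K] o.Mat3, F o.braid2Inv * F o.braid2 = 1 := fun F => by
    rw [← map_mul, braid2Inv_mul_braid2, map_one]
  have hr : ∀ F : o.Mat2 →ₐ[K] o.Mat3, F o.braid2 * F o.braid2Inv = 1 := fun F => by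
    rw [← map_mul, braid2_mul_braid2Inv, map_one]
  have hc : ∀ F : o.Mat2 →ₐ[K] o.Mat3, F o.braid2 * F o.capCup = o.twist • F o.capCup := fun F => by
    rw [← map_mul, braid2_mul_capCup, map_smul]
  have hc' : ∀ F : o.Mat2 →ₐ[K] o.Mat3, F o.capCup * F o.braid2 = o.twist • F o.capCup := fun F => by
    rw [← map_mul, capCup_mul_braid2, map_smul]
  exact
    { ne_zero := q_sub_inv_ne_zero
      ν_ne_zero := left_ne_zero_of_mul_eq_one o.twist_relation
      left_inv₁ := by rw [← hS, hl]
      right_inv₁ := by rw [← hS, hr]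
      left_inv₂ := by rw [← hS, hl]
      right_inv₂ := by rw [← hS, hr]
      mul_cup₁ := hc _
      cap_mul₁ := hc' _
      mul_cup₂ := hc _
      cap_mul₂ := hc' _
      braid := o.braid_relation
      cap_slide := o.cap_slide
      zigzag₁ := o.zigzag_left
      zigzag₂ := o.zigzag_right }

/-! ### The Yang–Baxter equation -/

/-- The action of matrices on `V ⊗ V ⊗ V`. -/
def act3 : o.Mat3 →ₐ[K] Module.End K o.VV3 :=
  (LinearEquiv.conjAlgEquiv K
    (TensorProduct.assoc K (o.VV K) (o.VV K) (o.VV K)).symm).toAlgHom.comp <|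
  ((Module.endTensorEndAlgHom (R := K) (S := K) (A := K) (M := o.VV K) (N := o.VV2 K)).comp
    (Algebra.TensorProduct.map (o.act K) (o.act2 K))).comp
      (Matrix.kroneckerAlgEquiv (Fin o.N) (Fin o.N × Fin o.N) K).symm.toAlgHom

theorem act3_kronecker (M : o.Mat) (M' : o.Mat2) : o.act3 (M ⊗ₖ M') =
    (TensorProduct.assoc K (o.VV K) (o.VV K) (o.VV K)).symm.toLinearMap ∘ₗ
      TensorProduct.map (o.act K M) (o.act2 K M') ∘ₗ
        (TensorProduct.assoc K (o.VV K) (o.VV K) (o.VV K)).toLinearMap := by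
  have h : (Matrix.kroneckerAlgEquiv (Fin o.N) (Fin o.N × Fin o.N) K).symm (M ⊗ₖ M') =
      M ⊗ₜ[K] M' := by
    rw [AlgEquiv.symm_apply_eq]
    simp
  change (TensorProduct.assoc K (o.VV K) (o.VV K) (o.VV K)).symm.toLinearMap ∘ₗ
    (Module.endTensorEndAlgHom (Algebra.TensorProduct.map (o.act K) (o.act2 K)
    ((Matrix.kroneckerAlgEquiv (Fin o.N) (Fin o.N × Fin o.N) K).symm (M ⊗ₖ M')))) ∘ₗ
    (TensorProduct.assoc K (o.VV K) (o.VV K) (o.VV K)).toLinearMap = _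
  rw [h, Algebra.TensorProduct.map_tmul]
  congr 2

theorem act3_mat23 (M : o.Mat2) : o.act3 (o.mat23 M) = op23 (o.act2 K M) := by
  rw [mat23_eq, act3_kronecker, map_one]
  rfl

theorem act3_mat12 (M : o.Mat2) : o.act3 (o.mat12 M) = op12 (o.act2 K M) := by
  induction M using o.mat2_induction with
  | h0 => rw [map_zero, map_zero, map_zero, op12, LinearMap.rTensor_zero]
  | hadd M M' h h' =>
    rw [map_add, map_add, map_add, h, h', op12, op12, op12, LinearMap.rTensor_add]
  | h M M' =>
    rw [mat12_kronecker, act3_kronecker, act2_kronecker, act2_kronecker, map_one]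
    exact TensorProduct.ext_threefold fun x y z => rfl

/-- The matrix of `R̂(z)`. -/
def rHatMat (z : K) : o.Mat2 := (z - o.crossing) • o.braid2 +
  ((q - q⁻¹) * ((z - o.crossing) / (z - 1))) • 1 - ((q - q⁻¹) * o.crossing) • o.capCup

theorem rHatMat_yangBaxter {x y : K} (hx : x - 1 ≠ 0) (hy : y - 1 ≠ 0) (hxy : x * y - 1 ≠ 0) :
    o.mat12 (o.rHatMat x) * (o.mat23 (o.rHatMat (x * y)) * o.mat12 (o.rHatMat y)) =
      o.mat23 (o.rHatMat y) * (o.mat12 (o.rHatMat (x * y)) * o.mat23 (o.rHatMat x)) := by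
  have h : ∀ (F : o.Mat2 →ₐ[K] o.Mat3) (z : K), F (o.rHatMat z) = (z - o.crossing) • F o.braid2 +
      ((q - q⁻¹) * ((z - o.crossing) / (z - 1))) • 1 - ((q - q⁻¹) * o.crossing) • F o.capCup :=
    fun F z => by rw [rHatMat, map_sub, map_add, map_smul, map_smul, map_smul, map_one]
  simp only [h]
  exact o.isBMW.yangBaxter q_ne_zero rfl o.crossing_eq_twist hx hy hxy

theorem spectralR_eq (z : K) : o.spectralR z = o.act2 K (o.swapMat * o.rHatMat z) := by
  have h : o.superSwap K * o.superSwap K = 1 := by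
    rw [superSwap_eq, coefSwap_field, one_mul, ← act2_swapMat, ← map_mul, swapMat_mul_swapMat,
      map_one]
  rw [map_mul, rHatMat, ← spectralRHat_eq, spectralRHat, act2_swapMat]
  have h' : o.superSwap K = o.tauOp K := by rw [superSwap_eq, coefSwap_field, one_mul]
  rw [← h', ← mul_assoc, h, one_mul]

/-! ### The graded flip on three factors and the passage from R̂ to R. -/

theorem swapMat_flips (t x y c : Fin o.N) : o.swapMat (x, y) (t, c) =
    if x = c ∧ y = t then (sgn (o.par c * o.par t) : K) else 0 := by
  rw [swapMat_apply, mul_ite, mul_one, mul_zero]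
  by_cases h : x = c ∧ y = t
  · rw [if_pos h, if_pos h.symm, h.1, h.2]
  · rw [if_neg h, if_neg fun h' => h h'.symm]

-- Moving one vector past two factors with the graded flip produces a product of parity signs on
-- these factors. M commutes with it, because it commutes with all diagonal operators whose values
-- at c and c' are inverse.
variable {o} in
theorem IsInvariant.mat12_mul_swap {M : o.Mat2} (hM : o.IsInvariant M) :
    o.mat12 M * (o.mat23 o.swapMat * o.mat12 o.swapMat) =
      o.mat23 o.swapMat * o.mat12 o.swapMat * o.mat23 M := by
  rw [← sub_eq_zero]
  refine o.col_injective fun t => ?_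
  have h : Commute M (Matrix.diagonal (fun c => (sgn (o.par c * o.par t) : K)) ⊗ₖ
      Matrix.diagonal (fun c => (sgn (o.par c * o.par t) : K))) :=
    hM.diag fun c => by rw [par_rev, sgn_cast_mul_self]
  rw [col_sub, col_mul_mat23, col_mul, o.col_slide (o.swapMat_flips t), ← Matrix.mul_assoc,
    mat12_mul_ins, Matrix.mul_assoc, Matrix.mul_assoc, h.eq, sub_self]

theorem swapMat_comm_diagonal (f : Fin o.N → K) :
    Commute o.swapMat (Matrix.diagonal f ⊗ₖ Matrix.diagonal f) := by
  rw [Commute, SemiconjBy]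
  ext ⟨x, y⟩ ⟨a, c⟩
  rw [swapMat_mul_apply, Matrix.diagonal_kronecker_diagonal, Matrix.diagonal_mul,
    Matrix.diagonal_apply, swapMat_apply]
  simp only [Prod.mk.injEq]
  by_cases h : y = a ∧ x = c
  · rw [if_pos h, if_pos h]
    ring
  · rw [if_neg h, if_neg h]
    ring

theorem swap_braid : o.mat23 o.swapMat * (o.mat12 o.swapMat * o.mat23 o.swapMat) =
    o.mat12 o.swapMat * (o.mat23 o.swapMat * o.mat12 o.swapMat) := by
  rw [← sub_eq_zero]
  refine o.col_injective fun t => ?_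
  have h := o.swapMat_comm_diagonal fun c => (sgn (o.par c * o.par t) : K)
  rw [col_sub, ← mul_assoc, col_mul_mat23, col_mul _ (o.mat12 _) (_ * _),
    o.col_slide (o.swapMat_flips t), ← Matrix.mul_assoc,
    mat12_mul_ins, Matrix.mul_assoc, Matrix.mul_assoc, h.eq, sub_self]

theorem rHatMat_isInvariant (z : K) : o.IsInvariant (o.rHatMat z) := by
  have hT := o.braid2_isInvariant
  have hQ := o.capCup_isInvariant
  have key : ∀ {X : o.Mat2}, Commute o.braid2 X → Commute o.capCup X → Commute (o.rHatMat z) X :=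
    fun h1 h2 => ((h1.smul_left _).add_left ((Commute.one_left _).smul_left _)).sub_left
      (h2.smul_left _)
  exact ⟨fun h0 hi => key (hT.raise h0 hi) (hQ.raise h0 hi),
    fun hf => key (hT.diag hf) (hQ.diag hf)⟩

/-- The braid form of the Yang–Baxter equation implies the original one. -/
theorem yangBaxter_of_braid {B : Type} [Ring B] {t₁ t₂ A₁ A₂ C₁ C₂ D₁ D₂ : B} (h₁ : t₁ * t₁ = 1)
    (h₂ : t₂ * t₂ = 1) (ht : t₂ * (t₁ * t₂) = t₁ * (t₂ * t₁))
    (hA : A₁ * (t₂ * t₁) = t₂ * t₁ * A₂) (hC : C₁ * (t₂ * t₁) = t₂ * t₁ * C₂)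
    (hD : D₁ * (t₂ * t₁) = t₂ * t₁ * D₂) (h : D₁ * (C₂ * A₁) = A₂ * (C₁ * D₂)) :
    (t₁ * A₁) * (t₂ * (t₁ * C₁) * t₂) * (t₂ * D₂) =
      (t₂ * D₂) * (t₂ * (t₁ * C₁) * t₂) * (t₁ * A₁) := by
  have h21 : t₂ * t₁ * (t₁ * t₂) = 1 := by
    rw [mul_assoc, ← mul_assoc t₁, h₁, one_mul, h₂]
  have h12 : t₁ * t₂ * (t₂ * t₁) = 1 := by
    rw [mul_assoc, ← mul_assoc t₂, h₂, one_mul, h₁]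
  have hD' : D₂ * (t₁ * t₂) = t₁ * t₂ * D₁ :=
    calc D₂ * (t₁ * t₂) = t₁ * t₂ * (t₂ * t₁ * D₂) * (t₁ * t₂) := by
          rw [← mul_assoc (t₁ * t₂), h12, one_mul]
      _ = t₁ * t₂ * D₁ := by rw [← hD, mul_assoc, mul_assoc D₁, h21, mul_one]
  have h4 : t₂ * (t₁ * (t₂ * t₁)) = t₁ * t₂ := by
    rw [← ht, ← mul_assoc, h₂, one_mul]
  calc (t₁ * A₁) * (t₂ * (t₁ * C₁) * t₂) * (t₂ * D₂)
      = t₁ * (A₁ * (t₂ * t₁)) * C₁ * (t₂ * t₂) * D₂ := by simp only [mul_assoc]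
    _ = t₁ * (t₂ * t₁) * (A₂ * (C₁ * D₂)) := by
        rw [hA, h₂, mul_one]
        simp only [mul_assoc]
    _ = t₂ * (t₁ * t₂ * D₁) * (C₂ * A₁) := by
        rw [← h, ← ht]
        simp only [mul_assoc]
    _ = t₂ * D₂ * (t₂ * (t₁ * (t₂ * t₁))) * (C₂ * A₁) := by
        rw [← hD', h4]
        simp only [mul_assoc]
    _ = t₂ * D₂ * t₂ * t₁ * (t₂ * t₁ * C₂) * A₁ := by simp only [mul_assoc]
    _ = _ := by
        rw [← hC]
        simp only [mul_assoc]

theorem yangBaxter {u v w : K} (hu : u ≠ 0) (hv : v ≠ 0) (hw : w ≠ 0) (huv : u ≠ v) (huw : u ≠ w)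
    (hvw : v ≠ w) :
    (op12 (o.spectralR (v / w)) * op13 (o.spectralR (u / w)) * op23 (o.spectralR (u / v)) =
      op23 (o.spectralR (u / v)) * op13 (o.spectralR (u / w)) * op12 (o.spectralR (v / w))) ∧
    (op12 (o.spectralRHat (v / w)) * op23 (o.spectralRHat (u / w)) *
        op12 (o.spectralRHat (u / v)) =
      op23 (o.spectralRHat (u / v)) * op12 (o.spectralRHat (u / w)) *
        op23 (o.spectralRHat (v / w))) := by
  have h1 : v / w * (u / v) = u / w := by field_simp
  have h2 : u / v * (v / w) = u / w := by field_simp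
  have hne : ∀ {x y : K}, y ≠ 0 → x ≠ y → x / y - 1 ≠ 0 := fun hy hxy h =>
    hxy ((div_eq_one_iff_eq hy).1 (sub_eq_zero.1 h))
  have hH : ∀ z, o.spectralRHat z = o.act2 K (o.rHatMat z) := o.spectralRHat_eq
  have hs : o.superSwap K = o.act2 K o.swapMat := by
    rw [superSwap_eq, coefSwap_field, one_mul, act2_swapMat]
  have hsq : ∀ F : o.Mat2 →ₐ[K] o.Mat3, F o.swapMat * F o.swapMat = 1 := fun F => by
    rw [← map_mul, swapMat_mul_swapMat, map_one]
  constructor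
  · have hb := o.rHatMat_yangBaxter (hne hv huv) (hne hw hvw) (by rw [h2]; exact hne hw huw)
    -- The form with R uses the braid equation at x = u/v, y = v/w; the form with R̂ below uses it
    -- with the two arguments interchanged.
    rw [h2] at hb
    have h := yangBaxter_of_braid (hsq o.mat12) (hsq o.mat23) o.swap_braid
      (o.rHatMat_isInvariant _).mat12_mul_swap (o.rHatMat_isInvariant _).mat12_mul_swap
      (o.rHatMat_isInvariant _).mat12_mul_swap hb
    simp only [op13, spectralR_eq, hs, ← act3_mat12, ← act3_mat23, ← map_mul]
    simp only [← map_mul o.mat12, ← map_mul o.mat23] at h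
    rw [h]
  · have hb := o.rHatMat_yangBaxter (hne hw hvw) (hne hv huv) (by rw [h1]; exact hne hw huw)
    rw [h1] at hb
    simp only [hH, ← act3_mat12, ← act3_mat23, ← map_mul]
    rw [mul_assoc, hb, mul_assoc]

end OspAffine.OspDatum

end

theorem theorem6p3 (o : OspAffine.OspDatum) :
    -- formal parameters: the modules `V(u)`, `V(v)` over the full algebra
    (∀ a b : OspAffine.K, a * b = o.abValue →
      ∃ ρ : o.U →ₐ[OspAffine.K] Module.End OspAffine.K o.FormalV,
        OspAffine.OspDatum.IsFormalEvaluation a b ρ ∧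
        ∃ π : o.U →ₐ[OspAffine.K] Module.End OspAffine.K (o.VV2 (LaurentPolynomial OspAffine.K)),
          OspAffine.OspDatum.IsFormalTensor ρ ρ π ∧
          ∀ x : o.U, o.formalRHat * π x = π x * o.formalRHat) ∧
    -- numerical parameters: the modules `V(u)`, `V(v)` over the algebra without `D`
    (∀ a b : OspAffine.K, a * b = o.abValue → ∀ u v : OspAffine.Kˣ, u ≠ v →
      ∃ ρu ρv : o.UReduced →ₐ[OspAffine.K] Module.End OspAffine.K (o.VV OspAffine.K),
        OspAffine.OspDatum.IsEvaluation a b u ρu ∧ OspAffine.OspDatum.IsEvaluation a b v ρv ∧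
        ∃ πuv πvu : o.UReduced →ₐ[OspAffine.K] Module.End OspAffine.K (o.VV2 OspAffine.K),
          OspAffine.OspDatum.IsTensor ρu ρv πuv ∧ OspAffine.OspDatum.IsTensor ρv ρu πvu ∧
          ∀ x : o.UReduced,
            o.spectralRHat ((u : OspAffine.K) / v) * πuv x =
              πvu x * o.spectralRHat ((u : OspAffine.K) / v)) ∧
    -- the Yang-Baxter equation with a spectral parameter, for `R` and for `R̂`
    (∀ u v w : OspAffine.K, u ≠ 0 → v ≠ 0 → w ≠ 0 → u ≠ v → u ≠ w → v ≠ w →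
      (OspAffine.OspDatum.op12 (o.spectralR (v / w)) *
          OspAffine.OspDatum.op13 (o.spectralR (u / w)) *
          OspAffine.OspDatum.op23 (o.spectralR (u / v)) =
        OspAffine.OspDatum.op23 (o.spectralR (u / v)) *
          OspAffine.OspDatum.op13 (o.spectralR (u / w)) *
          OspAffine.OspDatum.op12 (o.spectralR (v / w))) ∧
      (OspAffine.OspDatum.op12 (o.spectralRHat (v / w)) *
          OspAffine.OspDatum.op23 (o.spectralRHat (u / w)) *
          OspAffine.OspDatum.op12 (o.spectralRHat (u / v)) =
        OspAffine.OspDatum.op23 (o.spectralRHat (u / v)) *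
          OspAffine.OspDatum.op12 (o.spectralRHat (u / w)) *
          OspAffine.OspDatum.op23 (o.spectralRHat (v / w)))) :=
  ⟨fun _ _ hab => o.formal_intertwiner hab, fun _ _ hab _ _ huv => o.numeric_intertwiner hab huv,
    fun _ _ _ hu hv hw huv huw hvw => o.yangBaxter hu hv hw huv huw hvw⟩
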